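/- Let $n,W\ge 1$ be integers. Let $V_1,\dots,V_n$ be random Hermitian $W\times W$ matrices and $T_1,\dots,T_{n-1}$ random complex $W\times W$ matrices with joint density $$\frac1{Z_{n,W}}\exp\Bigl(-W\operatorname{tr}\Bigl(\sum_{j=1}^n|V_j|^2+\sum_{j=1}^{n-1}|T_j|^2\Bigr)\Bigr),\qquad |A|^2=A^*A,$$ with respect to the product of the Lebesgue measures on Hermitian, respectively complex, $W\times W$ matrices. Let $H$ be the $nW\times nW$ block tridiagonal Hermitian matrix with diagonal blocks $H_{jj}=V_j$, off-diagonal blocks $H_{j+1,j}=-T_j$ and $H_{j,j+1}=-T_j^*$, and all other blocks $0$. For $z\in\mathbb R$ let $G(x,y;z)$ be the $(x,y)$ block, of size $W\times W$, of $(H-z)^{-1}$, and put $X_n=\log\|G(1,n;z)\|$ with the Euclidean operator norm. For $q>0$ let $\mathbb E_q[f]=\mathbb E[f e^{qX_n}]/\mathbb E[e^{qX_n}]$, let $\mathbb P_q$ be the corresponding probability measure, and $\overline{X_n}=X_n-\mathbb E_q[X_n]$. Proposition. Let $\xi>0$, $s\in(0,1)$, $m>0$ and $\sharp\ge 3$.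 There are constants $c,C>0$, $\varepsilon\in(0,1/2)$ and $n_0,W_0$, depending only on $\xi,s,m,\sharp$, such that for all $n\ge n_0$, $W\ge W_0$ and all real $z$ with $|z|\le m\sqrt W$ the following holds. If $$\mathbb E\bigl[e^{\frac s2X_n}\bigr]\ge e^{-\xi n},$$ then there are $\alpha,\beta$ with $$c\sqrt{n/W^\sharp}\le\alpha\le C\sqrt{n/W^\sharp},\qquad c\le\beta\le C,$$ such that for every $q\in(s/2,s)$ the expectation $\mathbb E[e^{qX_n}]$ is finite, $X_n$ is $\mathbb P_q$-integrable, and $$\mathbb P_q\bigl[|\overline{X_n}|\le\alpha\bigr]\le\beta\sqrt{\mathbb P_q\bigl[\overline{X_n}\ge2\alpha\bigr]\,\mathbb P_q\bigl[\overline{X_n}\le-2\alpha\bigr]}+\varepsilon .$$ -/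

import Mathlib

open MeasureTheory

noncomputable section

/-- The Hermitian `W × W` matrix with real coordinates `h`: the diagonal entries are `h i i`, and for
`i < j` the entry `(i, j)` has real part `h i j` and imaginary part `h j i`.  This is a linear
bijection from `ℝ^(W × W)` onto the Hermitian matrices, under which Lebesgue measure
`∏ d V i i ∏_{i < j} d Re (V i j) d Im (V i j)` is the volume of the coordinate space. -/
def hermitianOf {W : ℕ} (h : Fin W → Fin W → ℝ) : Matrix (Fin W) (Fin W) ℂ :=
  Matrix.of fun i j =>
    if i = j then (h i i : ℂ)
    else if i < j then (h i j : ℂ) + (h j i : ℂ) * Complex.I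
    else (h j i : ℂ) - (h i j : ℂ) * Complex.I

theorem hermitianOf_isHermitian {W : ℕ} (h : Fin W → Fin W → ℝ) :
    (hermitianOf h).IsHermitian := by
  ext i j
  rcases lt_trichotomy i j with hij | rfl | hij
  · simp [hermitianOf, hij.ne, hij.ne', hij, hij.not_gt, sub_eq_add_neg]
  · simp [hermitianOf]
  · simp [hermitianOf, hij.ne, hij.ne', hij, hij.not_gt, sub_eq_add_neg]

/-- The space of all `(V₁, …, Vₙ; T₁, …, Tₙ₋₁)`, with `Vⱼ` given by its real coordinates. Its volume
is the product of the Lebesgue measures on the Hermitian and on the complex `W × W` matrices. -/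
abbrev OrbitalSpace (n W : ℕ) : Type :=
  (Fin n → Fin W → Fin W → ℝ) × (Fin (n - 1) → Fin W → Fin W → ℂ)

namespace OrbitalSpace

variable {n W : ℕ}

/-- The on-site matrix `V_{j+1}` (indices start at `0` here). -/
def V (ω : OrbitalSpace n W) (j : Fin n) : Matrix (Fin W) (Fin W) ℂ := hermitianOf (ω.1 j)

/-- The hopping matrix `T_{j+1}`. -/
def T (ω : OrbitalSpace n W) (j : Fin (n - 1)) : Matrix (Fin W) (Fin W) ℂ := Matrix.of (ω.2 j)

/-- `tr (∑ⱼ |Vⱼ|² + ∑ⱼ |Tⱼ|²)`, where `|A|² = A* A`. -/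
def energy (ω : OrbitalSpace n W) : ℝ :=
  (Matrix.trace (∑ j, (V ω j).conjTranspose * V ω j
    + ∑ j, (T ω j).conjTranspose * T ω j)).re

/-- The `W × W` block of the Hamiltonian in position `(x, y)`: `Vₓ` on the diagonal, `-T_y` just below
it, `-Tₓ*` just above it, and `0` elsewhere. -/
def block (ω : OrbitalSpace n W) (x y : Fin n) : Matrix (Fin W) (Fin W) ℂ :=
  if x = y then V ω x
  else if h : x.val = y.val + 1 then -T ω ⟨y.val, by omega⟩
  else if h : y.val = x.val + 1 then -(T ω ⟨x.val, by omega⟩).conjTranspose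
  else 0

/-- The `nW × nW` block tridiagonal Hamiltonian of the Wegner `W`-orbital model. -/
def H (ω : OrbitalSpace n W) : Matrix (Fin n × Fin W) (Fin n × Fin W) ℂ :=
  Matrix.of fun a b => block ω a.1 b.1 a.2 b.2

/-- The `(x, y)` block of the resolvent `(H - z)⁻¹`. -/
def G (ω : OrbitalSpace n W) (z : ℝ) (x y : Fin n) : Matrix (Fin W) (Fin W) ℂ :=
  Matrix.of fun i j => (H ω - (z : ℂ) • 1)⁻¹ (x, i) (y, j)

/-- `Xₙ = log ‖G(1, n; z)‖`, with the operator norm of the Euclidean space `ℂ^W`. -/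
def X (hn : 0 < n) (z : ℝ) (ω : OrbitalSpace n W) : ℝ :=
  Real.log ‖Matrix.toEuclideanCLM (𝕜 := ℂ)
    (G ω z ⟨0, hn⟩ ⟨n - 1, Nat.sub_lt hn Nat.one_pos⟩)‖

end OrbitalSpace

/-- The law of the model: density `Z⁻¹ exp (-W tr (∑ |Vⱼ|² + ∑ |Tⱼ|²))` with respect to Lebesgue
measure, `Z` being the integral of the exponential. -/
def orbitalLaw (n W : ℕ) : Measure (OrbitalSpace n W) :=
  (volume : Measure (OrbitalSpace n W)).tilted fun ω => -(W : ℝ) * ω.energy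

/-- The `q`-weighted measure `ℙ_q`, with `𝔼_q[f] = 𝔼[f e^{q Xₙ}] / 𝔼[e^{q Xₙ}]`. -/
def weightedLaw {n : ℕ} (W : ℕ) (hn : 0 < n) (z q : ℝ) : Measure (OrbitalSpace n W) :=
  (orbitalLaw n W).tilted fun ω => q * ω.X hn z

/-- The centered observable `Xₙ - 𝔼_q[Xₙ]`. -/
def centeredX {n W : ℕ} (hn : 0 < n) (z q : ℝ) (ω : OrbitalSpace n W) : ℝ :=
  ω.X hn z - ∫ ω' : OrbitalSpace n W, ω'.X hn z ∂(weightedLaw W hn z q)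

end

/-! The argument is of Mermin–Wagner type. Replace the diagonal blocks by the Schur complements S_j
= V_j - z - Σ_j, with self-energies Σ_{j+1} = T_j S_j⁻¹ T_j* and Σ = 0 at the first site. At fixed T
this is a triangular shear, so Lebesgue measure is preserved, and block elimination gives G(1,n;z) =
S_1⁻¹ T_1* S_2⁻¹ ⋯ T_{n-1}* S_n⁻¹. Hence, at fixed S, multiplying T_j by e^u shifts X_n by exactly
u.

Flow every T_j to exp(± t_j χ_j) T_j, where χ_j depends only on S_j and T_j. The two flows shift X_n
by ± N with the same N = ∑ t_j χ_j, so the weights e^{qX_n} at the two images multiply to e^{2qX_n}.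
If the transported densities, with Jacobians, multiply to at least κ² times the square of the
original density and N ≥ 3α, then Cauchy–Schwarz bounds the mass of a window of radius α by κ⁻¹
times the geometric mean of the masses on its two sides (`lintegral_window_le`). First-order changes
of the energy cancel between the two flows. In the second order, V_{j+1} moves by (e^{±2 t_j χ_j} -
1) Σ_{j+1}; the cutoff χ_j = (1 + ‖Σ_{j+1}‖_HS / R)⁻¹ keeps this move of order R t_j
(`energy_flow_pair_le`, `flowJac_pair_ge`). With R of order W and t_j of order α/n the total cost is
of order α² W³ / n, which is bounded for α of order √(n/W^♯), ♯ ≥ 3.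

The shift is large enough only if at least half of the self-energies have Hilbert–Schmidt norm at
most R. Given the past, V_j is a fresh Gaussian, and the Wegner estimate `lawV_wegner`, of optimal
order in W and uniform in the shift, makes each failure improbable; an exponential moment of the
number of failures then gives probability e^{-Ln} for too many of them, with L as large as desired
(`orbitalLaw_badCount_ge`). For the Wegner estimate, one row and column of V is rotated into those
of an independent copy: along the rotation the determinant is a quartic over (1+t²)², so its
logarithmic derivative is large only close to four roots. Random sign vectors then pass from single
vectors to the Hilbert–Schmidt norm.

Exceptional events are measured under the weight e^{qX_n}. Spectral averaging gives ℙ(‖G‖ > t) ≤ K/t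
with K polynomial in n and W (`orbitalLaw_norm_G_gt`), so an event of probability b has weighted
mass at most K^q b^{1-q}/(1-q), while the hypothesis and Jensen bound the total mass below by
e^{-2ξn}. If n ≥ log W, probability e^{-Ln} suffices. If n < log W, powers of W must be beaten too,
so only events of probability of order e^{-W} may be discarded; there it is enough to move the first
site alone: for bounded z by rescaling S_1 and T_1 together so that Σ_2 is unchanged, and for large
|z| by flowing T_1, since Σ_2 is then of controlled size. -/

open MeasureTheory

noncomputable section

open scoped ENNReal Matrix

open scoped ENNReal

/-! ### Gaussian measures attached to quadratic forms. -/

section Gauss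

/-- A symmetric positive definite bilinear form. -/
structure IsGaussForm {E : Type*} [AddCommGroup E] [Module ℝ E] (B : LinearMap.BilinForm ℝ E) :
    Prop where
  symm : ∀ x y, B x y = B y x
  pos : ∀ x, x ≠ 0 → 0 < B x x

theorem IsGaussForm.nonneg {E : Type*} [AddCommGroup E] [Module ℝ E]
    {B : LinearMap.BilinForm ℝ E} (hB : IsGaussForm B) (x : E) :
    0 ≤ B x x := by
  by_cases h : x = 0
  · simp [h]
  · exact (hB.pos x h).le

theorem IsGaussForm.add_self {E : Type*} [AddCommGroup E] [Module ℝ E]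
    {B : LinearMap.BilinForm ℝ E} (hB : IsGaussForm B) (x y : E) :
    B (x + y) (x + y) = B x x + 2 * B x y + B y y := by
  simp only [map_add, LinearMap.add_apply, hB.symm y x]; ring

variable {E : Type*} [NormedAddCommGroup E] [NormedSpace ℝ E] [MeasurableSpace E] [BorelSpace E]
  [FiniteDimensional ℝ E]

/-- The Gaussian probability measure with density proportional to `exp (-B h h)`. -/
def gaussLaw (μ : Measure E) (B : LinearMap.BilinForm ℝ E) : Measure E :=
  μ.tilted fun h => -(B h h)

theorem continuous_bilin (B : LinearMap.BilinForm ℝ E) :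
    Continuous fun p : E × E => B p.1 p.2 := by
  let e : (E →ₗ[ℝ] ℝ) ≃ₗ[ℝ] (E →L[ℝ] ℝ) := LinearMap.toContinuousLinearMap
  let f : E →L[ℝ] (E →L[ℝ] ℝ) := LinearMap.toContinuousLinearMap (e.toLinearMap ∘ₗ B)
  have : (fun p : E × E => B p.1 p.2) = fun p => f p.1 p.2 := rfl
  rw [this]
  fun_prop

theorem continuous_bilin_self (B : LinearMap.BilinForm ℝ E) : Continuous fun x : E => B x x :=
  (continuous_bilin B).comp (continuous_id.prodMk continuous_id)

theorem continuous_bilin_right (B : LinearMap.BilinForm ℝ E) (a : E) :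
    Continuous fun x : E => B x a :=
  (continuous_bilin B).comp (continuous_id.prodMk continuous_const)

theorem IsGaussForm.exists_le {B : LinearMap.BilinForm ℝ E} (hB : IsGaussForm B) :
    ∃ c : ℝ, 0 < c ∧ ∀ x, c * ‖x‖ ^ 2 ≤ B x x := by
  by_cases hE : ∃ x : E, x ≠ 0
  · obtain ⟨x₀, hx₀⟩ := hE
    have hne : (Metric.sphere (0 : E) 1).Nonempty := by
      refine ⟨(‖x₀‖⁻¹ : ℝ) • x₀, ?_⟩
      simp [norm_smul, hx₀]
    obtain ⟨y, hy, hmin⟩ := (isCompact_sphere (0 : E) 1).exists_isMinOn hne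
      (continuous_bilin_self B).continuousOn
    have hy0 : y ≠ 0 := by
      rintro rfl; simp at hy
    refine ⟨B y y, hB.pos y hy0, fun x => ?_⟩
    by_cases hx : x = 0
    · simp [hx]
    have hx' : ‖x‖ ≠ 0 := by simpa using hx
    have h1 : (‖x‖⁻¹ : ℝ) • x ∈ Metric.sphere (0 : E) 1 := by simp [norm_smul, hx]
    have h2 := hmin h1
    simp only [map_smul, LinearMap.smul_apply, smul_eq_mul, Set.mem_ofPred_eq] at h2
    have h3 : B x x = ‖x‖ ^ 2 * (‖x‖⁻¹ * (‖x‖⁻¹ * B x x)) := by field_simp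
    rw [h3, mul_comm]
    gcongr
  · push Not at hE
    exact ⟨1, one_pos, fun x => by simp [hE x]⟩

/-- Domination by a multiple of (1 + ‖x‖)^(-d) with d one more than the dimension: the power is
beaten by exp (1 + ‖x‖), and ‖x‖ by c‖x‖² after completing the square. -/
theorem integrable_exp_neg_norm_sq (μ : Measure E) [μ.IsAddHaarMeasure] {c : ℝ} (hc : 0 < c) :
    Integrable (fun x : E => Real.exp (-(c * ‖x‖ ^ 2))) μ := by
  set d : ℕ := Module.finrank ℝ E + 1
  have hlt : (Module.finrank ℝ E : ℝ) < (d : ℝ) := by simp [d]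
  have h1 := (integrable_one_add_norm (μ := μ) hlt).const_mul
    (Real.exp (1 / (4 * c)) * d.factorial * Real.exp 1)
  refine h1.mono' (by fun_prop) (Filter.Eventually.of_forall fun x => ?_)
  rw [Real.norm_of_nonneg (Real.exp_pos _).le, Real.rpow_neg (by positivity), Real.rpow_natCast]
  have hn : 0 ≤ ‖x‖ := norm_nonneg x
  have h2 : (1 + ‖x‖) ^ d / d.factorial ≤ Real.exp (1 + ‖x‖) :=
    Real.pow_div_factorial_le_exp _ (by positivity) d
  have h3 : ‖x‖ ≤ c * ‖x‖ ^ 2 + 1 / (4 * c) := by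
    have : 0 ≤ (2 * c * ‖x‖ - 1) ^ 2 / (4 * c) := by positivity
    have e : (2 * c * ‖x‖ - 1) ^ 2 / (4 * c) = c * ‖x‖ ^ 2 + 1 / (4 * c) - ‖x‖ := by
      field_simp; ring
    linarith
  have hf : (0 : ℝ) < d.factorial := by positivity
  rw [div_le_iff₀ hf] at h2
  rw [← div_eq_mul_inv, le_div_iff₀ (by positivity)]
  calc Real.exp (-(c * ‖x‖ ^ 2)) * (1 + ‖x‖) ^ d
      ≤ Real.exp (-(c * ‖x‖ ^ 2)) * (Real.exp (1 + ‖x‖) * d.factorial) := by gcongr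
    _ = Real.exp (-(c * ‖x‖ ^ 2) + (1 + ‖x‖)) * d.factorial := by rw [Real.exp_add (-(c * ‖x‖ ^ 2))]; ring
    _ ≤ Real.exp (1 / (4 * c) + 1) * d.factorial := by
        gcongr ?_ * _
        exact Real.exp_le_exp.2 (by linarith)
    _ = _ := by rw [Real.exp_add]; ring

variable {μ : Measure E} [μ.IsAddHaarMeasure] {B : LinearMap.BilinForm ℝ E}

theorem IsGaussForm.integrable (hB : IsGaussForm B) :
    Integrable (fun x : E => Real.exp (-(B x x))) μ := by
  obtain ⟨c, hc, h⟩ := hB.exists_le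
  refine (integrable_exp_neg_norm_sq μ hc).mono' ?_ (Filter.Eventually.of_forall fun x => ?_)
  · exact (continuous_bilin_self B).neg.rexp.aestronglyMeasurable
  · rw [Real.norm_of_nonneg (Real.exp_pos _).le]
    have := h x
    gcongr

theorem IsGaussForm.isProbabilityMeasure (hB : IsGaussForm B) :
    IsProbabilityMeasure (gaussLaw μ B) :=
  isProbabilityMeasure_tilted hB.integrable

/-- The inverse of the normalising constant. -/
def gaussNorm (μ : Measure E) (B : LinearMap.BilinForm ℝ E) : ℝ≥0∞ :=
  ENNReal.ofReal (∫ x, Real.exp (-(B x x)) ∂μ)⁻¹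

theorem lintegral_gaussLaw (μ : Measure E) (B : LinearMap.BilinForm ℝ E) (F : E → ℝ≥0∞) :
    ∫⁻ x, F x ∂(gaussLaw μ B)
      = gaussNorm μ B * ∫⁻ x, ENNReal.ofReal (Real.exp (-(B x x))) * F x ∂μ := by
  rw [gaussLaw, lintegral_tilted, gaussNorm, ← lintegral_const_mul' _ _ ENNReal.ofReal_ne_top]
  refine lintegral_congr fun x => ?_
  rw [div_eq_mul_inv, ENNReal.ofReal_mul (Real.exp_pos _).le]
  ring

theorem gaussLaw_absolutelyContinuous (μ : Measure E) (B : LinearMap.BilinForm ℝ E) :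
    gaussLaw μ B ≪ μ := tilted_absolutelyContinuous _ _

theorem measurable_exp_bilin (B : LinearMap.BilinForm ℝ E) :
    Measurable fun x : E => ENNReal.ofReal (Real.exp (-(B x x))) :=
  (continuous_bilin_self B).neg.rexp.measurable.ennreal_ofReal

/-- A linear map preserving the form preserves the Gaussian law. -/
theorem IsGaussForm.lintegral_comp_isometry (hB : IsGaussForm B) (L : E →ₗ[ℝ] E)
    (hL : ∀ x, B (L x) (L x) = B x x) {F : E → ℝ≥0∞} (hF : Measurable F) :
    ∫⁻ x, F (L x) ∂(gaussLaw μ B) = ∫⁻ x, F x ∂(gaussLaw μ B) := by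
  have := hB.isProbabilityMeasure (μ := μ)
  have hinj : Function.Injective L := by
    rw [← LinearMap.ker_eq_bot, LinearMap.ker_eq_bot']
    intro x hx
    by_contra hne
    have := hB.pos x hne
    rw [← hL, hx] at this
    simp at this
  have hdet : LinearMap.det L ≠ 0 := by
    have : IsUnit L := (LinearMap.isUnit_iff_ker_eq_bot L).2 (LinearMap.ker_eq_bot.2 hinj)
    exact ((LinearMap.isUnit_iff_isUnit_det L).1 this).ne_zero
  have hLm : Measurable L := L.continuous_of_finiteDimensional.measurable
  have key : ∀ {G : E → ℝ≥0∞}, Measurable G → ∫⁻ x, G (L x) ∂(gaussLaw μ B)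
      = ENNReal.ofReal |(LinearMap.det L)⁻¹| * ∫⁻ x, G x ∂(gaussLaw μ B) := by
    intro G hG
    rw [lintegral_gaussLaw, lintegral_gaussLaw]
    have h1 : ∀ x, ENNReal.ofReal (Real.exp (-(B x x))) * G (L x)
        = (fun y => ENNReal.ofReal (Real.exp (-(B y y))) * G y) (L x) := by
      intro x; simp only [hL]
    rw [lintegral_congr h1, ← lintegral_map (f := fun y => ENNReal.ofReal (Real.exp (-(B y y))) * G y)
      ((measurable_exp_bilin B).mul hG) hLm,
      Measure.map_linearMap_addHaar_eq_smul_addHaar μ hdet, lintegral_smul_measure, smul_eq_mul]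
    ring
  -- Both sides have total mass one, which forces |det L| = 1 without computing the determinant.
  have h1 := key (G := fun _ => 1) measurable_const
  simp only [lintegral_const, measure_univ, mul_one] at h1
  rw [key hF, ← h1, one_mul]

/-- Change of variables under translations. -/
theorem IsGaussForm.lintegral_translate (hB : IsGaussForm B) (a : E) {F : E → ℝ≥0∞}
    (hF : Measurable F) :
    ∫⁻ x, ENNReal.ofReal (Real.exp (-(2 * B x a + B a a))) * F (x + a) ∂(gaussLaw μ B)
      = ∫⁻ x, F x ∂(gaussLaw μ B) := by
  rw [lintegral_gaussLaw, lintegral_gaussLaw]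
  congr 1
  rw [← lintegral_add_right_eq_self (μ := μ)
    (fun x => ENNReal.ofReal (Real.exp (-(B x x))) * F x) a]
  refine lintegral_congr fun x => ?_
  rw [← mul_assoc, ← ENNReal.ofReal_mul (Real.exp_pos _).le, ← Real.exp_add, hB.add_self]
  congr 3
  ring_nf

theorem IsGaussForm.lintegral_exp (hB : IsGaussForm B) (a : E) :
    ∫⁻ x, ENNReal.ofReal (Real.exp (2 * B x a)) ∂(gaussLaw μ B)
      = ENNReal.ofReal (Real.exp (B a a)) := by
  have := hB.isProbabilityMeasure (μ := μ)
  have h := hB.lintegral_translate (μ := μ) (-a) (F := fun _ => 1) measurable_const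
  simp only [mul_one, map_neg, LinearMap.neg_apply, lintegral_const, measure_univ] at h
  have h2 : ∀ x, ENNReal.ofReal (Real.exp (2 * B x a))
      = ENNReal.ofReal (Real.exp (B a a))
        * ENNReal.ofReal (Real.exp (-(2 * -(B x a) + - -(B a a)))) := by
    intro x
    rw [← ENNReal.ofReal_mul (Real.exp_pos _).le, ← Real.exp_add]
    congr 2; ring
  simp_rw [h2]
  rw [lintegral_const_mul' _ _ ENNReal.ofReal_ne_top, h, mul_one]

/-- Small ball estimate for linear functionals. -/
theorem IsGaussForm.small_ball (hB : IsGaussForm B) (a : E) :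
    gaussLaw μ B {x | |B x a| < Real.sqrt (B a a) / 4} ≤ 1 / 2 := by
  have := hB.isProbabilityMeasure (μ := μ)
  by_cases ha : a = 0
  · simp [ha]
  have hpos := hB.pos a ha
  set γ := gaussLaw μ B with hγ
  set b := B a a with hb
  set c := Real.sqrt b / 4 with hc
  have hc0 : 0 < c := by positivity
  have hcsq : c ^ 2 = b / 16 := by rw [hc, div_pow, Real.sq_sqrt hpos.le]; norm_num
  have hmeas : Measurable fun x => B x a := (continuous_bilin_right B a).measurable
  let slab : ℝ → Set E := fun u => {x | |B x a - u| < c}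
  have hslab : ∀ u, MeasurableSet (slab u) := fun u =>
    measurableSet_lt ((hmeas.sub_const u).abs) measurable_const
  -- Translation by `r • a` carries the central slab onto the one around ± 2c, at a density cost of
  -- at least exp (-(1/4 + 1/4)). The three slabs are disjoint and exp (-1/2) ≥ 1/2, so twice the
  -- mass of the central one is at most 1.
  have hlow : ∀ σ : ℝ, |σ| = 1 →
      ENNReal.ofReal (Real.exp (-(1/2))) * γ (slab 0) ≤ γ (slab (2 * c * σ)) := by
    intro σ hσ
    have hσ2 : σ ^ 2 = 1 := by rw [← sq_abs, hσ]; norm_num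
    set r : ℝ := 2 * c * σ / b with hr
    have hrb : r * b = 2 * c * σ := by rw [hr]; field_simp
    have h1 := hB.lintegral_translate (μ := μ) (r • a)
      (F := (slab (2 * c * σ)).indicator 1) (measurable_one.indicator (hslab _))
    rw [lintegral_indicator_one (hslab _)] at h1
    rw [← h1]
    rw [← lintegral_indicator_one (hslab 0), ← lintegral_const_mul' _ _ ENNReal.ofReal_ne_top]
    refine lintegral_mono fun x => ?_
    by_cases hx : x ∈ slab 0
    · have hx2 : x + r • a ∈ slab (2 * c * σ) := by
        have h : |B x a| < c := by simpa [slab] using hx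
        have h' : B (x + r • a) a - 2 * c * σ = B x a := by
          simp only [map_add, map_smul, LinearMap.add_apply, LinearMap.smul_apply, smul_eq_mul,
            ← hb, hrb]
          ring
        change |B (x + r • a) a - 2 * c * σ| < c
        rwa [h']
      rw [Set.indicator_of_mem hx, Set.indicator_of_mem hx2, Pi.one_apply, Pi.one_apply]
      gcongr
      simp only [slab, Set.mem_ofPred_eq, sub_zero] at hx
      simp only [map_smul, LinearMap.smul_apply, smul_eq_mul, ← hb, hrb]
      have h3 : |r * B x a| ≤ 2 * c * c / b := by
        rw [abs_mul, hr, abs_div, abs_mul, hσ, abs_of_pos hpos, abs_of_pos (by positivity : 0 < 2 * c)]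
        rw [mul_one, div_mul_eq_mul_div]
        gcongr
      have h4 : 2 * c * c / b = 1 / 8 := by
        rw [mul_assoc, ← sq, hcsq]; field_simp; norm_num
      have h5 : r * (2 * c * σ) = 1 / 4 := by
        rw [hr, div_mul_eq_mul_div]
        have : 2 * c * σ * (2 * c * σ) = 4 * c ^ 2 * σ ^ 2 := by ring
        rw [this, hσ2, hcsq]; field_simp; norm_num
      rw [h4] at h3
      have := (abs_le.1 h3).2
      rw [h5]
      linarith
    · rw [Set.indicator_of_notMem hx]; simp
  have e0 : {x | |B x a| < c} = slab 0 := by simp [slab]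
  rw [e0]
  have hp := hlow 1 (by simp)
  have hm := hlow (-1) (by simp)
  have d1 : Disjoint (slab 0) (slab (2 * c * 1)) := by
    rw [Set.disjoint_left]; intro x h1 h2
    simp only [slab, Set.mem_ofPred_eq, abs_lt] at h1 h2; linarith [h1.2, h2.1]
  have d2 : Disjoint (slab 0 ∪ slab (2 * c * 1)) (slab (2 * c * -1)) := by
    rw [Set.disjoint_left]; intro x h1 h2
    simp only [slab, Set.mem_ofPred_eq, abs_lt, Set.mem_union] at h1 h2
    rcases h1 with h1 | h1 <;> linarith [h1.1, h2.2]
  have htot : γ (slab 0) + γ (slab (2 * c * 1)) + γ (slab (2 * c * -1)) ≤ 1 := by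
    rw [← measure_union d1 (hslab _), ← measure_union d2 (hslab _)]
    exact prob_le_one
  have he : (1 / 2 : ℝ) ≤ Real.exp (-(1 / 2)) := by
    have := Real.add_one_le_exp (-(1 / 2) : ℝ); linarith
  have he2 : (1 / 2 : ℝ≥0∞) ≤ ENNReal.ofReal (Real.exp (-(1 / 2))) := by
    have h : (1 / 2 : ℝ≥0∞) = ENNReal.ofReal (1 / 2) := by
      rw [ENNReal.ofReal_div_of_pos (by norm_num)]; simp
    rw [h]
    exact ENNReal.ofReal_le_ofReal he
  have h2 : 2 * γ (slab 0) ≤ 1 := by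
    calc 2 * γ (slab 0) = γ (slab 0) + (1 / 2) * γ (slab 0) + (1 / 2) * γ (slab 0) := by
          rw [add_assoc, ← add_mul, ENNReal.add_halves, one_mul, two_mul]
      _ ≤ _ := by
          refine le_trans ?_ htot
          gcongr
          · exact le_trans (by gcongr) hp
          · exact le_trans (by gcongr) hm
  rw [ENNReal.le_div_iff_mul_le (by simp) (by simp), mul_comm]
  exact h2

/-- If the integral of `F` along every line in direction `e` is at most `C`, then the Gaussian
expectation of `F` is at most `8 C √(B e e)`. -/
theorem IsGaussForm.lintegral_le_of_lines (hB : IsGaussForm B) {e : E} (he : e ≠ 0)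
    {F : E → ℝ≥0∞} (hF : Measurable F) {C : ℝ≥0∞} (hC : ∀ x, ∫⁻ u : ℝ, F (x + u • e) ≤ C) :
    ∫⁻ x, F x ∂(gaussLaw μ B) ≤ ENNReal.ofReal (8 * Real.sqrt (B e e)) * C := by
  have := hB.isProbabilityMeasure (μ := μ)
  set γ := gaussLaw μ B with hγ
  have hpos := hB.pos e he
  set b := B e e with hb
  set δ : ℝ := (Real.sqrt b)⁻¹ with hδ
  have hδ0 : 0 < δ := by positivity
  have hδb : δ ^ 2 * b = 1 := by
    rw [hδ, inv_pow, Real.sq_sqrt hpos.le]; field_simp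
  -- `w` dominates the translation density for all shifts u in [0, δ] at once: that density is at
  -- most 1 where B x e ≥ 0, and is controlled by the extreme shift elsewhere. Its mean is 1 + exp 1
  -- because δ • e has B-norm one. Averaging over u then produces the line integrals of `F`.
  let w : E → ℝ≥0∞ := fun x =>
    1 + ENNReal.ofReal (Real.exp (2 * B x (-(δ • e))))
  have hw : ∫⁻ x, w x ∂γ ≤ ENNReal.ofReal 4 := by
    simp only [w]
    rw [lintegral_add_left measurable_const, hB.lintegral_exp]
    simp only [lintegral_const, measure_univ, mul_one]
    have : B (-(δ • e)) (-(δ • e)) = 1 := by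
      simp only [map_neg, map_smul, LinearMap.neg_apply, LinearMap.smul_apply, smul_eq_mul, neg_neg,
        ← hb]
      linear_combination hδb
    rw [this, ← ENNReal.ofReal_one, ← ENNReal.ofReal_add (by norm_num) (Real.exp_pos _).le]
    apply ENNReal.ofReal_le_ofReal
    linarith [Real.exp_one_lt_d9]
  have hwm : Measurable w := by
    have := (continuous_bilin_right B (-(δ • e))).measurable
    fun_prop
  have hle : ∀ u ∈ Set.Icc (0 : ℝ) δ, ∫⁻ x, F x ∂γ ≤ ∫⁻ x, w x * F (x + u • e) ∂γ := by
    intro u hu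
    rw [← hB.lintegral_translate (μ := μ) (u • e) hF]
    refine lintegral_mono fun x => ?_
    gcongr
    simp only [w]
    have hbb : 0 ≤ B (u • e) (u • e) := hB.nonneg _
    have h1 : Real.exp (-(2 * B x (u • e) + B (u • e) (u • e)))
        ≤ 1 + Real.exp (2 * B x (-(δ • e))) := by
      have e1 : B x (u • e) = u * B x e := by simp
      have e2 : B x (-(δ • e)) = -(δ * B x e) := by simp
      rw [e1, e2]
      rcases le_total 0 (B x e) with h | h
      · have : Real.exp (-(2 * (u * B x e) + B (u • e) (u • e))) ≤ 1 := by
          apply Real.exp_le_one_iff.2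
          have := mul_nonneg hu.1 h
          linarith
        linarith [Real.exp_pos (2 * -(δ * B x e))]
      · have : Real.exp (-(2 * (u * B x e) + B (u • e) (u • e)))
            ≤ Real.exp (2 * -(δ * B x e)) := by
          apply Real.exp_le_exp.2
          have := mul_le_mul_of_nonpos_right hu.2 h
          linarith
        linarith
    calc ENNReal.ofReal (Real.exp (-(2 * B x (u • e) + B (u • e) (u • e))))
        ≤ ENNReal.ofReal (1 + Real.exp (2 * B x (-(δ • e)))) := ENNReal.ofReal_le_ofReal h1
      _ = _ := by rw [ENNReal.ofReal_add zero_le_one (Real.exp_pos _).le, ENNReal.ofReal_one]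
  have hint : ENNReal.ofReal δ * ∫⁻ x, F x ∂γ ≤ ENNReal.ofReal 4 * C := by
    calc ENNReal.ofReal δ * ∫⁻ x, F x ∂γ
        = ∫⁻ u in Set.Icc (0 : ℝ) δ, (∫⁻ x, F x ∂γ) := by
          rw [setLIntegral_const, Real.volume_Icc, sub_zero, mul_comm]
      _ ≤ ∫⁻ u in Set.Icc (0 : ℝ) δ, ∫⁻ x, w x * F (x + u • e) ∂γ :=
          setLIntegral_mono' measurableSet_Icc hle
      _ ≤ ∫⁻ u : ℝ, ∫⁻ x, w x * F (x + u • e) ∂γ := setLIntegral_le_lintegral _ _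
      _ = ∫⁻ x, (∫⁻ u : ℝ, w x * F (x + u • e)) ∂γ := by
          refine lintegral_lintegral_swap ?_
          have : Measurable fun p : ℝ × E => w p.2 * F (p.2 + p.1 • e) := by fun_prop
          exact this.aemeasurable
      _ ≤ ∫⁻ x, w x * C ∂γ := by
          refine lintegral_mono fun x => ?_
          have : Measurable fun u : ℝ => F (x + u • e) := by fun_prop
          rw [lintegral_const_mul _ this]
          gcongr
          exact hC x
      _ ≤ _ := by
          rw [lintegral_mul_const _ hwm]; gcongr
  have hinv : ENNReal.ofReal (Real.sqrt b) * ENNReal.ofReal δ = 1 := by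
    rw [← ENNReal.ofReal_mul (by positivity), hδ, mul_inv_cancel₀ (by positivity), ENNReal.ofReal_one]
  calc ∫⁻ x, F x ∂γ = ENNReal.ofReal (Real.sqrt b) * (ENNReal.ofReal δ * ∫⁻ x, F x ∂γ) := by
        rw [← mul_assoc, hinv, one_mul]
    _ ≤ ENNReal.ofReal (Real.sqrt b) * (ENNReal.ofReal 4 * C) := by gcongr
    _ = ENNReal.ofReal (4 * Real.sqrt b) * C := by
        rw [ENNReal.ofReal_mul (by norm_num)]; ring
    _ ≤ _ := by gcongr; norm_num

/-- Exponential moments of the quadratic form, by scaling. -/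
theorem IsGaussForm.lintegral_exp_self (hB : IsGaussForm B) {r : ℝ} (hr : 0 < r) :
    ∫⁻ x, ENNReal.ofReal (Real.exp ((1 - r ^ 2) * B x x)) ∂(gaussLaw μ B)
      = ENNReal.ofReal (r⁻¹ ^ Module.finrank ℝ E) := by
  have := hB.isProbabilityMeasure (μ := μ)
  have hone : ∫⁻ x, (1 : ℝ≥0∞) ∂(gaussLaw μ B) = 1 := by simp
  rw [lintegral_gaussLaw] at hone ⊢
  simp only [mul_one] at hone
  have hr0 : r ≠ 0 := hr.ne'
  have h1 : ∀ x, ENNReal.ofReal (Real.exp (-(B x x))) * ENNReal.ofReal (Real.exp ((1 - r ^ 2) * B x x))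
      = (fun y => ENNReal.ofReal (Real.exp (-(B y y)))) (r • x) := by
    intro x
    rw [← ENNReal.ofReal_mul (Real.exp_pos _).le, ← Real.exp_add]
    simp only [map_smul, LinearMap.smul_apply, smul_eq_mul]
    congr 2; ring
  simp_rw [h1]
  rw [← lintegral_map (measurable_exp_bilin B) (measurable_const_smul r),
    Measure.map_addHaar_smul μ hr0, lintegral_smul_measure, smul_eq_mul, mul_left_comm, hone, mul_one,
    abs_of_pos (by positivity), inv_pow]

end Gauss

/-! ### Products of tilted measures. -/

section Products

theorem tilted_eq_withDensity {α : Type*} [MeasurableSpace α] (μ : Measure α) (f : α → ℝ) :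
    μ.tilted f = μ.withDensity
      fun x => ENNReal.ofReal (Real.exp (f x) / ∫ x, Real.exp (f x) ∂μ) := rfl

theorem prod_tilted {α β : Type*} [MeasurableSpace α] [MeasurableSpace β] (μ : Measure α)
    (ν : Measure β) [SigmaFinite μ] [SigmaFinite ν] {f : α → ℝ} {g : β → ℝ} (hf : Measurable f)
    (hg : Measurable g) :
    (μ.tilted f).prod (ν.tilted g) = (μ.prod ν).tilted fun p => f p.1 + g p.2 := by
  rw [tilted_eq_withDensity, tilted_eq_withDensity, tilted_eq_withDensity,
    prod_withDensity (by fun_prop) (by fun_prop)]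
  congr 1
  ext p
  rw [← ENNReal.ofReal_mul (div_nonneg (Real.exp_pos _).le
    (integral_nonneg fun _ => (Real.exp_pos _).le))]
  congr 1
  simp_rw [Real.exp_add]
  rw [integral_prod_mul (fun x => Real.exp (f x)) (fun y => Real.exp (g y))]
  rw [div_mul_div_comm]

theorem pi_tilted {ι : Type*} [Fintype ι] {α : Type*} [MeasurableSpace α] (μ : Measure α)
    [SigmaFinite μ] {f : α → ℝ} (hf : Measurable f) (hi : Integrable (fun x => Real.exp (f x)) μ) :
    Measure.pi (fun _ : ι => μ.tilted f) = (Measure.pi fun _ : ι => μ).tilted fun x => ∑ i, f (x i) := by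
  -- The tilt of the zero measure is not a probability measure, and over an empty index set the
  -- product is a unit mass all the same.
  by_cases hμ : μ = 0
  · subst hμ
    rcases isEmpty_or_nonempty ι with h | ⟨⟨i⟩⟩
    · rw [tilted_zero_measure]
      symm
      simp only [Finset.univ_eq_empty, Finset.sum_empty]
      have : IsProbabilityMeasure (Measure.pi fun _ : ι => (0 : Measure α)) :=
        ⟨by rw [← Set.pi_univ, Measure.pi_pi]; simp⟩
      exact tilted_zero (Measure.pi fun _ : ι => (0 : Measure α))
    · have h0 : ∀ ν : ι → Measure α, (∀ i, SigmaFinite (ν i)) → ν i = 0 → Measure.pi ν = 0 := by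
        intro ν hν h
        rw [← Measure.measure_univ_eq_zero, ← Set.pi_univ, Measure.pi_pi]
        exact Finset.prod_eq_zero (Finset.mem_univ i) (by simp [h])
      rw [h0 (fun _ => (0 : Measure α).tilted f)
          (fun _ => by rw [tilted_zero_measure]; infer_instance) (tilted_zero_measure f),
        h0 (fun _ => 0) (fun _ => inferInstance) rfl, tilted_zero_measure]
  have : NeZero μ := ⟨hμ⟩
  have := isProbabilityMeasure_tilted hi
  refine Measure.pi_eq fun s hs => ?_
  rw [tilted_apply_eq_ofReal_integral' _ (MeasurableSet.univ_pi hs)]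
  have hZ : ∫ x : ι → α, Real.exp (∑ i, f (x i)) ∂(Measure.pi fun _ => μ)
      = ∏ _i : ι, ∫ x, Real.exp (f x) ∂μ := by
    simp_rw [Real.exp_sum]
    exact integral_fintype_prod_eq_prod (𝕜 := ℝ) (fun _ => fun x => Real.exp (f x))
  rw [← integral_indicator (MeasurableSet.univ_pi hs)]
  have h1 : ∀ x : ι → α, (Set.univ.pi s).indicator (fun x =>
      Real.exp (∑ i, f (x i)) / ∫ x : ι → α, Real.exp (∑ i, f (x i)) ∂(Measure.pi fun _ => μ)) x
      = ∏ i, (s i).indicator (fun y => Real.exp (f y) / ∫ x, Real.exp (f x) ∂μ) (x i) := by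
    intro x
    by_cases hx : x ∈ Set.univ.pi s
    · rw [Set.indicator_of_mem hx, hZ, Real.exp_sum, ← Finset.prod_div_distrib]
      refine Finset.prod_congr rfl fun i _ => ?_
      rw [Set.indicator_of_mem (hx i (Set.mem_univ i))]
    · rw [Set.indicator_of_notMem hx]
      simp only [Set.mem_pi, Set.mem_univ, true_implies, not_forall] at hx
      obtain ⟨i, hi⟩ := hx
      exact (Finset.prod_eq_zero (Finset.mem_univ i) (Set.indicator_of_notMem hi _)).symm
  simp_rw [h1]
  rw [integral_fintype_prod_eq_prod (𝕜 := ℝ) (fun i => (s i).indicator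
    (fun y => Real.exp (f y) / ∫ x, Real.exp (f x) ∂μ)), ENNReal.ofReal_prod_of_nonneg]
  · refine Finset.prod_congr rfl fun i _ => ?_
    rw [integral_indicator (hs i), tilted_apply_eq_ofReal_integral' _ (hs i)]
  · exact fun i _ => integral_nonneg fun y => Set.indicator_nonneg
      (fun _ _ => div_nonneg (Real.exp_pos _).le (integral_nonneg fun _ => (Real.exp_pos _).le)) _

end Products

/-! ### Lebesgue measure on products of coordinate spaces. -/

open scoped ENNReal

instance sigmaFinite_volume_pi {ι E : Type*} [Fintype ι] [MeasureSpace E]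
    [SigmaFinite (volume : Measure E)] : SigmaFinite (volume : Measure (ι → E)) := by
  rw [volume_pi]; infer_instance

instance isAddHaarMeasure_volume_pi {ι E : Type*} [Fintype ι] [NormedAddCommGroup E]
    [MeasureSpace E] [SigmaFinite (volume : Measure E)] [BorelSpace E] [SecondCountableTopology E]
    [(volume : Measure E).IsAddHaarMeasure] :
    (volume : Measure (ι → E)).IsAddHaarMeasure := by
  rw [volume_pi]; infer_instance

instance isAddHaarMeasure_volume_prod {E F : Type*} [NormedAddCommGroup E] [MeasureSpace E]
    [SigmaFinite (volume : Measure E)] [BorelSpace E] [SecondCountableTopology E]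
    [(volume : Measure E).IsAddHaarMeasure] [NormedAddCommGroup F] [MeasureSpace F]
    [SigmaFinite (volume : Measure F)] [BorelSpace F] [SecondCountableTopology F]
    [(volume : Measure F).IsAddHaarMeasure] :
    (volume : Measure (E × F)).IsAddHaarMeasure := by
  rw [Measure.volume_eq_prod]; infer_instance

/-! ### The real Hilbert–Schmidt inner product. -/

section Frobenius

variable {ι κ : Type*} [Fintype ι] [Fintype κ]

/-- The squared Hilbert–Schmidt norm. -/
def frobSq (A : Matrix ι κ ℂ) : ℝ := ∑ i, ∑ j, ‖A i j‖ ^ 2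

/-- The real Hilbert–Schmidt inner product `Re tr (A* B)`. -/
def frobInner (A B : Matrix ι κ ℂ) : ℝ := ∑ i, ∑ j, (star (A i j) * B i j).re

theorem frobInner_self (A : Matrix ι κ ℂ) : frobInner A A = frobSq A := by
  unfold frobInner frobSq
  refine Finset.sum_congr rfl fun i _ => Finset.sum_congr rfl fun j _ => ?_
  rw [← Complex.normSq_eq_norm_sq, Complex.normSq_apply]
  simp

theorem frobInner_comm (A B : Matrix ι κ ℂ) : frobInner A B = frobInner B A := by
  unfold frobInner
  refine Finset.sum_congr rfl fun i _ => Finset.sum_congr rfl fun j _ => ?_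
  simp; ring

theorem frobInner_add_left (A B C : Matrix ι κ ℂ) :
    frobInner (A + B) C = frobInner A C + frobInner B C := by
  simp only [frobInner, Matrix.add_apply, star_add, add_mul, Complex.add_re, Finset.sum_add_distrib]

theorem frobInner_smul_left (c : ℝ) (A C : Matrix ι κ ℂ) :
    frobInner (c • A) C = c * frobInner A C := by
  simp only [frobInner, Finset.mul_sum]
  refine Finset.sum_congr rfl fun i _ => Finset.sum_congr rfl fun j _ => ?_
  simp; ring

theorem frobInner_add_right (A B C : Matrix ι κ ℂ) :
    frobInner A (B + C) = frobInner A B + frobInner A C := by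
  rw [frobInner_comm, frobInner_add_left, frobInner_comm B, frobInner_comm C]

theorem frobInner_smul_right (c : ℝ) (A C : Matrix ι κ ℂ) :
    frobInner A (c • C) = c * frobInner A C := by
  rw [frobInner_comm, frobInner_smul_left, frobInner_comm]

theorem frobInner_eq_trace (A B : Matrix ι κ ℂ) :
    frobInner A B = (Matrix.trace (A.conjTranspose * B)).re := by
  simp only [frobInner, Matrix.trace, Matrix.diag, Matrix.mul_apply, Matrix.conjTranspose_apply,
    Complex.re_sum]
  exact Finset.sum_comm

theorem frobSq_eq_trace (A : Matrix ι κ ℂ) :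
    frobSq A = (Matrix.trace (A.conjTranspose * A)).re := by
  rw [← frobInner_self, frobInner_eq_trace]

theorem frobSq_nonneg (A : Matrix ι κ ℂ) : 0 ≤ frobSq A := by
  unfold frobSq; positivity

theorem frobSq_eq_zero {A : Matrix ι κ ℂ} : frobSq A = 0 ↔ A = 0 := by
  constructor
  · intro h
    ext i j
    unfold frobSq at h
    rw [Finset.sum_eq_zero_iff_of_nonneg (fun _ _ => by positivity)] at h
    have h1 := h i (Finset.mem_univ i)
    rw [Finset.sum_eq_zero_iff_of_nonneg (fun _ _ => by positivity)] at h1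
    simpa using h1 j (Finset.mem_univ j)
  · rintro rfl; simp [frobSq]

theorem frobSq_pos {A : Matrix ι κ ℂ} (h : A ≠ 0) : 0 < frobSq A :=
  lt_of_le_of_ne (frobSq_nonneg A) fun h0 => h (frobSq_eq_zero.1 h0.symm)

theorem frobSq_add (A B : Matrix ι κ ℂ) :
    frobSq (A + B) = frobSq A + 2 * frobInner A B + frobSq B := by
  rw [← frobInner_self, frobInner_add_left, frobInner_add_right, frobInner_add_right,
    frobInner_self, frobInner_self, frobInner_comm B A]
  ring

theorem frobSq_smul (c : ℝ) (A : Matrix ι κ ℂ) : frobSq (c • A) = c ^ 2 * frobSq A := by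
  rw [← frobInner_self, frobInner_smul_left, frobInner_smul_right, frobInner_self]; ring

theorem two_abs_frobInner_le (A B : Matrix ι κ ℂ) :
    2 * |frobInner A B| ≤ frobSq A + frobSq B := by
  have h1 := frobSq_nonneg (A + B)
  have h2 := frobSq_nonneg (A + (-1 : ℝ) • B)
  rw [frobSq_add] at h1 h2
  rw [frobInner_smul_right, frobSq_smul] at h2
  rcases abs_cases (frobInner A B) with ⟨h, _⟩ | ⟨h, _⟩ <;> rw [h] <;> linarith

/-- `frobInner` as a bilinear form. -/
def frobForm (ι κ : Type*) [Fintype ι] [Fintype κ] : LinearMap.BilinForm ℝ (Matrix ι κ ℂ) :=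
  LinearMap.mk₂ ℝ frobInner frobInner_add_left (fun c A B => frobInner_smul_left c A B)
    frobInner_add_right (fun c A B => frobInner_smul_right c A B)

end Frobenius

/-! ### Real coordinates on Hermitian matrices and the one-block laws. -/

section Coordinates

variable {W : ℕ}

theorem hermitianOf_add (h k : Fin W → Fin W → ℝ) :
    hermitianOf (h + k) = hermitianOf h + hermitianOf k := by
  ext i j
  simp only [hermitianOf, Matrix.of_apply, Matrix.add_apply, Pi.add_apply]
  split_ifs <;> push_cast <;> ring

theorem hermitianOf_smul (c : ℝ) (h : Fin W → Fin W → ℝ) :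
    hermitianOf (c • h) = c • hermitianOf h := by
  ext i j
  simp only [hermitianOf, Matrix.of_apply, Matrix.smul_apply, Pi.smul_apply, smul_eq_mul,
    Complex.real_smul]
  split_ifs <;> push_cast <;> ring

/-- `hermitianOf` as a linear map. -/
def hermitianL (W : ℕ) : (Fin W → Fin W → ℝ) →ₗ[ℝ] Matrix (Fin W) (Fin W) ℂ where
  toFun := hermitianOf
  map_add' := hermitianOf_add
  map_smul' := hermitianOf_smul

/-- The coordinates of a Hermitian matrix. -/
def coordL (W : ℕ) : Matrix (Fin W) (Fin W) ℂ →ₗ[ℝ] (Fin W → Fin W → ℝ) where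
  toFun M := fun i j => if i ≤ j then (M i j).re else (M j i).im
  map_add' M N := by
    ext i j; simp only [Matrix.add_apply, Pi.add_apply]; split_ifs <;> simp
  map_smul' c M := by
    ext i j; simp only [Matrix.smul_apply, Pi.smul_apply]; split_ifs <;> simp

theorem hermitianOf_coordL {M : Matrix (Fin W) (Fin W) ℂ} (hM : M.IsHermitian) :
    hermitianOf (coordL W M) = M := by
  ext i j
  have h1 : ∀ i j, star (M j i) = M i j := fun i j => hM.apply i j
  have hre : ∀ i j, (M i j).re = (M j i).re := fun i j => by rw [← h1 i j]; simp
  have him : ∀ i j, (M i j).im = -(M j i).im := fun i j => by rw [← h1 i j]; simp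
  simp only [hermitianOf, coordL, Matrix.of_apply, LinearMap.coe_mk, AddHom.coe_mk]
  rcases lt_trichotomy i j with h | rfl | h
  · simp only [h.ne, h, h.le, h.not_ge, if_true, if_false]
    apply Complex.ext <;> simp
  · simp only [le_refl, if_true]
    apply Complex.ext
    · simp
    · have := him i i; simp; linarith
  · simp only [h.ne', h.not_gt, h.le, h.not_ge, if_true, if_false]
    apply Complex.ext
    · simp [hre i j]
    · simp [him i j]

theorem coordL_hermitianOf (h : Fin W → Fin W → ℝ) : coordL W (hermitianOf h) = h := by
  ext i j
  simp only [hermitianOf, coordL, Matrix.of_apply, LinearMap.coe_mk, AddHom.coe_mk]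
  rcases lt_trichotomy i j with h | rfl | h
  · simp [h.ne, h, h.le]
  · simp
  · simp [h.not_ge, h.ne, h]

theorem hermitianOf_injective : Function.Injective (hermitianOf (W := W)) :=
  Function.LeftInverse.injective coordL_hermitianOf

theorem hermitianOf_add_coordL (h : Fin W → Fin W → ℝ) {M : Matrix (Fin W) (Fin W) ℂ}
    (hM : M.IsHermitian) : hermitianOf (h + coordL W M) = hermitianOf h + M := by
  rw [hermitianOf_add, hermitianOf_coordL hM]

/-- The form `W Re tr (V V')` in the coordinates of `hermitianOf`. -/
def formV (W : ℕ) : LinearMap.BilinForm ℝ (Fin W → Fin W → ℝ) :=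
  (W : ℝ) • (frobForm (Fin W) (Fin W)).compl₁₂ (hermitianL W) (hermitianL W)

theorem formV_apply (h k : Fin W → Fin W → ℝ) :
    formV W h k = W * frobInner (hermitianOf h) (hermitianOf k) := rfl

theorem formV_self (h : Fin W → Fin W → ℝ) : formV W h h = W * frobSq (hermitianOf h) := by
  rw [formV_apply, frobInner_self]

/-- The form `W Re tr (T* T')`. -/
def formT (W : ℕ) : LinearMap.BilinForm ℝ (Fin W → Fin W → ℂ) :=
  (W : ℝ) • (frobForm (Fin W) (Fin W)).compl₁₂ (Matrix.ofLinearEquiv ℝ).toLinearMap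
    (Matrix.ofLinearEquiv ℝ).toLinearMap

theorem formT_apply (a b : Fin W → Fin W → ℂ) :
    formT W a b = W * frobInner (Matrix.of a) (Matrix.of b) := rfl

theorem formT_self (a : Fin W → Fin W → ℂ) : formT W a a = W * frobSq (Matrix.of a) := by
  rw [formT_apply, frobInner_self]

theorem isGaussForm_formV (hW : 0 < W) : IsGaussForm (formV W) where
  symm x y := by rw [formV_apply, formV_apply, frobInner_comm]
  pos x hx := by
    rw [formV_self]
    have : hermitianOf x ≠ 0 := fun h => hx (hermitianOf_injective (by
      rw [h]; exact ((hermitianL W).map_zero).symm))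
    have := frobSq_pos this
    positivity

theorem isGaussForm_formT (hW : 0 < W) : IsGaussForm (formT W) where
  symm x y := by rw [formT_apply, formT_apply, frobInner_comm]
  pos x hx := by
    rw [formT_self]
    have : Matrix.of x ≠ 0 := fun h => hx (Matrix.of.injective h)
    have := frobSq_pos this
    positivity

/-- The law of a single on-site matrix, in coordinates. -/
def lawV (W : ℕ) : Measure (Fin W → Fin W → ℝ) := gaussLaw volume (formV W)

/-- The law of a single hopping matrix. -/
def lawT (W : ℕ) : Measure (Fin W → Fin W → ℂ) := gaussLaw volume (formT W)

theorem isProbabilityMeasure_lawV (hW : 0 < W) : IsProbabilityMeasure (lawV W) :=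
  (isGaussForm_formV hW).isProbabilityMeasure

theorem isProbabilityMeasure_lawT (hW : 0 < W) : IsProbabilityMeasure (lawT W) :=
  (isGaussForm_formT hW).isProbabilityMeasure

end Coordinates

/-! ### The law of the model as a Gaussian product measure. -/

section Orbital

variable {n W : ℕ}

instance isAddHaarMeasure_volume_orbitalSpace :
    (volume : Measure (OrbitalSpace n W)).IsAddHaarMeasure :=
  isAddHaarMeasure_volume_prod

theorem energy_eq (ω : OrbitalSpace n W) :
    ω.energy = ∑ j, frobSq (hermitianOf (ω.1 j)) + ∑ j, frobSq (Matrix.of (ω.2 j)) := by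
  simp only [OrbitalSpace.energy, Matrix.trace_add, Complex.add_re, Matrix.trace_sum, Complex.re_sum,
    ← frobSq_eq_trace, OrbitalSpace.V, OrbitalSpace.T]

/-- The form `W × energy` on the whole space. -/
def formO (n W : ℕ) : LinearMap.BilinForm ℝ (OrbitalSpace n W) :=
  (∑ j, (formV W).compl₁₂ (LinearMap.proj j ∘ₗ LinearMap.fst ℝ _ _)
      (LinearMap.proj j ∘ₗ LinearMap.fst ℝ _ _))
  + ∑ j, (formT W).compl₁₂ (LinearMap.proj j ∘ₗ LinearMap.snd ℝ _ _)
      (LinearMap.proj j ∘ₗ LinearMap.snd ℝ _ _)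

theorem formO_apply (ω η : OrbitalSpace n W) :
    formO n W ω η = ∑ j, formV W (ω.1 j) (η.1 j) + ∑ j, formT W (ω.2 j) (η.2 j) := by
  simp [formO, LinearMap.sum_apply]

theorem formO_self (ω : OrbitalSpace n W) : formO n W ω ω = W * ω.energy := by
  rw [formO_apply, energy_eq, mul_add, Finset.mul_sum, Finset.mul_sum]
  simp_rw [formV_self, formT_self]

theorem isGaussForm_formO (hW : 0 < W) : IsGaussForm (formO n W) where
  symm x y := by
    rw [formO_apply, formO_apply]
    simp_rw [(isGaussForm_formV hW).symm (x.1 _), (isGaussForm_formT hW).symm (x.2 _)]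
  pos x hx := by
    rw [formO_apply]
    have h1 : ∀ j, 0 ≤ formV W (x.1 j) (x.1 j) := fun j => (isGaussForm_formV hW).nonneg _
    have h2 : ∀ j, 0 ≤ formT W (x.2 j) (x.2 j) := fun j => (isGaussForm_formT hW).nonneg _
    have h1s := Finset.sum_nonneg fun j (_ : j ∈ Finset.univ) => h1 j
    have h2s := Finset.sum_nonneg fun j (_ : j ∈ Finset.univ) => h2 j
    by_cases hx1 : x.1 = 0
    · have hx2 : x.2 ≠ 0 := fun h => hx (Prod.ext hx1 h)
      obtain ⟨j, hj⟩ := Function.ne_iff.1 hx2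
      have := Finset.sum_pos' (fun j (_ : j ∈ Finset.univ) => h2 j)
        ⟨j, Finset.mem_univ j, (isGaussForm_formT hW).pos _ hj⟩
      linarith
    · obtain ⟨j, hj⟩ := Function.ne_iff.1 hx1
      have := Finset.sum_pos' (fun j (_ : j ∈ Finset.univ) => h1 j)
        ⟨j, Finset.mem_univ j, (isGaussForm_formV hW).pos _ hj⟩
      linarith

theorem orbitalLaw_eq_gaussLaw (n W : ℕ) : orbitalLaw n W = gaussLaw volume (formO n W) := by
  unfold orbitalLaw gaussLaw
  congr 1
  ext ω
  rw [formO_self]; ring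

theorem isProbabilityMeasure_orbitalLaw (hW : 0 < W) : IsProbabilityMeasure (orbitalLaw n W) := by
  rw [orbitalLaw_eq_gaussLaw]; exact (isGaussForm_formO hW).isProbabilityMeasure

/-- The energy is a sum over blocks. This independence is what allows conditioning on all blocks but
one. -/
theorem orbitalLaw_eq_prod (hW : 0 < W) :
    orbitalLaw n W = (Measure.pi fun _ => lawV W).prod (Measure.pi fun _ => lawT W) := by
  have hV : Measurable fun x => -(formV W x x) := (continuous_bilin_self (formV W)).measurable.neg
  have hT : Measurable fun x => -(formT W x x) := (continuous_bilin_self (formT W)).measurable.neg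
  have hV' : Measurable fun x : Fin n → Fin W → Fin W → ℝ => ∑ i, -(formV W (x i) (x i)) :=
    Finset.measurable_fun_sum _ fun j _ => hV.comp (measurable_pi_apply j)
  have hT' : Measurable fun x : Fin (n - 1) → Fin W → Fin W → ℂ => ∑ i, -(formT W (x i) (x i)) :=
    Finset.measurable_fun_sum _ fun j _ => hT.comp (measurable_pi_apply j)
  have eV : (Measure.pi fun _ : Fin n => lawV W) = (volume : Measure _).tilted
      fun x => ∑ i, -(formV W (x i) (x i)) :=
    pi_tilted volume hV (isGaussForm_formV hW).integrable
  have eT : (Measure.pi fun _ : Fin (n - 1) => lawT W) = (volume : Measure _).tilted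
      fun x => ∑ i, -(formT W (x i) (x i)) :=
    pi_tilted volume hT (isGaussForm_formT hW).integrable
  rw [eV, eT, prod_tilted _ _ hV' hT', ← Measure.volume_eq_prod, orbitalLaw_eq_gaussLaw, gaussLaw]
  congr 1
  ext ω
  rw [formO_apply, Finset.sum_neg_distrib, Finset.sum_neg_distrib, neg_add]

end Orbital

/-! ### Rank two perturbations. -/

section RankTwo

variable {ι : Type*}

/-- The Hermitian rank two matrix `φ y* + y φ*`. -/
def rankTwo (φ y : ι → ℂ) : Matrix ι ι ℂ :=
  Matrix.vecMulVec φ (star y) + Matrix.vecMulVec y (star φ)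

theorem rankTwo_add (φ y y' : ι → ℂ) : rankTwo φ (y + y') = rankTwo φ y + rankTwo φ y' := by
  simp only [rankTwo, star_add, Matrix.vecMulVec_add, Matrix.add_vecMulVec]; abel

theorem rankTwo_smul (c : ℝ) (φ y : ι → ℂ) : rankTwo φ (c • y) = c • rankTwo φ y := by
  ext i j
  simp [rankTwo, Matrix.vecMulVec_apply]

variable [Fintype ι]

theorem trace_mul_rankTwo (M : Matrix ι ι ℂ) (φ y : ι → ℂ) :
    (M * rankTwo φ y).trace = star y ⬝ᵥ (M *ᵥ φ) + star φ ⬝ᵥ (M *ᵥ y) := by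
  rw [rankTwo, Matrix.mul_add, Matrix.trace_add, Matrix.mul_vecMulVec, Matrix.mul_vecMulVec,
    Matrix.trace_vecMulVec, Matrix.trace_vecMulVec, dotProduct_comm, dotProduct_comm (M *ᵥ y)]

variable [DecidableEq ι]

/-- The perturbation factors through a two-dimensional space, so the matrix determinant lemma leaves
a 2 × 2 determinant. It is quadratic in `d`, which is why circular paths of `d` lead to quartics. -/
theorem det_add_rankTwo {A : Matrix ι ι ℂ} (hA : IsUnit A.det) (φ d : ι → ℂ) :
    (A + rankTwo φ d).det = A.det *
      ((1 + star d ⬝ᵥ (A⁻¹ *ᵥ φ)) * (1 + star φ ⬝ᵥ (A⁻¹ *ᵥ d))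
        - (star d ⬝ᵥ (A⁻¹ *ᵥ d)) * (star φ ⬝ᵥ (A⁻¹ *ᵥ φ))) := by
  let U : Matrix ι (Fin 2) ℂ := Matrix.of fun i k => if k = 0 then φ i else d i
  let V : Matrix (Fin 2) ι ℂ := Matrix.of fun k i => if k = 0 then star (d i) else star (φ i)
  have h1 : rankTwo φ d = U * V := by
    ext i j
    simp [rankTwo, Matrix.vecMulVec_apply, Matrix.mul_apply, U, V, Fin.sum_univ_two]
  have h2 : ∀ k l, (V * A⁻¹ * U) k l = (V k) ⬝ᵥ (A⁻¹ *ᵥ (fun i => U i l)) := by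
    intro k l
    rw [Matrix.mul_assoc]
    rfl
  have hV0 : V 0 = star d := by ext i; simp [V]
  have hV1 : V 1 = star φ := by ext i; simp [V]
  have hU0 : (fun i => U i 0) = φ := by ext i; simp [U]
  have hU1 : (fun i => U i 1) = d := by ext i; simp [U]
  rw [h1, Matrix.det_add_mul U V hA, Matrix.det_fin_two]
  simp only [Matrix.add_apply, h2, hV0, hV1, hU0, hU1]
  simp

end RankTwo

/-! ### Logarithmic derivatives of quartics. -/

section Quartic

open Polynomial

/-- If the logarithmic derivative of a polynomial is large at `t`, then `t` is close to a root. -/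
theorem exists_root_near {p : ℂ[X]} (hdeg : p.natDegree ≤ 4) {t : ℂ} (ht : p.eval t ≠ 0) {K : ℝ}
    (hK : 0 < K) (h : K ≤ ‖p.derivative.eval t / p.eval t‖) :
    ∃ r ∈ p.roots.toFinset, ‖t - r‖ ≤ 4 / K := by
  -- p'/p is the sum of 1/(t - r) over at most four roots; were all of them farther than 4/K, each
  -- term would be below K/4.
  rw [(IsAlgClosed.splits p).eval_derivative_div_eval_of_ne_zero ht] at h
  by_contra! hcon
  have h1 : ∀ r ∈ p.roots, ‖1 / (t - r)‖ ≤ K / 4 := by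
    intro r hr
    have := hcon r (Multiset.mem_toFinset.2 hr)
    rw [norm_div, norm_one, div_le_iff₀ (lt_trans (by positivity) this)]
    have := this.le
    rw [div_le_iff₀ hK] at this
    linarith
  have hstrict : ∀ r ∈ p.roots, ‖1 / (t - r)‖ < K / 4 := by
    intro r hr
    have := hcon r (Multiset.mem_toFinset.2 hr)
    rw [norm_div, norm_one, div_lt_iff₀ (lt_trans (by positivity) this)]
    rw [div_lt_iff₀ hK] at this
    linarith
  have hcard : p.roots.card ≤ 4 := (card_roots' p).trans hdeg
  have h2 : ‖(p.roots.map fun z => 1 / (t - z)).sum‖ ≤ (p.roots.map fun z => ‖1 / (t - z)‖).sum := by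
    refine (norm_multiset_sum_le _).trans ?_
    rw [Multiset.map_map]; rfl
  rcases Multiset.empty_or_exists_mem p.roots with h0 | ⟨r₀, hr₀⟩
  · rw [h0] at h; simp at h; linarith
  have h3 : (p.roots.map fun z => ‖1 / (t - z)‖).sum < (p.roots.map fun _ => K / 4).sum :=
    Multiset.sum_lt_sum h1 ⟨r₀, hr₀, hstrict r₀ hr₀⟩
  rw [Multiset.map_const', Multiset.sum_replicate, nsmul_eq_mul] at h3
  have h4 : (p.roots.card : ℝ) * (K / 4) ≤ 4 * (K / 4) := by
    gcongr; exact_mod_cast hcard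
  linarith

theorem volume_near_roots {p : ℂ[X]} (hdeg : p.natDegree ≤ 4) {δ : ℝ} (hδ : 0 ≤ δ) :
    volume {t : ℝ | ∃ r ∈ p.roots.toFinset, ‖(t : ℂ) - r‖ ≤ δ} ≤ ENNReal.ofReal (8 * δ) := by
  have hsub : {t : ℝ | ∃ r ∈ p.roots.toFinset, ‖(t : ℂ) - r‖ ≤ δ}
      ⊆ ⋃ r ∈ p.roots.toFinset, Set.Icc (r.re - δ) (r.re + δ) := by
    rintro t ⟨r, hr, h⟩
    refine Set.mem_biUnion hr ?_
    have h1 := (Complex.abs_re_le_norm ((t : ℂ) - r)).trans h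
    simp only [Complex.sub_re, Complex.ofReal_re] at h1
    rw [abs_le] at h1
    constructor <;> linarith [h1.1, h1.2]
  refine (measure_mono hsub).trans ((measure_biUnion_finset_le _ _).trans ?_)
  have h2 : ∀ r ∈ p.roots.toFinset, volume (Set.Icc (r.re - δ) (r.re + δ)) = ENNReal.ofReal (2 * δ) := by
    intro r _; rw [Real.volume_Icc]; congr 1; ring
  rw [Finset.sum_congr rfl h2, Finset.sum_const, nsmul_eq_mul]
  have hcard : p.roots.toFinset.card ≤ 4 :=
    (Multiset.toFinset_card_le _).trans ((card_roots' p).trans hdeg)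
  calc (p.roots.toFinset.card : ℝ≥0∞) * ENNReal.ofReal (2 * δ)
      ≤ (4 : ℕ) * ENNReal.ofReal (2 * δ) := by gcongr
    _ = ENNReal.ofReal (8 * δ) := by
        rw [← ENNReal.ofReal_natCast, ← ENNReal.ofReal_mul (by positivity)]
        congr 1; push_cast; ring

end Quartic

/-! ### The determinant along a rotation. -/

section Curve

open Polynomial

variable {ι : Type*} [Fintype ι] [DecidableEq ι]

/-- Rational parametrisation of the cosine. -/
def rcos (t : ℝ) : ℝ := (1 - t ^ 2) / (1 + t ^ 2)

/-- Rational parametrisation of the sine. -/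
def rsin (t : ℝ) : ℝ := 2 * t / (1 + t ^ 2)

theorem rcos_sq_add_rsin_sq (t : ℝ) : rcos t ^ 2 + rsin t ^ 2 = 1 := by
  unfold rcos rsin; field_simp; ring

/-- A circular path through rank two perturbations of `M`. -/
def rankTwoPath (M : Matrix ι ι ℂ) (φ y y' : ι → ℂ) (t : ℝ) : Matrix ι ι ℂ :=
  M + rankTwo φ (rcos t • y + rsin t • y')

/-- The determinant along the path, relative to the point `u`, is a quartic polynomial up to the
factor `(1 + t²)²`; its logarithmic derivative at `u` is a trace. -/
theorem exists_quartic (M : Matrix ι ι ℂ) (φ y y' : ι → ℂ) (u : ℝ)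
    (hu : IsUnit (rankTwoPath M φ y y' u).det) :
    ∃ p : ℂ[X], p.natDegree ≤ 4 ∧
      (∀ t : ℝ, (1 + (t : ℂ) ^ 2) ^ 2 * (rankTwoPath M φ y y' t).det
        = (rankTwoPath M φ y y' u).det * p.eval (t : ℂ)) ∧
      p.eval (u : ℂ) = (1 + (u : ℂ) ^ 2) ^ 2 ∧
      p.derivative.eval (u : ℂ) = (1 + (u : ℂ) ^ 2) * (4 * u +
        2 * ((rankTwoPath M φ y y' u)⁻¹ * rankTwo φ (-rsin u • y + rcos u • y')).trace) := by
  set A := rankTwoPath M φ y y' u with hA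
  let s : (ι → ℂ) → (ι → ℂ) → ℂ := fun x z => star x ⬝ᵥ (A⁻¹ *ᵥ z)
  have s_add_left : ∀ x x' z, s (x + x') z = s x z + s x' z := by
    intro x x' z; simp [s, add_dotProduct]
  have s_add_right : ∀ x z z', s x (z + z') = s x z + s x z' := by
    intro x z z'; simp [s, Matrix.mulVec_add, dotProduct_add]
  have s_smul_left : ∀ (c : ℝ) x z, s (c • x) z = c * s x z := by
    intro c x z
    have : star (c • x) = (c : ℂ) • star x := by ext i; simp
    simp only [s, this, smul_dotProduct, smul_eq_mul]
  have s_smul_right : ∀ (c : ℝ) x z, s x (c • z) = c * s x z := by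
    intro c x z
    have : c • z = (c : ℂ) • z := by ext i; simp
    simp only [s, this, Matrix.mulVec_smul, dotProduct_smul, smul_eq_mul]
  set D0 : ι → ℂ := (1 - rcos u) • y + (-rsin u) • y' with hD0
  set D1 : ι → ℂ := (2 : ℝ) • y' with hD1
  set D2 : ι → ℂ := (-(1 + rcos u)) • y + (-rsin u) • y' with hD2
  -- (1 + t²) times the displacement of the path from its position at `u`. Clearing the denominator
  -- makes it quadratic in t, and it vanishes at t = u.
  let D : ℝ → ι → ℂ := fun t => D0 + t • D1 + (t ^ 2) • D2
  have hDt : ∀ t : ℝ, D t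
      = (1 + t ^ 2) • ((rcos t • y + rsin t • y') - (rcos u • y + rsin u • y')) := by
    intro t
    have h1 : (1 + t ^ 2) * rcos t = 1 - t ^ 2 := by unfold rcos; field_simp
    have h2 : (1 + t ^ 2) * rsin t = 2 * t := by unfold rsin; field_simp
    ext i
    simp only [D, hD0, hD1, hD2, Pi.add_apply, Pi.smul_apply, Pi.sub_apply, Complex.real_smul]
    have h1' : ((1 : ℂ) + t ^ 2) * (rcos t : ℂ) = 1 - t ^ 2 := by exact_mod_cast h1
    have h2' : ((1 : ℂ) + t ^ 2) * (rsin t : ℂ) = 2 * t := by exact_mod_cast h2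
    push_cast
    linear_combination (-(y i)) * h1' - (y' i) * h2'
  have hDu : D u = 0 := by rw [hDt]; simp
  have hDr : ∀ x, s x (D u) = 0 := by intro x; rw [hDu]; simp [s]
  have hDl : ∀ x, s (D u) x = 0 := by intro x; rw [hDu]; simp [s]
  have exR : ∀ (x : ι → ℂ) (t : ℝ), s x (D t) = s x D0 + t * s x D1 + t ^ 2 * s x D2 := by
    intro x t; simp only [D, s_add_right, s_smul_right]; push_cast; ring
  have exL : ∀ (x : ι → ℂ) (t : ℝ), s (D t) x = s D0 x + t * s D1 x + t ^ 2 * s D2 x := by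
    intro x t; simp only [D, s_add_left, s_smul_left]; push_cast; ring
  let a : ℂ[X] := C (s φ D0) + C (s φ D1) * X + C (s φ D2) * X ^ 2
  let b : ℂ[X] := C (s D0 φ) + C (s D1 φ) * X + C (s D2 φ) * X ^ 2
  let e : ℂ[X] := C (s D0 D0) + C (s D0 D1 + s D1 D0) * X
    + C (s D0 D2 + s D1 D1 + s D2 D0) * X ^ 2 + C (s D1 D2 + s D2 D1) * X ^ 3
    + C (s D2 D2) * X ^ 4
  let p : ℂ[X] := (1 + X ^ 2 + b) * (1 + X ^ 2 + a) - C (s φ φ) * e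
  have hea : ∀ t : ℝ, a.eval (t : ℂ) = s φ (D t) := by
    intro t; simp only [a, exR]; simp; ring
  have heb : ∀ t : ℝ, b.eval (t : ℂ) = s (D t) φ := by
    intro t; simp only [b, exL]; simp; ring
  have hee : ∀ t : ℝ, e.eval (t : ℂ) = s (D t) (D t) := by
    intro t
    rw [exL, exR, exR, exR]; simp only [e]; simp; ring
  have hda : a.derivative.eval (u : ℂ) = s φ D1 + 2 * u * s φ D2 := by
    simp [a]; ring
  have hdb : b.derivative.eval (u : ℂ) = s D1 φ + 2 * u * s D2 φ := by
    simp [b]; ring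
  -- `e` represents s (D t) (D t), which vanishes to second order at u; only the terms linear in D
  -- reach the derivative.
  have hde : e.derivative.eval (u : ℂ) = 0 := by
    have r0 := hDr D0
    have r1 := hDr D1
    have r2 := hDr D2
    have l0 := hDl D0
    have l1 := hDl D1
    have l2 := hDl D2
    rw [exR] at r0 r1 r2
    rw [exL] at l0 l1 l2
    simp [e]
    linear_combination r1 + 2 * (u : ℂ) * r2 + l1 + 2 * (u : ℂ) * l2
  have hau : a.eval (u : ℂ) = 0 := by rw [hea, hDr]
  have hbu : b.eval (u : ℂ) = 0 := by rw [heb, hDl]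
  have heu : e.eval (u : ℂ) = 0 := by rw [hee, hDr]
  refine ⟨p, ?_, ?_, ?_, ?_⟩
  · simp only [p, a, b, e]
    compute_degree
  · intro t
    set d := (rcos t • y + rsin t • y') - (rcos u • y + rsin u • y') with hd
    have hpath : rankTwoPath M φ y y' t = A + rankTwo φ d := by
      rw [hA, rankTwoPath, rankTwoPath, add_assoc, ← rankTwo_add]
      congr 2
      rw [hd]; abel
    have ha' : s φ (D t) = (1 + (t : ℂ) ^ 2) * s φ d := by
      rw [hDt, s_smul_right]; push_cast; ring
    have hb' : s (D t) φ = (1 + (t : ℂ) ^ 2) * s d φ := by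
      rw [hDt, s_smul_left]; push_cast; ring
    have he' : s (D t) (D t) = (1 + (t : ℂ) ^ 2) ^ 2 * s d d := by
      rw [hDt, s_smul_left, s_smul_right]; push_cast; ring
    rw [hpath, det_add_rankTwo hu]
    have hev : p.eval (t : ℂ) = (1 + (t : ℂ) ^ 2 + s (D t) φ) * (1 + (t : ℂ) ^ 2 + s φ (D t))
        - s φ φ * s (D t) (D t) := by
      simp only [p, eval_sub, eval_mul, eval_add, eval_one, eval_pow, eval_X, eval_C, hea, heb, hee]
    rw [hev, ha', hb', he']
    simp only [s]
    ring
  · simp only [p, eval_sub, eval_mul, eval_add, eval_one, eval_pow, eval_X, eval_C, hau, hbu, heu]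
    ring
  · have h1 : p.derivative.eval (u : ℂ) = (2 * u + b.derivative.eval (u : ℂ)) * (1 + (u : ℂ) ^ 2)
        + (1 + (u : ℂ) ^ 2) * (2 * u + a.derivative.eval (u : ℂ)) := by
      simp only [p, derivative_sub, derivative_mul, derivative_add, derivative_one, derivative_X_pow,
        derivative_C, eval_sub, eval_mul, eval_add, eval_one, eval_pow, eval_X, eval_C, hau, hbu, heu,
        hde]
      simp
    rw [h1, hda, hdb, trace_mul_rankTwo]
    -- This is D'(u). The angle moves at speed 2/(1 + u²), and the factor 1 + u² in D compensates.
    have hw : D1 + (2 * u) • D2 = (2 : ℝ) • (-rsin u • y + rcos u • y') := by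
      have h1 : u * (1 + rcos u) = rsin u := by unfold rcos rsin; field_simp; ring
      have h2 : 1 - u * rsin u = rcos u := by unfold rcos rsin; field_simp; ring
      ext i
      simp only [hD1, hD2, Pi.add_apply, Pi.smul_apply, Complex.real_smul]
      have h1' : (u : ℂ) * (1 + rcos u) = rsin u := by exact_mod_cast h1
      have h2' : 1 - (u : ℂ) * rsin u = rcos u := by exact_mod_cast h2
      push_cast
      linear_combination (-2 * y i) * h1' + (2 * y' i) * h2'
    have hr := congrArg (s φ) hw
    have hl := congrArg (fun x => s x φ) hw
    simp only [s_add_right, s_smul_right] at hr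
    simp only [s_add_left, s_smul_left] at hl
    have e1 : star (-rsin u • y + rcos u • y') ⬝ᵥ (A⁻¹ *ᵥ φ) = s (-rsin u • y + rcos u • y') φ := rfl
    have e2 : star φ ⬝ᵥ (A⁻¹ *ᵥ (-rsin u • y + rcos u • y')) = s φ (-rsin u • y + rcos u • y') := rfl
    rw [e1, e2]
    simp only [s_add_right, s_smul_right, s_add_left, s_smul_left]
    push_cast at hr hl ⊢
    linear_combination (1 + (u : ℂ) ^ 2) * (hr + hl)

/-- The times at which the logarithmic derivative of the determinant is large form a small set. -/
theorem volume_large_trace (M : Matrix ι ι ℂ) (φ y y' : ι → ℂ) {K : ℝ} (hK : 0 < K) :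
    volume {t : ℝ | t ∈ Set.Icc (-1 : ℝ) 1 ∧ K ≤ ‖((rankTwoPath M φ y y' t)⁻¹
      * rankTwo φ (-rsin t • y + rcos t • y')).trace‖} ≤ ENNReal.ofReal (64 / K) := by
  set S := {t : ℝ | t ∈ Set.Icc (-1 : ℝ) 1 ∧ K ≤ ‖((rankTwoPath M φ y y' t)⁻¹
      * rankTwo φ (-rsin t • y + rcos t • y')).trace‖} with hS
  -- For K < 4 the claimed bound exceeds the length 2 of the interval. For K ≥ 4 the term 4t coming
  -- from (1 + t²)² is harmless.
  rcases lt_or_ge K 4 with hK4 | hK4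
  · calc volume S ≤ volume (Set.Icc (-1 : ℝ) 1) := measure_mono fun t ht => ht.1
      _ = ENNReal.ofReal 2 := by rw [Real.volume_Icc]; norm_num
      _ ≤ _ := by
        apply ENNReal.ofReal_le_ofReal
        rw [le_div_iff₀ hK]; linarith
  rcases S.eq_empty_or_nonempty with hemp | ⟨u, hu⟩
  · rw [hemp]; simp
  have hunit : ∀ t ∈ S, IsUnit (rankTwoPath M φ y y' t).det := by
    intro t ht
    by_contra hcon
    have := ht.2
    rw [Matrix.nonsing_inv_apply_not_isUnit _ hcon] at this
    simp at this
    linarith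
  -- The quartic based at one point `u` serves all t: the quartic `q` based at t gives the
  -- derivative in closed form, and it is proportional to `p` because the two represent the same
  -- determinant. So the same four roots control the whole set, each excluding an interval of length
  -- 16/K.
  obtain ⟨p, hdeg, hp, -, -⟩ := exists_quartic M φ y y' u (hunit u hu)
  refine (measure_mono (t := {t : ℝ | ∃ r ∈ p.roots.toFinset, ‖(t : ℂ) - r‖ ≤ 8 / K}) ?_).trans
    ((volume_near_roots hdeg (by positivity)).trans (ENNReal.ofReal_le_ofReal (le_of_eq (by ring))))
  intro t ht
  obtain ⟨q, -, hq, hqt, hq't⟩ := exists_quartic M φ y y' t (hunit t ht)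
  have hdu : (rankTwoPath M φ y y' u).det ≠ 0 := (hunit u hu).ne_zero
  have hdt : (rankTwoPath M φ y y' t).det ≠ 0 := (hunit t ht).ne_zero
  have hpq : C (rankTwoPath M φ y y' u).det * p = C (rankTwoPath M φ y y' t).det * q := by
    refine Polynomial.eq_of_infinite_eval_eq _ _ ?_
    refine Set.Infinite.mono (s := Set.range fun x : ℝ => (x : ℂ)) ?_
      (Set.infinite_range_of_injective Complex.ofReal_injective)
    rintro _ ⟨x, rfl⟩
    simp only [Set.mem_ofPred_eq, eval_mul, eval_C]
    rw [← hp, ← hq]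
  have hratio : p.derivative.eval (t : ℂ) / p.eval (t : ℂ)
      = q.derivative.eval (t : ℂ) / q.eval (t : ℂ) := by
    have h1 := congrArg (fun f => f.eval (t : ℂ)) hpq
    have h2 := congrArg (fun f => f.derivative.eval (t : ℂ)) hpq
    simp only [eval_mul, eval_C, derivative_C_mul] at h1 h2
    rw [← mul_div_mul_left _ _ hdu, ← mul_div_mul_left (q.derivative.eval (t : ℂ)) _ hdt, h1, h2]
  have ht2 : (1 : ℂ) + (t : ℂ) ^ 2 ≠ 0 := by
    have : (0 : ℝ) < 1 + t ^ 2 := by positivity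
    exact_mod_cast this.ne'
  have hpt : p.eval (t : ℂ) ≠ 0 := by
    have := hp t
    intro h0
    rw [h0, mul_zero] at this
    exact (mul_ne_zero (pow_ne_zero 2 ht2) hdt) this
  -- The logarithmic derivative is (4t + 2τ)/(1 + t²), of modulus at least (2K - 4)/2 ≥ K/2 since
  -- |t| ≤ 1 and K ≥ 4.
  obtain ⟨r, hr, hrt⟩ := exists_root_near hdeg hpt (K := K / 2) (by positivity) (by
    rw [hratio, hq't, hqt]
    set τ := ((rankTwoPath M φ y y' t)⁻¹ * rankTwo φ (-rsin t • y + rcos t • y')).trace with hτ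
    have e1 : (1 + (t : ℂ) ^ 2) * (4 * t + 2 * τ) / (1 + (t : ℂ) ^ 2) ^ 2
        = (4 * t + 2 * τ) / (1 + (t : ℂ) ^ 2) := by
      field_simp
    have e2 : ‖(1 : ℂ) + (t : ℂ) ^ 2‖ = 1 + t ^ 2 := by
      rw [show (1 : ℂ) + (t : ℂ) ^ 2 = ((1 + t ^ 2 : ℝ) : ℂ) by push_cast; rfl, Complex.norm_real,
        Real.norm_of_nonneg (by positivity)]
    rw [e1, norm_div, e2, le_div_iff₀ (by positivity)]
    have h3 : ‖2 * τ‖ ≤ ‖4 * (t : ℂ) + 2 * τ‖ + ‖4 * (t : ℂ)‖ := by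
      calc ‖2 * τ‖ = ‖(4 * (t : ℂ) + 2 * τ) - 4 * (t : ℂ)‖ := by congr 1; ring
        _ ≤ _ := norm_sub_le _ _
    have h4 : ‖4 * (t : ℂ)‖ = 4 * |t| := by simp
    have h5 : ‖2 * τ‖ = 2 * ‖τ‖ := by simp
    have h6 : |t| ≤ 1 := abs_le.2 ht.1
    have h7 : t ^ 2 ≤ 1 := by rw [← sq_abs]; nlinarith [abs_nonneg t]
    have h8 := ht.2
    rw [← hτ] at h8
    nlinarith)
  refine ⟨r, hr, hrt.trans (le_of_eq ?_)⟩
  field_simp; norm_num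

end Curve

/-! ### Measurability of matrix-valued functions. -/

section EntrywiseMeasurable

variable {Ω : Type*} [MeasurableSpace Ω] {ι κ l : Type*}

/-- A matrix-valued function all of whose entries are measurable. -/
def EntrywiseMeasurable (f : Ω → Matrix ι κ ℂ) : Prop := ∀ i j, Measurable fun x => f x i j

theorem EntrywiseMeasurable.const (A : Matrix ι κ ℂ) : EntrywiseMeasurable fun _ : Ω => A :=
  fun _ _ => measurable_const

theorem EntrywiseMeasurable.add {f g : Ω → Matrix ι κ ℂ} (hf : EntrywiseMeasurable f)
    (hg : EntrywiseMeasurable g) : EntrywiseMeasurable fun x => f x + g x :=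
  fun i j => (hf i j).add (hg i j)

theorem EntrywiseMeasurable.sub {f g : Ω → Matrix ι κ ℂ} (hf : EntrywiseMeasurable f)
    (hg : EntrywiseMeasurable g) : EntrywiseMeasurable fun x => f x - g x :=
  fun i j => (hf i j).sub (hg i j)

theorem EntrywiseMeasurable.neg {f : Ω → Matrix ι κ ℂ} (hf : EntrywiseMeasurable f) :
    EntrywiseMeasurable fun x => -f x :=
  fun i j => (hf i j).neg

theorem EntrywiseMeasurable.conjTranspose {f : Ω → Matrix ι κ ℂ} (hf : EntrywiseMeasurable f) :
    EntrywiseMeasurable fun x => (f x)ᴴ := by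
  intro i j
  exact (continuous_star.measurable).comp (hf j i)

theorem EntrywiseMeasurable.mul [Fintype κ] {f : Ω → Matrix ι κ ℂ} {g : Ω → Matrix κ l ℂ}
    (hf : EntrywiseMeasurable f) (hg : EntrywiseMeasurable g) :
    EntrywiseMeasurable fun x => f x * g x := by
  intro i j
  simp only [Matrix.mul_apply]
  exact Finset.measurable_fun_sum _ fun k _ => (hf i k).mul (hg k j)

theorem EntrywiseMeasurable.trace [Fintype ι] {f : Ω → Matrix ι ι ℂ} (hf : EntrywiseMeasurable f) :
    Measurable fun x => (f x).trace := by
  simp only [Matrix.trace, Matrix.diag]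
  exact Finset.measurable_fun_sum _ fun k _ => hf k k

theorem EntrywiseMeasurable.det [Fintype ι] [DecidableEq ι] {f : Ω → Matrix ι ι ℂ}
    (hf : EntrywiseMeasurable f) : Measurable fun x => (f x).det := by
  simp only [Matrix.det_apply]
  refine Finset.measurable_fun_sum _ fun σ _ => ?_
  exact (Finset.measurable_fun_prod _ fun k _ => hf (σ k) k).const_smul _

theorem EntrywiseMeasurable.inv [Fintype ι] [DecidableEq ι] {f : Ω → Matrix ι ι ℂ}
    (hf : EntrywiseMeasurable f) : EntrywiseMeasurable fun x => (f x)⁻¹ := by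
  intro i j
  simp only [Matrix.inv_def, Matrix.smul_apply, smul_eq_mul, Ring.inverse_eq_inv', Matrix.adjugate_apply]
  refine hf.det.inv.mul (EntrywiseMeasurable.det fun k m => ?_)
  by_cases hk : k = j
  · subst hk; simp
  · simp only [Matrix.updateRow_apply, if_neg hk]; exact hf k m

theorem EntrywiseMeasurable.frobSq [Fintype ι] [Fintype κ] {f : Ω → Matrix ι κ ℂ}
    (hf : EntrywiseMeasurable f) : Measurable fun x => frobSq (f x) := by
  unfold _root_.frobSq
  exact Finset.measurable_fun_sum _ fun i _ => Finset.measurable_fun_sum _ fun j _ =>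
    (hf i j).norm.pow_const 2

theorem entrywiseMeasurable_hermitianOf {W : ℕ} :
    EntrywiseMeasurable (hermitianOf (W := W)) := by
  intro i j
  have h : ∀ a b : Fin W, Measurable fun h : Fin W → Fin W → ℝ => (h a b : ℂ) := fun a b =>
    Complex.measurable_ofReal.comp ((measurable_pi_apply b).comp (measurable_pi_apply a))
  simp only [hermitianOf, Matrix.of_apply]
  split_ifs
  · exact h i i
  · exact (h i j).add ((h j i).mul_const _)
  · exact (h j i).sub ((h i j).mul_const _)

theorem EntrywiseMeasurable.comp {Ω' : Type*} [MeasurableSpace Ω'] {f : Ω → Matrix ι κ ℂ}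
    (hf : EntrywiseMeasurable f) {g : Ω' → Ω} (hg : Measurable g) :
    EntrywiseMeasurable fun x => f (g x) :=
  fun i j => (hf i j).comp hg

end EntrywiseMeasurable

/-! ### Compression of a Hermitian matrix to one row and column. -/

section Projection

variable {ι : Type*} [Fintype ι]

/-- The squared Euclidean norm of a vector. -/
def vecSq (v : ι → ℂ) : ℝ := ∑ i, ‖v i‖ ^ 2

theorem vecSq_eq (v : ι → ℂ) : (vecSq v : ℂ) = star v ⬝ᵥ v := by
  simp only [vecSq, dotProduct, Pi.star_apply]
  push_cast
  refine Finset.sum_congr rfl fun i _ => ?_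
  rw [← Complex.conj_mul', Complex.star_def]

theorem vecSq_mulVec_le (A : Matrix ι ι ℂ) (v : ι → ℂ) :
    vecSq (A *ᵥ v) ≤ frobSq A * vecSq v := by
  unfold vecSq frobSq
  rw [Finset.sum_mul]
  refine Finset.sum_le_sum fun i _ => ?_
  calc ‖(A *ᵥ v) i‖ ^ 2 ≤ (∑ j, ‖A i j‖ * ‖v j‖) ^ 2 := by
        gcongr
        simp only [Matrix.mulVec, dotProduct]
        refine (norm_sum_le _ _).trans (le_of_eq ?_)
        simp
    _ ≤ _ := Finset.sum_mul_sq_le_sq_mul_sq _ _ _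

/-- The vector `y` with `φ y* + y φ*` equal to the compression of `M` to the matrices
supported on the row and column of `φ`. -/
def edgeVec (φ : ι → ℂ) : Matrix ι ι ℂ →ₗ[ℝ] (ι → ℂ) where
  toFun M := M *ᵥ φ - ((1 / 2 : ℂ) * (star φ ⬝ᵥ (M *ᵥ φ))) • φ
  map_add' M N := by
    ext i; simp [Matrix.add_mulVec, dotProduct_add]; ring
  map_smul' c M := by
    ext i; simp [Matrix.smul_mulVec, dotProduct_smul]; ring

theorem edgeVec_apply (φ : ι → ℂ) (M : Matrix ι ι ℂ) :
    edgeVec φ M = M *ᵥ φ - ((1 / 2 : ℂ) * (star φ ⬝ᵥ (M *ᵥ φ))) • φ := rfl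

theorem isHermitian_rankTwo (φ y : ι → ℂ) : (rankTwo φ y).IsHermitian := by
  ext i j
  simp [rankTwo, Matrix.vecMulVec_apply]; ring

theorem dotProduct_conj {M : Matrix ι ι ℂ} (hM : M.IsHermitian) (x y : ι → ℂ) :
    star (star x ⬝ᵥ (M *ᵥ y)) = star y ⬝ᵥ (M *ᵥ x) := by
  rw [Matrix.star_dotProduct, star_star, Matrix.star_mulVec, hM.eq, Matrix.dotProduct_mulVec]

theorem rankTwo_mulVec (φ y v : ι → ℂ) :
    rankTwo φ y *ᵥ v = (star y ⬝ᵥ v) • φ + (star φ ⬝ᵥ v) • y := by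
  ext i
  simp only [rankTwo, Matrix.add_mulVec, Matrix.vecMulVec_mulVec, Pi.add_apply, Pi.smul_apply,
    smul_eq_mul, MulOpposite.smul_eq_mul_unop, MulOpposite.unop_op]
  ring

variable {φ : ι → ℂ}

/-- Both φ y* and y φ* contribute to the diagonal entry at φ; the factor 1/2 in `edgeVec` makes it
count once, so the compression is idempotent. -/
theorem edgeVec_rankTwo (hφ : star φ ⬝ᵥ φ = 1) {M : Matrix ι ι ℂ} (hM : M.IsHermitian) :
    edgeVec φ (rankTwo φ (edgeVec φ M)) = edgeVec φ M := by
  set y := edgeVec φ M with hy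
  set m := star φ ⬝ᵥ (M *ᵥ φ) with hm
  have hmr : star m = m := dotProduct_conj hM φ φ
  have h1 : star φ ⬝ᵥ y = (1 / 2 : ℂ) * m := by
    rw [hy, edgeVec_apply, dotProduct_sub, dotProduct_smul, hφ, smul_eq_mul, ← hm]; ring
  have h2 : star y ⬝ᵥ φ = (1 / 2 : ℂ) * m := by
    have : star y ⬝ᵥ φ = star (star φ ⬝ᵥ y) := Matrix.star_dotProduct _ _
    rw [this, h1, star_mul', hmr]; simp
  rw [edgeVec_apply, rankTwo_mulVec, hφ, one_smul, h2, dotProduct_add, dotProduct_smul, hφ, h1]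
  ext i
  simp; ring

theorem rankTwo_edgeVec_mulVec (hφ : star φ ⬝ᵥ φ = 1) {M : Matrix ι ι ℂ} (hM : M.IsHermitian) :
    rankTwo φ (edgeVec φ M) *ᵥ φ = M *ᵥ φ := by
  set m := star φ ⬝ᵥ (M *ᵥ φ) with hm
  have hmr : star m = m := dotProduct_conj hM φ φ
  have h1 : star φ ⬝ᵥ edgeVec φ M = (1 / 2 : ℂ) * m := by
    rw [edgeVec_apply, dotProduct_sub, dotProduct_smul, hφ, smul_eq_mul, ← hm]; ring
  have h2 : star (edgeVec φ M) ⬝ᵥ φ = (1 / 2 : ℂ) * m := by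
    have : star (edgeVec φ M) ⬝ᵥ φ = star (star φ ⬝ᵥ edgeVec φ M) := Matrix.star_dotProduct _ _
    rw [this, h1, star_mul', hmr]; simp
  rw [rankTwo_mulVec, hφ, one_smul, h2, edgeVec_apply, ← hm]
  abel

/-- Both sides equal 2 Re ⟨Nφ, Mφ⟩ - ⟨φ, Mφ⟩⟨φ, Nφ⟩, which is symmetric in M and N. With idempotence
this makes the compression an orthogonal projection when φ is a unit vector. -/
theorem frobInner_rankTwo_edgeVec [DecidableEq ι] {M N : Matrix ι ι ℂ}
    (hM : M.IsHermitian) (hN : N.IsHermitian) :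
    frobInner (rankTwo φ (edgeVec φ M)) N = frobInner M (rankTwo φ (edgeVec φ N)) := by
  have key : ∀ {M N : Matrix ι ι ℂ}, M.IsHermitian → N.IsHermitian →
      frobInner M (rankTwo φ (edgeVec φ N)) = 2 * (star (N *ᵥ φ) ⬝ᵥ (M *ᵥ φ)).re
        - (star φ ⬝ᵥ (M *ᵥ φ)).re * (star φ ⬝ᵥ (N *ᵥ φ)).re := by
    intro M N hM hN
    rw [frobInner_eq_trace, hM.eq, trace_mul_rankTwo, Complex.add_re]
    have e : (star (edgeVec φ N) ⬝ᵥ (M *ᵥ φ)).re = (star φ ⬝ᵥ (M *ᵥ edgeVec φ N)).re := by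
      rw [← dotProduct_conj hM]; simp
    rw [← e]
    have hmr : star (star φ ⬝ᵥ (M *ᵥ φ)) = star φ ⬝ᵥ (M *ᵥ φ) := dotProduct_conj hM φ φ
    have hnr : star (star φ ⬝ᵥ (N *ᵥ φ)) = star φ ⬝ᵥ (N *ᵥ φ) := dotProduct_conj hN φ φ
    have hmi : (star φ ⬝ᵥ (M *ᵥ φ)).im = 0 := Complex.conj_eq_iff_im.1 hmr
    rw [edgeVec_apply, star_sub, sub_dotProduct, star_smul, smul_dotProduct, smul_eq_mul, star_mul', hnr]
    have h2 : star (1 / 2 : ℂ) = 1 / 2 := by simp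
    rw [h2, Complex.sub_re, Complex.mul_re, hmi]
    have h3 : ((1 / 2 : ℂ) * (star φ ⬝ᵥ (N *ᵥ φ))).re = (1 / 2) * (star φ ⬝ᵥ (N *ᵥ φ)).re := by
      simp
    rw [h3]; ring
  rw [frobInner_comm, key hN hM, key hM hN]
  have : (star (M *ᵥ φ) ⬝ᵥ (N *ᵥ φ)).re = (star (N *ᵥ φ) ⬝ᵥ (M *ᵥ φ)).re := by
    have h : star (star (N *ᵥ φ) ⬝ᵥ (M *ᵥ φ)) = star (M *ᵥ φ) ⬝ᵥ (N *ᵥ φ) := by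
      rw [Matrix.star_dotProduct, star_star]
    rw [← h]; simp
  rw [this]; ring

end Projection

/-! ### Rotating part of a Gaussian vector into an independent copy. -/

section Rotation

variable {W : ℕ}

/-- The compression to the row and column of `φ`, in the coordinates of Hermitian matrices. -/
def edgeProj (φ : Fin W → ℂ) : (Fin W → Fin W → ℝ) →ₗ[ℝ] (Fin W → Fin W → ℝ) where
  toFun h := coordL W (rankTwo φ (edgeVec φ (hermitianOf h)))
  map_add' h k := by rw [hermitianOf_add, map_add, rankTwo_add, map_add]
  map_smul' c h := by
    rw [hermitianOf_smul, map_smul, rankTwo_smul, map_smul]; rfl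

theorem hermitianOf_edgeProj (φ : Fin W → ℂ) (h : Fin W → Fin W → ℝ) :
    hermitianOf (edgeProj φ h) = rankTwo φ (edgeVec φ (hermitianOf h)) :=
  hermitianOf_coordL (isHermitian_rankTwo _ _)

theorem formV_edgeProj (φ : Fin W → ℂ) (h k : Fin W → Fin W → ℝ) :
    formV W (edgeProj φ h) k = formV W h (edgeProj φ k) := by
  rw [formV_apply, formV_apply, hermitianOf_edgeProj, hermitianOf_edgeProj,
    frobInner_rankTwo_edgeVec (hermitianOf_isHermitian _) (hermitianOf_isHermitian _)]

theorem edgeProj_edgeProj {φ : Fin W → ℂ} (hφ : star φ ⬝ᵥ φ = 1) (h : Fin W → Fin W → ℝ) :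
    edgeProj φ (edgeProj φ h) = edgeProj φ h := by
  apply hermitianOf_injective
  rw [hermitianOf_edgeProj, hermitianOf_edgeProj, edgeVec_rankTwo hφ (hermitianOf_isHermitian _)]

variable {E : Type*} [NormedAddCommGroup E] [NormedSpace ℝ E]

/-- The form `B ⊕ B`. -/
def doubleForm (B : LinearMap.BilinForm ℝ E) : LinearMap.BilinForm ℝ (E × E) :=
  B.compl₁₂ (LinearMap.fst ℝ E E) (LinearMap.fst ℝ E E)
    + B.compl₁₂ (LinearMap.snd ℝ E E) (LinearMap.snd ℝ E E)

theorem doubleForm_apply (B : LinearMap.BilinForm ℝ E) (x y : E × E) :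
    doubleForm B x y = B x.1 y.1 + B x.2 y.2 := rfl

theorem IsGaussForm.double {B : LinearMap.BilinForm ℝ E} (hB : IsGaussForm B) :
    IsGaussForm (doubleForm B) where
  symm x y := by simp only [doubleForm_apply, hB.symm x.1, hB.symm x.2]
  pos x hx := by
    rw [doubleForm_apply]
    by_cases h : x.1 = 0
    · have h2 : x.2 ≠ 0 := fun h2 => hx (Prod.ext h h2)
      have := hB.pos _ h2
      have := hB.nonneg x.1
      linarith
    · have := hB.pos _ h
      have := hB.nonneg x.2
      linarith

/-- The rotation by `(c, s)` of the components of a pair in the range of `P`. -/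
def partialRotation (P : E →ₗ[ℝ] E) (c s : ℝ) : E × E →ₗ[ℝ] E × E :=
  ((LinearMap.fst ℝ E E + P ∘ₗ ((c - 1) • LinearMap.fst ℝ E E + s • LinearMap.snd ℝ E E)).prod
    (LinearMap.snd ℝ E E + P ∘ₗ ((c - 1) • LinearMap.snd ℝ E E + (-s) • LinearMap.fst ℝ E E)))

theorem partialRotation_apply (P : E →ₗ[ℝ] E) (c s : ℝ) (x : E × E) :
    partialRotation P c s x = (x.1 + P ((c - 1) • x.1 + s • x.2),
      x.2 + P ((c - 1) • x.2 + (-s) • x.1)) := rfl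

/-- P is a B-orthogonal projection by `hP` and `hPP`; the pair of components in its range is rotated
and the complementary components are left alone. -/
theorem doubleForm_partialRotation {B : LinearMap.BilinForm ℝ E} (hB : IsGaussForm B)
    {P : E →ₗ[ℝ] E} (hP : ∀ x y, B (P x) y = B x (P y)) (hPP : ∀ x, P (P x) = P x) {c s : ℝ}
    (hcs : c ^ 2 + s ^ 2 = 1) (x : E × E) :
    doubleForm B (partialRotation P c s x) (partialRotation P c s x) = doubleForm B x x := by
  rw [partialRotation_apply, doubleForm_apply, doubleForm_apply]
  simp only [hB.add_self]
  have h1 : ∀ u, B (P u) (P u) = B u (P u) := fun u => by rw [hP, hPP]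
  have h2 : B x.2 (P x.1) = B x.1 (P x.2) := by rw [← hP, hB.symm]
  simp only [h1]
  simp only [map_add, map_smul, LinearMap.add_apply, LinearMap.smul_apply, smul_eq_mul, h2]
  linear_combination (B x.1 (P x.1) + B x.2 (P x.2)) * hcs

end Rotation

/-! ### Resolvent of one shifted Gaussian block on a fixed vector. -/

section SiteEstimate

variable {W : ℕ}

theorem entrywiseMeasurable_rankTwo_edgeVec (φ : Fin W → ℂ) :
    EntrywiseMeasurable fun h : Fin W → Fin W → ℝ => rankTwo φ (edgeVec φ (hermitianOf h)) := by
  have : (fun h : Fin W → Fin W → ℝ => rankTwo φ (edgeVec φ (hermitianOf h)))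
      = fun h => hermitianOf (edgeProj φ h) := by
    ext1 h; rw [hermitianOf_edgeProj]
  rw [this]
  exact entrywiseMeasurable_hermitianOf.comp
    (edgeProj φ).continuous_of_finiteDimensional.measurable

theorem lawV_prod_lawV (hW : 0 < W) :
    (lawV W).prod (lawV W) = gaussLaw volume (doubleForm (formV W)) := by
  have hV : Measurable fun x => -(formV W x x) := (continuous_bilin_self (formV W)).measurable.neg
  unfold lawV gaussLaw
  rw [prod_tilted _ _ hV hV, ← Measure.volume_eq_prod]
  congr 1
  ext p
  rw [doubleForm_apply]; ring

/-- Rotating the row and column of φ between the two copies preserves their joint law. Along an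
orbit the first copy runs through a `rankTwoPath`, and the trace is the logarithmic derivative of
its determinant with respect to the angle, so `volume_large_trace` bounds the time spent in the
event. -/
theorem lawV_prod_large_trace (hW : 0 < W) {φ : Fin W → ℂ} (hφ : star φ ⬝ᵥ φ = 1)
    (B₀ : Matrix (Fin W) (Fin W) ℂ) {K : ℝ} (hK : 0 < K) :
    ((lawV W).prod (lawV W)) {p | K ≤ ‖((hermitianOf p.1 - B₀)⁻¹
      * rankTwo φ (edgeVec φ (hermitianOf p.2))).trace‖} ≤ ENNReal.ofReal (32 / K) := by
  have hprob := isProbabilityMeasure_lawV hW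
  have : (volume : Measure ((Fin W → Fin W → ℝ) × (Fin W → Fin W → ℝ))).IsAddHaarMeasure :=
    isAddHaarMeasure_volume_prod
  set P := (lawV W).prod (lawV W) with hPdef
  set N := {p : (Fin W → Fin W → ℝ) × (Fin W → Fin W → ℝ) | K ≤ ‖((hermitianOf p.1 - B₀)⁻¹
      * rankTwo φ (edgeVec φ (hermitianOf p.2))).trace‖} with hN
  have hNm : MeasurableSet N := by
    refine measurableSet_le measurable_const (Measurable.norm ?_)
    exact (((entrywiseMeasurable_hermitianOf.comp measurable_fst).sub (.const B₀)).inv.mul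
      ((entrywiseMeasurable_rankTwo_edgeVec φ).comp measurable_snd)).trace
  let R : ℝ → (Fin W → Fin W → ℝ) × (Fin W → Fin W → ℝ) →
      (Fin W → Fin W → ℝ) × (Fin W → Fin W → ℝ) :=
    fun t => partialRotation (edgeProj φ) (rcos t) (rsin t)
  have hinv : ∀ t, P N = ∫⁻ p, N.indicator (fun _ => (1 : ℝ≥0∞)) (R t p) ∂P := by
    intro t
    rw [← lintegral_indicator_one hNm, hPdef, lawV_prod_lawV hW]
    exact ((isGaussForm_formV hW).double.lintegral_comp_isometry _
      (doubleForm_partialRotation (isGaussForm_formV hW) (formV_edgeProj φ)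
        (edgeProj_edgeProj hφ) (rcos_sq_add_rsin_sq t)) (measurable_const.indicator hNm)).symm
  have hPcont : Continuous (edgeProj φ) := (edgeProj φ).continuous_of_finiteDimensional
  have hRm : Measurable fun q : ℝ × ((Fin W → Fin W → ℝ) × (Fin W → Fin W → ℝ)) => R q.1 q.2 := by
    have hc : Measurable rcos := by unfold rcos; fun_prop
    have hs : Measurable rsin := by unfold rsin; fun_prop
    simp only [R, partialRotation_apply]
    have := hPcont.measurable
    fun_prop
  have hline : ∀ p : (Fin W → Fin W → ℝ) × (Fin W → Fin W → ℝ),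
      ∫⁻ t in Set.Icc (-1 : ℝ) 1, N.indicator (fun _ => (1 : ℝ≥0∞)) (R t p) ≤ ENNReal.ofReal (64 / K) := by
    intro p
    set V := hermitianOf p.1
    set V' := hermitianOf p.2
    have hV : V.IsHermitian := hermitianOf_isHermitian _
    have hV' : V'.IsHermitian := hermitianOf_isHermitian _
    set y := edgeVec φ V with hy
    set y' := edgeVec φ V' with hy'
    set M := V - rankTwo φ y - B₀ with hM
    refine le_trans ?_ (volume_large_trace M φ y y' hK)
    have h1 : ∀ t, hermitianOf (R t p).1 - B₀ = rankTwoPath M φ y y' t := by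
      intro t
      simp only [R, partialRotation_apply]
      rw [hermitianOf_add, hermitianOf_edgeProj, hermitianOf_add, map_add, hermitianOf_smul,
        hermitianOf_smul, map_smul, map_smul, rankTwoPath, hM]
      have : (rcos t - 1) • y + rsin t • y' = (rcos t • y + rsin t • y') + (-1 : ℝ) • y := by module
      rw [← hy, ← hy', this, rankTwo_add, rankTwo_smul]
      module
    have h2 : ∀ t, rankTwo φ (edgeVec φ (hermitianOf (R t p).2))
        = rankTwo φ (-rsin t • y + rcos t • y') := by
      intro t
      congr 1
      simp only [R, partialRotation_apply]
      rw [hermitianOf_add, hermitianOf_edgeProj, hermitianOf_add, map_add, map_add,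
        hermitianOf_smul, hermitianOf_smul, map_smul, map_smul, rankTwo_add, map_add,
        rankTwo_smul, rankTwo_smul, map_smul, map_smul, edgeVec_rankTwo hφ hV,
        edgeVec_rankTwo hφ hV', ← hy, ← hy']
      module
    have h3 : ∀ t, N.indicator (fun _ => (1 : ℝ≥0∞)) (R t p) = {t : ℝ | K ≤ ‖((rankTwoPath M φ y y' t)⁻¹
        * rankTwo φ (-rsin t • y + rcos t • y')).trace‖}.indicator 1 t := by
      intro t
      by_cases h : R t p ∈ N
      · rw [Set.indicator_of_mem h, Set.indicator_of_mem]
        · rfl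
        · simp only [hN, Set.mem_ofPred_eq, h1, h2] at h ⊢
          exact h
      · rw [Set.indicator_of_notMem h, Set.indicator_of_notMem]
        simp only [hN, Set.mem_ofPred_eq, h1, h2] at h ⊢
        exact h
    have hSm : MeasurableSet {t : ℝ | K ≤ ‖((rankTwoPath M φ y y' t)⁻¹
        * rankTwo φ (-rsin t • y + rcos t • y')).trace‖} := by
      have : {t : ℝ | K ≤ ‖((rankTwoPath M φ y y' t)⁻¹
        * rankTwo φ (-rsin t • y + rcos t • y')).trace‖} = (fun t => R t p) ⁻¹' N := by
        ext t; simp only [hN, Set.mem_ofPred_eq, Set.mem_preimage, h1, h2]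
      rw [this]
      exact (hRm.comp (measurable_id.prodMk measurable_const)) hNm
    simp_rw [h3]
    rw [lintegral_indicator_one hSm, Measure.restrict_apply hSm]
    exact measure_mono fun t ht => ⟨ht.2, ht.1⟩
  have h2P : ENNReal.ofReal 2 * P N ≤ ENNReal.ofReal (64 / K) := by
    calc ENNReal.ofReal 2 * P N = ∫⁻ _ in Set.Icc (-1 : ℝ) 1, P N := by
          rw [setLIntegral_const, Real.volume_Icc, mul_comm]; norm_num
      _ = ∫⁻ t in Set.Icc (-1 : ℝ) 1, ∫⁻ p, N.indicator (fun _ => (1 : ℝ≥0∞)) (R t p) ∂P :=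
          lintegral_congr fun t => hinv t
      _ = ∫⁻ p, (∫⁻ t in Set.Icc (-1 : ℝ) 1, N.indicator (fun _ => (1 : ℝ≥0∞)) (R t p)) ∂P := by
          refine lintegral_lintegral_swap (Measurable.aemeasurable ?_)
          exact (measurable_const.indicator hNm).comp hRm
      _ ≤ ∫⁻ _, ENNReal.ofReal (64 / K) ∂P := lintegral_mono hline
      _ = _ := by simp
  have h64 : ENNReal.ofReal (64 / K) = ENNReal.ofReal 2 * ENNReal.ofReal (32 / K) := by
    rw [← ENNReal.ofReal_mul (by norm_num)]; congr 1; ring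
  rw [h64] at h2P
  exact (ENNReal.mul_le_mul_iff_right (by simp) (by simp)).1 h2P

/-- A fixed vector is not stretched much by the resolvent of a shifted Gaussian matrix. -/
theorem lawV_resolvent_vec (hW : 0 < W) {φ : Fin W → ℂ} (hφ : star φ ⬝ᵥ φ = 1)
    {B₀ : Matrix (Fin W) (Fin W) ℂ} (hB : B₀.IsHermitian) {Q : ℝ} (hQ : 0 < Q) :
    lawV W {h | Q ≤ vecSq ((hermitianOf h - B₀)⁻¹ *ᵥ φ)}
      ≤ ENNReal.ofReal (256 * Real.sqrt (W / Q)) := by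
  have hprob := isProbabilityMeasure_lawV hW
  have hW' : (0 : ℝ) < W := by exact_mod_cast hW
  set S := {h : Fin W → Fin W → ℝ | Q ≤ vecSq ((hermitianOf h - B₀)⁻¹ *ᵥ φ)} with hS
  -- For fixed `h` in `S` the trace against an independent copy h' has real part `formV W h' a`, a
  -- Gaussian functional with formV a a ≥ Q/W. By `small_ball` it exceeds K in modulus with
  -- conditional probability at least 1/2, so `S` is at most twice as likely as `N`.
  set K : ℝ := Real.sqrt (Q / W) / 4 with hKdef
  have hK : 0 < K := by positivity
  set N := {p : (Fin W → Fin W → ℝ) × (Fin W → Fin W → ℝ) | K ≤ ‖((hermitianOf p.1 - B₀)⁻¹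
      * rankTwo φ (edgeVec φ (hermitianOf p.2))).trace‖} with hN
  have hNm : MeasurableSet N := by
    refine measurableSet_le measurable_const (Measurable.norm ?_)
    exact (((entrywiseMeasurable_hermitianOf.comp measurable_fst).sub (.const B₀)).inv.mul
      ((entrywiseMeasurable_rankTwo_edgeVec φ).comp measurable_snd)).trace
  have hSm : MeasurableSet S := by
    refine measurableSet_le measurable_const ?_
    unfold vecSq
    refine Finset.measurable_fun_sum _ fun i _ => Measurable.pow_const (Measurable.norm ?_) 2
    simp only [Matrix.mulVec, dotProduct]
    exact Finset.measurable_fun_sum _ fun j _ =>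
      ((entrywiseMeasurable_hermitianOf.sub (.const B₀)).inv i j).mul_const _
  have hfib : ∀ h ∈ S, (1 / 2 : ℝ≥0∞) ≤ lawV W {h' | (h, h') ∈ N} := by
    intro h hh
    set Γ := (hermitianOf h - B₀)⁻¹ with hΓ
    have hΓh : Γ.IsHermitian := ((hermitianOf_isHermitian h).sub hB).inv
    set a : Fin W → Fin W → ℝ := (W : ℝ)⁻¹ • coordL W (rankTwo φ (edgeVec φ Γ)) with ha
    have hta : ∀ h', formV W h' a = (Γ * rankTwo φ (edgeVec φ (hermitianOf h'))).trace.re := by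
      intro h'
      rw [ha, formV_apply, hermitianOf_smul, hermitianOf_coordL (isHermitian_rankTwo _ _),
        frobInner_smul_right, ← mul_assoc, mul_inv_cancel₀ hW'.ne', one_mul, frobInner_comm,
        frobInner_rankTwo_edgeVec hΓh (hermitianOf_isHermitian h'), frobInner_eq_trace, hΓh.eq]
    have haa : Q / W ≤ formV W a a := by
      rw [formV_self, ha, hermitianOf_smul, hermitianOf_coordL (isHermitian_rankTwo _ _),
        frobSq_smul]
      have h1 := vecSq_mulVec_le (rankTwo φ (edgeVec φ Γ)) φ
      have h2 : vecSq φ = 1 := by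
        have := vecSq_eq φ
        rw [hφ] at this
        exact_mod_cast this
      rw [rankTwo_edgeVec_mulVec hφ hΓh, h2, mul_one] at h1
      have h3 : Q ≤ frobSq (rankTwo φ (edgeVec φ Γ)) := le_trans hh h1
      have h4 : (W : ℝ) * ((W : ℝ)⁻¹ ^ 2 * frobSq (rankTwo φ (edgeVec φ Γ)))
          = frobSq (rankTwo φ (edgeVec φ Γ)) / W := by field_simp
      rw [h4]
      gcongr
    have hsb := (isGaussForm_formV hW).small_ball (μ := volume) a
    have hmeas : MeasurableSet {x | |formV W x a| < Real.sqrt (formV W a a) / 4} :=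
      measurableSet_lt ((continuous_bilin_right (formV W) a).measurable.abs) measurable_const
    have hcompl := prob_compl_eq_one_sub (μ := lawV W) hmeas
    have hge : (1 / 2 : ℝ≥0∞) ≤ lawV W {x | |formV W x a| < Real.sqrt (formV W a a) / 4}ᶜ := by
      rw [hcompl]
      have : (1 : ℝ≥0∞) - 1 / 2 ≤ 1 - lawV W {x | |formV W x a| < Real.sqrt (formV W a a) / 4} :=
        tsub_le_tsub_left hsb 1
      refine le_trans (le_of_eq ?_) this
      simp
    refine hge.trans (measure_mono ?_)
    intro h' hh'
    simp only [Set.mem_compl_iff, Set.mem_ofPred_eq, not_lt] at hh'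
    change K ≤ ‖(Γ * rankTwo φ (edgeVec φ (hermitianOf h'))).trace‖
    calc K ≤ Real.sqrt (formV W a a) / 4 := by rw [hKdef]; gcongr
      _ ≤ |formV W h' a| := hh'
      _ = |(Γ * rankTwo φ (edgeVec φ (hermitianOf h'))).trace.re| := by rw [hta]
      _ ≤ _ := Complex.abs_re_le_norm _
  have hmain : (1 / 2 : ℝ≥0∞) * lawV W S ≤ ENNReal.ofReal (32 / K) := by
    calc (1 / 2 : ℝ≥0∞) * lawV W S = ∫⁻ h in S, (1 / 2 : ℝ≥0∞) ∂(lawV W) := by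
          rw [setLIntegral_const]
      _ ≤ ∫⁻ h in S, lawV W {h' | (h, h') ∈ N} ∂(lawV W) := setLIntegral_mono' hSm hfib
      _ ≤ ∫⁻ h, lawV W {h' | (h, h') ∈ N} ∂(lawV W) := setLIntegral_le_lintegral _ _
      _ = ((lawV W).prod (lawV W)) N := (Measure.prod_apply hNm).symm
      _ ≤ _ := lawV_prod_large_trace hW hφ B₀ hK
  have hKinv : 2 * (32 / K) = 256 * Real.sqrt (W / Q) := by
    rw [hKdef, Real.sqrt_div hQ.le, Real.sqrt_div hW'.le]
    have := Real.sqrt_pos.2 hQ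
    have := Real.sqrt_pos.2 hW'
    field_simp; norm_num
  calc lawV W S = 2 * ((1 / 2 : ℝ≥0∞) * lawV W S) := by
        rw [← mul_assoc]
        have : (2 : ℝ≥0∞) * (1 / 2) = 1 := by
          rw [one_div, ENNReal.mul_inv_cancel (by simp) (by simp)]
        rw [this, one_mul]
    _ ≤ 2 * ENNReal.ofReal (32 / K) := by gcongr
    _ = ENNReal.ofReal (256 * Real.sqrt (W / Q)) := by
        rw [← hKinv, ENNReal.ofReal_mul (by norm_num)]; simp

end SiteEstimate

/-! ### Moments of random signed sums. -/

section Signs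

variable {ι H : Type*} [DecidableEq ι] [NormedAddCommGroup H] [InnerProductSpace ℂ H]

/-- The signed sum with signs `+` on `s` and `-` off `s`. -/
def signSum (t : Finset ι) (v : ι → H) (s : Finset ι) : H :=
  ∑ i ∈ t, if i ∈ s then v i else -v i

theorem signSum_insert_of_subset {t : Finset ι} {a : ι} (ha : a ∉ t) (v : ι → H) {s : Finset ι}
    (hs : s ⊆ t) : signSum (insert a t) v s = signSum t v s - v a := by
  have : a ∉ s := fun h => ha (hs h)
  rw [signSum, Finset.sum_insert ha, if_neg this, signSum]
  abel

theorem signSum_insert_insert {t : Finset ι} {a : ι} (ha : a ∉ t) (v : ι → H) (s : Finset ι) :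
    signSum (insert a t) v (insert a s) = signSum t v s + v a := by
  rw [signSum, Finset.sum_insert ha, if_pos (Finset.mem_insert_self a s), signSum, add_comm]
  congr 1
  refine Finset.sum_congr rfl fun i hi => ?_
  have : i ≠ a := fun h => ha (h ▸ hi)
  simp [Finset.mem_insert, this]

theorem sum_norm_sq_add_sub (x a : H) :
    ‖x - a‖ ^ 2 + ‖x + a‖ ^ 2 = 2 * (‖x‖ ^ 2 + ‖a‖ ^ 2) := by
  rw [norm_sub_sq (𝕜 := ℂ), norm_add_sq (𝕜 := ℂ)]; ring

theorem sum_norm_four_add_sub (x a : H) :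
    ‖x - a‖ ^ 4 + ‖x + a‖ ^ 4 ≤ 2 * (‖x‖ ^ 4 + 6 * ‖x‖ ^ 2 * ‖a‖ ^ 2 + ‖a‖ ^ 4) := by
  have h1 : ‖x - a‖ ^ 4 = (‖x - a‖ ^ 2) ^ 2 := by ring
  have h2 : ‖x + a‖ ^ 4 = (‖x + a‖ ^ 2) ^ 2 := by ring
  rw [h1, h2, norm_sub_sq (𝕜 := ℂ), norm_add_sq (𝕜 := ℂ)]
  have h3 : RCLike.re (inner ℂ x a) ^ 2 ≤ ‖x‖ ^ 2 * ‖a‖ ^ 2 := by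
    rw [← mul_pow, ← sq_abs]
    gcongr
    exact (RCLike.abs_re_le_norm _).trans (norm_inner_le_norm x a)
  nlinarith

theorem sum_signSum_sq (t : Finset ι) (v : ι → H) :
    ∑ s ∈ t.powerset, ‖signSum t v s‖ ^ 2 = 2 ^ t.card * ∑ i ∈ t, ‖v i‖ ^ 2 := by
  induction t using Finset.induction_on with
  | empty => simp [signSum]
  | insert a t ha ih =>
    rw [Finset.sum_powerset_insert ha, ← Finset.sum_add_distrib, Finset.card_insert_of_notMem ha,
      Finset.sum_insert ha]
    have h1 : ∀ s ∈ t.powerset, ‖signSum (insert a t) v s‖ ^ 2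
        + ‖signSum (insert a t) v (insert a s)‖ ^ 2 = 2 * ‖signSum t v s‖ ^ 2 + 2 * ‖v a‖ ^ 2 := by
      intro s hs
      rw [signSum_insert_of_subset ha v (Finset.mem_powerset.1 hs), signSum_insert_insert ha,
        sum_norm_sq_add_sub]; ring
    rw [Finset.sum_congr rfl h1, Finset.sum_add_distrib, ← Finset.mul_sum, ih, Finset.sum_const,
      Finset.card_powerset, nsmul_eq_mul]
    push_cast; ring

/-- Averaging over the sign of the added vector removes the odd terms; with a the square of its
norm, the induction closes because 3m² + 6ma + a² ≤ 3(m + a)². -/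
theorem sum_signSum_four (t : Finset ι) (v : ι → H) :
    ∑ s ∈ t.powerset, ‖signSum t v s‖ ^ 4 ≤ 3 * 2 ^ t.card * (∑ i ∈ t, ‖v i‖ ^ 2) ^ 2 := by
  induction t using Finset.induction_on with
  | empty => simp [signSum]
  | insert a t ha ih =>
    rw [Finset.sum_powerset_insert ha, ← Finset.sum_add_distrib, Finset.card_insert_of_notMem ha,
      Finset.sum_insert ha]
    have h1 : ∀ s ∈ t.powerset, ‖signSum (insert a t) v s‖ ^ 4
        + ‖signSum (insert a t) v (insert a s)‖ ^ 4
        ≤ 2 * ‖signSum t v s‖ ^ 4 + (12 * ‖v a‖ ^ 2) * ‖signSum t v s‖ ^ 2 + 2 * ‖v a‖ ^ 4 := by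
      intro s hs
      rw [signSum_insert_of_subset ha v (Finset.mem_powerset.1 hs), signSum_insert_insert ha]
      refine (sum_norm_four_add_sub _ _).trans (le_of_eq (by ring))
    refine (Finset.sum_le_sum h1).trans ?_
    rw [Finset.sum_add_distrib, Finset.sum_add_distrib, ← Finset.mul_sum, ← Finset.mul_sum,
      sum_signSum_sq, Finset.sum_const, Finset.card_powerset, nsmul_eq_mul]
    push_cast
    have hp : (0 : ℝ) < 2 ^ t.card := by positivity
    have hq : (2 : ℝ) ^ (t.card + 1) = 2 * 2 ^ t.card := by ring
    rw [hq]
    have h4 := mul_nonneg hp.le (pow_nonneg (norm_nonneg (v a)) 4)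
    linear_combination 2 * ih + 4 * h4

/-- Paley–Zygmund for signed sums: a positive proportion of them is of the typical size. -/
theorem card_signSum_ge (t : Finset ι) (v : ι → H) :
    (2 : ℝ) ^ t.card / 12 ≤ (t.powerset.filter fun s =>
      (∑ i ∈ t, ‖v i‖ ^ 2) / 2 ≤ ‖signSum t v s‖ ^ 2).card := by
  set m := ∑ i ∈ t, ‖v i‖ ^ 2 with hm
  set G := t.powerset.filter fun s => m / 2 ≤ ‖signSum t v s‖ ^ 2 with hG
  have hm0 : 0 ≤ m := Finset.sum_nonneg fun _ _ => by positivity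
  have hp : (0 : ℝ) < 2 ^ t.card := by positivity
  rcases hm0.eq_or_lt with h0 | hpos
  · have : G = t.powerset := by
      rw [hG]; refine Finset.filter_true_of_mem fun s _ => ?_
      rw [← h0]; simp
    rw [this, Finset.card_powerset]; push_cast; linarith
  have h1 : 2 ^ t.card * m / 2 ≤ ∑ s ∈ G, ‖signSum t v s‖ ^ 2 := by
    have hsplit := Finset.sum_filter_add_sum_filter_not t.powerset
      (fun s => m / 2 ≤ ‖signSum t v s‖ ^ 2) (fun s => ‖signSum t v s‖ ^ 2)
    rw [sum_signSum_sq] at hsplit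
    have h2 : ∑ s ∈ t.powerset.filter (fun s => ¬ m / 2 ≤ ‖signSum t v s‖ ^ 2), ‖signSum t v s‖ ^ 2
        ≤ 2 ^ t.card * (m / 2) := by
      calc _ ≤ ∑ s ∈ t.powerset.filter (fun s => ¬ m / 2 ≤ ‖signSum t v s‖ ^ 2), m / 2 := by
            refine Finset.sum_le_sum fun s hs => ?_
            exact (not_le.1 (Finset.mem_filter.1 hs).2).le
        _ ≤ ∑ s ∈ t.powerset, m / 2 :=
            Finset.sum_le_sum_of_subset_of_nonneg (Finset.filter_subset _ _)
              fun _ _ _ => by positivity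
        _ = _ := by rw [Finset.sum_const, Finset.card_powerset, nsmul_eq_mul]; push_cast; rfl
    rw [← hm, ← hG] at hsplit
    linarith
  -- At least half of the second moment comes from `G`, and the mean fourth moment is at most 3m²;
  -- Cauchy–Schwarz gives the proportion (1/2)²/3 = 1/12.
  have h2 : (∑ s ∈ G, ‖signSum t v s‖ ^ 2) ^ 2 ≤ G.card * (3 * 2 ^ t.card * m ^ 2) := by
    have hcs := sq_sum_le_card_mul_sum_sq (s := G) (f := fun s => ‖signSum t v s‖ ^ 2)
    refine hcs.trans ?_
    gcongr
    refine le_trans ?_ (sum_signSum_four t v)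
    refine le_trans (Finset.sum_le_sum_of_subset_of_nonneg (Finset.filter_subset _ _)
      fun _ _ _ => by positivity) (le_of_eq ?_)
    refine Finset.sum_congr rfl fun s _ => by ring
  have h3 : (2 ^ t.card * m / 2) ^ 2 ≤ G.card * (3 * 2 ^ t.card * m ^ 2) :=
    le_trans (by gcongr) h2
  have h4 : (2 ^ t.card * m ^ 2) * (2 ^ t.card / 12) ≤ (2 ^ t.card * m ^ 2) * G.card := by
    nlinarith
  exact le_of_mul_le_mul_left h4 (by positivity)

end Signs

/-! ### The Wegner estimate at one site. -/

section SiteWegner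

variable {W : ℕ}

/-- The unit vector with entries `± W ^ (-1/2)`. -/
def signVec (W : ℕ) (s : Finset (Fin W)) : Fin W → ℂ :=
  fun i => ((if i ∈ s then (1 : ℝ) else -1) / Real.sqrt W : ℝ)

theorem signVec_unit (hW : 0 < W) (s : Finset (Fin W)) :
    star (signVec W s) ⬝ᵥ signVec W s = 1 := by
  have hW' : (0 : ℝ) < W := by exact_mod_cast hW
  rw [← vecSq_eq]
  have h1 : ∀ i, ‖signVec W s i‖ ^ 2 = 1 / W := by
    intro i
    unfold signVec
    rw [Complex.norm_real, Real.norm_eq_abs, sq_abs, div_pow, Real.sq_sqrt hW'.le]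
    split_ifs <;> norm_num
  unfold vecSq
  simp_rw [h1]
  rw [Finset.sum_const, Finset.card_univ, Fintype.card_fin, nsmul_eq_mul]
  have : (W : ℝ) * (1 / W) = 1 := by field_simp
  rw [this]; simp

theorem vecSq_mulVec_signVec (hW : 0 < W) (A : Matrix (Fin W) (Fin W) ℂ) (s : Finset (Fin W)) :
    vecSq (A *ᵥ signVec W s)
      = ‖signSum Finset.univ (fun j => WithLp.toLp 2 fun i => A i j) s‖ ^ 2 / W := by
  have hW' : (0 : ℝ) < W := by exact_mod_cast hW
  rw [EuclideanSpace.norm_sq_eq, vecSq, Finset.sum_div]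
  refine Finset.sum_congr rfl fun i _ => ?_
  have h1 : (signSum Finset.univ (fun j => WithLp.toLp 2 fun i => A i j) s : EuclideanSpace ℂ (Fin W)) i
      = (A *ᵥ signVec W s) i * (Real.sqrt W : ℂ) := by
    simp only [signSum, WithLp.ofLp_sum, Finset.sum_apply, Matrix.mulVec, dotProduct, Finset.sum_mul]
    refine Finset.sum_congr rfl fun j _ => ?_
    have hs : (Real.sqrt W : ℂ) ≠ 0 := by
      exact_mod_cast (Real.sqrt_pos.2 hW').ne'
    unfold signVec
    split_ifs <;> push_cast <;> field_simp <;> simp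
  rw [h1, norm_mul, mul_pow, Complex.norm_real, Real.norm_eq_abs, sq_abs, Real.sq_sqrt hW'.le]
  field_simp

/-- Wegner estimate at a site, of the optimal order in `W`, uniform in the shift. -/
theorem lawV_wegner (hW : 0 < W) {B₀ : Matrix (Fin W) (Fin W) ℂ} (hB : B₀.IsHermitian) {lam : ℝ}
    (hlam : 0 < lam) :
    lawV W {h | (lam * W) ^ 2 ≤ frobSq (hermitianOf h - B₀)⁻¹} ≤ ENNReal.ofReal (6000 / lam) := by
  have hprob := isProbabilityMeasure_lawV hW
  have hW' : (0 : ℝ) < W := by exact_mod_cast hW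
  set S := {h : Fin W → Fin W → ℝ | (lam * W) ^ 2 ≤ frobSq (hermitianOf h - B₀)⁻¹} with hS
  -- The mean over signs of ‖Γφ‖² is ‖Γ‖_HS²/W, at least 2Q on `S`. At least 1/12 of the sign
  -- vectors reach half of it, so averaging the single-vector bound over signs costs only a factor
  -- 12, and 12 · 500 = 6000.
  set Q : ℝ := lam ^ 2 * W / 2 with hQ
  have hQ0 : 0 < Q := by positivity
  let E : Finset (Fin W) → Set (Fin W → Fin W → ℝ) := fun s =>
    {h | Q ≤ vecSq ((hermitianOf h - B₀)⁻¹ *ᵥ signVec W s)}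
  have hinv := (entrywiseMeasurable_hermitianOf (W := W)).sub (.const B₀) |>.inv
  have hSm : MeasurableSet S := measurableSet_le measurable_const hinv.frobSq
  have hEm : ∀ s, MeasurableSet (E s) := by
    intro s
    refine measurableSet_le measurable_const ?_
    unfold vecSq
    refine Finset.measurable_fun_sum _ fun i _ => Measurable.pow_const (Measurable.norm ?_) 2
    simp only [Matrix.mulVec, dotProduct]
    exact Finset.measurable_fun_sum _ fun j _ => (hinv i j).mul_const _
  set U := (Finset.univ : Finset (Fin W)).powerset with hU
  have hpt : ∀ h ∈ S, ENNReal.ofReal (2 ^ W / 12) ≤ ∑ s ∈ U, (E s).indicator (fun _ => (1 : ℝ≥0∞)) h := by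
    intro h hh
    set Γ := (hermitianOf h - B₀)⁻¹ with hΓ
    let v : Fin W → EuclideanSpace ℂ (Fin W) := fun j => WithLp.toLp 2 fun i => Γ i j
    have hm : ∑ j, ‖v j‖ ^ 2 = frobSq Γ := by
      simp only [v, EuclideanSpace.norm_sq_eq, frobSq]
      exact Finset.sum_comm
    have hc := card_signSum_ge Finset.univ v
    rw [Finset.card_univ, Fintype.card_fin, hm] at hc
    set G := Finset.univ.powerset.filter fun s => frobSq Γ / 2 ≤ ‖signSum Finset.univ v s‖ ^ 2 with hG
    calc ENNReal.ofReal (2 ^ W / 12) ≤ ENNReal.ofReal G.card := ENNReal.ofReal_le_ofReal hc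
      _ = ∑ s ∈ G, (1 : ℝ≥0∞) := by simp
      _ = ∑ s ∈ G, (E s).indicator (fun _ => (1 : ℝ≥0∞)) h := by
          refine Finset.sum_congr rfl fun s hs => ?_
          rw [Set.indicator_of_mem]
          have h1 := (Finset.mem_filter.1 hs).2
          change Q ≤ vecSq (Γ *ᵥ signVec W s)
          rw [vecSq_mulVec_signVec hW]
          have h2 : (lam * W) ^ 2 ≤ frobSq Γ := hh
          rw [le_div_iff₀ hW', hQ]
          calc lam ^ 2 * W / 2 * W = (lam * W) ^ 2 / 2 := by ring
            _ ≤ frobSq Γ / 2 := by gcongr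
            _ ≤ _ := h1
      _ ≤ _ := Finset.sum_le_sum_of_subset (Finset.filter_subset _ _)
  have hsq : 256 * Real.sqrt (W / Q) ≤ 500 / lam := by
    have : Real.sqrt (W / Q) = Real.sqrt 2 / lam := by
      have : (W : ℝ) / Q = 2 / lam ^ 2 := by rw [hQ]; field_simp
      rw [this, Real.sqrt_div (by norm_num), Real.sqrt_sq hlam.le]
    rw [this, ← mul_div_assoc]
    gcongr
    have : Real.sqrt 2 ≤ 1.5 := by
      rw [Real.sqrt_le_left (by norm_num)]; norm_num
    linarith
  have hmain : ENNReal.ofReal (2 ^ W / 12) * lawV W S ≤ ENNReal.ofReal (2 ^ W * (500 / lam)) := by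
    calc ENNReal.ofReal (2 ^ W / 12) * lawV W S
        = ∫⁻ _ in S, ENNReal.ofReal (2 ^ W / 12) ∂(lawV W) := by rw [setLIntegral_const]
      _ ≤ ∫⁻ h in S, ∑ s ∈ U, (E s).indicator (fun _ => (1 : ℝ≥0∞)) h ∂(lawV W) :=
          setLIntegral_mono' hSm hpt
      _ ≤ ∫⁻ h, ∑ s ∈ U, (E s).indicator (fun _ => (1 : ℝ≥0∞)) h ∂(lawV W) :=
          setLIntegral_le_lintegral _ _
      _ = ∑ s ∈ U, lawV W (E s) := by
          rw [lintegral_finsetSum _ fun s _ => measurable_const.indicator (hEm s)]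
          refine Finset.sum_congr rfl fun s _ => ?_
          rw [lintegral_indicator_const (hEm s), one_mul]
      _ ≤ ∑ s ∈ U, ENNReal.ofReal (500 / lam) := by
          refine Finset.sum_le_sum fun s _ => ?_
          refine (lawV_resolvent_vec hW (signVec_unit hW s) hB hQ0).trans ?_
          exact ENNReal.ofReal_le_ofReal hsq
      _ = _ := by
          rw [Finset.sum_const, hU, Finset.card_powerset, Finset.card_univ, Fintype.card_fin,
            nsmul_eq_mul, ENNReal.ofReal_mul (by positivity)]
          congr 1
          rw [ENNReal.ofReal_pow (by norm_num)]; simp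
  have e : ENNReal.ofReal (2 ^ W * (500 / lam))
      = ENNReal.ofReal (2 ^ W / 12) * ENNReal.ofReal (6000 / lam) := by
    rw [← ENNReal.ofReal_mul (by positivity)]; congr 1; ring
  rw [e] at hmain
  have hpos : (0 : ℝ) < 2 ^ W / 12 := by positivity
  exact (ENNReal.mul_le_mul_iff_right (by simpa using hpos) (by simp)).1 hmain

end SiteWegner

/-! ### Operator norms of Gaussian blocks. -/

section OpNormTail

variable {W : ℕ}

/-- Start from a vector nearly attaining the norm and its normalised image; displacing both by 1/5
still leaves 19/20 - 1/5 - 1/5 - 1/25 ≥ 1/2 of the norm. -/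
theorem re_inner_ge_of_near {A : EuclideanSpace ℂ (Fin W) →L[ℂ] EuclideanSpace ℂ (Fin W)}
    {R : ℝ} (hR : 0 ≤ R) (hA : R < ‖A‖) :
    ∃ u v : EuclideanSpace ℂ (Fin W), ‖u‖ ≤ 1 ∧ ‖v‖ ≤ 1 ∧
      ∀ χ ∈ Metric.ball u (1 / 5), ∀ φ ∈ Metric.ball v (1 / 5), R / 2 ≤ (inner ℂ χ (A φ)).re := by
  have hpos : 0 < ‖A‖ := hR.trans_lt hA
  obtain ⟨v, hv, hAv⟩ := A.exists_lt_apply_of_lt_opNorm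
    (show 19 / 20 * ‖A‖ < ‖A‖ by linarith)
  have hAv0 : 0 < ‖A v‖ := lt_of_le_of_lt (by positivity) hAv
  set u : EuclideanSpace ℂ (Fin W) := ((‖A v‖⁻¹ : ℝ) : ℂ) • A v with hu
  have hu1 : ‖u‖ = 1 := by
    rw [hu, norm_smul, Complex.norm_real, norm_inv, norm_norm, inv_mul_cancel₀ hAv0.ne']
  refine ⟨u, v, hu1.le, hv.le, fun χ hχ φ hφ => ?_⟩
  rw [mem_ball_iff_norm] at hχ hφ
  have huv : (inner ℂ u (A v)).re = ‖A v‖ := by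
    rw [hu, inner_smul_left, inner_self_eq_norm_sq_to_K]
    simp only [Complex.conj_ofReal, Complex.coe_algebraMap, ← Complex.ofReal_pow, ← Complex.ofReal_mul,
      Complex.ofReal_re]
    field_simp
  have hdec : inner ℂ χ (A φ) = inner ℂ u (A v) + inner ℂ u (A (φ - v)) + inner ℂ (χ - u) (A v)
      + inner ℂ (χ - u) (A (φ - v)) := by
    simp only [map_sub, inner_sub_left, inner_sub_right]; ring
  have hb : ∀ x y : EuclideanSpace ℂ (Fin W), -(‖x‖ * (‖A‖ * ‖y‖)) ≤ (inner ℂ x (A y)).re := by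
    intro x y
    have h1 := (Complex.abs_re_le_norm (inner ℂ x (A y))).trans (norm_inner_le_norm x (A y))
    have h2 := mul_le_mul_of_nonneg_left (A.le_opNorm y) (norm_nonneg x)
    exact neg_le_of_abs_le (h1.trans h2)
  have h1 := hb u (φ - v)
  have h2 := hb (χ - u) v
  have h3 := hb (χ - u) (φ - v)
  rw [hdec, Complex.add_re, Complex.add_re, Complex.add_re, huv]
  have e1 : ‖u‖ * (‖A‖ * ‖φ - v‖) ≤ ‖A‖ * (1 / 5) := by
    rw [hu1, one_mul]; gcongr
  have e2 : ‖χ - u‖ * (‖A‖ * ‖v‖) ≤ 1 / 5 * (‖A‖ * 1) := by gcongr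
  have e3 : ‖χ - u‖ * (‖A‖ * ‖φ - v‖) ≤ 1 / 5 * (‖A‖ * (1 / 5)) := by gcongr
  linarith

/-- A volume argument in place of a net: exp (W Re ⟨χ, Mφ⟩) is integrated over χ and φ in the ball
of radius 6/5. A norm above 20 forces the value exp (10W) on a product of balls of radius 1/5, while
the mean is at most exp (0.6W) times the volume. In real dimension 4W the volume ratio is 6^(4W) ≤
exp (8W). -/
theorem opNorm_tail {Ω : Type*} [MeasurableSpace Ω] (γ : Measure Ω) [SFinite γ]
    {M : Ω → Matrix (Fin W) (Fin W) ℂ} (hM : EntrywiseMeasurable M)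
    (h : ∀ χ φ : EuclideanSpace ℂ (Fin W),
      ∫⁻ x, ENNReal.ofReal (Real.exp (W * (inner ℂ χ (Matrix.toEuclideanCLM (𝕜 := ℂ) (M x) φ)).re)) ∂γ
        ≤ ENNReal.ofReal (Real.exp (W / 4 * (‖χ‖ ^ 2 * ‖φ‖ ^ 2)))) :
    γ {x | 20 < ‖Matrix.toEuclideanCLM (𝕜 := ℂ) (M x)‖} ≤ ENNReal.ofReal (Real.exp (-W)) := by
  set ν : Measure (EuclideanSpace ℂ (Fin W)) := Measure.addHaar with hν
  set f : Ω → EuclideanSpace ℂ (Fin W) × EuclideanSpace ℂ (Fin W) → ℝ≥0∞ := fun x p =>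
    ENNReal.ofReal (Real.exp (W * (inner ℂ p.1 (Matrix.toEuclideanCLM (𝕜 := ℂ) (M x) p.2)).re)) with hf
  set K := Metric.ball (0 : EuclideanSpace ℂ (Fin W)) (6 / 5)
  set b := ν (Metric.ball 0 1) with hb
  have hb0 : b ≠ 0 := (Metric.measure_ball_pos ν _ one_pos).ne'
  have hbt : b ≠ ∞ := measure_ball_lt_top.ne
  have hfin : Module.finrank ℝ (EuclideanSpace ℂ (Fin W)) = 2 * W := by
    rw [finrank_real_of_complex, finrank_euclideanSpace_fin]
  have hvol : ∀ (x : EuclideanSpace ℂ (Fin W)) {r : ℝ}, 0 < r →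
      ν (Metric.ball x r) = ENNReal.ofReal (r ^ (2 * W)) * b := by
    intro x r hr
    rw [Measure.addHaar_ball_of_pos ν x hr, hfin]
  have hfm : Measurable (Function.uncurry f) := by
    simp only [hf, Function.uncurry_def]
    refine ENNReal.measurable_ofReal.comp (Real.measurable_exp.comp (Measurable.const_mul ?_ _))
    refine Complex.measurable_re.comp ?_
    have : ∀ q : Ω × (EuclideanSpace ℂ (Fin W) × EuclideanSpace ℂ (Fin W)),
        inner ℂ q.2.1 (Matrix.toEuclideanCLM (𝕜 := ℂ) (M q.1) q.2.2)
          = ∑ i, (∑ j, M q.1 i j * q.2.2 j) * star (q.2.1 i) := by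
      intro q
      rw [PiLp.inner_apply]
      refine Finset.sum_congr rfl fun i _ => ?_
      simp [Matrix.mulVec, dotProduct]
    simp only [this]
    have hev : ∀ i, Measurable fun v : EuclideanSpace ℂ (Fin W) => v i := fun i =>
      (EuclideanSpace.proj (𝕜 := ℂ) i).continuous.measurable
    refine Finset.measurable_fun_sum _ fun i _ => (Finset.measurable_fun_sum _ fun j _ => ?_).mul ?_
    · exact ((hM i j).comp measurable_fst).mul ((hev j).comp (measurable_snd.comp measurable_snd))
    · exact (continuous_star.measurable).comp ((hev i).comp (measurable_fst.comp measurable_snd))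
  have hlow : ∀ x ∈ {x | 20 < ‖Matrix.toEuclideanCLM (𝕜 := ℂ) (M x)‖},
      ENNReal.ofReal (Real.exp (10 * W)) * (ENNReal.ofReal ((1 / 5) ^ (2 * W)) * b) ^ 2
        ≤ ∫⁻ p in K ×ˢ K, f x p ∂(ν.prod ν) := by
    intro x hx
    obtain ⟨u, v, hu, hv, huv⟩ := re_inner_ge_of_near (by norm_num) hx
    have hsub : Metric.ball u (1 / 5) ×ˢ Metric.ball v (1 / 5) ⊆ K ×ˢ K := by
      refine Set.prod_mono ?_ ?_ <;> refine Metric.ball_subset_ball' ?_ <;>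
        rw [dist_zero_right] <;> linarith
    calc _ = ∫⁻ p in Metric.ball u (1 / 5) ×ˢ Metric.ball v (1 / 5),
          ENNReal.ofReal (Real.exp (10 * W)) ∂(ν.prod ν) := by
          rw [setLIntegral_const, Measure.prod_prod, hvol u (by norm_num), hvol v (by norm_num), sq]
      _ ≤ ∫⁻ p in Metric.ball u (1 / 5) ×ˢ Metric.ball v (1 / 5), f x p ∂(ν.prod ν) := by
          refine setLIntegral_mono' (measurableSet_ball.prod measurableSet_ball) fun p hp => ?_
          refine ENNReal.ofReal_le_ofReal (Real.exp_le_exp.2 ?_)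
          have := huv p.1 hp.1 p.2 hp.2
          have h2 := mul_le_mul_of_nonneg_left this (Nat.cast_nonneg (α := ℝ) W)
          linarith
      _ ≤ _ := lintegral_mono_set hsub
  have hup : ∫⁻ x, ∫⁻ p in K ×ˢ K, f x p ∂(ν.prod ν) ∂γ
      ≤ ENNReal.ofReal (Real.exp (W * (6 / 10))) * (ENNReal.ofReal ((6 / 5) ^ (2 * W)) * b) ^ 2 := by
    rw [lintegral_lintegral_swap hfm.aemeasurable]
    calc _ ≤ ∫⁻ p in K ×ˢ K, ENNReal.ofReal (Real.exp (W * (6 / 10))) ∂(ν.prod ν) := by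
          refine setLIntegral_mono' (measurableSet_ball.prod measurableSet_ball) fun p hp => ?_
          refine (h p.1 p.2).trans (ENNReal.ofReal_le_ofReal (Real.exp_le_exp.2 ?_))
          have h1 : ‖p.1‖ ≤ 6 / 5 := by
            have := hp.1; rw [mem_ball_zero_iff] at this; exact this.le
          have h2 : ‖p.2‖ ≤ 6 / 5 := by
            have := hp.2; rw [mem_ball_zero_iff] at this; exact this.le
          have : ‖p.1‖ ^ 2 * ‖p.2‖ ^ 2 ≤ (6 / 5) ^ 2 * (6 / 5) ^ 2 := by gcongr
          have hW := Nat.cast_nonneg (α := ℝ) W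
          nlinarith
      _ = _ := by
          rw [setLIntegral_const, Measure.prod_prod, hvol 0 (by norm_num), sq]
  have hmk := mul_meas_ge_le_lintegral₀ (μ := γ)
    (f := fun x => ∫⁻ p in K ×ˢ K, f x p ∂(ν.prod ν)) (hfm.lintegral_prod_right'.aemeasurable)
    (ENNReal.ofReal (Real.exp (10 * W)) * (ENNReal.ofReal ((1 / 5) ^ (2 * W)) * b) ^ 2)
  have h1 : ENNReal.ofReal (Real.exp (10 * W)) * (ENNReal.ofReal ((1 / 5) ^ (2 * W)) * b) ^ 2
      * γ {x | 20 < ‖Matrix.toEuclideanCLM (𝕜 := ℂ) (M x)‖}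
      ≤ ENNReal.ofReal (Real.exp (W * (6 / 10))) * (ENNReal.ofReal ((6 / 5) ^ (2 * W)) * b) ^ 2 := by
    refine le_trans (mul_le_mul_right (measure_mono ?_) _) (hmk.trans hup)
    exact fun x hx => hlow x hx
  set c := ENNReal.ofReal (Real.exp (10 * W)) * (ENNReal.ofReal ((1 / 5) ^ (2 * W)) * b) ^ 2 with hc
  have hc0 : c ≠ 0 := by
    refine mul_ne_zero (by simpa using Real.exp_pos _) (pow_ne_zero _ (mul_ne_zero ?_ hb0))
    simp
  have hct : c ≠ ∞ := by finiteness
  have h2 : ENNReal.ofReal (Real.exp (W * (6 / 10))) * (ENNReal.ofReal ((6 / 5) ^ (2 * W)) * b) ^ 2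
      ≤ c * ENNReal.ofReal (Real.exp (-W)) := by
    have e : c * ENNReal.ofReal (Real.exp (-W)) = ENNReal.ofReal (Real.exp (10 * W)
        * ((1 / 5) ^ (2 * W)) ^ 2 * Real.exp (-W)) * b ^ 2 := by
      rw [hc, mul_pow, ← ENNReal.ofReal_pow (by positivity), ENNReal.ofReal_mul (by positivity),
        ENNReal.ofReal_mul (by positivity)]; ring
    rw [e, mul_pow, ← ENNReal.ofReal_pow (by positivity), ← mul_assoc,
      ← ENNReal.ofReal_mul (by positivity)]
    refine mul_le_mul_left (ENNReal.ofReal_le_ofReal ?_) _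
    have h6 : (6 / 5 : ℝ) = 6 * (1 / 5) := by norm_num
    rw [h6, mul_pow, mul_pow, ← mul_assoc, mul_right_comm (Real.exp (10 * W))]
    refine mul_le_mul_of_nonneg_right ?_ (by positivity)
    have h7 : ((6 : ℝ) ^ (2 * W)) ^ 2 ≤ Real.exp (8 * W) := by
      rw [← pow_mul, show 2 * W * 2 = 4 * W by ring, pow_mul, mul_comm (8 : ℝ), Real.exp_nat_mul]
      refine pow_le_pow_left₀ (by positivity) ?_ _
      rw [show (8 : ℝ) = ((8 : ℕ) : ℝ) * 1 by norm_num, Real.exp_nat_mul]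
      have := Real.exp_one_gt_d9
      calc (6 : ℝ) ^ 4 ≤ 2.7 ^ 8 := by norm_num
        _ ≤ _ := pow_le_pow_left₀ (by norm_num) (by linarith) 8
    calc Real.exp (W * (6 / 10)) * ((6 : ℝ) ^ (2 * W)) ^ 2
        ≤ Real.exp (W * (6 / 10)) * Real.exp (8 * W) := by gcongr
      _ ≤ Real.exp (10 * W) * Real.exp (-W) := by
        rw [← Real.exp_add, ← Real.exp_add]
        refine Real.exp_le_exp.2 ?_
        have hW := Nat.cast_nonneg (α := ℝ) W
        linarith
  exact (ENNReal.mul_le_mul_iff_right hc0 hct).1 (h1.trans h2)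

theorem inner_toEuclideanCLM (M : Matrix (Fin W) (Fin W) ℂ) (χ φ : EuclideanSpace ℂ (Fin W)) :
    (inner ℂ χ (Matrix.toEuclideanCLM (𝕜 := ℂ) M φ)).re
      = frobInner (Matrix.of fun i j => χ i * star (φ j)) M := by
  rw [PiLp.inner_apply, frobInner, Complex.re_sum]
  refine Finset.sum_congr rfl fun i _ => ?_
  simp only [Matrix.ofLp_toEuclideanCLM, Matrix.mulVec, dotProduct, RCLike.inner_apply,
    Finset.sum_mul, Complex.re_sum, Matrix.of_apply, star_mul', star_star]
  refine Finset.sum_congr rfl fun j _ => ?_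
  congr 1
  simp only [Complex.star_def]
  ring

theorem frobSq_vecMul (χ φ : EuclideanSpace ℂ (Fin W)) :
    frobSq (Matrix.of fun i j => χ i * star (φ j)) = ‖χ‖ ^ 2 * ‖φ‖ ^ 2 := by
  rw [EuclideanSpace.norm_sq_eq, EuclideanSpace.norm_sq_eq, Finset.sum_mul_sum, frobSq]
  refine Finset.sum_congr rfl fun i _ => Finset.sum_congr rfl fun j _ => ?_
  simp [mul_pow]

theorem lawT_opNorm_tail (hW : 0 < W) :
    lawT W {t | 20 < ‖Matrix.toEuclideanCLM (𝕜 := ℂ) (Matrix.of t : Matrix (Fin W) (Fin W) ℂ)‖}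
      ≤ ENNReal.ofReal (Real.exp (-W)) := by
  have := isProbabilityMeasure_lawT hW
  refine opNorm_tail (lawT W) (M := fun t => Matrix.of t)
    (fun i j => (measurable_pi_apply j).comp (measurable_pi_apply i)) fun χ φ => ?_
  set a : Matrix (Fin W) (Fin W) ℂ := (1 / 2 : ℝ) • Matrix.of fun i j => χ i * star (φ j)
  have h := (isGaussForm_formT hW).lintegral_exp (μ := volume) (Matrix.of.symm a)
  have e1 : ∀ t : Fin W → Fin W → ℂ, 2 * formT W t (Matrix.of.symm a)
      = W * (inner ℂ χ (Matrix.toEuclideanCLM (𝕜 := ℂ) (Matrix.of t) φ)).re := by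
    intro t
    rw [inner_toEuclideanCLM, formT_apply, Equiv.apply_symm_apply, frobInner_comm, frobInner_smul_left]
    ring
  have e2 : formT W (Matrix.of.symm a) (Matrix.of.symm a) = W / 4 * (‖χ‖ ^ 2 * ‖φ‖ ^ 2) := by
    rw [formT_self, Equiv.apply_symm_apply, frobSq_smul, frobSq_vecMul]
    ring
  simp only [e1, e2] at h
  exact h.le

/-- A Hermitian matrix only sees the Hermitian part of χ φ*, whose Hilbert–Schmidt norm is no larger
than that of χ φ*; the exponential moment is therefore at most the one for a complex block. -/
theorem lawV_opNorm_tail (hW : 0 < W) :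
    lawV W {v | 20 < ‖Matrix.toEuclideanCLM (𝕜 := ℂ) (hermitianOf v)‖}
      ≤ ENNReal.ofReal (Real.exp (-W)) := by
  have := isProbabilityMeasure_lawV hW
  refine opNorm_tail (lawV W) (M := hermitianOf) entrywiseMeasurable_hermitianOf fun χ φ => ?_
  set c : Matrix (Fin W) (Fin W) ℂ := Matrix.of fun i j => χ i * star (φ j) with hc
  set a : Matrix (Fin W) (Fin W) ℂ := (1 / 4 : ℝ) • (c + cᴴ) with ha
  have hstar : ∀ A B : Matrix (Fin W) (Fin W) ℂ, frobInner Aᴴ Bᴴ = frobInner A B := by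
    intro A B
    rw [frobInner, Finset.sum_comm, frobInner]
    refine Finset.sum_congr rfl fun i _ => Finset.sum_congr rfl fun j _ => ?_
    simp only [Matrix.conjTranspose_apply, Complex.mul_re, Complex.star_def, Complex.conj_re,
      Complex.conj_im]
    ring
  have haH : a.IsHermitian := by
    rw [ha]
    refine Matrix.IsHermitian.smul ?_ (by simp [IsSelfAdjoint])
    rw [Matrix.IsHermitian, Matrix.conjTranspose_add, Matrix.conjTranspose_conjTranspose, add_comm]
  have h := (isGaussForm_formV hW).lintegral_exp (μ := volume) (coordL W a)
  have e1 : ∀ v : Fin W → Fin W → ℝ, 2 * formV W v (coordL W a)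
      = W * (inner ℂ χ (Matrix.toEuclideanCLM (𝕜 := ℂ) (hermitianOf v) φ)).re := by
    intro v
    rw [inner_toEuclideanCLM, formV_apply, hermitianOf_coordL haH, frobInner_comm, ha,
      frobInner_smul_left, frobInner_add_left]
    have : frobInner cᴴ (hermitianOf v) = frobInner c (hermitianOf v) := by
      have h2 := hstar c (hermitianOf v)
      rwa [(hermitianOf_isHermitian v).eq] at h2
    rw [this]; ring
  have e2 : formV W (coordL W a) (coordL W a) ≤ W / 4 * (‖χ‖ ^ 2 * ‖φ‖ ^ 2) := by
    rw [formV_self, hermitianOf_coordL haH, frobSq_smul, frobSq_add]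
    have h1 := (mul_le_mul_of_nonneg_left (le_abs_self (frobInner c cᴴ)) zero_le_two).trans
      (two_abs_frobInner_le c cᴴ)
    have h2 : frobSq cᴴ = frobSq c := by
      rw [← frobInner_self, hstar, frobInner_self]
    have h3 : frobSq c = ‖χ‖ ^ 2 * ‖φ‖ ^ 2 := frobSq_vecMul χ φ
    rw [← h3]
    have hW' := Nat.cast_nonneg (α := ℝ) W
    nlinarith
  simp only [e1] at h
  exact h.le.trans (ENNReal.ofReal_le_ofReal (Real.exp_le_exp.2 e2))

end OpNormTail

/-- A Gaussian vector whose law has density proportional to `exp (-B x x)` has `B x x` of order the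
dimension. -/
theorem IsGaussForm.self_tail {E : Type*} [NormedAddCommGroup E] [NormedSpace ℝ E]
    [FiniteDimensional ℝ E] [MeasurableSpace E] [BorelSpace E] {μ : Measure E} [μ.IsAddHaarMeasure]
    {B : LinearMap.BilinForm ℝ E} (hB : IsGaussForm B) (y : ℝ) :
    gaussLaw μ B {x | y ≤ B x x}
      ≤ ENNReal.ofReal (Real.exp (7 / 10 * Module.finrank ℝ E - 3 / 4 * y)) := by
  set d := Module.finrank ℝ E
  -- Chernoff's bound with exponent 3/4 = 1 - (1/2)²; the moment is 2^d ≤ exp (7d/10).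
  have h := hB.lintegral_exp_self (μ := μ) (r := 1 / 2) (by norm_num)
  have h2 := mul_meas_ge_le_lintegral₀ (μ := gaussLaw μ B)
    (f := fun x => ENNReal.ofReal (Real.exp ((1 - (1 / 2) ^ 2) * B x x))) (by
      refine (ENNReal.measurable_ofReal.comp (Real.measurable_exp.comp ?_)).aemeasurable
      exact ((continuous_bilin_self B).measurable).const_mul _)
    (ENNReal.ofReal (Real.exp (3 / 4 * y)))
  rw [h] at h2
  have h3 : ENNReal.ofReal (Real.exp (3 / 4 * y)) * gaussLaw μ B {x | y ≤ B x x}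
      ≤ ENNReal.ofReal (Real.exp (3 / 4 * y))
        * ENNReal.ofReal (Real.exp (7 / 10 * d - 3 / 4 * y)) := by
    refine (mul_le_mul_right (measure_mono fun x hx => ?_) _).trans (h2.trans ?_)
    · refine ENNReal.ofReal_le_ofReal (Real.exp_le_exp.2 ?_)
      have : y ≤ B x x := hx
      linarith
    · rw [← ENNReal.ofReal_mul (Real.exp_pos _).le, ← Real.exp_add]
      refine ENNReal.ofReal_le_ofReal ?_
      have h4 : ((1 / 2 : ℝ)⁻¹) ^ d = Real.exp (d * Real.log 2) := by
        rw [Real.exp_nat_mul, Real.exp_log two_pos]; norm_num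
      rw [h4]
      refine Real.exp_le_exp.2 ?_
      have := mul_le_mul_of_nonneg_left Real.log_two_lt_d9.le (Nat.cast_nonneg (α := ℝ) d)
      have hd := Nat.cast_nonneg (α := ℝ) d
      linarith
  exact (ENNReal.mul_le_mul_iff_right (by simpa using Real.exp_pos _) ENNReal.ofReal_ne_top).1 h3

/-! ### Triangular shears. -/

section Shear

variable {n : ℕ} {E : Type*} [AddCommGroup E] [MeasurableSpace E] [MeasurableAdd₂ E]

/-- Triangular shears preserve the product of translation invariant measures. -/
theorem lintegral_pi_shear (μ : Measure E) [SigmaFinite μ] [μ.IsAddLeftInvariant]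
    {f : Fin n → (Fin n → E) → E} (hf : ∀ j, Measurable (f j))
    (hdep : ∀ j x y, (∀ i < j, x i = y i) → f j x = f j y) {F : (Fin n → E) → ℝ≥0∞}
    (hF : Measurable F) :
    ∫⁻ x, F (fun j => x j + f j x) ∂(Measure.pi fun _ => μ) = ∫⁻ x, F x ∂(Measure.pi fun _ => μ) := by
  -- `Φ m` shifts only the coordinates from m on. Lowering m by one shifts a further coordinate by a
  -- function of earlier ones, which are still unshifted, so each step is a translation in one
  -- variable.
  set Φ : ℕ → (Fin n → E) → Fin n → E := fun m x j => x j + if m ≤ j.val then f j x else 0 with hΦ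
  have hΦm : ∀ m, Measurable (Φ m) := by
    intro m
    refine measurable_pi_iff.2 fun j => ?_
    simp only [hΦ]
    split_ifs
    · exact (measurable_pi_apply j).add (hf j)
    · simpa using measurable_pi_apply j
  have hsingle : ∀ (i : Fin n) (G : (Fin n → E) → ℝ≥0∞), Measurable G →
      ∫⁻ x, G (Function.update x i (x i + f i x)) ∂(Measure.pi fun _ => μ)
        = ∫⁻ x, G x ∂(Measure.pi fun _ => μ) := by
    intro i G hG
    have hm : Measurable fun x : Fin n → E => Function.update x i (x i + f i x) := by
      refine measurable_pi_iff.2 fun j => ?_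
      by_cases hj : j = i
      · rw [hj]; simp only [Function.update_self]; exact (measurable_pi_apply i).add (hf i)
      · simpa [hj] using measurable_pi_apply j
    have h := lmarginal_eq_of_subset (μ := fun _ : Fin n => μ) (s := {i}) (Finset.subset_univ _)
      (hG.comp hm) hG (by
        rw [lmarginal_singleton, lmarginal_singleton]
        ext x
        have e : ∀ y, (G ∘ fun x => Function.update x i (x i + f i x)) (Function.update x i y)
            = (fun y => G (Function.update x i y)) (f i x + y) := by
          intro y
          have : f i (Function.update x i y) = f i x :=
            hdep _ _ _ fun k hk => Function.update_of_ne hk.ne _ _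
          simp [this, add_comm]
        simp_rw [e]
        exact lintegral_add_left_eq_self (fun y => G (Function.update x i y)) (f i x))
    rw [lmarginal_univ, lmarginal_univ] at h
    exact congrFun h 0
  have key : ∀ k ≤ n, ∀ G : (Fin n → E) → ℝ≥0∞, Measurable G →
      ∫⁻ x, G (Φ (n - k) x) ∂(Measure.pi fun _ => μ) = ∫⁻ x, G x ∂(Measure.pi fun _ => μ) := by
    intro k
    induction k with
    | zero =>
      intro _ G _
      have : ∀ x, Φ (n - 0) x = x := by
        intro x; ext j
        simp [hΦ, j.isLt]
      simp_rw [this]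
    | succ k ih =>
      intro hk G hG
      have hlt : n - (k + 1) < n := by omega
      set i : Fin n := ⟨n - (k + 1), hlt⟩ with hi
      have hm : Measurable fun x : Fin n → E => Function.update x i (x i + f i x) := by
        refine measurable_pi_iff.2 fun j => ?_
        by_cases hj : j = i
        · rw [hj]; simp only [Function.update_self]; exact (measurable_pi_apply i).add (hf i)
        · simpa [hj] using measurable_pi_apply j
      have h1 := ih (by omega) _ (hG.comp hm)
      rw [← hsingle i G hG]
      refine Eq.trans (lintegral_congr fun x => ?_) h1
      have hfi : f i (Φ (n - k) x) = f i x := by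
        refine hdep _ _ _ fun l hl => ?_
        have : ¬ n - k ≤ l.val := by
          have := Fin.lt_def.1 hl; simp only [hi] at this; omega
        simp [hΦ, this]
      simp only [Function.comp_apply]
      rw [hfi]
      congr 1
      ext j
      by_cases hj : j = i
      · rw [hj, Function.update_self]
        have h2 : ¬ n - k ≤ i.val := by simp only [hi]; omega
        have h3 : n - (k + 1) ≤ i.val := le_rfl
        simp only [hΦ, h2, h3, if_true, if_false, add_zero]
      · rw [Function.update_of_ne hj]
        have : (n - (k + 1) ≤ j.val) ↔ n - k ≤ j.val := by
          have : j.val ≠ n - (k + 1) := fun h => hj (Fin.ext h)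
          omega
        simp only [hΦ, this]
  have h := key n le_rfl F hF
  simpa [hΦ] using h

end Shear

/-! ### Measurability of the Hermitian coordinates. -/

section Coordinates

variable {Ω : Type*} [MeasurableSpace Ω] {W : ℕ}

theorem EntrywiseMeasurable.coordL {f : Ω → Matrix (Fin W) (Fin W) ℂ} (hf : EntrywiseMeasurable f) :
    Measurable fun x => coordL W (f x) := by
  refine measurable_pi_iff.2 fun i => measurable_pi_iff.2 fun j => ?_
  simp only [_root_.coordL, LinearMap.coe_mk, AddHom.coe_mk]
  split_ifs
  all_goals first
    | exact Complex.measurable_re.comp (hf _ _)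
    | exact Complex.measurable_im.comp (hf _ _)

end Coordinates

/-! ### Schur complements as coordinates. -/

namespace OrbitalSpace

variable {n W : ℕ}

/-- The diagonal blocks, extended by `0`. -/
def siteV (ω : OrbitalSpace n W) (j : ℕ) : Matrix (Fin W) (Fin W) ℂ :=
  if h : j < n then V ω ⟨j, h⟩ else 0

/-- The hopping matrices, extended by `0`. -/
def hop (ω : OrbitalSpace n W) (j : ℕ) : Matrix (Fin W) (Fin W) ℂ :=
  if h : j < n - 1 then T ω ⟨j, h⟩ else 0

theorem siteV_isHermitian (ω : OrbitalSpace n W) (j : ℕ) : (siteV ω j).IsHermitian := by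
  unfold siteV
  split_ifs
  · exact hermitianOf_isHermitian _
  · exact Matrix.isHermitian_zero

/-- The self-energies, by the Schur complement recursion. -/
def selfEnergy (z : ℝ) (ω : OrbitalSpace n W) : ℕ → Matrix (Fin W) (Fin W) ℂ
  | 0 => 0
  | j + 1 => hop ω j * (siteV ω j - (z : ℂ) • 1 - selfEnergy z ω j)⁻¹ * (hop ω j)ᴴ

/-- The self-energies as functions of the Schur complements, which here play the role of the
diagonal blocks. -/
def schurEnergy (s : OrbitalSpace n W) : ℕ → Matrix (Fin W) (Fin W) ℂ
  | 0 => 0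
  | j + 1 => hop s j * (siteV s j)⁻¹ * (hop s j)ᴴ

theorem isHermitian_smul_one (z : ℝ) : ((z : ℂ) • (1 : Matrix (Fin W) (Fin W) ℂ)).IsHermitian := by
  rw [Matrix.IsHermitian, Matrix.conjTranspose_smul, Matrix.conjTranspose_one]
  simp

theorem schurEnergy_isHermitian (s : OrbitalSpace n W) (j : ℕ) : (schurEnergy s j).IsHermitian := by
  cases j with
  | zero => exact Matrix.isHermitian_zero
  | succ j =>
    exact Matrix.isHermitian_mul_mul_conjTranspose _ (siteV_isHermitian s j).inv

theorem selfEnergy_isHermitian (z : ℝ) (ω : OrbitalSpace n W) (j : ℕ) :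
    (selfEnergy z ω j).IsHermitian := by
  induction j with
  | zero => exact Matrix.isHermitian_zero
  | succ j ih =>
    exact Matrix.isHermitian_mul_mul_conjTranspose _
      (((siteV_isHermitian ω j).sub (isHermitian_smul_one z)).sub ih).inv

/-- The change of variables from Schur complements to diagonal blocks. -/
def ofSchur (z : ℝ) (s : OrbitalSpace n W) : OrbitalSpace n W :=
  (fun j => s.1 j + coordL W ((z : ℂ) • 1 + schurEnergy s j), s.2)

theorem hop_ofSchur (z : ℝ) (s : OrbitalSpace n W) (j : ℕ) : hop (ofSchur z s) j = hop s j := rfl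

theorem siteV_ofSchur (z : ℝ) (s : OrbitalSpace n W) {j : ℕ} (hj : j < n) :
    siteV (ofSchur z s) j = siteV s j + (z : ℂ) • 1 + schurEnergy s j := by
  rw [siteV, siteV, dif_pos hj, dif_pos hj, V, V, ofSchur, add_assoc]
  exact hermitianOf_add_coordL _ ((isHermitian_smul_one z).add (schurEnergy_isHermitian s j))

/-- In the new coordinates the recursion collapses: V_j - z minus the self-energy is the coordinate
itself, so each self-energy involves only one Schur complement and one hopping matrix. -/
theorem selfEnergy_ofSchur (z : ℝ) (s : OrbitalSpace n W) {j : ℕ} (hj : j ≤ n) :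
    selfEnergy z (ofSchur z s) j = schurEnergy s j := by
  induction j with
  | zero => rfl
  | succ j ih =>
    rw [selfEnergy, ih (by omega), siteV_ofSchur z s (by omega), hop_ofSchur, schurEnergy]
    congr 3
    abel

theorem entrywiseMeasurable_siteV (j : ℕ) :
    EntrywiseMeasurable fun ω : OrbitalSpace n W => siteV ω j := by
  unfold siteV
  split_ifs with h
  · exact entrywiseMeasurable_hermitianOf.comp ((measurable_pi_apply _).comp measurable_fst)
  · exact EntrywiseMeasurable.const 0

theorem entrywiseMeasurable_hop (j : ℕ) :
    EntrywiseMeasurable fun ω : OrbitalSpace n W => hop ω j := by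
  unfold hop
  split_ifs with h
  · exact fun i k => (measurable_pi_apply k).comp ((measurable_pi_apply i).comp
      ((measurable_pi_apply _).comp measurable_snd))
  · exact EntrywiseMeasurable.const 0

theorem entrywiseMeasurable_schurEnergy (j : ℕ) :
    EntrywiseMeasurable fun ω : OrbitalSpace n W => schurEnergy ω j := by
  cases j with
  | zero => exact EntrywiseMeasurable.const 0
  | succ j =>
    exact ((entrywiseMeasurable_hop j).mul (entrywiseMeasurable_siteV j).inv).mul
      (entrywiseMeasurable_hop j).conjTranspose

theorem entrywiseMeasurable_selfEnergy (z : ℝ) (j : ℕ) :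
    EntrywiseMeasurable fun ω : OrbitalSpace n W => selfEnergy z ω j := by
  induction j with
  | zero => exact EntrywiseMeasurable.const 0
  | succ j ih =>
    exact ((entrywiseMeasurable_hop j).mul (((entrywiseMeasurable_siteV j).sub
      (EntrywiseMeasurable.const _)).sub ih).inv).mul (entrywiseMeasurable_hop j).conjTranspose

theorem measurable_ofSchur (z : ℝ) : Measurable (ofSchur z : OrbitalSpace n W → OrbitalSpace n W) := by
  refine Measurable.prodMk (measurable_pi_iff.2 fun j => ?_) measurable_snd
  exact ((measurable_pi_apply j).comp measurable_fst).add
    ((EntrywiseMeasurable.const _).add (entrywiseMeasurable_schurEnergy j)).coordL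

/-- At fixed hopping matrices the shift of the j-th block depends only on the preceding Schur
complement. -/
theorem lintegral_ofSchur (z : ℝ) {F : OrbitalSpace n W → ℝ≥0∞} (hF : Measurable F) :
    ∫⁻ s, F (ofSchur z s) = ∫⁻ ω, F ω := by
  have hG : Measurable fun s => F (ofSchur z s) := hF.comp (measurable_ofSchur z)
  rw [Measure.volume_eq_prod, lintegral_prod_symm' _ hG, lintegral_prod_symm' _ hF]
  refine lintegral_congr fun t => ?_
  refine lintegral_pi_shear (volume : Measure (Fin W → Fin W → ℝ))
    (f := fun j x => coordL W ((z : ℂ) • 1 + schurEnergy (x, t) j)) (fun j => ?_) ?_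
    (F := fun x => F (x, t)) (hF.comp (measurable_id.prodMk measurable_const))
  · exact ((EntrywiseMeasurable.const _).add ((entrywiseMeasurable_schurEnergy j).comp
      (measurable_id.prodMk measurable_const))).coordL
  · intro j x y hxy
    congr 2
    rcases j with ⟨j, hj⟩
    cases j with
    | zero => rfl
    | succ j =>
      have : siteV ((x, t) : OrbitalSpace n W) j = siteV ((y, t) : OrbitalSpace n W) j := by
        rw [siteV, siteV, dif_pos (by omega), dif_pos (by omega), V, V]
        exact congrArg hermitianOf (hxy ⟨j, by omega⟩ (Fin.lt_def.2 (Nat.lt_succ_self j)))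
      simp only [schurEnergy, this]
      rfl

theorem measurePreserving_ofSchur (z : ℝ) :
    MeasurePreserving (ofSchur z : OrbitalSpace n W → OrbitalSpace n W) volume volume := by
  refine ⟨measurable_ofSchur z, ?_⟩
  ext s hs
  rw [← lintegral_indicator_one hs, lintegral_map (measurable_one.indicator hs) (measurable_ofSchur z),
    ← lintegral_indicator_one hs, lintegral_ofSchur z (measurable_one.indicator hs)]

end OrbitalSpace

/-! ### The corner block of the resolvent as a product. -/

namespace OrbitalSpace

variable {n W : ℕ}

/-- The product `S₀⁻¹ T₀* S₁⁻¹ T₁* ⋯` over the first `j` sites. -/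
def greenChain (s : OrbitalSpace n W) : ℕ → Matrix (Fin W) (Fin W) ℂ
  | 0 => 1
  | j + 1 => greenChain s j * ((siteV s j)⁻¹ * (hop s j)ᴴ)

/-- The corner block of the resolvent in terms of the Schur complements. -/
def cornerGreen (s : OrbitalSpace n W) : Matrix (Fin W) (Fin W) ℂ :=
  greenChain s (n - 1) * (siteV s (n - 1))⁻¹

theorem block_eq (ω : OrbitalSpace n W) (x y : Fin n) :
    block ω x y = (if x.val = y.val then siteV ω y else 0)
      + (if x.val = y.val + 1 then -hop ω y else 0)
      + (if y.val = x.val + 1 then -(hop ω x)ᴴ else 0) := by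
  unfold block
  by_cases h1 : x = y
  · subst h1
    simp [siteV]
  · have h1' : x.val ≠ y.val := fun h => h1 (Fin.ext h)
    simp only [h1, h1', if_false, zero_add]
    by_cases h2 : x.val = y.val + 1
    · have h3 : ¬ y.val = x.val + 1 := by omega
      have h4 : y.val < n - 1 := by omega
      rw [dif_pos h2, if_pos h2, if_neg h3, hop, dif_pos h4, add_zero]
    · by_cases h3 : y.val = x.val + 1
      · have h4 : x.val < n - 1 := by omega
        rw [dif_neg h2, dif_pos h3, if_neg h2, if_pos h3, hop, dif_pos h4, zero_add]
      · simp [h2, h3]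

theorem sum_block_mul_G (ω : OrbitalSpace n W) (z : ℝ) (hH : IsUnit (H ω - (z : ℂ) • 1).det)
    (x l : Fin n) :
    ∑ y, (block ω x y - if x.val = y.val then (z : ℂ) • 1 else 0) * G ω z y l
      = if x.val = l.val then 1 else 0 := by
  have h := Matrix.mul_nonsing_inv _ hH
  ext i k
  have h2 := congrFun (congrFun h (x, i)) (l, k)
  rw [Matrix.mul_apply, Fintype.sum_prod_type] at h2
  rw [Matrix.sum_apply]
  refine Eq.trans (Finset.sum_congr rfl fun y _ => ?_) (h2.trans ?_)
  · rw [Matrix.mul_apply]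
    refine Finset.sum_congr rfl fun j _ => ?_
    congr 1
    by_cases hxy : x = y
    · subst hxy
      simp [H, Matrix.one_apply]
    · have : x.val ≠ y.val := fun h => hxy (Fin.ext h)
      simp [H, Matrix.one_apply, hxy, this]
  · by_cases hxy : x = l
    · subst hxy
      simp [Matrix.one_apply]
    · have : x.val ≠ l.val := fun h => hxy (Fin.ext h)
      simp [Matrix.one_apply, hxy, this]

/-- A block row of (H - z) G = 1. The column is extended by zero beyond the chain so that the last
row has the general form; the guard on x is needed because x - 1 is truncated at 0. -/
theorem G_row (ω : OrbitalSpace n W) (z : ℝ) (hH : IsUnit (H ω - (z : ℂ) • 1).det)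
    (l : Fin n) {x : ℕ} (hx : x < n) {col : ℕ → Matrix (Fin W) (Fin W) ℂ}
    (hcol : ∀ y : Fin n, col y = G ω z y l) (hcol' : ∀ y, n ≤ y → col y = 0) :
    (siteV ω x - (z : ℂ) • 1) * col x - (if 0 < x then hop ω (x - 1) * col (x - 1) else 0)
      - (hop ω x)ᴴ * col (x + 1) = if x = l.val then 1 else 0 := by
  have h := sum_block_mul_G ω z hH ⟨x, hx⟩ l
  simp only [block_eq] at h
  rw [← h]
  have e : ∀ y : Fin n, ((if x = y.val then siteV ω y else 0)
      + (if x = y.val + 1 then -hop ω y else 0)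
      + (if y.val = x + 1 then -(hop ω x)ᴴ else 0)
      - (if x = y.val then (z : ℂ) • 1 else 0)) * G ω z y l
      = (fun y : ℕ => (if x = y then (siteV ω y - (z : ℂ) • 1) * col y else 0)
        + (if x = y + 1 then -(hop ω y * col y) else 0)
        + (if y = x + 1 then -((hop ω x)ᴴ * col y) else 0)) y := by
    intro y
    rw [← hcol y]
    simp only
    split_ifs <;> first | omega | simp [sub_mul]
  simp_rw [e]
  rw [Fin.sum_univ_eq_sum_range (fun y : ℕ => (if x = y then (siteV ω y - (z : ℂ) • 1) * col y else 0)
        + (if x = y + 1 then -(hop ω y * col y) else 0)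
        + (if y = x + 1 then -((hop ω x)ᴴ * col y) else 0)) n, Finset.sum_add_distrib,
    Finset.sum_add_distrib, Finset.sum_ite_eq, Finset.sum_ite_eq', if_pos (Finset.mem_range.2 hx)]
  have e2 : (if x + 1 ∈ Finset.range n then -((hop ω x)ᴴ * col (x + 1)) else 0)
      = -((hop ω x)ᴴ * col (x + 1)) := by
    split_ifs with h
    · rfl
    · rw [hcol' _ (by simpa using h)]; simp
  have e3 : (∑ y ∈ Finset.range n, if x = y + 1 then -(hop ω y * col y) else 0)
      = -(if 0 < x then hop ω (x - 1) * col (x - 1) else 0) := by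
    cases x with
    | zero => simp
    | succ x =>
      simp only [Nat.add_right_cancel_iff, Nat.succ_pos, if_true, Nat.add_sub_cancel]
      rw [Finset.sum_ite_eq, if_pos (Finset.mem_range.2 (by omega))]
  rw [e2, e3]
  abel

/-- Block elimination on the last column of the resolvent: its right-hand side lives in the last
row, so every earlier row becomes S_x g_x = T_x* g_{x+1}, and the chain unrolls. The minus signs of
the off-diagonal blocks of H cancel here. -/
theorem G_ofSchur (z : ℝ) (s : OrbitalSpace n W) (hn : 0 < n)
    (hS : ∀ j < n, IsUnit (siteV s j).det) (hH : IsUnit (H (ofSchur z s) - (z : ℂ) • 1).det) :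
    G (ofSchur z s) z ⟨0, hn⟩ ⟨n - 1, Nat.sub_lt hn Nat.one_pos⟩ = cornerGreen s := by
  set ω := ofSchur z s with hω
  set l : Fin n := ⟨n - 1, Nat.sub_lt hn Nat.one_pos⟩ with hl
  set col : ℕ → Matrix (Fin W) (Fin W) ℂ := fun j => if h : j < n then G ω z ⟨j, h⟩ l else 0 with hc
  have hcol : ∀ y : Fin n, col y = G ω z y l := fun y => by simp [hc]
  have hcol' : ∀ y, n ≤ y → col y = 0 := fun y hy => by simp [hc, hy.not_gt]
  have hrow : ∀ x < n, siteV s x * col x = (hop s x)ᴴ * col (x + 1) + if x = n - 1 then 1 else 0 := by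
    intro x
    induction x with
    | zero =>
      intro hx
      have h := G_row ω z hH l hx hcol hcol'
      rw [hω, siteV_ofSchur z s hx, schurEnergy, hop_ofSchur] at h
      simp only [lt_irrefl, if_false, sub_zero, add_zero, add_sub_cancel_right, zero_add] at h
      rw [zero_add, ← h]
      abel
    | succ x ih =>
      intro hx
      have h := G_row ω z hH l hx hcol hcol'
      have ih' := ih (by omega)
      rw [if_neg (by omega), add_zero] at ih'
      have hsol : col x = (siteV s x)⁻¹ * ((hop s x)ᴴ * col (x + 1)) := by
        rw [← ih', Matrix.nonsing_inv_mul_cancel_left _ _ (hS x (by omega))]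
      rw [hω, siteV_ofSchur z s hx, schurEnergy, hop_ofSchur, hop_ofSchur, if_pos (Nat.succ_pos x),
        Nat.add_sub_cancel, hsol] at h
      rw [← h]
      simp only [Matrix.mul_assoc, add_mul, sub_mul]
      abel
  have hchain : ∀ j ≤ n - 1, col 0 = greenChain s j * col j := by
    intro j
    induction j with
    | zero => intro _; rw [greenChain, one_mul]
    | succ j ih =>
      intro hj
      have h := hrow j (by omega)
      rw [if_neg (by omega), add_zero] at h
      rw [ih (by omega), greenChain, Matrix.mul_assoc, Matrix.mul_assoc, ← h,
        Matrix.nonsing_inv_mul_cancel_left _ _ (hS j (by omega))]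
  have hlast := hrow (n - 1) (by omega)
  rw [if_pos rfl, hcol' (n - 1 + 1) (by omega), mul_zero, zero_add] at hlast
  have h0 := hchain (n - 1) le_rfl
  have e : G ω z ⟨0, hn⟩ l = col 0 := (hcol ⟨0, hn⟩).symm
  rw [e, h0, cornerGreen]
  congr 1
  rw [← Matrix.nonsing_inv_mul_cancel_left _ (col (n - 1)) (hS (n - 1) (by omega)), hlast, mul_one]

theorem greenChain_isUnit (s : OrbitalSpace n W) (hS : ∀ j < n, IsUnit (siteV s j).det)
    (hT : ∀ j < n - 1, IsUnit (hop s j).det) {j : ℕ} (hj : j ≤ n - 1) :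
    IsUnit (greenChain s j).det := by
  induction j with
  | zero => simp [greenChain]
  | succ j ih =>
    rw [greenChain, Matrix.det_mul, Matrix.det_mul, Matrix.det_conjTranspose]
    exact (ih (by omega)).mul ((Matrix.isUnit_nonsing_inv_det _ (hS j (by omega))).mul
      (hT j (by omega)).star)

theorem cornerGreen_isUnit (s : OrbitalSpace n W) (hn : 0 < n) (hS : ∀ j < n, IsUnit (siteV s j).det)
    (hT : ∀ j < n - 1, IsUnit (hop s j).det) : IsUnit (cornerGreen s).det := by
  rw [cornerGreen, Matrix.det_mul]
  exact (greenChain_isUnit s hS hT le_rfl).mul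
    (Matrix.isUnit_nonsing_inv_det _ (hS (n - 1) (by omega)))

/-- The zeros are eigenvalues of -A. Applied on lines in an identity direction, this gives almost
sure invertibility of the blocks and of H - z. -/
theorem ae_det_add_smul_one {ι : Type*} [Fintype ι] [DecidableEq ι] (A : Matrix ι ι ℂ) :
    ∀ᵐ u : ℝ, (A + (u : ℂ) • (1 : Matrix ι ι ℂ)).det ≠ 0 := by
  have h : {u : ℝ | ¬ (A + (u : ℂ) • (1 : Matrix ι ι ℂ)).det ≠ 0}
      ⊆ (fun u : ℝ => (u : ℂ)) ⁻¹' {x | x ∈ (-A).charpoly.roots} := by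
    intro u hu
    have hu' : (A + (u : ℂ) • (1 : Matrix ι ι ℂ)).det = 0 := not_not.1 hu
    have : (-A).charpoly.eval (u : ℂ) = 0 := by
      rw [Matrix.eval_charpoly, ← hu', sub_neg_eq_add, add_comm]
      congr 2
      exact (Algebra.algebraMap_eq_smul_one (A := Matrix ι ι ℂ) (u : ℂ))
    exact (Polynomial.mem_roots (Matrix.charpoly_monic _).ne_zero).2 this
  refine (((Multiset.finite_toSet _).preimage ?_).subset h).measure_zero _
  exact Complex.ofReal_injective.injOn

theorem ae_isUnit_det_hermitianOf :
    ∀ᵐ h : Fin W → Fin W → ℝ, IsUnit (hermitianOf h).det := by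
  have hm : MeasurableSet {h : Fin W → Fin W → ℝ | IsUnit (hermitianOf h).det} := by
    simp only [isUnit_iff_ne_zero]
    exact (entrywiseMeasurable_hermitianOf.det (measurableSet_singleton 0)).compl
  refine ae_mem_of_ae_add_linearMap_mem (𝕜 := ℝ)
    (LinearMap.toSpanSingleton ℝ (Fin W → Fin W → ℝ) (coordL W 1)) volume volume hm fun x => ?_
  filter_upwards [ae_det_add_smul_one (hermitianOf x)] with u hu
  change IsUnit (hermitianOf (x + u • coordL W 1)).det
  rw [hermitianOf_add, hermitianOf_smul, hermitianOf_coordL Matrix.isHermitian_one]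
  exact isUnit_iff_ne_zero.2 hu

theorem ae_isUnit_det_of :
    ∀ᵐ t : Fin W → Fin W → ℂ, IsUnit (Matrix.of t : Matrix (Fin W) (Fin W) ℂ).det := by
  have hm : MeasurableSet {t : Fin W → Fin W → ℂ |
      IsUnit (Matrix.of t : Matrix (Fin W) (Fin W) ℂ).det} := by
    simp only [isUnit_iff_ne_zero]
    have : EntrywiseMeasurable fun t : Fin W → Fin W → ℂ => (Matrix.of t : Matrix (Fin W) (Fin W) ℂ) :=
      fun i j => (measurable_pi_apply j).comp (measurable_pi_apply i)
    exact (this.det (measurableSet_singleton 0)).compl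
  refine ae_mem_of_ae_add_linearMap_mem (𝕜 := ℝ)
    (LinearMap.toSpanSingleton ℝ (Fin W → Fin W → ℂ) (Matrix.of.symm 1)) volume volume hm fun x => ?_
  filter_upwards [ae_det_add_smul_one (Matrix.of x : Matrix (Fin W) (Fin W) ℂ)] with u hu
  exact isUnit_iff_ne_zero.2 hu

theorem entrywiseMeasurable_H : EntrywiseMeasurable fun ω : OrbitalSpace n W => H ω := by
  rintro ⟨x, i⟩ ⟨y, j⟩
  change Measurable fun ω : OrbitalSpace n W => block ω x y i j
  simp only [block_eq, Matrix.add_apply]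
  have h0 : EntrywiseMeasurable fun _ : OrbitalSpace n W => (0 : Matrix (Fin W) (Fin W) ℂ) :=
    EntrywiseMeasurable.const 0
  refine Measurable.add (Measurable.add ?_ ?_) ?_ <;> split_ifs
  · exact entrywiseMeasurable_siteV _ i j
  · exact h0 i j
  · exact (entrywiseMeasurable_hop _).neg i j
  · exact h0 i j
  · exact (entrywiseMeasurable_hop _).conjTranspose.neg i j
  · exact h0 i j

theorem H_add_smul_identity (ω : OrbitalSpace n W) (u : ℝ) :
    H (ω + u • ((fun _ => coordL W 1, 0) : OrbitalSpace n W)) = H ω + (u : ℂ) • 1 := by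
  ext ⟨x, i⟩ ⟨y, j⟩
  have hV : ∀ x, V (ω + u • ((fun _ => coordL W 1, 0) : OrbitalSpace n W)) x
      = V ω x + (u : ℂ) • 1 := by
    intro x
    change hermitianOf (ω.1 x + u • coordL W 1) = _
    rw [hermitianOf_add, hermitianOf_smul, hermitianOf_coordL Matrix.isHermitian_one]
    rfl
  have hT : ∀ x, T (ω + u • ((fun _ => coordL W 1, 0) : OrbitalSpace n W)) x = T ω x := by
    intro x
    change Matrix.of (ω.2 x + u • (0 : Fin W → Fin W → ℂ)) = _
    rw [smul_zero, add_zero]; rfl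
  change block _ x y i j = block ω x y i j + ((u : ℂ) • (1 : Matrix _ _ ℂ)) (x, i) (y, j)
  unfold block
  simp only [hV, hT]
  by_cases hxy : x = y
  · subst hxy
    simp [Matrix.one_apply]
  · simp [hxy, Matrix.one_apply]

theorem ae_isUnit_det_H (z : ℝ) :
    ∀ᵐ ω : OrbitalSpace n W, IsUnit (H ω - (z : ℂ) • 1).det := by
  have hm : MeasurableSet {ω : OrbitalSpace n W | IsUnit (H ω - (z : ℂ) • 1).det} := by
    simp only [isUnit_iff_ne_zero]
    exact ((entrywiseMeasurable_H.sub (EntrywiseMeasurable.const _)).det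
      (measurableSet_singleton 0)).compl
  refine ae_mem_of_ae_add_linearMap_mem (𝕜 := ℝ)
    (LinearMap.toSpanSingleton ℝ (OrbitalSpace n W) (fun _ => coordL W 1, 0)) volume volume hm
    fun ω => ?_
  filter_upwards [ae_det_add_smul_one (H ω - (z : ℂ) • 1)] with u hu
  change IsUnit (H (ω + u • ((fun _ => coordL W 1, 0) : OrbitalSpace n W)) - (z : ℂ) • 1).det
  rw [H_add_smul_identity, add_sub_right_comm]
  exact isUnit_iff_ne_zero.2 hu

theorem ae_isUnit_siteV : ∀ᵐ s : OrbitalSpace n W, ∀ j < n, IsUnit (siteV s j).det := by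
  have h1 : ∀ᵐ v : Fin n → Fin W → Fin W → ℝ, ∀ j, IsUnit (hermitianOf (v j)).det :=
    ae_all_iff.2 fun j => (Measure.quasiMeasurePreserving_eval
      (fun _ : Fin n => (volume : Measure (Fin W → Fin W → ℝ))) j).ae ae_isUnit_det_hermitianOf
  have h2 := (Measure.quasiMeasurePreserving_fst (μ := (volume : Measure (Fin n → Fin W → Fin W → ℝ)))
    (ν := (volume : Measure (Fin (n - 1) → Fin W → Fin W → ℂ)))).ae h1
  filter_upwards [h2] with s hs j hj
  rw [siteV, dif_pos hj]
  exact hs _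

theorem ae_isUnit_hop : ∀ᵐ s : OrbitalSpace n W, ∀ j < n - 1, IsUnit (hop s j).det := by
  have h1 : ∀ᵐ v : Fin (n - 1) → Fin W → Fin W → ℂ, ∀ j,
      IsUnit (Matrix.of (v j) : Matrix (Fin W) (Fin W) ℂ).det :=
    ae_all_iff.2 fun j => (Measure.quasiMeasurePreserving_eval
      (fun _ : Fin (n - 1) => (volume : Measure (Fin W → Fin W → ℂ))) j).ae ae_isUnit_det_of
  have h2 := (Measure.quasiMeasurePreserving_snd (μ := (volume : Measure (Fin n → Fin W → Fin W → ℝ)))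
    (ν := (volume : Measure (Fin (n - 1) → Fin W → Fin W → ℂ)))).ae h1
  filter_upwards [h2] with s hs j hj
  rw [hop, dif_pos hj]
  exact hs _

/-- `log ‖S₀⁻¹ T₀* ⋯ Sₙ₋₁⁻¹‖`, the observable in terms of the Schur complements. -/
def schurX (s : OrbitalSpace n W) : ℝ :=
  Real.log ‖Matrix.toEuclideanCLM (𝕜 := ℂ) (cornerGreen s)‖

theorem ae_X_ofSchur (z : ℝ) (hn : 0 < n) :
    ∀ᵐ s : OrbitalSpace n W, X hn z (ofSchur z s) = schurX s := by
  filter_upwards [ae_isUnit_siteV, (measurePreserving_ofSchur z).quasiMeasurePreserving.ae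
    (ae_isUnit_det_H z)] with s h1 h2
  rw [X, schurX, G_ofSchur z s hn h1 h2]

/-- Scaling the corner block shifts its logarithm only where the norm is positive, the real
logarithm being 0 at 0. -/
theorem ae_cornerGreen_norm_pos (hn : 0 < n) (hW : 0 < W) :
    ∀ᵐ s : OrbitalSpace n W, 0 < ‖Matrix.toEuclideanCLM (𝕜 := ℂ) (cornerGreen s)‖ := by
  filter_upwards [ae_isUnit_siteV, ae_isUnit_hop] with s h1 h2
  rw [norm_pos_iff, Ne, EmbeddingLike.map_eq_zero_iff]
  intro h
  have h3 := cornerGreen_isUnit s hn h1 h2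
  have : Nonempty (Fin W) := ⟨⟨0, hW⟩⟩
  rw [h, Matrix.det_zero] at h3
  exact not_isUnit_zero h3

end OrbitalSpace

/-! ### Fractional moments of weak-type functions. -/

section WeakType

variable {Ω : Type*} [MeasurableSpace Ω] {μ : Measure Ω}

/-- A function of weak type `(1, 1)` has fractional moments, which are small on small sets. -/
theorem setLIntegral_rpow_le_of_weak {f : Ω → ℝ} (hf : Measurable f) (hf0 : 0 ≤ f) {K : ℝ}
    (hK : 0 < K) (hw : ∀ t : ℝ, 0 < t → μ {x | t < f x} ≤ ENNReal.ofReal (K / t)) {p : ℝ}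
    (hp0 : 0 < p) (hp1 : p < 1) {b : ℝ} (hb : 0 < b) {B : Set Ω} (hB : μ B ≤ ENNReal.ofReal b) :
    ∫⁻ x in B, ENNReal.ofReal (f x ^ p) ∂μ
      ≤ ENNReal.ofReal (K ^ p * b ^ (1 - p) / (1 - p)) := by
  -- The level at which the two bounds on the measure of {t < f} ∩ B, namely b and K/t, cross; each
  -- is used on its own side in the layer-cake formula.
  set a := K / b with ha
  have ha0 : 0 < a := by positivity
  have hq : 0 < 1 - p := by linarith
  have hKp : K ^ p * b ^ (1 - p) = b * a ^ p := by
    rw [ha, Real.div_rpow hK.le hb.le, Real.rpow_sub hb, Real.rpow_one]; field_simp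
  have hKp' : K * a ^ (p - 1) = b * a ^ p := by
    rw [Real.rpow_sub_one ha0.ne', ha]; field_simp
  have h1 : ∫⁻ t in Set.Ioc 0 a, (μ.restrict B) {x | t < f x} * ENNReal.ofReal (t ^ (p - 1))
      ≤ ENNReal.ofReal (b * a ^ p / p) := by
    have hint : IntegrableOn (fun t : ℝ => t ^ (p - 1)) (Set.Ioc 0 a) :=
      (intervalIntegrable_iff_integrableOn_Ioc_of_le ha0.le).1
        (intervalIntegral.intervalIntegrable_rpow' (by linarith))
    calc _ ≤ ∫⁻ t in Set.Ioc 0 a, ENNReal.ofReal b * ENNReal.ofReal (t ^ (p - 1)) := by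
          refine lintegral_mono fun t => ?_
          gcongr
          refine (measure_mono (Set.subset_univ _)).trans ?_
          rwa [Measure.restrict_apply_univ]
      _ = ENNReal.ofReal b * ENNReal.ofReal (∫ t in Set.Ioc 0 a, t ^ (p - 1)) := by
          rw [lintegral_const_mul' _ _ ENNReal.ofReal_ne_top, ofReal_integral_eq_lintegral_ofReal hint]
          filter_upwards [ae_restrict_mem measurableSet_Ioc] with t ht
          exact Real.rpow_nonneg ht.1.le _
      _ = _ := by
          rw [← intervalIntegral.integral_of_le ha0.le, integral_rpow (Or.inl (by linarith)),
            ← ENNReal.ofReal_mul hb.le, sub_add_cancel, Real.zero_rpow hp0.ne', sub_zero, mul_div_assoc]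
  have h2 : ∫⁻ t in Set.Ioi a, (μ.restrict B) {x | t < f x} * ENNReal.ofReal (t ^ (p - 1))
      ≤ ENNReal.ofReal (b * a ^ p / (1 - p)) := by
    calc _ ≤ ∫⁻ t in Set.Ioi a, ENNReal.ofReal K * ENNReal.ofReal (t ^ (p - 2)) := by
          refine setLIntegral_mono' measurableSet_Ioi fun t ht => ?_
          have ht0 : 0 < t := ha0.trans ht
          rw [← ENNReal.ofReal_mul hK.le, show K * t ^ (p - 2) = K / t * t ^ (p - 1) by
            rw [show p - 2 = p - 1 - 1 by ring, Real.rpow_sub_one ht0.ne']; ring,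
            ENNReal.ofReal_mul (by positivity)]
          gcongr
          exact (Measure.restrict_apply_le _ _).trans (hw t ht0)
      _ = ENNReal.ofReal K * ENNReal.ofReal (∫ t in Set.Ioi a, t ^ (p - 2)) := by
          rw [lintegral_const_mul' _ _ ENNReal.ofReal_ne_top, ofReal_integral_eq_lintegral_ofReal
            (integrableOn_Ioi_rpow_of_lt (by linarith) ha0)]
          filter_upwards [ae_restrict_mem measurableSet_Ioi] with t ht
          exact Real.rpow_nonneg (ha0.trans ht).le _
      _ = _ := by
          rw [integral_Ioi_rpow_of_lt (by linarith) ha0, ← ENNReal.ofReal_mul hK.le,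
            show p - 2 + 1 = p - 1 by ring, ← hKp']
          congr 1
          rw [neg_div, ← div_neg, neg_sub, mul_div_assoc]
  rw [lintegral_rpow_eq_lintegral_meas_lt_mul _ (Filter.Eventually.of_forall hf0) hf.aemeasurable hp0,
    ← Set.Ioc_union_Ioi_eq_Ioi ha0.le]
  refine (mul_le_mul_right ((lintegral_union_le _ _ _).trans (add_le_add h1 h2)) _).trans ?_
  rw [← ENNReal.ofReal_add (by positivity) (by positivity), ← ENNReal.ofReal_mul hp0.le, hKp]
  refine ENNReal.ofReal_le_ofReal (le_of_eq ?_)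
  field_simp
  ring

end WeakType

/-! ### Ward identity and spectral averaging. -/

section Resolvent

variable {ι : Type*} [Fintype ι] [DecidableEq ι]

theorem isUnit_det_sub_complex {A : Matrix ι ι ℂ} (hA : A.IsHermitian) {w : ℂ} (hw : w.im ≠ 0) :
    IsUnit (A - w • 1).det := by
  rw [isUnit_iff_ne_zero]
  intro h
  obtain ⟨v, hv, hv0⟩ := Matrix.exists_mulVec_eq_zero_iff.2 h
  rw [Matrix.sub_mulVec, Matrix.smul_mulVec, Matrix.one_mulVec, sub_eq_zero] at hv0
  have h1 := dotProduct_conj hA v v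
  rw [hv0, dotProduct_smul, smul_eq_mul, ← vecSq_eq, star_mul', Complex.star_def,
    Complex.conj_ofReal] at h1
  have h2 := congrArg Complex.im h1
  simp at h2
  have h3 : vecSq v = 0 := by
    rcases mul_eq_zero.1 (show w.im * vecSq v = 0 by linarith) with h | h
    · exact absurd h hw
    · exact h
  refine hv (funext fun i => ?_)
  have := (Finset.sum_eq_zero_iff_of_nonneg (fun i _ => by positivity)).1 h3 i (Finset.mem_univ i)
  simpa using this

/-- The diagonal entries of the resolvent have imaginary part given by the Ward identity. -/
theorem resolvent_diag_im {A : Matrix ι ι ℂ} (hA : A.IsHermitian) {w : ℂ} (hw : w.im ≠ 0) (i : ι) :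
    ((A - w • 1)⁻¹ i i).im = w.im * ∑ j, ‖(A - w • 1)⁻¹ j i‖ ^ 2 := by
  set M := A - w • (1 : Matrix ι ι ℂ) with hM
  have hu := isUnit_det_sub_complex hA hw
  rw [← hM] at hu
  have hMH : M = Mᴴ - (2 * w.im * Complex.I) • (1 : Matrix ι ι ℂ) := by
    rw [hM, Matrix.conjTranspose_sub, Matrix.conjTranspose_smul, Matrix.conjTranspose_one, hA.eq,
      sub_sub, ← add_smul]
    congr 2
    apply Complex.ext <;> simp
    ring
  have h1 : M⁻¹ = M⁻¹ᴴ + (2 * w.im * Complex.I) • (M⁻¹ᴴ * M⁻¹) := by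
    have h2 : M⁻¹ᴴ * M * M⁻¹ = M⁻¹ᴴ := Matrix.mul_nonsing_inv_cancel_right _ _ hu
    have h3 : M⁻¹ᴴ * Mᴴ = 1 := by
      rw [← Matrix.conjTranspose_mul, Matrix.mul_nonsing_inv _ hu, Matrix.conjTranspose_one]
    have h4 : M⁻¹ᴴ * (Mᴴ - (2 * w.im * Complex.I) • (1 : Matrix ι ι ℂ)) * M⁻¹ = M⁻¹ᴴ := by
      rw [← hMH, h2]
    rw [mul_sub, h3, sub_mul, one_mul, Matrix.mul_smul, mul_one, Matrix.smul_mul] at h4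
    exact sub_eq_iff_eq_add.1 h4
  have h5 := congrArg Complex.im (congrFun (congrFun h1 i) i)
  have h6 : (M⁻¹ᴴ * M⁻¹) i i = ((∑ j, ‖M⁻¹ j i‖ ^ 2 : ℝ) : ℂ) := by
    rw [Matrix.mul_apply]
    push_cast
    refine Finset.sum_congr rfl fun j _ => ?_
    rw [Matrix.conjTranspose_apply, ← Complex.conj_mul', Complex.star_def]
  rw [Matrix.add_apply, Matrix.smul_apply, h6, Matrix.conjTranspose_apply] at h5
  simp only [Complex.add_im, Complex.star_def, Complex.conj_im, smul_eq_mul, Complex.mul_im,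
    Complex.ofReal_re, Complex.ofReal_im, Complex.mul_re, Complex.I_re, Complex.I_im] at h5
  simp at h5
  linarith

theorem resolvent_diag_im_pos {A : Matrix ι ι ℂ} (hA : A.IsHermitian) {w : ℂ} (hw : 0 < w.im)
    (i : ι) : 0 < ((A - w • 1)⁻¹ i i).im := by
  rw [resolvent_diag_im hA hw.ne']
  refine mul_pos hw ((Finset.sum_nonneg fun j _ => by positivity).lt_of_ne fun h => ?_)
  have h2 := (Finset.sum_eq_zero_iff_of_nonneg (fun j _ => by positivity)).1 h.symm
  have h3 := Matrix.mul_nonsing_inv _ (isUnit_det_sub_complex hA hw.ne')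
  have h4 := congrFun (congrFun h3 i) i
  rw [Matrix.mul_apply, Finset.sum_eq_zero fun j hj => ?_, Matrix.one_apply_eq] at h4
  · exact zero_ne_one h4
  · have : (A - w • 1)⁻¹ j i = 0 := by simpa using h2 j hj
    rw [this, mul_zero]

theorem resolvent_diag_line {A : Matrix ι ι ℂ} (hA : A.IsHermitian) {w : ℂ} (hw : 0 < w.im) (i : ι)
    (u : ℝ) : (A + (u : ℂ) • Matrix.single i i (1 : ℂ) - w • (1 : Matrix ι ι ℂ))⁻¹ i i
      = ((u : ℂ) + ((A - w • 1)⁻¹ i i)⁻¹)⁻¹ := by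
  set c := (A - w • 1)⁻¹ i i with hc
  have hcim : 0 < c.im := resolvent_diag_im_pos hA hw i
  have hc0 : c ≠ 0 := fun h => by rw [h] at hcim; simp at hcim
  have hE : (A + (u : ℂ) • Matrix.single i i (1 : ℂ)).IsHermitian := by
    refine hA.add ?_
    rw [Matrix.IsHermitian, Matrix.conjTranspose_smul, Matrix.conjTranspose_single]
    simp
  set N := A + (u : ℂ) • Matrix.single i i (1 : ℂ) - w • 1 with hN
  have hNu : IsUnit N.det := isUnit_det_sub_complex hE hw.ne'
  have hMu := isUnit_det_sub_complex hA hw.ne'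
  have hdec : A - w • 1 = N - (u : ℂ) • Matrix.single i i 1 := by rw [hN]; abel
  have h1 : N⁻¹ = (A - w • 1)⁻¹ - (u : ℂ) • ((A - w • 1)⁻¹ * Matrix.single i i (1 : ℂ) * N⁻¹) := by
    have h2 : (A - w • 1)⁻¹ * (A - w • 1) * N⁻¹ = N⁻¹ := by
      rw [Matrix.nonsing_inv_mul _ hMu, one_mul]
    rw [← h2]
    conv_lhs => rw [Matrix.mul_assoc, hdec, sub_mul, Matrix.mul_nonsing_inv _ hNu, mul_sub, mul_one]
    rw [Matrix.nonsing_inv_mul _ hMu, one_mul, ← hdec, Matrix.smul_mul, Matrix.mul_smul,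
      Matrix.mul_assoc]
  have h3 := congrFun (congrFun h1 i) i
  have h4 : ((A - w • 1)⁻¹ * Matrix.single i i (1 : ℂ) * N⁻¹) i i = c * N⁻¹ i i := by
    rw [Matrix.mul_apply, Finset.sum_eq_single i]
    · rw [Matrix.mul_single_apply_same, mul_one]
    · intro j _ hj
      rw [Matrix.mul_single_apply_of_ne _ _ _ _ _ hj, zero_mul]
    · simp
  rw [Matrix.sub_apply, Matrix.smul_apply, h4, ← hc, smul_eq_mul] at h3
  have h5 : N⁻¹ i i * ((u : ℂ) + c⁻¹) = 1 := by
    field_simp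
    linear_combination h3
  exact eq_inv_of_mul_eq_one_left h5

/-- By the rank one formula the entry is (u + c⁻¹)⁻¹ with Im c > 0, so its imaginary part is π times
a Cauchy density in u, whatever A is. -/
theorem lintegral_im_resolvent_line {A : Matrix ι ι ℂ} (hA : A.IsHermitian) {w : ℂ} (hw : 0 < w.im)
    (i : ι) : ∫⁻ u : ℝ, ENNReal.ofReal
      ((A + (u : ℂ) • Matrix.single i i (1 : ℂ) - w • (1 : Matrix ι ι ℂ))⁻¹ i i).im = ENNReal.ofReal Real.pi := by
  set c := (A - w • 1)⁻¹ i i with hc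
  have hcim : 0 < c.im := resolvent_diag_im_pos hA hw i
  set g : NNReal := ⟨-(c⁻¹).im, by
    rw [Complex.inv_im, neg_div, neg_neg]; exact div_nonneg hcim.le (Complex.normSq_nonneg _)⟩ with hg
  have hg0 : g ≠ 0 := by
    intro h
    have h2 : -(c⁻¹).im = 0 := congrArg NNReal.toReal h
    rw [Complex.inv_im, neg_div, neg_neg] at h2
    have : c ≠ 0 := fun h => by rw [h] at hcim; simp at hcim
    have h3 := div_pos hcim (Complex.normSq_pos.2 this)
    linarith
  have h1 : ∀ u : ℝ, ENNReal.ofReal ((A + (u : ℂ) • Matrix.single i i (1 : ℂ) - w • (1 : Matrix ι ι ℂ))⁻¹ i i).im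
      = ENNReal.ofReal Real.pi * ProbabilityTheory.cauchyPDF (-(c⁻¹).re) g u := by
    intro u
    rw [ProbabilityTheory.cauchyPDF_def, ← ENNReal.ofReal_mul Real.pi_pos.le,
      resolvent_diag_line hA hw, ← hc, ProbabilityTheory.cauchyPDFReal_def]
    congr 1
    have hgc : (g : ℝ) = -(c⁻¹).im := rfl
    rw [hgc, Complex.inv_im, Complex.normSq_apply]
    simp only [Complex.add_re, Complex.add_im, Complex.ofReal_re, Complex.ofReal_im, zero_add]
    rw [mul_assoc, mul_inv_cancel_left₀ Real.pi_pos.ne', div_eq_mul_inv]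
    congr 2; ring
  simp_rw [h1]
  rw [lintegral_const_mul _ (ProbabilityTheory.measurable_cauchyPDF _ _),
    ProbabilityTheory.lintegral_cauchyPDF_eq_one _ hg0, mul_one]

/-- A bound for the regularized resolvent at scale `η⁻¹` bounds the resolvent itself. -/
theorem vecSq_resolvent_le (A : Matrix ι ι ℂ) {z η : ℝ} (hη : 0 < η)
    (hu : IsUnit (A - ((z : ℂ) + η * Complex.I) • 1).det)
    (h : frobSq (A - ((z : ℂ) + η * Complex.I) • 1)⁻¹ ≤ 1 / (4 * η ^ 2)) (v : ι → ℂ) :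
    vecSq ((A - (z : ℂ) • 1)⁻¹ *ᵥ v) ≤ vecSq v / η ^ 2 := by
  by_cases hz : IsUnit (A - (z : ℂ) • 1).det
  swap
  · rw [Matrix.nonsing_inv_apply_not_isUnit _ hz, Matrix.zero_mulVec]
    simp only [vecSq, Pi.zero_apply, norm_zero]
    simp only [ne_eq, OfNat.ofNat_ne_zero, not_false_eq_true, zero_pow, Finset.sum_const_zero]
    positivity
  set y := (A - (z : ℂ) • 1)⁻¹ *ᵥ v with hy
  set R := (A - ((z : ℂ) + η * Complex.I) • (1 : Matrix ι ι ℂ))⁻¹ with hR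
  have h1 : (A - (z : ℂ) • 1) *ᵥ y = v := by
    rw [hy, Matrix.mulVec_mulVec, Matrix.mul_nonsing_inv _ hz, Matrix.one_mulVec]
  have h2 : (A - ((z : ℂ) + η * Complex.I) • (1 : Matrix ι ι ℂ)) *ᵥ y
      = v - ((η : ℂ) * Complex.I) • y := by
    rw [add_smul, ← sub_sub, Matrix.sub_mulVec, h1, Matrix.smul_mulVec, Matrix.one_mulVec]
  -- y solves the regularised equation with right-hand side v - iηy. Since ‖R‖² ≤ 1/(4η²), the part
  -- containing y is at most half of ‖y‖² and can be absorbed.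
  have h3 : y = R *ᵥ (v - ((η : ℂ) * Complex.I) • y) := by
    rw [← h2, Matrix.mulVec_mulVec, hR, Matrix.nonsing_inv_mul _ hu, Matrix.one_mulVec]
  have h4 : vecSq (v - ((η : ℂ) * Complex.I) • y) ≤ 2 * vecSq v + 2 * η ^ 2 * vecSq y := by
    unfold vecSq
    rw [Finset.mul_sum, Finset.mul_sum, ← Finset.sum_add_distrib]
    refine Finset.sum_le_sum fun i _ => ?_
    have h5 : ‖(v - ((η : ℂ) * Complex.I) • y) i‖ ≤ ‖v i‖ + η * ‖y i‖ := by
      refine (norm_sub_le _ _).trans ?_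
      simp [abs_of_pos hη]
    have h6 := pow_le_pow_left₀ (norm_nonneg _) h5 2
    nlinarith [sq_nonneg (‖v i‖ - η * ‖y i‖)]
  have hyn : 0 ≤ vecSq y := Finset.sum_nonneg fun i _ => by positivity
  have hvn : 0 ≤ vecSq v := Finset.sum_nonneg fun i _ => by positivity
  have h7 : vecSq y ≤ 1 / (4 * η ^ 2) * (2 * vecSq v + 2 * η ^ 2 * vecSq y) := by
    conv_lhs => rw [h3]
    refine (vecSq_mulVec_le _ _).trans ?_
    exact mul_le_mul h h4 (Finset.sum_nonneg fun i _ => by positivity) (by positivity)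
  rw [le_div_iff₀ (by positivity)]
  have h8 : 1 / (4 * η ^ 2) * (2 * vecSq v + 2 * η ^ 2 * vecSq y)
      = vecSq v / (2 * η ^ 2) + vecSq y / 2 := by field_simp; ring
  rw [h8] at h7
  have h9 : vecSq y ≤ vecSq v / η ^ 2 := by
    have : vecSq v / (2 * η ^ 2) = vecSq v / η ^ 2 / 2 := by field_simp
    linarith
  rwa [le_div_iff₀ (by positivity)] at h9

end Resolvent

/-! ### Weak-type bound for the Green function. -/

namespace OrbitalSpace

variable {n W : ℕ}

theorem H_isHermitian (ω : OrbitalSpace n W) : (H ω).IsHermitian := by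
  ext ⟨x, i⟩ ⟨y, j⟩
  rw [Matrix.conjTranspose_apply]
  change star (block ω y x j i) = block ω x y i j
  rw [block_eq, block_eq]
  have hV := (siteV_isHermitian ω x.val).apply i j
  simp only [Matrix.add_apply, star_add]
  by_cases hxy : x.val = y.val
  · have h1 : ¬ x.val = y.val + 1 := by omega
    have h2 : ¬ y.val = x.val + 1 := by omega
    simp only [hxy] at hV ⊢
    simp [hV]
  · by_cases h1 : x.val = y.val + 1
    · have h2 : ¬ y.val = x.val + 1 := by omega
      simp only [if_neg hxy, if_neg (Ne.symm hxy), if_pos h1, if_neg h2]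
      simp
    · by_cases h2 : y.val = x.val + 1
      · simp only [if_neg hxy, if_neg (Ne.symm hxy), if_neg h1, if_pos h2]
        simp
      · simp [h1, hxy, h2, Ne.symm hxy]

/-- The coordinate direction of a diagonal entry of the Hamiltonian. -/
def diagDir (a : Fin n × Fin W) : OrbitalSpace n W :=
  (Pi.single a.1 (coordL W (Matrix.single a.2 a.2 1)), 0)

theorem isHermitian_single (i : Fin W) : (Matrix.single i i (1 : ℂ)).IsHermitian := by
  rw [Matrix.IsHermitian, Matrix.conjTranspose_single, star_one]

theorem H_add_smul_diagDir (ω : OrbitalSpace n W) (a : Fin n × Fin W) (u : ℝ) :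
    H (ω + u • diagDir a) = H ω + (u : ℂ) • Matrix.single a a 1 := by
  obtain ⟨l, k⟩ := a
  ext ⟨x, i⟩ ⟨y, j⟩
  have hV : ∀ x, V (ω + u • diagDir (l, k)) x
      = V ω x + (u : ℂ) • if x = l then Matrix.single k k 1 else 0 := by
    intro x
    change hermitianOf (ω.1 x + u • (Pi.single l (coordL W (Matrix.single k k 1)) :
      Fin n → Fin W → Fin W → ℝ) x) = _
    rw [hermitianOf_add, hermitianOf_smul]
    by_cases hx : x = l
    · subst hx
      rw [Pi.single_eq_same, hermitianOf_coordL (isHermitian_single k), if_pos rfl]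
      rfl
    · rw [Pi.single_eq_of_ne hx, if_neg hx]
      have : hermitianOf (0 : Fin W → Fin W → ℝ) = 0 := (hermitianL W).map_zero
      rw [this, smul_zero, smul_zero]; rfl
  have hT : ∀ x, T (ω + u • diagDir (l, k)) x = T ω x := by
    intro x
    change Matrix.of (ω.2 x + u • (0 : Fin W → Fin W → ℂ)) = _
    rw [smul_zero, add_zero]; rfl
  change block _ x y i j = block ω x y i j
    + ((u : ℂ) • (Matrix.single (l, k) (l, k) 1 : Matrix (Fin n × Fin W) (Fin n × Fin W) ℂ)) (x, i) (y, j)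
  unfold block
  simp only [hV, hT]
  by_cases hxy : x = y
  · subst hxy
    by_cases hx : x = l
    · subst hx; simp [Matrix.single_apply]
    · simp [Matrix.single_apply, hx, Ne.symm hx]
  · have : ¬ (l = x ∧ l = y) := fun h => hxy (h.1.symm.trans h.2)
    simp [hxy, Matrix.single_apply]
    tauto

theorem formO_diagDir (a : Fin n × Fin W) : formO n W (diagDir a) (diagDir a) = W := by
  rw [formO_apply]
  have h1 : ∀ j, formT W ((diagDir a).2 j) ((diagDir a).2 j) = 0 := by
    intro j
    have : (diagDir a).2 j = 0 := rfl
    rw [this, map_zero]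
  simp only [h1, Finset.sum_const_zero, add_zero]
  rw [Finset.sum_eq_single a.1]
  · simp only [diagDir, Pi.single_eq_same]
    rw [formV_self, hermitianOf_coordL (isHermitian_single a.2)]
    have : frobSq (Matrix.single a.2 a.2 (1 : ℂ)) = 1 := by
      unfold frobSq
      rw [Finset.sum_eq_single a.2, Finset.sum_eq_single a.2]
      · simp
      · intro j _ hj; simp [Matrix.single_apply, Ne.symm hj]
      · simp
      · intro j _ hj; simp [Matrix.single_apply, Ne.symm hj]
      · simp
    rw [this, mul_one]
  · intro j _ hj
    simp only [diagDir]
    rw [Pi.single_eq_of_ne hj, map_zero]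
  · simp

/-- By the Ward identity ‖R‖_HS² is η⁻¹ times the sum of the nW imaginary parts Im R_aa. Averaging
over the a-th diagonal entry of H bounds each mean by 8π√W. -/
theorem lintegral_frobSq_resolvent (hW : 0 < W) (z : ℝ) {η : ℝ} (hη : 0 < η) :
    ∫⁻ ω : OrbitalSpace n W, ENNReal.ofReal
        (frobSq (H ω - ((z : ℂ) + η * Complex.I) • 1)⁻¹) ∂(orbitalLaw n W)
      ≤ ENNReal.ofReal (8 * Real.pi * n * W * Real.sqrt W / η) := by
  set w : ℂ := (z : ℂ) + η * Complex.I with hw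
  have hwim : w.im = η := by simp [hw]
  have hmeas : EntrywiseMeasurable fun ω : OrbitalSpace n W => (H ω - w • 1)⁻¹ :=
    (entrywiseMeasurable_H.sub (EntrywiseMeasurable.const _)).inv
  have hM : ∀ a, Measurable fun ω : OrbitalSpace n W => ENNReal.ofReal ((H ω - w • 1)⁻¹ a a).im :=
    fun a => ENNReal.measurable_ofReal.comp (Complex.measurable_im.comp (hmeas a a))
  have h1 : ∀ a, ∫⁻ ω : OrbitalSpace n W, ENNReal.ofReal ((H ω - w • 1)⁻¹ a a).im ∂(orbitalLaw n W)
      ≤ ENNReal.ofReal (8 * Real.sqrt W) * ENNReal.ofReal Real.pi := by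
    intro a
    have hne : diagDir a ≠ 0 := by
      intro h
      have h2 := formO_diagDir a
      rw [h, map_zero] at h2
      have : (0 : ℝ) < W := by exact_mod_cast hW
      linarith
    have h3 := (isGaussForm_formO hW).lintegral_le_of_lines (μ := volume) hne (hM a)
      (C := ENNReal.ofReal Real.pi) fun ω => by
        simp_rw [H_add_smul_diagDir]
        exact (lintegral_im_resolvent_line (H_isHermitian ω) (by rw [hwim]; exact hη) a).le
    rwa [formO_diagDir, ← orbitalLaw_eq_gaussLaw] at h3
  have h2 : ∀ ω : OrbitalSpace n W, ENNReal.ofReal (frobSq (H ω - w • 1)⁻¹)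
      = ENNReal.ofReal (1 / η) * ∑ a, ENNReal.ofReal ((H ω - w • 1)⁻¹ a a).im := by
    intro ω
    have hd := resolvent_diag_im (H_isHermitian ω) (w := w) (by rw [hwim]; exact hη.ne')
    rw [hwim] at hd
    rw [← ENNReal.ofReal_sum_of_nonneg, ← ENNReal.ofReal_mul (by positivity)]
    · congr 1
      simp_rw [hd]
      rw [← Finset.mul_sum, frobSq, Finset.sum_comm]
      field_simp
    · intro a _
      rw [hd]
      exact mul_nonneg hη.le (Finset.sum_nonneg fun _ _ => by positivity)
  simp_rw [h2]
  rw [lintegral_const_mul _ (Finset.measurable_fun_sum _ fun a _ => hM a),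
    lintegral_finsetSum _ fun a _ => hM a]
  calc _ ≤ ENNReal.ofReal (1 / η) * ∑ a : Fin n × Fin W,
        ENNReal.ofReal (8 * Real.sqrt W) * ENNReal.ofReal Real.pi := by gcongr; exact h1 _
    _ = _ := by
      rw [Finset.sum_const, nsmul_eq_mul, Finset.card_univ, Fintype.card_prod, Fintype.card_fin,
        Fintype.card_fin, ← ENNReal.ofReal_mul (by positivity), ← ENNReal.ofReal_natCast,
        ← ENNReal.ofReal_mul (by positivity), ← ENNReal.ofReal_mul (by positivity)]
      congr 1
      push_cast
      field_simp

theorem norm_G_le (ω : OrbitalSpace n W) (z : ℝ) {η : ℝ} (hη : 0 < η)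
    (h : frobSq (H ω - ((z : ℂ) + η * Complex.I) • 1)⁻¹ ≤ 1 / (4 * η ^ 2)) (x l : Fin n) :
    ‖Matrix.toEuclideanCLM (𝕜 := ℂ) (G ω z x l)‖ ≤ 1 / η := by
  refine ContinuousLinearMap.opNorm_le_bound _ (by positivity) fun v => ?_
  set v' : Fin n × Fin W → ℂ := fun a => if a.1 = l then v a.2 else 0 with hv'
  have hu : IsUnit (H ω - ((z : ℂ) + η * Complex.I) • 1).det :=
    isUnit_det_sub_complex (H_isHermitian ω) (by simp [hη.ne'])
  have h1 := vecSq_resolvent_le (H ω) hη hu h v'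
  have h2 : vecSq v' = ‖v‖ ^ 2 := by
    rw [EuclideanSpace.norm_sq_eq, vecSq, Fintype.sum_prod_type, Finset.sum_eq_single l]
    · simp [hv']
    · intro y _ hy; simp [hv', hy]
    · simp
  have h3 : ‖Matrix.toEuclideanCLM (𝕜 := ℂ) (G ω z x l) v‖ ^ 2
      ≤ vecSq ((H ω - (z : ℂ) • 1)⁻¹ *ᵥ v') := by
    rw [EuclideanSpace.norm_sq_eq, vecSq, Fintype.sum_prod_type]
    refine le_trans (le_of_eq ?_) (Finset.single_le_sum
      (f := fun y => ∑ i, ‖((H ω - (z : ℂ) • 1)⁻¹ *ᵥ v') (y, i)‖ ^ 2)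
      (fun y _ => Finset.sum_nonneg fun i _ => by positivity) (Finset.mem_univ x))
    refine Finset.sum_congr rfl fun i _ => ?_
    congr 2
    rw [Matrix.ofLp_toEuclideanCLM]
    simp only [Matrix.mulVec, dotProduct, Fintype.sum_prod_type]
    rw [Finset.sum_eq_single l]
    · simp [hv', G]
    · intro y _ hy; simp [hv', hy]
    · simp
  rw [h2] at h1
  refine le_of_sq_le_sq ?_ (by positivity)
  rw [mul_pow, div_pow, one_pow]
  refine h3.trans (h1.trans (le_of_eq (by ring)))

/-- The corner block of the resolvent is of weak type `(1, 1)`. -/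
theorem orbitalLaw_norm_G_gt (hn : 0 < n) (hW : 0 < W) (z : ℝ) (x l : Fin n) {t : ℝ} (ht : 0 < t) :
    orbitalLaw n W {ω | t < ‖Matrix.toEuclideanCLM (𝕜 := ℂ) (G ω z x l)‖}
      ≤ ENNReal.ofReal (32 * Real.pi * n * W * Real.sqrt W / t) := by
  -- At this scale a block of norm above t forces ‖R‖_HS² > 1/(4η²), and Markov's inequality
  -- applies.
  set η := 1 / t with hη
  have hη0 : 0 < η := by positivity
  have htη : 1 / η = t := by rw [hη, one_div_one_div]
  have h1 := lintegral_frobSq_resolvent (n := n) hW z hη0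
  have h2 := mul_meas_ge_le_lintegral₀ (μ := orbitalLaw n W)
    (f := fun ω : OrbitalSpace n W =>
      ENNReal.ofReal (frobSq (H ω - ((z : ℂ) + η * Complex.I) • 1)⁻¹))
    (ENNReal.measurable_ofReal.comp ((entrywiseMeasurable_H.sub
      (EntrywiseMeasurable.const _)).inv.frobSq)).aemeasurable
    (ENNReal.ofReal (1 / (4 * η ^ 2)))
  have h3 : ENNReal.ofReal (1 / (4 * η ^ 2))
      * orbitalLaw n W {ω | t < ‖Matrix.toEuclideanCLM (𝕜 := ℂ) (G ω z x l)‖}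
      ≤ ENNReal.ofReal (1 / (4 * η ^ 2)) * ENNReal.ofReal (32 * Real.pi * n * W * Real.sqrt W / t) := by
    refine (mul_le_mul_right (measure_mono fun ω hω => ?_) _).trans (h2.trans (h1.trans (le_of_eq ?_)))
    · refine ENNReal.ofReal_le_ofReal ?_
      by_contra hlt
      have h4 := norm_G_le ω z hη0 (not_le.1 hlt).le x l
      rw [htη] at h4
      exact absurd hω (not_lt.2 h4)
    · rw [← ENNReal.ofReal_mul (by positivity)]
      congr 1
      rw [hη]; field_simp; norm_num
  exact (ENNReal.mul_le_mul_iff_right (by simpa using by positivity) ENNReal.ofReal_ne_top).1 h3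

end OrbitalSpace

/-! ### Radial flows with a decaying cutoff. -/

section RadialFlow

/-- The radial cutoff on the ray with parameter `a`, in logarithmic coordinates. -/
def radialCut (a u : ℝ) : ℝ := (1 + a * Real.exp (2 * u))⁻¹

theorem radialCut_pos {a : ℝ} (ha : 0 ≤ a) (u : ℝ) : 0 < radialCut a u := by
  unfold radialCut; positivity

theorem radialCut_le_one {a : ℝ} (ha : 0 ≤ a) (u : ℝ) : radialCut a u ≤ 1 := by
  unfold radialCut
  refine inv_le_one_of_one_le₀ ?_
  have : 0 ≤ a * Real.exp (2 * u) := by positivity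
  linarith

theorem hasDerivAt_radialCut {a : ℝ} (ha : 0 ≤ a) (u : ℝ) :
    HasDerivAt (radialCut a) (-(2 * radialCut a u * (1 - radialCut a u))) u := by
  have h1 : HasDerivAt (fun u => 1 + a * Real.exp (2 * u)) (a * (Real.exp (2 * u) * (2 * 1))) u :=
    ((((hasDerivAt_id u).const_mul 2).exp).const_mul a).const_add 1
  have hpos : 0 < 1 + a * Real.exp (2 * u) := by positivity
  refine (h1.inv hpos.ne').congr_deriv ?_
  unfold radialCut
  field_simp
  ring

/-- The cutoff satisfies χ' = -2χ(1 - χ), so u ↦ u + tχ(u) has derivative at least 1/2 and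
displacement at most 1: an increasing bijection of the line. -/
theorem lintegral_radial_substitution {a t : ℝ} (ha : 0 ≤ a) (ht : |t| ≤ 1) (f : ℝ → ℝ≥0∞) :
    ∫⁻ u, f (u + t * radialCut a u)
        * ENNReal.ofReal (1 - 2 * t * (radialCut a u * (1 - radialCut a u)))
      = ∫⁻ u, f u := by
  set g : ℝ → ℝ := fun u => u + t * radialCut a u with hg
  set g' : ℝ → ℝ := fun u => 1 - 2 * t * (radialCut a u * (1 - radialCut a u)) with hg'
  have hd : ∀ u, HasDerivAt g (g' u) u := by
    intro u
    refine ((hasDerivAt_id u).add ((hasDerivAt_radialCut ha u).const_mul t)).congr_deriv ?_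
    simp only [hg']; ring
  have hpos : ∀ u, 0 < g' u := by
    intro u
    have h1 := radialCut_pos ha u
    have h2 := radialCut_le_one ha u
    have h3 : radialCut a u * (1 - radialCut a u) ≤ 1 / 4 := by
      nlinarith [sq_nonneg (radialCut a u - 1 / 2)]
    have h4 : 0 ≤ radialCut a u * (1 - radialCut a u) := mul_nonneg h1.le (by linarith)
    have := abs_le.1 ht
    simp only [hg']
    nlinarith
  have hmono : StrictMono g := strictMono_of_deriv_pos fun u => by rw [(hd u).deriv]; exact hpos u
  have hcont : Continuous g := continuous_iff_continuousAt.2 fun u => (hd u).continuousAt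
  have hbd : ∀ u, |g u - u| ≤ 1 := by
    intro u
    simp only [hg, add_sub_cancel_left, abs_mul, abs_of_pos (radialCut_pos ha u)]
    have h1 := radialCut_le_one ha u
    have h2 := (radialCut_pos ha u).le
    calc |t| * radialCut a u ≤ 1 * 1 := by gcongr
      _ = 1 := one_mul 1
  have hsurj : Function.Surjective g := by
    intro y
    have h1 : g (y - 1) ≤ y := by have := (abs_le.1 (hbd (y - 1))).2; linarith
    have h2 : y ≤ g (y + 1) := by have := (abs_le.1 (hbd (y + 1))).1; linarith
    exact intermediate_value_univ (y - 1) (y + 1) hcont ⟨h1, h2⟩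
  have h := lintegral_image_eq_lintegral_abs_deriv_mul MeasurableSet.univ
    (fun u _ => (hd u).hasDerivWithinAt) hmono.injective.injOn f
  rw [Set.image_univ, hsurj.range_eq, Measure.restrict_univ] at h
  rw [h]
  refine lintegral_congr fun u => ?_
  rw [abs_of_pos (hpos u), mul_comm]

variable {E : Type*} [NormedAddCommGroup E] [NormedSpace ℝ E] [FiniteDimensional ℝ E]
  [MeasurableSpace E] [BorelSpace E] (μ : Measure E) [μ.IsAddHaarMeasure]

theorem lintegral_exp_smul (u : ℝ) {G : E → ℝ≥0∞} (hG : Measurable G) :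
    ∫⁻ x, G (Real.exp u • x) * ENNReal.ofReal (Real.exp (Module.finrank ℝ E * u)) ∂μ = ∫⁻ x, G x ∂μ := by
  have hu := Real.exp_pos u
  have hGm : Measurable fun x => G (Real.exp u • x) := hG.comp (measurable_const_smul _)
  rw [lintegral_mul_const _ hGm,
    ← lintegral_map hG (measurable_const_smul (Real.exp u)),
    Measure.map_addHaar_smul μ hu.ne', lintegral_smul_measure, smul_eq_mul,
    abs_of_pos (by positivity), mul_right_comm, ← ENNReal.ofReal_mul (by positivity), Real.exp_nat_mul,
    inv_mul_cancel₀ (by positivity), ENNReal.ofReal_one, one_mul]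

/-- Integration along rays. -/
theorem lintegral_rays [Nontrivial E] {G : E → ℝ≥0∞} (hG : Measurable G) :
    ∫⁻ x, G x ∂μ = ∫⁻ x, (Set.indicator {x : E | 1 ≤ ‖x‖ ∧ ‖x‖ < Real.exp 1} 1 x
      * ∫⁻ u : ℝ, G (Real.exp u • x) * ENNReal.ofReal (Real.exp (Module.finrank ℝ E * u))) ∂μ := by
  -- Every ray meets this shell in logarithmic length exactly one, so inserting the shell and
  -- integrating over dilations yields polar coordinates without a measure on the sphere.
  set κ : E → ℝ≥0∞ := Set.indicator {x : E | 1 ≤ ‖x‖ ∧ ‖x‖ < Real.exp 1} 1 with hκ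
  have hκm : Measurable κ := by
    refine measurable_one.indicator ?_
    exact (measurableSet_le measurable_const measurable_norm).inter
      (measurableSet_lt measurable_norm measurable_const)
  have hone : ∀ x : E, x ≠ 0 → ∫⁻ u : ℝ, κ (Real.exp (-u) • x) = 1 := by
    intro x hx
    have hx' : 0 < ‖x‖ := norm_pos_iff.2 hx
    have e : ∀ u : ℝ, κ (Real.exp (-u) • x)
        = Set.indicator (Set.Ioc (Real.log ‖x‖ - 1) (Real.log ‖x‖)) 1 u := by
      intro u
      have h1 : ‖Real.exp (-u) • x‖ = Real.exp (Real.log ‖x‖ - u) := by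
        rw [norm_smul, Real.norm_of_nonneg (Real.exp_pos _).le, sub_eq_neg_add, Real.exp_add,
          Real.exp_log hx']
      have h2 : Real.exp (-u) • x ∈ {x : E | 1 ≤ ‖x‖ ∧ ‖x‖ < Real.exp 1}
          ↔ u ∈ Set.Ioc (Real.log ‖x‖ - 1) (Real.log ‖x‖) := by
        change 1 ≤ ‖Real.exp (-u) • x‖ ∧ ‖Real.exp (-u) • x‖ < Real.exp 1 ↔ _
        rw [h1, Real.exp_lt_exp, Real.one_le_exp_iff, Set.mem_Ioc]
        constructor <;> rintro ⟨_, _⟩ <;> constructor <;> linarith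
      simp only [hκ, Set.indicator_apply, h2]
      rfl
    simp_rw [e]
    rw [lintegral_indicator_one measurableSet_Ioc, Real.volume_Ioc]
    simp
  have hm1 : Measurable fun p : E × ℝ => κ p.1
      * (G (Real.exp p.2 • p.1) * ENNReal.ofReal (Real.exp (Module.finrank ℝ E * p.2))) := by
    fun_prop
  have hm2 : Measurable fun p : E × ℝ => κ (Real.exp (-p.2) • p.1) * G p.1 := by fun_prop
  symm
  calc _ = ∫⁻ x, (∫⁻ u : ℝ, κ x
        * (G (Real.exp u • x) * ENNReal.ofReal (Real.exp (Module.finrank ℝ E * u)))) ∂μ := by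
        refine lintegral_congr fun x => ?_
        rw [lintegral_const_mul]
        fun_prop
    _ = ∫⁻ u : ℝ, ∫⁻ x, κ x
        * (G (Real.exp u • x) * ENNReal.ofReal (Real.exp (Module.finrank ℝ E * u))) ∂μ :=
        lintegral_lintegral_swap hm1.aemeasurable
    _ = ∫⁻ u : ℝ, ∫⁻ x, κ (Real.exp (-u) • x) * G x ∂μ := by
        refine lintegral_congr fun u => ?_
        rw [← lintegral_exp_smul μ u (G := fun x => κ (Real.exp (-u) • x) * G x) (by fun_prop)]
        refine lintegral_congr fun x => ?_
        rw [smul_smul, ← Real.exp_add, neg_add_cancel, Real.exp_zero, one_smul, mul_assoc]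
    _ = ∫⁻ x, (∫⁻ u : ℝ, κ (Real.exp (-u) • x) * G x) ∂μ :=
        (lintegral_lintegral_swap hm2.aemeasurable).symm
    _ = _ := by
        refine lintegral_congr_ae ?_
        have h0 : ∀ᵐ x ∂μ, x ≠ 0 := by
          rw [ae_iff]; simp
        filter_upwards [h0] with x hx
        rw [lintegral_mul_const, hone x hx, one_mul]
        fun_prop

/-- The radial flow with a cutoff that decays along rays. -/
def radialFlow (a : E → ℝ) (t : ℝ) (x : E) : E := Real.exp (t * (1 + a x)⁻¹) • x

/-- The Jacobian of the radial flow. -/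
def radialJac (a : E → ℝ) (t : ℝ) (x : E) : ℝ :=
  Real.exp (Module.finrank ℝ E * (t * (1 + a x)⁻¹))
    * (1 - 2 * t * ((1 + a x)⁻¹ * (1 - (1 + a x)⁻¹)))

/-- Homogeneity of degree two turns the flow on a ray, in the coordinate log ‖x‖, into the preceding
substitution. The exponential factor of the Jacobian comes from the radial volume e^{dim · u}. -/
theorem lintegral_radialFlow [Nontrivial E] {a : E → ℝ} (ham : Measurable a) (ha : ∀ x, 0 ≤ a x)
    (hhom : ∀ (c : ℝ) x, 0 < c → a (c • x) = c ^ 2 * a x) {t : ℝ} (ht : |t| ≤ 1)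
    {F : E → ℝ≥0∞} (hF : Measurable F) :
    ∫⁻ x, F (radialFlow a t x) * ENNReal.ofReal (radialJac a t x) ∂μ = ∫⁻ x, F x ∂μ := by
  have hm : Measurable fun x => F (radialFlow a t x) * ENNReal.ofReal (radialJac a t x) := by
    unfold radialFlow radialJac
    fun_prop
  rw [lintegral_rays μ hm, lintegral_rays μ hF]
  refine lintegral_congr fun x => ?_
  congr 1
  rw [← lintegral_radial_substitution (ha x) ht
    (fun u => F (Real.exp u • x) * ENNReal.ofReal (Real.exp (Module.finrank ℝ E * u)))]
  refine lintegral_congr fun u => ?_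
  have h1 : (1 + a (Real.exp u • x))⁻¹ = radialCut (a x) u := by
    rw [hhom _ _ (Real.exp_pos u), radialCut, ← Real.exp_nat_mul]
    push_cast
    rw [mul_comm (a x)]
  unfold radialFlow radialJac
  rw [h1, smul_smul, ← Real.exp_add, ENNReal.ofReal_mul (Real.exp_pos _).le, add_comm u, mul_add,
    Real.exp_add (Module.finrank ℝ E * (t * radialCut (a x) u)), ENNReal.ofReal_mul (Real.exp_pos _).le]
  ring

end RadialFlow

/-! ### Coordinatewise changes of variables. -/

section ProductFlow

variable {ι : Type*} [Fintype ι] [DecidableEq ι] {E : Type*} [MeasurableSpace E]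

/-- Coordinatewise changes of variables in a product. -/
theorem lintegral_pi_flow (μ : Measure E) [SigmaFinite μ] {θ : ι → E → E} (hθ : ∀ j, Measurable (θ j))
    {J : ι → E → ℝ≥0∞} (hJ : ∀ j, Measurable (J j))
    (h : ∀ j, ∀ F : E → ℝ≥0∞, Measurable F → ∫⁻ x, F (θ j x) * J j x ∂μ = ∫⁻ x, F x ∂μ)
    {F : (ι → E) → ℝ≥0∞} (hF : Measurable F) :
    ∫⁻ x, F (fun j => θ j (x j)) * ∏ j, J j (x j) ∂(Measure.pi fun _ => μ)
      = ∫⁻ x, F x ∂(Measure.pi fun _ => μ) := by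
  have key : ∀ s : Finset ι,
      ∫⁻ x, F (fun j => if j ∈ s then θ j (x j) else x j) * ∏ j ∈ s, J j (x j) ∂(Measure.pi fun _ => μ)
        = ∫⁻ x, F x ∂(Measure.pi fun _ => μ) := by
    intro s
    induction s using Finset.induction_on with
    | empty => simp
    | insert i s hi ih =>
      rw [← ih]
      have hmm : ∀ s : Finset ι, Measurable fun x : ι → E =>
          F (fun j => if j ∈ s then θ j (x j) else x j) * ∏ j ∈ s, J j (x j) := by
        intro s
        refine (hF.comp (measurable_pi_iff.2 fun j => ?_)).mul
          (Finset.measurable_fun_prod _ fun j _ => (hJ j).comp (measurable_pi_apply j))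
        split_ifs
        · exact (hθ j).comp (measurable_pi_apply j)
        · exact measurable_pi_apply j
      have h1 := lmarginal_eq_of_subset (μ := fun _ : ι => μ) (s := {i}) (Finset.subset_univ _)
        (hmm (insert i s)) (hmm s) (by
          rw [lmarginal_singleton, lmarginal_singleton]
          ext x
          have hm : Measurable fun y => F (fun j => if j ∈ s then θ j (x j) else Function.update x i y j) := by
            refine hF.comp (measurable_pi_iff.2 fun j => ?_)
            split_ifs
            · exact measurable_const
            · exact (measurable_pi_apply j).comp (measurable_update x)
          have h2 := h i _ hm
          have hne : ∀ j ∈ s, j ≠ i := fun j hj h => hi (h ▸ hj)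
          have hp : ∀ y, ∏ j ∈ s, J j (Function.update x i y j) = ∏ j ∈ s, J j (x j) := fun y =>
            Finset.prod_congr rfl fun j hj => by rw [Function.update_of_ne (hne j hj)]
          have e1 : ∀ y, (fun j => if j ∈ s then θ j (Function.update x i y j)
              else Function.update x i y j)
              = fun j => if j ∈ s then θ j (x j) else Function.update x i y j := by
            intro y
            ext j
            by_cases hj : j ∈ s
            · rw [if_pos hj, if_pos hj, Function.update_of_ne (hne j hj)]
            · rw [if_neg hj, if_neg hj]
          have e2 : ∀ y, (fun j => if j ∈ insert i s then θ j (Function.update x i y j)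
              else Function.update x i y j)
              = fun j => if j ∈ s then θ j (x j) else Function.update x i (θ i y) j := by
            intro y
            ext j
            by_cases hj : j = i
            · rw [hj, if_pos (Finset.mem_insert_self i s), if_neg hi, Function.update_self,
                Function.update_self]
            · by_cases hjs : j ∈ s
              · rw [if_pos (Finset.mem_insert_of_mem hjs), if_pos hjs, Function.update_of_ne hj]
              · rw [if_neg (by simp [hj, hjs]), if_neg hjs, Function.update_of_ne hj,
                  Function.update_of_ne hj]
          simp_rw [e1, e2, Finset.prod_insert hi, hp, Function.update_self, ← mul_assoc]
          rw [lintegral_mul_const _ (by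
              refine Measurable.mul ?_ (hJ i)
              exact hm.comp (hθ i)), lintegral_mul_const _ hm, h2])
      rw [lmarginal_univ, lmarginal_univ] at h1
      rcases isEmpty_or_nonempty (ι → E) with he | ⟨⟨x⟩⟩
      · simp [lintegral_of_isEmpty]
      · exact congrFun h1 x
  have := key Finset.univ
  simpa using this

end ProductFlow

/-! ### Hilbert–Schmidt norms of products. -/

section Frobenius

variable {W : ℕ}

theorem frobSq_conjTranspose {ι κ : Type*} [Fintype ι] [Fintype κ] (A : Matrix ι κ ℂ) :
    frobSq Aᴴ = frobSq A := by
  unfold frobSq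
  rw [Finset.sum_comm]
  simp

theorem frobSq_mul_le (A B : Matrix (Fin W) (Fin W) ℂ) :
    frobSq (A * B) ≤ ‖Matrix.toEuclideanCLM (𝕜 := ℂ) A‖ ^ 2 * frobSq B := by
  unfold frobSq
  rw [Finset.sum_comm, Finset.sum_comm (f := fun i j => ‖B i j‖ ^ 2), Finset.mul_sum]
  refine Finset.sum_le_sum fun j _ => ?_
  have h := (Matrix.toEuclideanCLM (𝕜 := ℂ) A).le_opNorm (WithLp.toLp 2 fun i => B i j)
  have h2 := pow_le_pow_left₀ (norm_nonneg _) h 2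
  rw [mul_pow, EuclideanSpace.norm_sq_eq, EuclideanSpace.norm_sq_eq] at h2
  refine le_trans (le_of_eq ?_) h2
  refine Finset.sum_congr rfl fun i _ => ?_
  rw [Matrix.ofLp_toEuclideanCLM]
  rfl

theorem frobSq_conj_le (A B : Matrix (Fin W) (Fin W) ℂ) :
    frobSq (A * B * Aᴴ) ≤ ‖Matrix.toEuclideanCLM (𝕜 := ℂ) A‖ ^ 4 * frobSq B := by
  rw [Matrix.mul_assoc]
  refine (frobSq_mul_le A _).trans ?_
  have h : frobSq (B * Aᴴ) ≤ ‖Matrix.toEuclideanCLM (𝕜 := ℂ) A‖ ^ 2 * frobSq B := by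
    rw [← frobSq_conjTranspose, Matrix.conjTranspose_mul, Matrix.conjTranspose_conjTranspose,
      ← frobSq_conjTranspose B]
    exact frobSq_mul_le A _
  calc _ ≤ ‖Matrix.toEuclideanCLM (𝕜 := ℂ) A‖ ^ 2
        * (‖Matrix.toEuclideanCLM (𝕜 := ℂ) A‖ ^ 2 * frobSq B) := by gcongr
    _ = _ := by ring

end Frobenius

/-! ### Conditioning on all coordinates but one. -/

section Conditioning

variable {ι E : Type*} [Fintype ι] [DecidableEq ι] [MeasurableSpace E]

/-- An event of conditional probability at most `c` given the other coordinates, integrated against a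
function of the other coordinates. -/
theorem lintegral_pi_indicator_le (μ : Measure E) [IsProbabilityMeasure μ] (i : ι)
    {G : (ι → E) → ℝ≥0∞} (hG : Measurable G) (hGi : ∀ x y, G (Function.update x i y) = G x)
    {D : Set (ι → E)} (hD : MeasurableSet D) {c : ℝ≥0∞}
    (hc : ∀ x, μ {y | Function.update x i y ∈ D} ≤ c) :
    ∫⁻ x, G x * D.indicator 1 x ∂(Measure.pi fun _ => μ) ≤ c * ∫⁻ x, G x ∂(Measure.pi fun _ => μ) := by
  have hm : Measurable fun x => G x * D.indicator 1 x := hG.mul (measurable_one.indicator hD)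
  have h := lmarginal_le_of_subset (μ := fun _ : ι => μ) (s := {i}) (Finset.subset_univ _)
    hm (hG.const_mul c) (by
      rw [lmarginal_singleton, lmarginal_singleton]
      intro x
      simp only [hGi]
      have hDx : MeasurableSet {y | Function.update x i y ∈ D} := (measurable_update x) hD
      have e : ∀ y, D.indicator (1 : (ι → E) → ℝ≥0∞) (Function.update x i y)
          = Set.indicator {y | Function.update x i y ∈ D} 1 y := fun y => rfl
      simp_rw [e]
      rw [lintegral_const_mul _ (measurable_one.indicator hDx), lintegral_indicator_one hDx,
        lintegral_const, measure_univ, mul_one, mul_comm]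
      gcongr
      exact hc x)
  rw [lmarginal_univ, lmarginal_univ] at h
  rcases isEmpty_or_nonempty (ι → E) with he | ⟨⟨x⟩⟩
  · simp [lintegral_of_isEmpty]
  · refine (h x).trans (le_of_eq ?_)
    exact lintegral_const_mul _ hG

end Conditioning

/-! ### Large self-energies are rare. -/

namespace OrbitalSpace

variable {n W : ℕ}

/-- The self-energy at j involves only earlier blocks, so under the law of the model it is
independent of V_j. -/
theorem selfEnergy_congr (z : ℝ) {ω ω' : OrbitalSpace n W} {j : ℕ}
    (h : ∀ i < j, siteV ω i = siteV ω' i ∧ hop ω i = hop ω' i) :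
    selfEnergy z ω j = selfEnergy z ω' j := by
  induction j with
  | zero => rfl
  | succ j ih =>
    rw [selfEnergy, selfEnergy, ih fun i hi => h i (by omega), (h j (by omega)).1, (h j (by omega)).2]

theorem siteV_update_of_ne (v : Fin n → Fin W → Fin W → ℝ) (t : Fin (n - 1) → Fin W → Fin W → ℂ)
    {m : Fin n} {j : ℕ} (h : j ≠ m) (y : Fin W → Fin W → ℝ) :
    siteV ((Function.update v m y, t) : OrbitalSpace n W) j = siteV ((v, t) : OrbitalSpace n W) j := by
  unfold siteV
  split_ifs with hj
  · have : (⟨j, hj⟩ : Fin n) ≠ m := fun e => h (by rw [← e])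
    simp only [V, Function.update_of_ne this]
  · rfl

theorem hop_update_of_ne (v : Fin n → Fin W → Fin W → ℝ) (t : Fin (n - 1) → Fin W → Fin W → ℂ)
    {m : Fin (n - 1)} {j : ℕ} (h : j ≠ m) (y : Fin W → Fin W → ℂ) :
    hop ((v, Function.update t m y) : OrbitalSpace n W) j = hop ((v, t) : OrbitalSpace n W) j := by
  unfold hop
  split_ifs with hj
  · have : (⟨j, hj⟩ : Fin (n - 1)) ≠ m := fun e => h (by rw [← e])
    simp only [T, Function.update_of_ne this]
  · rfl

/-- The Green function of the `j`-th Schur complement is large. -/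
def resonant (z lam : ℝ) (j : ℕ) : Set (OrbitalSpace n W) :=
  {ω | (lam * W) ^ 2 ≤ frobSq (siteV ω j - (z : ℂ) • 1 - selfEnergy z ω j)⁻¹}

/-- The `j`-th hopping matrix is large. -/
def largeHop (j : ℕ) : Set (OrbitalSpace n W) :=
  {ω | 20 < ‖Matrix.toEuclideanCLM (𝕜 := ℂ) (hop ω j)‖}

theorem measurableSet_resonant (z lam : ℝ) (j : ℕ) :
    MeasurableSet (resonant z lam j : Set (OrbitalSpace n W)) :=
  measurableSet_le measurable_const (((entrywiseMeasurable_siteV j).sub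
    (EntrywiseMeasurable.const _)).sub (entrywiseMeasurable_selfEnergy z j)).inv.frobSq

theorem continuous_norm_toEuclideanCLM :
    Continuous fun A : Matrix (Fin W) (Fin W) ℂ => ‖Matrix.toEuclideanCLM (𝕜 := ℂ) A‖ := by
  refine continuous_norm.comp ?_
  exact LinearMap.continuous_of_finiteDimensional
    ((Matrix.toEuclideanCLM (𝕜 := ℂ) (n := Fin W)).toAlgEquiv.toLinearMap)

theorem _root_.EntrywiseMeasurable.opNorm {Ω : Type*} [MeasurableSpace Ω]
    {f : Ω → Matrix (Fin W) (Fin W) ℂ} (hf : EntrywiseMeasurable f) :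
    Measurable fun x => ‖Matrix.toEuclideanCLM (𝕜 := ℂ) (f x)‖ := by
  have h : Measurable fun x => Matrix.of.symm (f x) :=
    measurable_pi_iff.2 fun i => measurable_pi_iff.2 fun j => hf i j
  have h2 : Continuous fun A : Fin W → Fin W → ℂ =>
      ‖Matrix.toEuclideanCLM (𝕜 := ℂ) (Matrix.of A)‖ := continuous_norm_toEuclideanCLM
  exact h2.measurable.comp h

theorem measurableSet_largeHop (j : ℕ) :
    MeasurableSet (largeHop j : Set (OrbitalSpace n W)) :=
  measurableSet_lt measurable_const (entrywiseMeasurable_hop j).opNorm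

/-- Exponential weight counting the bad sites. -/
def badWeight (z lam : ℝ) (Y : ℝ≥0∞) (m : ℕ) (ω : OrbitalSpace n W) : ℝ≥0∞ :=
  ∏ j ∈ Finset.range m, (1 + Y * ((resonant z lam j).indicator 1 ω + (largeHop j).indicator 1 ω))

theorem measurable_badWeight (z lam : ℝ) (Y : ℝ≥0∞) (m : ℕ) :
    Measurable (badWeight z lam Y m : OrbitalSpace n W → ℝ≥0∞) :=
  Finset.measurable_fun_prod _ fun j _ => (((measurable_one.indicator
    (measurableSet_resonant z lam j)).add (measurable_one.indicator
    (measurableSet_largeHop j))).const_mul Y).const_add 1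

theorem badWeight_congr (z lam : ℝ) (Y : ℝ≥0∞) {m : ℕ} {ω ω' : OrbitalSpace n W}
    (h : ∀ i < m, siteV ω i = siteV ω' i ∧ hop ω i = hop ω' i) :
    badWeight z lam Y m ω = badWeight z lam Y m ω' := by
  refine Finset.prod_congr rfl fun j hj => ?_
  have hj' := Finset.mem_range.1 hj
  have h1 : ω ∈ resonant z lam j ↔ ω' ∈ resonant z lam j := by
    simp only [resonant, Set.mem_ofPred_eq]
    rw [selfEnergy_congr z fun i hi => h i (by omega), (h j hj').1]
  have h2 : ω ∈ largeHop j ↔ ω' ∈ largeHop j := by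
    simp only [largeHop, Set.mem_ofPred_eq]
    rw [(h j hj').2]
  have e1 : (resonant z lam j).indicator (1 : OrbitalSpace n W → ℝ≥0∞) ω
      = (resonant z lam j).indicator 1 ω' := by
    by_cases h3 : ω ∈ resonant z lam j
    · rw [Set.indicator_of_mem h3, Set.indicator_of_mem (h1.1 h3)]; rfl
    · rw [Set.indicator_of_notMem h3, Set.indicator_of_notMem fun h4 => h3 (h1.2 h4)]
  have e2 : (largeHop j).indicator (1 : OrbitalSpace n W → ℝ≥0∞) ω
      = (largeHop j).indicator 1 ω' := by
    by_cases h3 : ω ∈ largeHop j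
    · rw [Set.indicator_of_mem h3, Set.indicator_of_mem (h2.1 h3)]; rfl
    · rw [Set.indicator_of_notMem h3, Set.indicator_of_notMem fun h4 => h3 (h2.2 h4)]
  rw [e1, e2]

/-- Given everything else, V_m is a fresh Gaussian block shifted by z plus a self-energy that does
not involve it, and neither does the weight up to m. Uniformity of the Wegner estimate in the shift
is essential here. -/
theorem lintegral_badWeight_resonant (hW : 0 < W) (z : ℝ) {lam : ℝ} (hlam : 0 < lam) (Y : ℝ≥0∞)
    {m : ℕ} (hm : m < n) :
    ∫⁻ ω : OrbitalSpace n W, badWeight z lam Y m ω * (resonant z lam m).indicator 1 ω ∂(orbitalLaw n W)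
      ≤ ENNReal.ofReal (6000 / lam) * ∫⁻ ω, badWeight z lam Y m ω ∂(orbitalLaw n W) := by
  have := isProbabilityMeasure_lawV hW
  have := isProbabilityMeasure_lawT hW
  have hmeas : Measurable fun ω : OrbitalSpace n W =>
      badWeight z lam Y m ω * (resonant z lam m).indicator 1 ω :=
    (measurable_badWeight z lam Y m).mul (measurable_one.indicator (measurableSet_resonant z lam m))
  rw [orbitalLaw_eq_prod hW, lintegral_prod_symm' _ hmeas,
    lintegral_prod_symm' _ (measurable_badWeight z lam Y m), ← lintegral_const_mul _
      (measurable_badWeight z lam Y m).lintegral_prod_left']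
  refine lintegral_mono fun t => ?_
  have hsec : Measurable fun v : Fin n → Fin W → Fin W → ℝ => ((v, t) : OrbitalSpace n W) :=
    measurable_id.prodMk measurable_const
  refine lintegral_pi_indicator_le (lawV W) ⟨m, hm⟩ ((measurable_badWeight z lam Y m).comp hsec)
    (fun v y => ?_) (D := {v | ((v, t) : OrbitalSpace n W) ∈ resonant z lam m})
    (hsec (measurableSet_resonant z lam m)) fun v => ?_
  · exact badWeight_congr z lam Y fun i hi => ⟨siteV_update_of_ne v t (ne_of_lt hi) y, rfl⟩
  · have h0 : ∀ y, siteV ((Function.update v ⟨m, hm⟩ y, t) : OrbitalSpace n W) m = hermitianOf y := by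
      intro y
      rw [siteV, dif_pos hm, V]
      exact congrArg hermitianOf (Function.update_self _ _ _)
    have h1 : ∀ y, selfEnergy z ((Function.update v ⟨m, hm⟩ y, t) : OrbitalSpace n W) m
        = selfEnergy z ((v, t) : OrbitalSpace n W) m := fun y =>
      selfEnergy_congr z fun i hi => ⟨siteV_update_of_ne v t (ne_of_lt hi) y, rfl⟩
    have h2 := lawV_wegner hW (B₀ := (z : ℂ) • 1 + selfEnergy z ((v, t) : OrbitalSpace n W) m)
      ((isHermitian_smul_one z).add (selfEnergy_isHermitian z _ m)) hlam
    refine le_trans (le_of_eq ?_) h2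
    congr 1
    ext y
    simp only [resonant, Set.mem_ofPred_eq, h0, h1, sub_sub]

theorem lintegral_badWeight_largeHop (hW : 0 < W) (z lam : ℝ) (Y : ℝ≥0∞) {m : ℕ} (hm : m < n - 1) :
    ∫⁻ ω : OrbitalSpace n W, badWeight z lam Y m ω * (largeHop m).indicator 1 ω ∂(orbitalLaw n W)
      ≤ ENNReal.ofReal (Real.exp (-W)) * ∫⁻ ω, badWeight z lam Y m ω ∂(orbitalLaw n W) := by
  have := isProbabilityMeasure_lawV hW
  have := isProbabilityMeasure_lawT hW
  have hmeas : Measurable fun ω : OrbitalSpace n W =>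
      badWeight z lam Y m ω * (largeHop m).indicator 1 ω :=
    (measurable_badWeight z lam Y m).mul (measurable_one.indicator (measurableSet_largeHop m))
  rw [orbitalLaw_eq_prod hW, lintegral_prod _ hmeas.aemeasurable,
    lintegral_prod _ (measurable_badWeight z lam Y m).aemeasurable, ← lintegral_const_mul _
      (measurable_badWeight z lam Y m).lintegral_prod_right']
  refine lintegral_mono fun v => ?_
  have hsec : Measurable fun t : Fin (n - 1) → Fin W → Fin W → ℂ => ((v, t) : OrbitalSpace n W) :=
    measurable_const.prodMk measurable_id
  refine lintegral_pi_indicator_le (lawT W) ⟨m, hm⟩ ((measurable_badWeight z lam Y m).comp hsec)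
    (fun t y => ?_) (D := {t | ((v, t) : OrbitalSpace n W) ∈ largeHop m})
    (hsec (measurableSet_largeHop m)) fun t => ?_
  · exact badWeight_congr z lam Y fun i hi => ⟨rfl, hop_update_of_ne v t (ne_of_lt hi) y⟩
  · refine le_trans (le_of_eq ?_) (lawT_opNorm_tail hW)
    congr 1
    ext y
    simp only [largeHop, Set.mem_ofPred_eq]
    have h0 : hop ((v, Function.update t ⟨m, hm⟩ y) : OrbitalSpace n W) m = Matrix.of y := by
      rw [hop, dif_pos hm, T]
      exact congrArg Matrix.of (Function.update_self _ _ _)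
    rw [h0]

/-- The bad events need not be independent, but each has a small conditional probability given the
earlier ones, so the exponential moment is bounded by a product. -/
theorem lintegral_badWeight_le (hW : 0 < W) (z : ℝ) {lam : ℝ} (hlam : 0 < lam) (Y : ℝ≥0∞)
    {m : ℕ} (hm : m ≤ n - 1) :
    ∫⁻ ω : OrbitalSpace n W, badWeight z lam Y m ω ∂(orbitalLaw n W)
      ≤ (1 + Y * (ENNReal.ofReal (6000 / lam) + ENNReal.ofReal (Real.exp (-W)))) ^ m := by
  have := isProbabilityMeasure_orbitalLaw (n := n) hW
  induction m with
  | zero => simp [badWeight]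
  | succ m ih =>
    have e : ∀ ω : OrbitalSpace n W, badWeight z lam Y (m + 1) ω = badWeight z lam Y m ω
        + Y * (badWeight z lam Y m ω * (resonant z lam m).indicator 1 ω
          + badWeight z lam Y m ω * (largeHop m).indicator 1 ω) := by
      intro ω
      rw [badWeight, Finset.prod_range_succ, ← badWeight]
      ring
    have hmG := measurable_badWeight (n := n) (W := W) z lam Y m
    have hm1 : Measurable fun ω : OrbitalSpace n W =>
        badWeight z lam Y m ω * (resonant z lam m).indicator 1 ω :=
      hmG.mul (measurable_one.indicator (measurableSet_resonant z lam m))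
    have hm2 : Measurable fun ω : OrbitalSpace n W =>
        badWeight z lam Y m ω * (largeHop m).indicator 1 ω :=
      hmG.mul (measurable_one.indicator (measurableSet_largeHop m))
    simp_rw [e]
    have hm3 : Measurable fun ω : OrbitalSpace n W =>
        badWeight z lam Y m ω * (resonant z lam m).indicator 1 ω
          + badWeight z lam Y m ω * (largeHop m).indicator 1 ω := hm1.add hm2
    rw [lintegral_add_left hmG, lintegral_const_mul _ hm3, lintegral_add_left hm1]
    have h1 := lintegral_badWeight_resonant hW z hlam Y (show m < n by omega)
    have h2 := lintegral_badWeight_largeHop hW z lam Y (show m < n - 1 by omega)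
    have ih' := ih (by omega)
    calc _ ≤ (∫⁻ ω : OrbitalSpace n W, badWeight z lam Y m ω ∂(orbitalLaw n W))
          + Y * (ENNReal.ofReal (6000 / lam) * ∫⁻ ω, badWeight z lam Y m ω ∂(orbitalLaw n W)
            + ENNReal.ofReal (Real.exp (-W)) * ∫⁻ ω, badWeight z lam Y m ω ∂(orbitalLaw n W)) := by
          gcongr
      _ = (∫⁻ ω : OrbitalSpace n W, badWeight z lam Y m ω ∂(orbitalLaw n W))
          * (1 + Y * (ENNReal.ofReal (6000 / lam) + ENNReal.ofReal (Real.exp (-W)))) := by ring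
      _ ≤ _ := by rw [pow_succ]; gcongr

/-- The number of sites with a large self-energy. -/
def badCount (z R : ℝ) (ω : OrbitalSpace n W) : ℕ :=
  ((Finset.range (n - 1)).filter fun j => R ^ 2 < frobSq (selfEnergy z ω (j + 1))).card

/-- At a site that is not resonant and whose hopping matrix has norm at most 20, ‖TΓT*‖_HS ≤ 20² λW;
hence the threshold 400λW. -/
theorem pow_badCount_le (z : ℝ) {lam : ℝ} (hlam : 0 < lam) {Y : ℝ≥0∞} (ω : OrbitalSpace n W) :
    Y ^ badCount z (400 * lam * W) ω ≤ badWeight z lam Y (n - 1) ω := by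
  rw [badCount, ← Finset.prod_const, Finset.prod_filter]
  refine Finset.prod_le_prod' fun j _ => ?_
  split_ifs with h
  · have hor : ω ∈ resonant z lam j ∨ ω ∈ largeHop j := by
      by_contra hcon
      rw [not_or] at hcon
      obtain ⟨h1, h2⟩ := hcon
      simp only [resonant, largeHop, Set.mem_ofPred_eq, not_le, not_lt] at h1 h2
      have h3 := frobSq_conj_le (hop ω j) (siteV ω j - (z : ℂ) • 1 - selfEnergy z ω j)⁻¹
      rw [selfEnergy] at h
      have h4 : ‖Matrix.toEuclideanCLM (𝕜 := ℂ) (hop ω j)‖ ^ 4 ≤ 20 ^ 4 :=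
        pow_le_pow_left₀ (norm_nonneg _) h2 4
      have h5 := mul_le_mul h4 h1.le (frobSq_nonneg _) (by norm_num)
      have h6 : (20 : ℝ) ^ 4 * (lam * W) ^ 2 = (400 * lam * W) ^ 2 := by ring
      linarith
    refine le_trans ?_ (le_add_left le_rfl)
    conv_lhs => rw [← mul_one Y]
    gcongr
    rcases hor with h1 | h1
    · rw [Set.indicator_of_mem h1]; exact le_add_right le_rfl
    · rw [Set.indicator_of_mem h1 (f := 1)]; exact le_add_left le_rfl
  · exact le_add_right le_rfl

/-- Exponential Markov inequality; the hypothesis on Y makes each factor of the moment bound at most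
2. -/
theorem orbitalLaw_badCount_ge (hW : 0 < W) (z : ℝ) {lam Y : ℝ} (hlam : 0 < lam) (hY : 1 ≤ Y)
    (h : Y * (6000 / lam + Real.exp (-W)) ≤ 1) (k : ℕ) :
    orbitalLaw n W {ω | k ≤ badCount z (400 * lam * W) ω} ≤ ENNReal.ofReal (2 ^ (n - 1) / Y ^ k) := by
  have hYpos : 0 < Y := by linarith
  have h1 := lintegral_badWeight_le (n := n) hW z hlam (ENNReal.ofReal Y) le_rfl
  have h2 : (1 + ENNReal.ofReal Y * (ENNReal.ofReal (6000 / lam) + ENNReal.ofReal (Real.exp (-W))))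
      ^ (n - 1) ≤ ENNReal.ofReal (2 ^ (n - 1)) := by
    rw [← ENNReal.ofReal_add (by positivity) (by positivity), ← ENNReal.ofReal_mul hYpos.le,
      ← ENNReal.ofReal_one, ← ENNReal.ofReal_add zero_le_one (by positivity),
      ← ENNReal.ofReal_pow (by positivity)]
    refine ENNReal.ofReal_le_ofReal (pow_le_pow_left₀ (by positivity) ?_ _)
    linarith
  have h3 := mul_meas_ge_le_lintegral₀ (μ := orbitalLaw n W)
    (measurable_badWeight (n := n) (W := W) z lam (ENNReal.ofReal Y) (n - 1)).aemeasurable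
    (ENNReal.ofReal (Y ^ k))
  have h4 : ENNReal.ofReal (Y ^ k) * orbitalLaw n W {ω | k ≤ badCount z (400 * lam * W) ω}
      ≤ ENNReal.ofReal (Y ^ k) * ENNReal.ofReal (2 ^ (n - 1) / Y ^ k) := by
    refine (mul_le_mul_right (measure_mono fun ω hω => ?_) _).trans (h3.trans (h1.trans (h2.trans ?_)))
    · refine le_trans ?_ (pow_badCount_le z hlam ω)
      rw [ENNReal.ofReal_pow hYpos.le]
      refine pow_le_pow_right₀ ?_ hω
      rw [← ENNReal.ofReal_one]
      exact ENNReal.ofReal_le_ofReal hY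
    · rw [← ENNReal.ofReal_mul (by positivity)]
      refine ENNReal.ofReal_le_ofReal (le_of_eq ?_)
      field_simp
  exact (ENNReal.mul_le_mul_iff_right (by simpa using by positivity) ENNReal.ofReal_ne_top).1 h4

end OrbitalSpace

/-! ### The two-sided shift inequality. -/

section TwoSidedShift

variable {Ω : Type*} [MeasurableSpace Ω] {lam : Measure Ω}

/-- A pair of changes of variables that shift `x` in opposite directions, at a bounded cost off a bad
set, bounds the mass of a window by the geometric mean of the masses on its two sides. -/
theorem lintegral_window_le {x ρ : Ω → ℝ} (hx : Measurable x) (hρ : Measurable ρ) (hρ0 : ∀ ω, 0 ≤ ρ ω)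
    (q : ℝ) {Θ₁ Θ₂ : Ω → Ω} (hΘ₁ : Measurable Θ₁) (hΘ₂ : Measurable Θ₂) {J₁ J₂ : Ω → ℝ}
    (hJ₁ : Measurable J₁) (hJ₂ : Measurable J₂)
    (h₁ : ∀ F : Ω → ℝ≥0∞, Measurable F → ∫⁻ ω, F (Θ₁ ω) * ENNReal.ofReal (J₁ ω) ∂lam = ∫⁻ ω, F ω ∂lam)
    (h₂ : ∀ F : Ω → ℝ≥0∞, Measurable F → ∫⁻ ω, F (Θ₂ ω) * ENNReal.ofReal (J₂ ω) ∂lam = ∫⁻ ω, F ω ∂lam)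
    {N : Ω → ℝ} {α κ c : ℝ} (hκ : 0 < κ) {B : Set Ω} (hB : MeasurableSet B)
    (hoff : ∀ᵐ ω ∂lam, ω ∉ B → x (Θ₁ ω) = x ω + N ω ∧ x (Θ₂ ω) = x ω - N ω ∧ 3 * α ≤ N ω ∧
      0 ≤ J₁ ω ∧ 0 ≤ J₂ ω ∧ κ ^ 2 * ρ ω ^ 2 ≤ (ρ (Θ₁ ω) * J₁ ω) * (ρ (Θ₂ ω) * J₂ ω)) :
    ∫⁻ ω in {ω | |x ω - c| ≤ α}, ENNReal.ofReal (Real.exp (q * x ω) * ρ ω) ∂lam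
      ≤ ENNReal.ofReal κ⁻¹
        * ((∫⁻ ω in {ω | 2 * α ≤ x ω - c}, ENNReal.ofReal (Real.exp (q * x ω) * ρ ω) ∂lam) ^ (1 / 2 : ℝ)
        * (∫⁻ ω in {ω | x ω - c ≤ -2 * α}, ENNReal.ofReal (Real.exp (q * x ω) * ρ ω) ∂lam) ^ (1 / 2 : ℝ))
        + ∫⁻ ω in B, ENNReal.ofReal (Real.exp (q * x ω) * ρ ω) ∂lam := by
  set w : Ω → ℝ := fun ω => Real.exp (q * x ω) * ρ ω with hw
  have hwm : Measurable fun ω => ENNReal.ofReal (w ω) := by fun_prop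
  have hw0 : ∀ ω, 0 ≤ w ω := fun ω => mul_nonneg (Real.exp_pos _).le (hρ0 ω)
  set A := {ω | |x ω - c| ≤ α} with hA
  set U := {ω | 2 * α ≤ x ω - c} with hU
  set D := {ω | x ω - c ≤ -2 * α} with hD
  have hAm : MeasurableSet A := measurableSet_le (by fun_prop) measurable_const
  have hUm : MeasurableSet U := measurableSet_le measurable_const (by fun_prop)
  have hDm : MeasurableSet D := measurableSet_le (by fun_prop) measurable_const
  set FU : Ω → ℝ≥0∞ := U.indicator fun ω => ENNReal.ofReal (w ω) with hFU
  set FD : Ω → ℝ≥0∞ := D.indicator fun ω => ENNReal.ofReal (w ω) with hFD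
  have hFUm : Measurable FU := hwm.indicator hUm
  have hFDm : Measurable FD := hwm.indicator hDm
  set a : Ω → ℝ≥0∞ := fun ω => FU (Θ₁ ω) * ENNReal.ofReal (J₁ ω) with ha
  set b : Ω → ℝ≥0∞ := fun ω => FD (Θ₂ ω) * ENNReal.ofReal (J₂ ω) with hb
  have ham : Measurable a := by fun_prop
  have hbm : Measurable b := by fun_prop
  have hia : ∫⁻ ω, a ω ∂lam = ∫⁻ ω in U, ENNReal.ofReal (w ω) ∂lam := by
    rw [ha, h₁ FU hFUm, hFU, lintegral_indicator hUm]
  have hib : ∫⁻ ω, b ω ∂lam = ∫⁻ ω in D, ENNReal.ofReal (w ω) ∂lam := by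
    rw [hb, h₂ FD hFDm, hFD, lintegral_indicator hDm]
  -- A shift by at least 3α carries a window of radius α beyond 2α on either side. The factors
  -- e^{q(x ± N)} multiply to e^{2qx} whatever N is, so κ only has to compare densities. By the
  -- changes of variables `a` and `b` integrate to the side masses, and Cauchy–Schwarz finishes.
  have hpt : ∀ᵐ ω ∂lam, ω ∈ A \ B → ENNReal.ofReal (w ω)
      ≤ ENNReal.ofReal κ⁻¹ * (a ω ^ (1 / 2 : ℝ) * b ω ^ (1 / 2 : ℝ)) := by
    filter_upwards [hoff] with ω hω hAB
    obtain ⟨e1, e2, hN, hj1, hj2, hcost⟩ := hω hAB.2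
    have hωA : |x ω - c| ≤ α := hAB.1
    have hα : 0 ≤ α := (abs_nonneg _).trans hωA
    have hωA' := abs_le.1 hωA
    have hU1 : Θ₁ ω ∈ U := by
      change 2 * α ≤ x (Θ₁ ω) - c
      rw [e1]; linarith
    have hD1 : Θ₂ ω ∈ D := by
      change x (Θ₂ ω) - c ≤ -2 * α
      rw [e2]; linarith
    have ea : a ω = ENNReal.ofReal (w (Θ₁ ω) * J₁ ω) := by
      simp only [ha, hFU, Set.indicator_of_mem hU1]
      rw [ENNReal.ofReal_mul (hw0 _)]
    have eb : b ω = ENNReal.ofReal (w (Θ₂ ω) * J₂ ω) := by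
      simp only [hb, hFD, Set.indicator_of_mem hD1]
      rw [ENNReal.ofReal_mul (hw0 _)]
    have hp1 : 0 ≤ w (Θ₁ ω) * J₁ ω := mul_nonneg (hw0 _) hj1
    have hp2 : 0 ≤ w (Θ₂ ω) * J₂ ω := mul_nonneg (hw0 _) hj2
    rw [ea, eb, ENNReal.ofReal_rpow_of_nonneg hp1 (by norm_num),
      ENNReal.ofReal_rpow_of_nonneg hp2 (by norm_num), ← ENNReal.ofReal_mul (by positivity),
      ← ENNReal.ofReal_mul (by positivity)]
    refine ENNReal.ofReal_le_ofReal ?_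
    rw [← Real.sqrt_eq_rpow, ← Real.sqrt_eq_rpow, ← Real.sqrt_mul hp1, ← div_eq_inv_mul,
      le_div_iff₀ hκ]
    refine Real.le_sqrt_of_sq_le ?_
    have e3 : w (Θ₁ ω) * J₁ ω * (w (Θ₂ ω) * J₂ ω)
        = Real.exp (q * x ω) ^ 2 * ((ρ (Θ₁ ω) * J₁ ω) * (ρ (Θ₂ ω) * J₂ ω)) := by
      have : Real.exp (q * x (Θ₁ ω)) * Real.exp (q * x (Θ₂ ω)) = Real.exp (q * x ω) ^ 2 := by
        rw [← Real.exp_add, ← Real.exp_nat_mul, e1, e2]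
        congr 1; push_cast; ring
      rw [← this]; simp only [hw]; ring
    rw [e3]
    calc (w ω * κ) ^ 2 = Real.exp (q * x ω) ^ 2 * (κ ^ 2 * ρ ω ^ 2) := by simp only [hw]; ring
      _ ≤ _ := by gcongr
  have hsplit : ∫⁻ ω in A, ENNReal.ofReal (w ω) ∂lam
      ≤ ∫⁻ ω in A \ B, ENNReal.ofReal (w ω) ∂lam + ∫⁻ ω in B, ENNReal.ofReal (w ω) ∂lam := by
    refine (lintegral_mono_set ?_).trans (lintegral_union_le _ (A \ B) B)
    intro ω hω
    by_cases h : ω ∈ B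
    · exact Or.inr h
    · exact Or.inl ⟨hω, h⟩
  refine hsplit.trans (add_le_add ?_ le_rfl)
  have hhol := ENNReal.lintegral_mul_le_Lp_mul_Lq lam Real.HolderConjugate.two_two
    (f := fun ω => a ω ^ (1 / 2 : ℝ)) (g := fun ω => b ω ^ (1 / 2 : ℝ))
    (ham.pow_const _).aemeasurable (hbm.pow_const _).aemeasurable
  have hpow : ∀ y : ℝ≥0∞, (y ^ (1 / 2 : ℝ)) ^ (2 : ℝ) = y := by
    intro y; rw [← ENNReal.rpow_mul]; norm_num
  simp only [hpow, hia, hib] at hhol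
  calc ∫⁻ ω in A \ B, ENNReal.ofReal (w ω) ∂lam
      ≤ ∫⁻ ω in A \ B, ENNReal.ofReal κ⁻¹ * (a ω ^ (1 / 2 : ℝ) * b ω ^ (1 / 2 : ℝ)) ∂lam :=
        lintegral_mono_ae ((ae_restrict_iff' (hAm.diff hB)).2 hpt)
    _ ≤ ∫⁻ ω, ENNReal.ofReal κ⁻¹ * (a ω ^ (1 / 2 : ℝ) * b ω ^ (1 / 2 : ℝ)) ∂lam :=
        setLIntegral_le_lintegral _ _
    _ = ENNReal.ofReal κ⁻¹ * ∫⁻ ω, a ω ^ (1 / 2 : ℝ) * b ω ^ (1 / 2 : ℝ) ∂lam :=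
        lintegral_const_mul' _ _ ENNReal.ofReal_ne_top
    _ ≤ _ := mul_le_mul_right hhol _

end TwoSidedShift

/-! ### The weighted mass in Schur coordinates. -/

namespace OrbitalSpace

variable {n W : ℕ}

theorem entrywiseMeasurable_G (z : ℝ) (x l : Fin n) :
    EntrywiseMeasurable fun ω : OrbitalSpace n W => G ω z x l := fun i j =>
  (entrywiseMeasurable_H.sub (EntrywiseMeasurable.const _)).inv (x, i) (l, j)

theorem measurable_X (hn : 0 < n) (z : ℝ) : Measurable (X (W := W) hn z) :=
  Real.measurable_log.comp (entrywiseMeasurable_G z _ _).opNorm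

theorem entrywiseMeasurable_greenChain (j : ℕ) :
    EntrywiseMeasurable fun s : OrbitalSpace n W => greenChain s j := by
  induction j with
  | zero => exact EntrywiseMeasurable.const 1
  | succ j ih =>
    exact ih.mul ((entrywiseMeasurable_siteV j).inv.mul (entrywiseMeasurable_hop j).conjTranspose)

theorem measurable_schurX : Measurable (schurX (n := n) (W := W)) :=
  Real.measurable_log.comp
    ((entrywiseMeasurable_greenChain _).mul (entrywiseMeasurable_siteV _).inv).opNorm

theorem measurable_energy : Measurable (energy : OrbitalSpace n W → ℝ) := by
  have : (energy : OrbitalSpace n W → ℝ) = fun ω =>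
      ∑ j, frobSq (hermitianOf (ω.1 j)) + ∑ j, frobSq (Matrix.of (ω.2 j)) := by
    ext ω; exact energy_eq ω
  rw [this]
  refine Measurable.add (Finset.measurable_fun_sum _ fun j _ => ?_)
    (Finset.measurable_fun_sum _ fun j _ => ?_)
  · exact (entrywiseMeasurable_hermitianOf.comp
      ((measurable_pi_apply j).comp measurable_fst)).frobSq
  · exact EntrywiseMeasurable.frobSq fun i k => (measurable_pi_apply k).comp
      ((measurable_pi_apply i).comp ((measurable_pi_apply j).comp measurable_snd))

/-- The density of the model in terms of the Schur complements. -/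
def schurDensity (z : ℝ) (s : OrbitalSpace n W) : ℝ := Real.exp (-(W * energy (ofSchur z s)))

theorem measurable_schurDensity (z : ℝ) : Measurable (schurDensity (n := n) (W := W) z) :=
  Real.measurable_exp.comp ((measurable_energy.comp (measurable_ofSchur z)).const_mul _).neg

/-- The `q`-weighted mass of a set. -/
def tiltedMass (W : ℕ) (hn : 0 < n) (z q : ℝ) (S : Set (OrbitalSpace n W)) : ℝ≥0∞ :=
  ∫⁻ ω in S, ENNReal.ofReal (Real.exp (q * X hn z ω)) ∂(orbitalLaw n W)

/-- The two sets need to correspond only at points where `X` and `schurX` agree, which is almost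
everywhere. -/
theorem tiltedMass_eq (hn : 0 < n) (z q : ℝ) {S : Set (OrbitalSpace n W)} (hS : MeasurableSet S)
    {S' : Set (OrbitalSpace n W)} (hS' : MeasurableSet S')
    (h : ∀ s, X hn z (ofSchur z s) = schurX s → (ofSchur z s ∈ S ↔ s ∈ S')) :
    tiltedMass W hn z q S = gaussNorm volume (formO n W)
      * ∫⁻ s in S', ENNReal.ofReal (Real.exp (q * schurX s) * schurDensity z s) := by
  have hXm := measurable_X (W := W) hn z
  have hm : Measurable fun ω : OrbitalSpace n W => ENNReal.ofReal (Real.exp (q * X hn z ω)) := by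
    fun_prop
  have hB := (continuous_bilin_self (formO n W)).measurable
  have hm2 : Measurable fun ω : OrbitalSpace n W => ENNReal.ofReal (Real.exp (-(formO n W ω ω)))
      * S.indicator (fun ω => ENNReal.ofReal (Real.exp (q * X hn z ω))) ω :=
    (measurable_exp_bilin _).mul (hm.indicator hS)
  rw [tiltedMass, ← lintegral_indicator hS, orbitalLaw_eq_gaussLaw, lintegral_gaussLaw,
    ← lintegral_ofSchur z hm2, ← lintegral_indicator hS']
  congr 1
  refine lintegral_congr_ae ?_
  filter_upwards [ae_X_ofSchur z hn] with s hs
  by_cases h1 : s ∈ S'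
  · rw [Set.indicator_of_mem h1, Set.indicator_of_mem ((h s hs).2 h1), hs, formO_self, mul_comm,
      ← ENNReal.ofReal_mul (Real.exp_pos _).le]
    rfl
  · rw [Set.indicator_of_notMem h1, Set.indicator_of_notMem (fun h2 => h1 ((h s hs).1 h2)), mul_zero]

/-- The window bound in terms of changes of variables on the Schur complements. -/
theorem tiltedMass_window_le (hn : 0 < n) (hW : 0 < W) (z q : ℝ)
    {Θ₁ Θ₂ : OrbitalSpace n W → OrbitalSpace n W} (hΘ₁ : Measurable Θ₁) (hΘ₂ : Measurable Θ₂)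
    {J₁ J₂ : OrbitalSpace n W → ℝ} (hJ₁ : Measurable J₁) (hJ₂ : Measurable J₂)
    (h₁ : ∀ F : OrbitalSpace n W → ℝ≥0∞, Measurable F →
      ∫⁻ ω, F (Θ₁ ω) * ENNReal.ofReal (J₁ ω) = ∫⁻ ω, F ω)
    (h₂ : ∀ F : OrbitalSpace n W → ℝ≥0∞, Measurable F →
      ∫⁻ ω, F (Θ₂ ω) * ENNReal.ofReal (J₂ ω) = ∫⁻ ω, F ω)
    {N : OrbitalSpace n W → ℝ} {α κ c : ℝ} (hκ : 0 < κ) {B : Set (OrbitalSpace n W)}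
    (hB : MeasurableSet B)
    (hoff : ∀ᵐ s, ofSchur z s ∉ B → schurX (Θ₁ s) = schurX s + N s ∧ schurX (Θ₂ s) = schurX s - N s
      ∧ 3 * α ≤ N s ∧ 0 ≤ J₁ s ∧ 0 ≤ J₂ s ∧ κ ^ 2 * schurDensity z s ^ 2
        ≤ (schurDensity z (Θ₁ s) * J₁ s) * (schurDensity z (Θ₂ s) * J₂ s)) :
    tiltedMass W hn z q {ω | |X hn z ω - c| ≤ α}
      ≤ ENNReal.ofReal κ⁻¹ * (tiltedMass W hn z q {ω | 2 * α ≤ X hn z ω - c} ^ (1 / 2 : ℝ)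
        * tiltedMass W hn z q {ω | X hn z ω - c ≤ -2 * α} ^ (1 / 2 : ℝ))
        + tiltedMass W hn z q B := by
  have hXm := measurable_X (W := W) hn z
  have hsm := measurable_schurX (n := n) (W := W)
  have h := lintegral_window_le hsm (measurable_schurDensity z) (fun s => (Real.exp_pos _).le) q hΘ₁ hΘ₂
    hJ₁ hJ₂ h₁ h₂ (c := c) hκ (B := ofSchur z ⁻¹' B) (measurable_ofSchur z hB) hoff
  rw [tiltedMass_eq hn z q (measurableSet_le (by fun_prop) measurable_const)
      (S' := {s | |schurX s - c| ≤ α}) (measurableSet_le (by fun_prop) measurable_const)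
      (fun s hs => by simp only [Set.mem_ofPred_eq, hs]),
    tiltedMass_eq hn z q (S := {ω | 2 * α ≤ X hn z ω - c}) (measurableSet_le measurable_const (by fun_prop))
      (S' := {s | 2 * α ≤ schurX s - c}) (measurableSet_le measurable_const (by fun_prop))
      (fun s hs => by simp only [Set.mem_ofPred_eq, hs]),
    tiltedMass_eq hn z q (S := {ω | X hn z ω - c ≤ -2 * α}) (measurableSet_le (by fun_prop) measurable_const)
      (S' := {s | schurX s - c ≤ -2 * α}) (measurableSet_le (by fun_prop) measurable_const)
      (fun s hs => by simp only [Set.mem_ofPred_eq, hs]),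
    tiltedMass_eq hn z q hB (S' := ofSchur z ⁻¹' B) (measurable_ofSchur z hB) (fun s _ => Iff.rfl)]
  set g := gaussNorm volume (formO n W) with hg
  rw [ENNReal.mul_rpow_of_nonneg _ _ (by norm_num), ENNReal.mul_rpow_of_nonneg _ _ (by norm_num)]
  have hgg : g ^ (1 / 2 : ℝ) * g ^ (1 / 2 : ℝ) = g := by
    rw [← ENNReal.rpow_add_of_nonneg _ _ (by norm_num) (by norm_num)]; norm_num
  have hswap : ∀ a b : ℝ≥0∞, g ^ (1 / 2 : ℝ) * a * (g ^ (1 / 2 : ℝ) * b) = g * (a * b) := by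
    intro a b
    rw [mul_mul_mul_comm, hgg]
  rw [hswap]
  refine (mul_le_mul_right h g).trans (le_of_eq ?_)
  ring

end OrbitalSpace

/-! ### Fractional moments and normalisation. -/

namespace OrbitalSpace

variable {n W : ℕ}

/-- The norm of the corner block of the resolvent. -/
def cornerNorm (hn : 0 < n) (z : ℝ) (ω : OrbitalSpace n W) : ℝ :=
  ‖Matrix.toEuclideanCLM (𝕜 := ℂ) (G ω z ⟨0, hn⟩ ⟨n - 1, Nat.sub_lt hn Nat.one_pos⟩)‖

theorem measurable_cornerNorm (hn : 0 < n) (z : ℝ) : Measurable (cornerNorm (W := W) hn z) :=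
  (entrywiseMeasurable_G z _ _).opNorm

theorem ae_cornerNorm_pos (hn : 0 < n) (hW : 0 < W) (z : ℝ) :
    ∀ᵐ ω ∂(orbitalLaw n W), 0 < cornerNorm hn z ω := by
  have hm : MeasurableSet {ω : OrbitalSpace n W | 0 < cornerNorm hn z ω} :=
    measurableSet_lt measurable_const (measurable_cornerNorm hn z)
  rw [orbitalLaw_eq_gaussLaw]
  refine (gaussLaw_absolutelyContinuous volume (formO n W)).ae_le ?_
  change ∀ᵐ ω, 0 < cornerNorm hn z ω
  rw [← (measurePreserving_ofSchur z).map_eq, ae_map_iff (measurable_ofSchur z).aemeasurable hm]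
  filter_upwards [ae_isUnit_siteV, (measurePreserving_ofSchur z).quasiMeasurePreserving.ae
    (ae_isUnit_det_H z), ae_cornerGreen_norm_pos hn hW] with s h1 h2 h3
  rw [cornerNorm, G_ofSchur z s hn h1 h2]
  exact h3

theorem ae_exp_mul_X (hn : 0 < n) (hW : 0 < W) (z q : ℝ) :
    ∀ᵐ ω ∂(orbitalLaw n W), Real.exp (q * X hn z ω) = cornerNorm hn z ω ^ q := by
  filter_upwards [ae_cornerNorm_pos hn hW z] with ω hω
  rw [Real.rpow_def_of_pos hω, mul_comm]
  rfl

/-- The constant in the weak type bound. -/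
def weakConst (n W : ℕ) : ℝ := 32 * Real.pi * n * W * Real.sqrt W

/-- The price of an exceptional event under the weight e^{qX}: the weak-type bound interpolated with
the probability of the event. -/
theorem tiltedMass_le (hn : 0 < n) (hW : 0 < W) (z : ℝ) {q : ℝ} (hq0 : 0 < q) (hq1 : q < 1)
    {b : ℝ} (hb : 0 < b) {B : Set (OrbitalSpace n W)} (hB : orbitalLaw n W B ≤ ENNReal.ofReal b) :
    tiltedMass W hn z q B ≤ ENNReal.ofReal (weakConst n W ^ q * b ^ (1 - q) / (1 - q)) := by
  have hK : 0 < weakConst n W := by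
    have h1 : (0 : ℝ) < n := by exact_mod_cast hn
    have h2 : (0 : ℝ) < W := by exact_mod_cast hW
    have := Real.pi_pos
    unfold weakConst
    positivity
  refine le_trans (le_of_eq ?_) (setLIntegral_rpow_le_of_weak (measurable_cornerNorm hn z)
    (fun ω => norm_nonneg _) hK (fun t ht => orbitalLaw_norm_G_gt hn hW z _ _ ht) hq0 hq1 hb hB)
  refine lintegral_congr_ae (ae_restrict_of_ae ?_)
  filter_upwards [ae_exp_mul_X hn hW z q] with ω hω
  rw [hω]

theorem integrable_exp_mul_X (hn : 0 < n) (hW : 0 < W) (z : ℝ) {q : ℝ} (hq0 : 0 < q) (hq1 : q < 1) :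
    Integrable (fun ω => Real.exp (q * X hn z ω)) (orbitalLaw n W) := by
  have := isProbabilityMeasure_orbitalLaw (n := n) hW
  have hm := measurable_X (W := W) hn z
  refine ⟨by fun_prop, ?_⟩
  rw [hasFiniteIntegral_iff_ofReal (Filter.Eventually.of_forall fun ω => (Real.exp_pos _).le)]
  have h := tiltedMass_le hn hW z hq0 hq1 one_pos (B := Set.univ) (by simp)
  rw [tiltedMass, Measure.restrict_univ] at h
  exact h.trans_lt ENNReal.ofReal_lt_top

theorem integrable_X_weightedLaw (hn : 0 < n) (hW : 0 < W) (z : ℝ) {q : ℝ} (hq0 : 0 < q) (hq1 : q < 1) :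
    Integrable (X hn z) (weightedLaw W hn z q) := by
  have hm := measurable_X (W := W) hn z
  rw [weightedLaw, integrable_tilted_iff (integrable_exp_mul_X hn hW z hq0 hq1)]
  -- Both q + δ and q - δ stay in (0, 1), and |x| is at most δ⁻¹(e^{δx} + e^{-δx}).
  set δ := min q (1 - q) / 2 with hδ
  have hδ0 : 0 < δ := by have : 0 < 1 - q := by linarith
                         positivity
  have h1 : δ < q := by have := min_le_left q (1 - q); simp only [hδ] at hδ0 ⊢; linarith
  have h2 : δ < 1 - q := by have := min_le_right q (1 - q); simp only [hδ] at hδ0 ⊢; linarith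
  have hi := ((integrable_exp_mul_X hn hW z (q := q + δ) (by linarith) (by linarith)).add
    (integrable_exp_mul_X hn hW z (q := q - δ) (by linarith) (by linarith))).const_mul δ⁻¹
  refine hi.mono (by fun_prop) (Filter.Eventually.of_forall fun ω => ?_)
  set x := X hn z ω
  have hx : |x| ≤ δ⁻¹ * (Real.exp (δ * x) + Real.exp (-(δ * x))) := by
    rw [← div_eq_inv_mul, le_div_iff₀ hδ0]
    have e1 := Real.add_one_le_exp (δ * x)
    have e2 := Real.add_one_le_exp (-(δ * x))
    have e3 := Real.exp_pos (δ * x)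
    have e4 := Real.exp_pos (-(δ * x))
    rcases abs_cases x with ⟨h, _⟩ | ⟨h, _⟩ <;> rw [h] <;> linarith
  have e : δ⁻¹ * (Real.exp ((q + δ) * x) + Real.exp ((q - δ) * x))
      = Real.exp (q * x) * (δ⁻¹ * (Real.exp (δ * x) + Real.exp (-(δ * x)))) := by
    rw [add_mul, sub_mul, Real.exp_add, sub_eq_add_neg, Real.exp_add]; ring
  simp only [Pi.add_apply]
  rw [e, smul_eq_mul, norm_mul, norm_mul, Real.norm_eq_abs x]
  refine mul_le_mul_of_nonneg_left (hx.trans (Real.le_norm_self _)) (norm_nonneg _)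

/-- Jensen's inequality for the power r = q/(s/2), in the form of Bernoulli's tangent-line bound at
the mean. Since 1 ≤ r ≤ 2, the exponent ξ at most doubles. -/
theorem exp_le_integral_exp_mul_X (hn : 0 < n) (hW : 0 < W) (z : ℝ) {s ξ q : ℝ} (hs0 : 0 < s)
    (hξ : 0 < ξ) (hs1 : s < 1)
    (h : Real.exp (-ξ * n) ≤ ∫ ω, Real.exp (s / 2 * X hn z ω) ∂(orbitalLaw n W))
    (hq0 : s / 2 < q) (hqs : q < s) :
    Real.exp (-(2 * ξ * n)) ≤ ∫ ω, Real.exp (q * X hn z ω) ∂(orbitalLaw n W) := by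
  have := isProbabilityMeasure_orbitalLaw (n := n) hW
  set I := ∫ ω, Real.exp (s / 2 * X hn z ω) ∂(orbitalLaw n W) with hI
  have hIpos : 0 < I := (Real.exp_pos _).trans_le h
  set r := q / (s / 2) with hr
  have hr1 : 1 ≤ r := by rw [hr, le_div_iff₀ (by linarith)]; linarith
  have hr2 : r ≤ 2 := by rw [hr, div_le_iff₀ (by linarith)]; linarith
  have i1 := integrable_exp_mul_X (W := W) hn hW z (q := s / 2) (by linarith) (by linarith)
  have i2 := integrable_exp_mul_X (W := W) hn hW z (q := q) (by linarith) (by linarith)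
  have hpt : ∀ ω : OrbitalSpace n W, I ^ r * (1 - r) + I ^ r * r / I * Real.exp (s / 2 * X hn z ω)
      ≤ Real.exp (q * X hn z ω) := by
    intro ω
    have hy : 0 < Real.exp (s / 2 * X hn z ω) / I := div_pos (Real.exp_pos _) hIpos
    have hb := one_add_mul_self_le_rpow_one_add
      (show -1 ≤ Real.exp (s / 2 * X hn z ω) / I - 1 by linarith) hr1
    rw [add_sub_cancel, Real.div_rpow (Real.exp_pos _).le hIpos.le, ← Real.exp_mul] at hb
    have e : s / 2 * X hn z ω * r = q * X hn z ω := by rw [hr]; field_simp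
    rw [e, le_div_iff₀ (by positivity)] at hb
    refine le_trans (le_of_eq ?_) hb
    field_simp
    ring
  have hint := integral_mono ((integrable_const (I ^ r * (1 - r))).add (i1.const_mul (I ^ r * r / I)))
    i2 hpt
  rw [integral_add' (integrable_const _) (i1.const_mul _), integral_const, integral_const_mul, ← hI,
    probReal_univ, one_smul] at hint
  have e : I ^ r * (1 - r) + I ^ r * r / I * I = I ^ r := by field_simp; ring
  rw [e] at hint
  calc Real.exp (-(2 * ξ * n)) ≤ Real.exp (-ξ * n) ^ r := by
        rw [← Real.exp_mul]
        refine Real.exp_le_exp.2 ?_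
        have : 0 ≤ ξ * n := by positivity
        nlinarith
    _ ≤ I ^ r := Real.rpow_le_rpow (Real.exp_pos _).le h (by linarith)
    _ ≤ _ := hint

theorem weightedLaw_real (hn : 0 < n) (hW : 0 < W) (z : ℝ) {q : ℝ} (hq0 : 0 < q) (hq1 : q < 1)
    {S : Set (OrbitalSpace n W)} (hS : MeasurableSet S) :
    (weightedLaw W hn z q).real S
      = (tiltedMass W hn z q S).toReal / ∫ ω, Real.exp (q * X hn z ω) ∂(orbitalLaw n W) := by
  have hi := integrable_exp_mul_X (W := W) hn hW z hq0 hq1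
  rw [Measure.real, weightedLaw, tilted_apply_eq_ofReal_integral' _ hS, ENNReal.toReal_ofReal
    (integral_nonneg fun _ => div_nonneg (Real.exp_pos _).le
      (integral_nonneg fun _ => (Real.exp_pos _).le)), integral_div, tiltedMass,
    ← ofReal_integral_eq_lintegral_ofReal hi.integrableOn
      (Filter.Eventually.of_forall fun _ => (Real.exp_pos _).le),
    ENNReal.toReal_ofReal (integral_nonneg fun _ => (Real.exp_pos _).le)]

/-- From the mass bound to the bound on probabilities. -/
theorem weightedLaw_window_le (hn : 0 < n) (hW : 0 < W) (z : ℝ) {q : ℝ} (hq0 : 0 < q) (hq1 : q < 1)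
    {α κ : ℝ} (hκ : 0 < κ) {B : Set (OrbitalSpace n W)} {b : ℝ} (hb : 0 < b)
    (hB : orbitalLaw n W B ≤ ENNReal.ofReal b)
    (hsmall : weakConst n W ^ q * b ^ (1 - q) / (1 - q)
      ≤ (∫ ω, Real.exp (q * X hn z ω) ∂(orbitalLaw n W)) / 4)
    (h : ∀ c, tiltedMass W hn z q {ω | |X hn z ω - c| ≤ α}
      ≤ ENNReal.ofReal κ⁻¹ * (tiltedMass W hn z q {ω | 2 * α ≤ X hn z ω - c} ^ (1 / 2 : ℝ)
        * tiltedMass W hn z q {ω | X hn z ω - c ≤ -2 * α} ^ (1 / 2 : ℝ))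
        + tiltedMass W hn z q B) :
    (weightedLaw W hn z q).real {ω | |centeredX hn z q ω| ≤ α}
      ≤ κ⁻¹ * Real.sqrt ((weightedLaw W hn z q).real {ω | 2 * α ≤ centeredX hn z q ω}
        * (weightedLaw W hn z q).real {ω | centeredX hn z q ω ≤ -2 * α}) + 1 / 4 := by
  have := isProbabilityMeasure_orbitalLaw (n := n) hW
  have hm := measurable_X (W := W) hn z
  have hi := integrable_exp_mul_X (W := W) hn hW z hq0 hq1
  set Z := ∫ ω, Real.exp (q * X hn z ω) ∂(orbitalLaw n W) with hZ
  have hZ0 : 0 < Z := integral_exp_pos hi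
  unfold centeredX
  set c := ∫ ω, X hn z ω ∂(weightedLaw W hn z q) with hc
  have hfin : ∀ S, tiltedMass W hn z q S ≠ ∞ := by
    intro S
    refine ne_top_of_le_ne_top ENNReal.ofReal_ne_top
      (tiltedMass_le hn hW z hq0 hq1 one_pos (B := S) ?_)
    rw [ENNReal.ofReal_one]; exact prob_le_one
  rw [weightedLaw_real hn hW z hq0 hq1 (measurableSet_le (by fun_prop) measurable_const),
    weightedLaw_real hn hW z hq0 hq1 (measurableSet_le measurable_const (by fun_prop)),
    weightedLaw_real hn hW z hq0 hq1 (measurableSet_le (by fun_prop) measurable_const), ← hZ]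
  have h1 := ENNReal.toReal_mono (by
    refine ENNReal.add_ne_top.2 ⟨ENNReal.mul_ne_top ENNReal.ofReal_ne_top (ENNReal.mul_ne_top
      (ENNReal.rpow_ne_top_of_nonneg (by norm_num) (hfin _))
      (ENNReal.rpow_ne_top_of_nonneg (by norm_num) (hfin _))), hfin B⟩) (h c)
  rw [ENNReal.toReal_add (ENNReal.mul_ne_top ENNReal.ofReal_ne_top (ENNReal.mul_ne_top
      (ENNReal.rpow_ne_top_of_nonneg (by norm_num) (hfin _))
      (ENNReal.rpow_ne_top_of_nonneg (by norm_num) (hfin _)))) (hfin B), ENNReal.toReal_mul,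
    ENNReal.toReal_mul, ENNReal.toReal_ofReal (by positivity), ← ENNReal.toReal_rpow,
    ← ENNReal.toReal_rpow, ← Real.sqrt_eq_rpow, ← Real.sqrt_eq_rpow,
    ← Real.sqrt_mul ENNReal.toReal_nonneg] at h1
  have h2 : (tiltedMass W hn z q B).toReal ≤ Z / 4 := by
    refine ENNReal.toReal_le_of_le_ofReal (by positivity) ?_
    exact (tiltedMass_le hn hW z hq0 hq1 hb hB).trans (ENNReal.ofReal_le_ofReal hsmall)
  set U := (tiltedMass W hn z q {ω | 2 * α ≤ X hn z ω - c}).toReal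
  set D := (tiltedMass W hn z q {ω | X hn z ω - c ≤ -2 * α}).toReal
  have hU : 0 ≤ U := ENNReal.toReal_nonneg
  have hD : 0 ≤ D := ENNReal.toReal_nonneg
  have h3 : Real.sqrt (U / Z * (D / Z)) = Real.sqrt (U * D) / Z := by
    rw [div_mul_div_comm, Real.sqrt_div (by positivity), Real.sqrt_mul_self hZ0.le]
  rw [h3, div_le_iff₀ hZ0, add_mul, ← mul_div_assoc, div_mul_cancel₀ _ hZ0.ne']
  linarith

end OrbitalSpace

/-! ### Second-order cost of a pair of opposite scalings. -/

section ScalarCost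

theorem exp_pair_bounds {x : ℝ} (hx : |x| ≤ 1 / 2) :
    (Real.exp (2 * x) - 1) ^ 2 ≤ 16 * x ^ 2 ∧ (Real.exp (-(2 * x)) - 1) ^ 2 ≤ 16 * x ^ 2 ∧
      0 ≤ Real.exp (2 * x) + Real.exp (-(2 * x)) - 2 ∧
      Real.exp (2 * x) + Real.exp (-(2 * x)) - 2 ≤ 16 * x ^ 2 := by
  have h1 : |2 * x| ≤ 1 := by rw [abs_mul, abs_two]; linarith
  have hp := Real.abs_exp_sub_one_le h1
  have hm := Real.abs_exp_sub_one_le (x := -(2 * x)) (by rwa [abs_neg])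
  rw [abs_mul, abs_two] at hp
  rw [abs_neg, abs_mul, abs_two] at hm
  have e1 : (Real.exp (2 * x) - 1) ^ 2 ≤ 16 * x ^ 2 := by
    rw [← sq_abs, ← sq_abs x]
    calc _ ≤ (2 * (2 * |x|)) ^ 2 := pow_le_pow_left₀ (abs_nonneg _) hp 2
      _ = _ := by ring
  have e2 : (Real.exp (-(2 * x)) - 1) ^ 2 ≤ 16 * x ^ 2 := by
    rw [← sq_abs, ← sq_abs x]
    calc _ ≤ (2 * (2 * |x|)) ^ 2 := pow_le_pow_left₀ (abs_nonneg _) hm 2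
      _ = _ := by ring
  have e3 : Real.exp (2 * x) * Real.exp (-(2 * x)) = 1 := by rw [← Real.exp_add]; simp
  have hP := Real.exp_pos (2 * x)
  have hM := Real.exp_pos (-(2 * x))
  refine ⟨e1, e2, ?_, ?_⟩
  · nlinarith [sq_nonneg (Real.exp (2 * x) - Real.exp (-(2 * x)))]
  · nlinarith [sq_nonneg (Real.exp (2 * x) - 1 + (Real.exp (-(2 * x)) - 1))]

/-- In the sum over ± x the cross term carries e^{2x} + e^{-2x} - 2, and the remaining excess
carries this or (e^{±2x} - 1)²; all are at most 16x². -/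
theorem frobSq_pair_le {W : ℕ} (V A T : Matrix (Fin W) (Fin W) ℂ) {x : ℝ} (hx : |x| ≤ 1 / 2) :
    frobSq (V + (Real.exp (2 * x) - 1) • A) + frobSq (Real.exp x • T)
      + (frobSq (V + (Real.exp (-(2 * x)) - 1) • A) + frobSq (Real.exp (-x) • T))
      ≤ 2 * (frobSq V + frobSq T) + 48 * x ^ 2 * (frobSq V + frobSq A + frobSq T) := by
  obtain ⟨h1, h2, h3, h4⟩ := exp_pair_bounds hx
  have hV := frobSq_nonneg V
  have hA := frobSq_nonneg A
  have hT := frobSq_nonneg T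
  have hin := (mul_le_mul_of_nonneg_left (le_abs_self (frobInner V A)) zero_le_two).trans
    (two_abs_frobInner_le V A)
  rw [frobSq_add, frobSq_add, frobSq_smul, frobSq_smul, frobSq_smul, frobSq_smul,
    frobInner_smul_right, frobInner_smul_right]
  have e1 : Real.exp x ^ 2 = Real.exp (2 * x) := by rw [← Real.exp_nat_mul]; norm_num
  have e2 : Real.exp (-x) ^ 2 = Real.exp (-(2 * x)) := by
    rw [← Real.exp_nat_mul]; congr 1; push_cast; ring
  rw [e1, e2]
  set p := Real.exp (2 * x)
  set m := Real.exp (-(2 * x))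
  have i1 := mul_le_mul_of_nonneg_left hin h3
  have i2 := mul_le_mul_of_nonneg_right h4 (add_nonneg hV hA)
  have i3 := mul_le_mul_of_nonneg_right h1 hA
  have i4 := mul_le_mul_of_nonneg_right h2 hA
  have i5 := mul_le_mul_of_nonneg_right h4 hT
  have i6 := mul_nonneg (sq_nonneg x) hV
  have i7 := mul_nonneg (sq_nonneg x) hT
  nlinarith

/-- The product is 1 - 4t²(χ(1 - χ))², at least 1 - t²/4. -/
theorem exp_neg_sq_le {t χ : ℝ} (ht : |t| ≤ 1 / 2) (h0 : 0 ≤ χ) (h1 : χ ≤ 1) :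
    Real.exp (-t ^ 2) ≤ (1 - 2 * t * (χ * (1 - χ))) * (1 - 2 * (-t) * (χ * (1 - χ))) := by
  have hy0 : 0 ≤ χ * (1 - χ) := mul_nonneg h0 (by linarith)
  have hy1 : χ * (1 - χ) ≤ 1 / 4 := by nlinarith [sq_nonneg (χ - 1 / 2)]
  have ht2 : t ^ 2 ≤ 1 / 4 := by
    rw [← sq_abs]; nlinarith [abs_nonneg t]
  have h2 : (χ * (1 - χ)) ^ 2 ≤ 1 / 16 := by nlinarith
  have h3 : 1 - t ^ 2 / 4 ≤ (1 - 2 * t * (χ * (1 - χ))) * (1 - 2 * (-t) * (χ * (1 - χ))) := by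
    nlinarith [mul_le_mul_of_nonneg_left h2 (sq_nonneg t)]
  refine le_trans ?_ h3
  have h4 := Real.add_one_le_exp (t ^ 2)
  rw [Real.exp_neg, inv_le_comm₀ (Real.exp_pos _) (by linarith)]
  refine le_trans ?_ h4
  rw [inv_le_iff_one_le_mul₀ (by linarith)]
  nlinarith [sq_nonneg t]

end ScalarCost

/-! ### The flow of the hopping matrices. -/

namespace OrbitalSpace

variable {n W : ℕ}

/-- The size of the self-energy created by a hopping matrix, relative to the scale `R`. -/
def hopSize (R : ℝ) (S T : Matrix (Fin W) (Fin W) ℂ) : ℝ := Real.sqrt (frobSq (T * S⁻¹ * Tᴴ)) / R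

theorem hopSize_nonneg {R : ℝ} (hR : 0 < R) (S T : Matrix (Fin W) (Fin W) ℂ) : 0 ≤ hopSize R S T := by
  unfold hopSize; positivity

theorem hopSize_smul {R : ℝ} (S T : Matrix (Fin W) (Fin W) ℂ) {c : ℝ} (hc : 0 < c) :
    hopSize R S (c • T) = c ^ 2 * hopSize R S T := by
  have h : (c • T) * S⁻¹ * (c • T)ᴴ = c ^ 2 • (T * S⁻¹ * Tᴴ) := by
    rw [Matrix.conjTranspose_smul, Matrix.smul_mul, Matrix.smul_mul, Matrix.mul_smul, smul_smul,
      star_trivial, sq]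
  unfold hopSize
  rw [h, frobSq_smul, Real.sqrt_mul (by positivity), Real.sqrt_sq (by positivity), mul_div_assoc]

/-- The flow scaling all hopping matrices at fixed Schur complements. -/
def flow (R : ℝ) (t : ℕ → ℝ) (s : OrbitalSpace n W) : OrbitalSpace n W :=
  (s.1, fun j => radialFlow (fun T => hopSize R (siteV s j) (Matrix.of T)) (t j) (s.2 j))

/-- The Jacobian of `flow`. -/
def flowJac (R : ℝ) (t : ℕ → ℝ) (s : OrbitalSpace n W) : ℝ :=
  ∏ j : Fin (n - 1), radialJac (fun T => hopSize R (siteV s j) (Matrix.of T)) (t j) (s.2 j)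

/-- The rate of the flow at the `j`-th hopping matrix. -/
def cut (R : ℝ) (s : OrbitalSpace n W) (j : ℕ) : ℝ :=
  (1 + Real.sqrt (frobSq (schurEnergy s (j + 1))) / R)⁻¹

theorem cut_nonneg {R : ℝ} (hR : 0 < R) (s : OrbitalSpace n W) (j : ℕ) : 0 ≤ cut R s j := by
  unfold cut; positivity

theorem cut_le_one {R : ℝ} (hR : 0 < R) (s : OrbitalSpace n W) (j : ℕ) : cut R s j ≤ 1 := by
  unfold cut
  refine inv_le_one_of_one_le₀ ?_
  have : 0 ≤ Real.sqrt (frobSq (schurEnergy s (j + 1))) / R := by positivity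
  linarith

/-- The purpose of the cutoff: under the flow the next diagonal block moves by an amount of order R
t, however large the self-energy is. -/
theorem cut_sq_mul_le {R : ℝ} (hR : 0 < R) (s : OrbitalSpace n W) (j : ℕ) :
    cut R s j ^ 2 * frobSq (schurEnergy s (j + 1)) ≤ R ^ 2 := by
  set y := Real.sqrt (frobSq (schurEnergy s (j + 1))) with hy
  have hy0 : 0 ≤ y := Real.sqrt_nonneg _
  have e : frobSq (schurEnergy s (j + 1)) = y ^ 2 := (Real.sq_sqrt (frobSq_nonneg _)).symm
  have h : cut R s j * y ≤ R := by
    rw [cut, ← hy, inv_mul_le_iff₀ (by positivity)]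
    have : (1 + y / R) * R = R + y := by field_simp
    rw [this]; linarith
  rw [e, ← mul_pow]
  exact pow_le_pow_left₀ (mul_nonneg (cut_nonneg hR s j) hy0) h 2

theorem hopSize_eq (R : ℝ) (s : OrbitalSpace n W) (j : Fin (n - 1)) :
    (1 + hopSize R (siteV s j) (Matrix.of (s.2 j)))⁻¹ = cut R s j := by
  have h : hop s j = Matrix.of (s.2 j) := by rw [hop, dif_pos j.isLt]; rfl
  rw [cut, schurEnergy, h]
  rfl

theorem flow_snd (R : ℝ) (t : ℕ → ℝ) (s : OrbitalSpace n W) (j : Fin (n - 1)) :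
    (flow R t s).2 j = Real.exp (t j * cut R s j) • s.2 j := by
  rw [← hopSize_eq]; rfl

theorem flowJac_eq (R : ℝ) (t : ℕ → ℝ) (s : OrbitalSpace n W) :
    flowJac R t s = ∏ j : Fin (n - 1),
      Real.exp (Module.finrank ℝ (Fin W → Fin W → ℂ) * (t j * cut R s j))
        * (1 - 2 * t j * (cut R s j * (1 - cut R s j))) := by
  unfold flowJac radialJac
  simp only [hopSize_eq]

theorem measurable_cut (R : ℝ) (j : ℕ) : Measurable fun s : OrbitalSpace n W => cut R s j := by
  have h := (entrywiseMeasurable_schurEnergy (n := n) (W := W) (j + 1)).frobSq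
  unfold cut
  exact (((Real.continuous_sqrt.measurable.comp h).div_const R).const_add 1).inv

theorem measurable_flow (R : ℝ) (t : ℕ → ℝ) : Measurable (flow (n := n) (W := W) R t) := by
  refine measurable_fst.prodMk (measurable_pi_iff.2 fun j => ?_)
  have h : ∀ s : OrbitalSpace n W, radialFlow (fun T => hopSize R (siteV s j) (Matrix.of T)) (t j) (s.2 j)
      = Real.exp (t j * cut R s j) • s.2 j := fun s => flow_snd R t s j
  simp_rw [h]
  exact (Real.measurable_exp.comp ((measurable_cut R j).const_mul _)).smul
    ((measurable_pi_apply j).comp measurable_snd)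

theorem measurable_flowJac (R : ℝ) (t : ℕ → ℝ) : Measurable (flowJac (n := n) (W := W) R t) := by
  have h : flowJac (n := n) (W := W) R t = _ := funext (flowJac_eq R t)
  rw [h]
  refine Finset.measurable_fun_prod _ fun j _ => ?_
  have := measurable_cut (n := n) (W := W) R j
  fun_prop

theorem radialJac_nonneg {E : Type*} [NormedAddCommGroup E] [NormedSpace ℝ E] {a : E → ℝ}
    (ha : ∀ x, 0 ≤ a x) {t : ℝ} (ht : |t| ≤ 1 / 2) (x : E) : 0 ≤ radialJac a t x := by
  unfold radialJac
  refine mul_nonneg (Real.exp_pos _).le ?_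
  have h1 : 0 < (1 + a x)⁻¹ := by have := ha x; positivity
  have h2 : (1 + a x)⁻¹ ≤ 1 := inv_le_one_of_one_le₀ (by have := ha x; linarith)
  set χ := (1 + a x)⁻¹
  have hy0 : 0 ≤ χ * (1 - χ) := mul_nonneg h1.le (by linarith)
  have hy1 : χ * (1 - χ) ≤ 1 / 4 := by nlinarith [sq_nonneg (χ - 1 / 2)]
  have := abs_le.1 ht
  nlinarith

/-- At fixed Schur complements the hopping matrices flow separately, each at a rate depending only
on itself and on the Schur complement at the same index. -/
theorem lintegral_flow (hW : 0 < W) {R : ℝ} (hR : 0 < R) {t : ℕ → ℝ} (ht : ∀ j, |t j| ≤ 1 / 2)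
    {F : OrbitalSpace n W → ℝ≥0∞} (hF : Measurable F) :
    ∫⁻ s, F (flow R t s) * ENNReal.ofReal (flowJac R t s) = ∫⁻ s, F s := by
  have : Nonempty (Fin W) := ⟨⟨0, hW⟩⟩
  have hm : Measurable fun s : OrbitalSpace n W => F (flow R t s) * ENNReal.ofReal (flowJac R t s) :=
    (hF.comp (measurable_flow R t)).mul (ENNReal.measurable_ofReal.comp (measurable_flowJac R t))
  rw [Measure.volume_eq_prod, lintegral_prod _ hm.aemeasurable, lintegral_prod _ hF.aemeasurable]
  refine lintegral_congr fun v => ?_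
  set S : Fin (n - 1) → Matrix (Fin W) (Fin W) ℂ := fun j => siteV ((v, 0) : OrbitalSpace n W) j with hS
  have hTm : EntrywiseMeasurable fun T : Fin W → Fin W → ℂ => (Matrix.of T : Matrix (Fin W) (Fin W) ℂ) :=
    fun i k => (measurable_pi_apply k).comp (measurable_pi_apply i)
  have ham : ∀ j, Measurable fun T : Fin W → Fin W → ℂ => hopSize R (S j) (Matrix.of T) := fun j =>
    (Real.continuous_sqrt.measurable.comp ((hTm.mul (EntrywiseMeasurable.const _)).mul
      hTm.conjTranspose).frobSq).div_const R
  have ha : ∀ j, ∀ T : Fin W → Fin W → ℂ, 0 ≤ hopSize R (S j) (Matrix.of T) := fun j T =>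
    hopSize_nonneg hR _ _
  have h := lintegral_pi_flow (ι := Fin (n - 1)) (volume : Measure (Fin W → Fin W → ℂ))
    (θ := fun j => radialFlow (fun T => hopSize R (S j) (Matrix.of T)) (t j))
    (J := fun j T => ENNReal.ofReal (radialJac (fun T => hopSize R (S j) (Matrix.of T)) (t j) T))
    (fun j => by have := ham j; unfold radialFlow; fun_prop)
    (fun j => by have := ham j; unfold radialJac; fun_prop)
    (fun j G hG => lintegral_radialFlow volume (ham j) (ha j)
      (fun c T hc => by
        rw [← hopSize_smul (S j) (Matrix.of T) hc]; rfl)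
      ((ht j).trans (by norm_num)) hG)
    (F := fun T => F (v, T)) (hF.comp (measurable_const.prodMk measurable_id))
  refine Eq.trans (lintegral_congr fun T => ?_) h
  have e := ENNReal.ofReal_prod_of_nonneg (s := Finset.univ)
    (f := fun j : Fin (n - 1) => radialJac (fun T => hopSize R (S j) (Matrix.of T)) (t j) (T j))
    fun j _ => radialJac_nonneg (ha j) (ht j) _
  rw [← e]
  rfl

theorem hop_flow (R : ℝ) (t : ℕ → ℝ) (s : OrbitalSpace n W) (j : ℕ) :
    hop (flow R t s) j = Real.exp (t j * cut R s j) • hop s j := by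
  unfold hop
  split_ifs with hj
  · change Matrix.of ((flow R t s).2 ⟨j, hj⟩) = _
    rw [flow_snd]; rfl
  · rw [smul_zero]

theorem schurEnergy_flow (R : ℝ) (t : ℕ → ℝ) (s : OrbitalSpace n W) (j : ℕ) :
    schurEnergy (flow R t s) (j + 1) = Real.exp (2 * (t j * cut R s j)) • schurEnergy s (j + 1) := by
  rw [schurEnergy, hop_flow, schurEnergy, Matrix.conjTranspose_smul, star_trivial, Matrix.smul_mul,
    Matrix.smul_mul, Matrix.mul_smul, smul_smul, ← Real.exp_add, two_mul]
  rfl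

theorem greenChain_flow (R : ℝ) (t : ℕ → ℝ) (s : OrbitalSpace n W) (m : ℕ) :
    greenChain (flow R t s) m
      = Real.exp (∑ j ∈ Finset.range m, t j * cut R s j) • greenChain s m := by
  induction m with
  | zero => simp [greenChain]
  | succ m ih =>
    rw [greenChain, ih, hop_flow, greenChain, Matrix.conjTranspose_smul, star_trivial, Matrix.mul_smul,
      Matrix.smul_mul, Matrix.mul_smul, smul_smul, ← Real.exp_add, Finset.sum_range_succ]
    rfl

theorem schurX_of_cornerGreen_smul {s s' : OrbitalSpace n W} {y : ℝ}
    (h : cornerGreen s' = Real.exp y • cornerGreen s)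
    (hs : 0 < ‖Matrix.toEuclideanCLM (𝕜 := ℂ) (cornerGreen s)‖) : schurX s' = schurX s + y := by
  have e : Matrix.toEuclideanCLM (𝕜 := ℂ) (cornerGreen s')
      = ((Real.exp y : ℝ) : ℂ) • Matrix.toEuclideanCLM (𝕜 := ℂ) (cornerGreen s) := by
    rw [← map_smul, h]; rfl
  rw [schurX, schurX, e, norm_smul, Complex.norm_real, Real.norm_of_nonneg (Real.exp_pos _).le,
    Real.log_mul (Real.exp_pos _).ne' hs.ne', Real.log_exp, add_comm]

/-- Each hopping matrix enters the product for the corner block exactly once, so the scalings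
multiply. -/
theorem schurX_flow (R : ℝ) (t : ℕ → ℝ) {s : OrbitalSpace n W}
    (hs : 0 < ‖Matrix.toEuclideanCLM (𝕜 := ℂ) (cornerGreen s)‖) :
    schurX (flow R t s) = schurX s + ∑ j ∈ Finset.range (n - 1), t j * cut R s j := by
  refine schurX_of_cornerGreen_smul ?_ hs
  rw [cornerGreen, greenChain_flow, Matrix.smul_mul, cornerGreen]
  rfl

theorem energy_eq_range (hn : 0 < n) (ω : OrbitalSpace n W) :
    energy ω = frobSq (siteV ω 0)
      + ∑ j ∈ Finset.range (n - 1), (frobSq (siteV ω (j + 1)) + frobSq (hop ω j)) := by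
  have h1 : ∀ j : Fin n, frobSq (hermitianOf (ω.1 j)) = (fun k : ℕ => frobSq (siteV ω k)) j := by
    intro j
    simp only [siteV, dif_pos j.isLt]; rfl
  have h2 : ∀ j : Fin (n - 1), frobSq (Matrix.of (ω.2 j)) = (fun k : ℕ => frobSq (hop ω k)) j := by
    intro j
    simp only [hop, dif_pos j.isLt]; rfl
  rw [energy_eq]
  simp_rw [h1, h2]
  rw [Fin.sum_univ_eq_sum_range (fun k => frobSq (siteV ω k)) n,
    Fin.sum_univ_eq_sum_range (fun k => frobSq (hop ω k)) (n - 1), Finset.sum_add_distrib, ← add_assoc]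
  congr 1
  obtain ⟨k, rfl⟩ : ∃ k, n = k + 1 := ⟨n - 1, by omega⟩
  rw [Finset.sum_range_succ', Nat.add_sub_cancel, add_comm]

theorem siteV_ofSchur_flow (z R : ℝ) (t : ℕ → ℝ) (s : OrbitalSpace n W) {j : ℕ} (hj : j + 1 < n) :
    siteV (ofSchur z (flow R t s)) (j + 1) = siteV (ofSchur z s) (j + 1)
      + (Real.exp (2 * (t j * cut R s j)) - 1) • schurEnergy s (j + 1) := by
  rw [siteV_ofSchur z _ hj, siteV_ofSchur z _ hj, schurEnergy_flow, sub_smul, one_smul]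
  have : siteV (flow R t s) (j + 1) = siteV s (j + 1) := rfl
  rw [this]
  abel

/-- At fixed Schur complements, scaling the j-th hopping matrix moves only that matrix and the
diagonal block at j + 1, the latter along its self-energy; the first diagonal block never moves. The
self-energy is charged to R² by the cutoff, everything else to the energy. -/
theorem energy_flow_pair_le (hn : 0 < n) (z : ℝ) {R : ℝ} (hR : 0 < R) {t : ℕ → ℝ}
    (ht : ∀ j, |t j| ≤ 1 / 2) {τ : ℝ} (hτ : ∀ j, t j ^ 2 ≤ τ) (s : OrbitalSpace n W) :
    energy (ofSchur z (flow R t s)) + energy (ofSchur z (flow R (fun j => -t j) s))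
      ≤ 2 * energy (ofSchur z s) + 48 * (τ * energy (ofSchur z s)
        + R ^ 2 * ∑ j ∈ Finset.range (n - 1), t j ^ 2) := by
  have hτ0 : 0 ≤ τ := (sq_nonneg _).trans (hτ 0)
  set ω := ofSchur z s with hω
  have h0 : ∀ t : ℕ → ℝ, siteV (ofSchur z (flow R t s)) 0 = siteV ω 0 := by
    intro t
    rw [hω, siteV_ofSchur z _ hn, siteV_ofSchur z _ hn]; rfl
  have hterm : ∀ j ∈ Finset.range (n - 1),
      (frobSq (siteV (ofSchur z (flow R t s)) (j + 1)) + frobSq (hop (ofSchur z (flow R t s)) j))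
      + (frobSq (siteV (ofSchur z (flow R (fun j => -t j) s)) (j + 1))
        + frobSq (hop (ofSchur z (flow R (fun j => -t j) s)) j))
      ≤ 2 * (frobSq (siteV ω (j + 1)) + frobSq (hop ω j))
        + 48 * (τ * (frobSq (siteV ω (j + 1)) + frobSq (hop ω j)) + R ^ 2 * t j ^ 2) := by
    intro j hj
    have hj' : j + 1 < n := by have := Finset.mem_range.1 hj; omega
    have hc0 := cut_nonneg hR s j
    have hc1 := cut_le_one hR s j
    have hx : |t j * cut R s j| ≤ 1 / 2 := by
      rw [abs_mul, abs_of_nonneg hc0]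
      calc |t j| * cut R s j ≤ 1 / 2 * 1 := mul_le_mul (ht j) hc1 hc0 (by norm_num)
        _ = 1 / 2 := mul_one _
    have hp := frobSq_pair_le (siteV ω (j + 1)) (schurEnergy s (j + 1)) (hop s j) hx
    rw [siteV_ofSchur_flow z R t s hj', siteV_ofSchur_flow z R (fun j => -t j) s hj', hop_ofSchur,
      hop_ofSchur, hop_flow, hop_flow, neg_mul, mul_neg, hω, hop_ofSchur, ← hω]
    refine hp.trans ?_
    have hV := frobSq_nonneg (siteV ω (j + 1))
    have hT := frobSq_nonneg (hop s j)
    have hA := frobSq_nonneg (schurEnergy s (j + 1))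
    have e1 : (t j * cut R s j) ^ 2 ≤ τ := by
      rw [mul_pow]
      calc t j ^ 2 * cut R s j ^ 2 ≤ t j ^ 2 * 1 :=
            mul_le_mul_of_nonneg_left (pow_le_one₀ hc0 hc1) (sq_nonneg _)
        _ ≤ τ := by rw [mul_one]; exact hτ j
    have e2 : (t j * cut R s j) ^ 2 * frobSq (schurEnergy s (j + 1)) ≤ R ^ 2 * t j ^ 2 := by
      rw [mul_pow, mul_assoc, mul_comm]
      exact mul_le_mul_of_nonneg_right (cut_sq_mul_le hR s j) (sq_nonneg _)
    have e3 := mul_le_mul_of_nonneg_right e1 (add_nonneg hV hT)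
    nlinarith
  have hsum := Finset.sum_le_sum hterm
  have hright : ∑ j ∈ Finset.range (n - 1), (2 * (frobSq (siteV ω (j + 1)) + frobSq (hop ω j))
        + 48 * (τ * (frobSq (siteV ω (j + 1)) + frobSq (hop ω j)) + R ^ 2 * t j ^ 2))
      = 2 * (∑ j ∈ Finset.range (n - 1), (frobSq (siteV ω (j + 1)) + frobSq (hop ω j)))
        + 48 * (τ * (∑ j ∈ Finset.range (n - 1), (frobSq (siteV ω (j + 1)) + frobSq (hop ω j)))
          + R ^ 2 * ∑ j ∈ Finset.range (n - 1), t j ^ 2) := by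
    simp only [Finset.mul_sum, ← Finset.sum_add_distrib]
  rw [hright, Finset.sum_add_distrib] at hsum
  rw [energy_eq_range hn, energy_eq_range hn (ofSchur z (flow R (fun j => -t j) s)), energy_eq_range hn ω,
    h0, h0]
  have h00 := mul_nonneg hτ0 (frobSq_nonneg (siteV ω 0))
  nlinarith

/-- The factors containing the dimension cancel between t and -t. Only the contribution from the
derivative of the cutoff survives, with no power of W. -/
theorem flowJac_pair_ge {R : ℝ} (hR : 0 < R) {t : ℕ → ℝ} (ht : ∀ j, |t j| ≤ 1 / 2)
    (s : OrbitalSpace n W) :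
    Real.exp (-∑ j ∈ Finset.range (n - 1), t j ^ 2)
      ≤ flowJac R t s * flowJac R (fun j => -t j) s := by
  rw [flowJac_eq, flowJac_eq, ← Finset.prod_mul_distrib,
    ← Fin.sum_univ_eq_sum_range (fun j => t j ^ 2), ← Finset.sum_neg_distrib, Real.exp_sum]
  refine Finset.prod_le_prod (fun j _ => (Real.exp_pos _).le) fun j _ => ?_
  refine (exp_neg_sq_le (ht j) (cut_nonneg hR s j) (cut_le_one hR s j)).trans (le_of_eq ?_)
  symm
  rw [mul_mul_mul_comm, ← Real.exp_add]
  have : (Module.finrank ℝ (Fin W → Fin W → ℂ) : ℝ) * (t j * cut R s j)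
      + Module.finrank ℝ (Fin W → Fin W → ℂ) * (-t j * cut R s j) = 0 := by ring
  rw [this, Real.exp_zero, one_mul]

/-- The window bound obtained from the flow of the hopping matrices. -/
theorem tiltedMass_window_of_flow (hn : 0 < n) (hW : 0 < W) (z q c : ℝ) {R : ℝ} (hR : 0 < R)
    {t : ℕ → ℝ} (ht : ∀ j, |t j| ≤ 1 / 2) {τ : ℝ} (hτ : ∀ j, t j ^ 2 ≤ τ) {Emax : ℝ}
    (hcost : 48 * W * (τ * Emax + R ^ 2 * ∑ j ∈ Finset.range (n - 1), t j ^ 2)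
      + ∑ j ∈ Finset.range (n - 1), t j ^ 2 ≤ 2) {α : ℝ} {B : Set (OrbitalSpace n W)}
    (hB : MeasurableSet B)
    (hoff : ∀ ω ∉ B, energy ω ≤ Emax ∧ 3 * α ≤ ∑ j ∈ Finset.range (n - 1),
      t j * (1 + Real.sqrt (frobSq (selfEnergy z ω (j + 1))) / R)⁻¹) :
    tiltedMass W hn z q {ω | |X hn z ω - c| ≤ α}
      ≤ ENNReal.ofReal (Real.exp (-1))⁻¹ * (tiltedMass W hn z q {ω | 2 * α ≤ X hn z ω - c} ^ (1 / 2 : ℝ)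
        * tiltedMass W hn z q {ω | X hn z ω - c ≤ -2 * α} ^ (1 / 2 : ℝ))
        + tiltedMass W hn z q B := by
  have ht' : ∀ j, |(-t j)| ≤ 1 / 2 := fun j => by rw [abs_neg]; exact ht j
  refine tiltedMass_window_le hn hW z q (measurable_flow R t) (measurable_flow R fun j => -t j)
    (measurable_flowJac R t) (measurable_flowJac R fun j => -t j)
    (fun F hF => lintegral_flow hW hR ht hF) (fun F hF => lintegral_flow hW hR ht' hF)
    (N := fun s => ∑ j ∈ Finset.range (n - 1), t j * cut R s j) (Real.exp_pos _) hB ?_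
  filter_upwards [ae_cornerGreen_norm_pos hn hW] with s hs hsB
  obtain ⟨hE, hN⟩ := hoff _ hsB
  have hnn : ∀ t : ℕ → ℝ, (∀ j, |t j| ≤ 1 / 2) → 0 ≤ flowJac R t s := fun t ht =>
    Finset.prod_nonneg fun j _ => radialJac_nonneg (fun T => hopSize_nonneg hR _ _) (ht j) _
  refine ⟨schurX_flow R t hs, ?_, ?_, hnn t ht, hnn _ ht', ?_⟩
  · rw [schurX_flow R _ hs, sub_eq_add_neg, ← Finset.sum_neg_distrib]
    simp only [neg_mul]
  · refine hN.trans (le_of_eq (Finset.sum_congr rfl fun j hj => ?_))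
    rw [selfEnergy_ofSchur z s (by have := Finset.mem_range.1 hj; omega)]
    rfl
  -- The total loss in the exponent for the pair is at most 2, by `hcost`; hence κ = exp (-1).
  · have h1 := energy_flow_pair_le hn z hR ht hτ s
    have h2 := flowJac_pair_ge (n := n) (W := W) hR ht s
    have hτ0 : 0 ≤ τ := (sq_nonneg _).trans (hτ 0)
    have hW' : (0 : ℝ) < W := by exact_mod_cast hW
    set S2 := ∑ j ∈ Finset.range (n - 1), t j ^ 2
    set e₁ := energy (ofSchur z (flow R t s)) with he₁
    set e₂ := energy (ofSchur z (flow R (fun j => -t j) s)) with he₂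
    set e₀ := energy (ofSchur z s) with he₀
    have h3 : schurDensity z (flow R t s) * schurDensity z (flow R (fun j => -t j) s)
        = Real.exp (-(W * (e₁ + e₂))) := by
      rw [schurDensity, schurDensity, ← Real.exp_add]; congr 1; ring
    have h4 : τ * e₀ ≤ τ * Emax := mul_le_mul_of_nonneg_left hE hτ0
    have h5 : W * (e₁ + e₂) ≤ W * (2 * e₀ + 48 * (τ * Emax + R ^ 2 * S2)) :=
      mul_le_mul_of_nonneg_left (by linarith) hW'.le
    calc Real.exp (-1) ^ 2 * schurDensity z s ^ 2 = Real.exp (-2 - W * (2 * e₀)) := by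
          rw [schurDensity, ← Real.exp_nat_mul, ← Real.exp_nat_mul, ← Real.exp_add, ← he₀]
          congr 1; push_cast; ring
      _ ≤ Real.exp (-(W * (e₁ + e₂)) + -S2) := Real.exp_le_exp.2 (by linarith)
      _ = Real.exp (-(W * (e₁ + e₂))) * Real.exp (-S2) := Real.exp_add _ _
      _ ≤ Real.exp (-(W * (e₁ + e₂))) * (flowJac R t s * flowJac R (fun j => -t j) s) := by gcongr
      _ = _ := by rw [← h3]; ring

end OrbitalSpace

/-! ### Rescaling the first site. -/

namespace OrbitalSpace

variable {n W : ℕ}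

theorem finrank_orbitalSpace (n W : ℕ) :
    Module.finrank ℝ (OrbitalSpace n W) = n * (W * W) + (n - 1) * (W * (W * 2)) := by
  rw [Module.finrank_prod, Module.finrank_pi_fintype, Module.finrank_pi_fintype]
  simp [Module.finrank_pi_fintype, Complex.finrank_real_complex]

/-- The dimension is at most 3nW² and the threshold for the form is 4nW²: 7/10 · 3 - 3/4 · 4 =
-9/10. -/
theorem orbitalLaw_energy_gt (hW : 0 < W) :
    orbitalLaw n W {ω | 4 * n * W < energy ω} ≤ ENNReal.ofReal (Real.exp (-(9 / 10 * (n * W ^ 2)))) := by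
  have h := (isGaussForm_formO (n := n) hW).self_tail (μ := volume) (4 * n * W ^ 2)
  rw [← orbitalLaw_eq_gaussLaw, finrank_orbitalSpace] at h
  have hW' : (0 : ℝ) < W := by exact_mod_cast hW
  refine (measure_mono fun ω hω => ?_).trans (h.trans (ENNReal.ofReal_le_ofReal (Real.exp_le_exp.2 ?_)))
  · have hω' : 4 * n * W < energy ω := hω
    change 4 * n * (W : ℝ) ^ 2 ≤ formO n W ω ω
    rw [formO_self]
    nlinarith
  · have h1 : ((n - 1 : ℕ) : ℝ) ≤ n := by exact_mod_cast Nat.sub_le n 1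
    push_cast
    have h2 : ((n - 1 : ℕ) : ℝ) * (W * (W * 2)) ≤ n * (W * (W * 2)) := by gcongr
    nlinarith

/-- Scaling of the first Schur complement and of the first hopping matrix. -/
def scaleFirst (d : ℝ) (s : OrbitalSpace n W) : OrbitalSpace n W :=
  (fun j => Real.exp (if j.val = 0 then 2 * d else 0) • s.1 j,
    fun j => Real.exp (if j.val = 0 then d else 0) • s.2 j)

/-- The Jacobian of `scaleFirst`. -/
def scaleFirstJac (n W : ℕ) (d : ℝ) : ℝ :=
  (∏ j : Fin n, Real.exp (Module.finrank ℝ (Fin W → Fin W → ℝ) * if j.val = 0 then 2 * d else 0))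
    * ∏ j : Fin (n - 1), Real.exp (Module.finrank ℝ (Fin W → Fin W → ℂ) * if j.val = 0 then d else 0)

theorem scaleFirstJac_pos (n W : ℕ) (d : ℝ) : 0 < scaleFirstJac n W d :=
  mul_pos (Finset.prod_pos fun _ _ => Real.exp_pos _) (Finset.prod_pos fun _ _ => Real.exp_pos _)

theorem scaleFirstJac_mul_neg (n W : ℕ) (d : ℝ) : scaleFirstJac n W d * scaleFirstJac n W (-d) = 1 := by
  unfold scaleFirstJac
  rw [mul_mul_mul_comm, ← Finset.prod_mul_distrib, ← Finset.prod_mul_distrib, Finset.prod_eq_one,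
    Finset.prod_eq_one, one_mul]
  · intro j _
    rw [← Real.exp_add, Real.exp_eq_one_iff]
    split_ifs <;> ring
  · intro j _
    rw [← Real.exp_add, Real.exp_eq_one_iff]
    split_ifs <;> ring

theorem measurable_scaleFirst (d : ℝ) : Measurable (scaleFirst (n := n) (W := W) d) := by
  refine Measurable.prodMk (measurable_pi_iff.2 fun j => ?_) (measurable_pi_iff.2 fun j => ?_)
  · have h : Measurable fun s : OrbitalSpace n W => s.1 j := (measurable_pi_apply j).comp measurable_fst
    exact (measurable_const_smul (Real.exp _)).comp h
  · have h : Measurable fun s : OrbitalSpace n W => s.2 j := (measurable_pi_apply j).comp measurable_snd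
    exact (measurable_const_smul (Real.exp _)).comp h

theorem lintegral_scaleFirst (d : ℝ) {F : OrbitalSpace n W → ℝ≥0∞} (hF : Measurable F) :
    ∫⁻ s, F (scaleFirst d s) * ENNReal.ofReal (scaleFirstJac n W d) = ∫⁻ s, F s := by
  have hm : Measurable fun s : OrbitalSpace n W =>
      F (scaleFirst d s) * ENNReal.ofReal (scaleFirstJac n W d) :=
    (hF.comp (measurable_scaleFirst d)).mul_const _
  rw [Measure.volume_eq_prod, lintegral_prod _ hm.aemeasurable, lintegral_prod _ hF.aemeasurable]
  set sc : (Fin n → Fin W → Fin W → ℝ) → Fin n → Fin W → Fin W → ℝ :=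
    fun v j => Real.exp (if j.val = 0 then 2 * d else 0) • v j with hsc
  set JV := ∏ j : Fin n, Real.exp (Module.finrank ℝ (Fin W → Fin W → ℝ) * if j.val = 0 then 2 * d else 0)
    with hJV
  have hJV0 : 0 ≤ JV := Finset.prod_nonneg fun _ _ => (Real.exp_pos _).le
  have hT : ∀ v, ∫⁻ T, F (scaleFirst d (v, T)) * ENNReal.ofReal (scaleFirstJac n W d)
      = ENNReal.ofReal JV * ∫⁻ T, F (sc v, T) := by
    intro v
    have h := lintegral_pi_flow (ι := Fin (n - 1)) (volume : Measure (Fin W → Fin W → ℂ))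
      (θ := fun j x => Real.exp (if j.val = 0 then d else 0) • x)
      (J := fun j _ => ENNReal.ofReal
        (Real.exp (Module.finrank ℝ (Fin W → Fin W → ℂ) * if j.val = 0 then d else 0)))
      (fun j => measurable_const_smul _) (fun j => measurable_const)
      (fun j G hG => lintegral_exp_smul volume _ hG)
      (F := fun T => F (sc v, T)) (hF.comp (measurable_const.prodMk measurable_id))
    have hm2 : Measurable fun T : Fin (n - 1) → Fin W → Fin W → ℂ => F (scaleFirst d (v, T)) :=
      (hF.comp (measurable_scaleFirst d)).comp (measurable_const.prodMk measurable_id)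
    rw [lintegral_mul_const _ hm2] at *
    rw [← ENNReal.ofReal_prod_of_nonneg fun _ _ => (Real.exp_pos _).le] at h
    rw [lintegral_mul_const _ (by exact hm2)] at h
    rw [scaleFirstJac, ENNReal.ofReal_mul hJV0, ← mul_assoc, mul_comm _ (ENNReal.ofReal JV), mul_assoc]
    congr 1
  simp_rw [hT]
  set G : (Fin n → Fin W → Fin W → ℝ) → ℝ≥0∞ := fun v => ∫⁻ T, F (v, T) with hG
  have hGm : Measurable G := hF.lintegral_prod_right'
  have h := lintegral_pi_flow (ι := Fin n) (volume : Measure (Fin W → Fin W → ℝ))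
      (θ := fun j x => Real.exp (if j.val = 0 then 2 * d else 0) • x)
      (J := fun j _ => ENNReal.ofReal
        (Real.exp (Module.finrank ℝ (Fin W → Fin W → ℝ) * if j.val = 0 then 2 * d else 0)))
      (fun j => measurable_const_smul _) (fun j => measurable_const)
      (fun j G hG => lintegral_exp_smul volume _ hG) hGm
  rw [← ENNReal.ofReal_prod_of_nonneg fun _ _ => (Real.exp_pos _).le] at h
  refine Eq.trans (lintegral_congr fun v => ?_) h
  rw [mul_comm]

theorem siteV_scaleFirst (d : ℝ) (s : OrbitalSpace n W) (j : ℕ) :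
    siteV (scaleFirst d s) j = Real.exp (if j = 0 then 2 * d else 0) • siteV s j := by
  unfold siteV
  split_ifs with h1 h2
  · subst h2
    change hermitianOf ((scaleFirst d s).1 ⟨0, h1⟩) = _
    simp only [scaleFirst, if_true, hermitianOf_smul]
    rfl
  · change hermitianOf ((scaleFirst d s).1 ⟨j, h1⟩) = _
    simp only [scaleFirst, h2, if_false, hermitianOf_smul]
    rfl
  · simp
  · simp

theorem hop_scaleFirst (d : ℝ) (s : OrbitalSpace n W) (j : ℕ) :
    hop (scaleFirst d s) j = Real.exp (if j = 0 then d else 0) • hop s j := by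
  unfold hop
  split_ifs with h1 h2
  · subst h2; simp only [T, scaleFirst, if_true]; rfl
  · simp only [T, scaleFirst, h2, if_false]; rfl
  · simp
  · simp

theorem inv_real_smul {r : ℝ} (hr : r ≠ 0) (A : Matrix (Fin W) (Fin W) ℂ) :
    (r • A)⁻¹ = r⁻¹ • A⁻¹ := by
  by_cases hA : IsUnit A.det
  · refine Matrix.inv_eq_left_inv ?_
    rw [Matrix.smul_mul, Matrix.mul_smul, smul_smul, inv_mul_cancel₀ hr, one_smul,
      Matrix.nonsing_inv_mul _ hA]
  · have h2 : ¬ IsUnit (r • A).det := by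
      intro h
      have e : A = r⁻¹ • (r • A) := by rw [smul_smul, inv_mul_cancel₀ hr, one_smul]
      refine hA ?_
      rw [isUnit_iff_ne_zero] at h ⊢
      intro h0
      apply h
      have e2 : r • A = ((r : ℝ) : ℂ) • A := rfl
      rw [e2, Matrix.det_smul, h0, mul_zero]
    rw [Matrix.nonsing_inv_apply_not_isUnit _ hA, Matrix.nonsing_inv_apply_not_isUnit _ h2, smul_zero]

/-- The exponents 2d and d are matched so that T_0 S_0⁻¹ T_0* is invariant; no diagonal block beyond
the first feels the change, and no cutoff is needed. -/
theorem schurEnergy_scaleFirst (d : ℝ) (s : OrbitalSpace n W) (j : ℕ) :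
    schurEnergy (scaleFirst d s) j = schurEnergy s j := by
  cases j with
  | zero => rfl
  | succ j =>
    have : (if j = 0 then d else 0) * 2 - (if j = 0 then 2 * d else 0) = 0 := by
      split_ifs <;> ring
    rw [schurEnergy, schurEnergy, hop_scaleFirst, siteV_scaleFirst, inv_real_smul (Real.exp_pos _).ne',
      Matrix.conjTranspose_smul, star_trivial, Matrix.smul_mul, Matrix.smul_mul, Matrix.mul_smul,
      Matrix.mul_smul, Matrix.smul_mul, smul_smul, smul_smul, ← Real.exp_neg, ← Real.exp_add,
      ← Real.exp_add]
    generalize (if j = 0 then d else 0) = u at *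
    generalize (if j = 0 then 2 * d else 0) = v at *
    rw [show u + u + -v = 0 by linarith, Real.exp_zero, one_smul]

theorem greenChain_scaleFirst (d : ℝ) (s : OrbitalSpace n W) (m : ℕ) :
    greenChain (scaleFirst d s) (m + 1) = Real.exp (-d) • greenChain s (m + 1) := by
  have hstep : ∀ j, (siteV (scaleFirst d s) j)⁻¹ * (hop (scaleFirst d s) j)ᴴ
      = Real.exp (if j = 0 then -d else 0) • ((siteV s j)⁻¹ * (hop s j)ᴴ) := by
    intro j
    rw [hop_scaleFirst, siteV_scaleFirst, inv_real_smul (Real.exp_pos _).ne',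
      Matrix.conjTranspose_smul, star_trivial, Matrix.smul_mul, Matrix.mul_smul, smul_smul,
      ← Real.exp_neg, ← Real.exp_add]
    congr 2
    split_ifs <;> ring
  induction m with
  | zero => rw [greenChain, greenChain, greenChain, hstep, if_pos rfl, one_mul, greenChain, one_mul]
  | succ m ih =>
    rw [greenChain, ih, hstep, if_neg (Nat.succ_ne_zero m), Real.exp_zero, one_smul, Matrix.smul_mul]
    rfl

/-- Only the factor S_0⁻¹ T_0* changes, by e^{-2d} e^d. The bound 2 ≤ n keeps the last site distinct
from the first. -/
theorem schurX_scaleFirst (hn : 2 ≤ n) (d : ℝ) {s : OrbitalSpace n W}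
    (hs : 0 < ‖Matrix.toEuclideanCLM (𝕜 := ℂ) (cornerGreen s)‖) :
    schurX (scaleFirst d s) = schurX s + -d := by
  refine schurX_of_cornerGreen_smul ?_ hs
  obtain ⟨m, rfl⟩ : ∃ m, n = m + 2 := ⟨n - 2, by omega⟩
  rw [cornerGreen, cornerGreen, siteV_scaleFirst, if_neg (by omega), Real.exp_zero, one_smul]
  have : m + 2 - 1 = m + 1 := rfl
  rw [this, greenChain_scaleFirst, Matrix.smul_mul]

/-- V_0 moves along V_0 - z, since no self-energy enters at the first site; this is the source of
the term z²W. -/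
theorem energy_scaleFirst_pair_le (hn : 2 ≤ n) (z : ℝ) {d : ℝ} (hd : |d| ≤ 1 / 2)
    (s : OrbitalSpace n W) :
    energy (ofSchur z (scaleFirst d s)) + energy (ofSchur z (scaleFirst (-d) s))
      ≤ 2 * energy (ofSchur z s) + 48 * d ^ 2 * (3 * energy (ofSchur z s) + 2 * z ^ 2 * W) := by
  set ω := ofSchur z s with hω
  obtain ⟨m, rfl⟩ : ∃ m, n = m + 2 := ⟨n - 2, by omega⟩
  have hE : ∀ ω : OrbitalSpace (m + 2) W, energy ω = frobSq (siteV ω 0) + frobSq (hop ω 0)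
      + (frobSq (siteV ω 1) + ∑ j ∈ Finset.range m, (frobSq (siteV ω (j + 2)) + frobSq (hop ω (j + 1)))) := by
    intro ω
    rw [energy_eq_range (by omega)]
    have : m + 2 - 1 = m + 1 := rfl
    rw [this, Finset.sum_range_succ']
    ring
  have h0 : ∀ d : ℝ, siteV (ofSchur z (scaleFirst d s)) 0
      = siteV ω 0 + (Real.exp (2 * d) - 1) • (siteV ω 0 - (z : ℂ) • 1) := by
    intro d
    rw [hω, siteV_ofSchur z _ (by omega), siteV_ofSchur z _ (by omega), siteV_scaleFirst, if_pos rfl,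
      schurEnergy, schurEnergy, sub_smul, one_smul, add_zero, add_zero, add_sub_cancel_right]
    abel
  have hj : ∀ d : ℝ, ∀ j, j + 1 < m + 2 → siteV (ofSchur z (scaleFirst d s)) (j + 1) = siteV ω (j + 1) := by
    intro d j hj
    rw [hω, siteV_ofSchur z _ hj, siteV_ofSchur z _ hj, siteV_scaleFirst, schurEnergy_scaleFirst,
      if_neg (Nat.succ_ne_zero j), Real.exp_zero, one_smul]
  have ht0 : ∀ d : ℝ, hop (ofSchur z (scaleFirst d s)) 0 = Real.exp d • hop ω 0 := by
    intro d
    rw [hω, hop_ofSchur, hop_ofSchur, hop_scaleFirst, if_pos rfl]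
  have htj : ∀ d : ℝ, ∀ j, hop (ofSchur z (scaleFirst d s)) (j + 1) = hop ω (j + 1) := by
    intro d j
    rw [hω, hop_ofSchur, hop_ofSchur, hop_scaleFirst, if_neg (Nat.succ_ne_zero j), Real.exp_zero, one_smul]
  have hrest : ∀ d : ℝ, frobSq (siteV (ofSchur z (scaleFirst d s)) 1) + ∑ j ∈ Finset.range m,
      (frobSq (siteV (ofSchur z (scaleFirst d s)) (j + 2)) + frobSq (hop (ofSchur z (scaleFirst d s)) (j + 1)))
      = frobSq (siteV ω 1) + ∑ j ∈ Finset.range m,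
        (frobSq (siteV ω (j + 2)) + frobSq (hop ω (j + 1))) := by
    intro d
    rw [hj d 0 (by omega)]
    congr 1
    refine Finset.sum_congr rfl fun j hjm => ?_
    have := Finset.mem_range.1 hjm
    rw [hj d (j + 1) (by omega), htj]
  rw [hE, hE (ofSchur z (scaleFirst (-d) s)), hE ω, hrest, hrest, h0, h0, ht0, ht0, mul_neg]
  have hp := frobSq_pair_le (siteV ω 0) (siteV ω 0 - (z : ℂ) • 1) (hop ω 0) hd
  have hA : frobSq (siteV ω 0 - (z : ℂ) • 1) ≤ 2 * frobSq (siteV ω 0) + 2 * (z ^ 2 * W) := by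
    have e : siteV ω 0 - (z : ℂ) • 1 = siteV ω 0 + (-z) • (1 : Matrix (Fin W) (Fin W) ℂ) := by
      rw [sub_eq_add_neg, neg_smul]; rfl
    have h1 : frobSq (1 : Matrix (Fin W) (Fin W) ℂ) = W := by
      unfold frobSq
      simp [Matrix.one_apply, apply_ite, Finset.sum_ite_eq]
    have h2 := (mul_le_mul_of_nonneg_left (le_abs_self (frobInner (siteV ω 0)
      ((-z) • (1 : Matrix (Fin W) (Fin W) ℂ)))) zero_le_two).trans (two_abs_frobInner_le _ _)
    rw [e, frobSq_add]
    have h3 : frobSq ((-z) • (1 : Matrix (Fin W) (Fin W) ℂ)) = z ^ 2 * W := by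
      rw [frobSq_smul, h1, neg_sq]
    rw [h3] at h2 ⊢
    linarith
  have hT := frobSq_nonneg (hop ω 0)
  have hV := frobSq_nonneg (siteV ω 0)
  have hR : 0 ≤ frobSq (siteV ω 1) + ∑ j ∈ Finset.range m,
      (frobSq (siteV ω (j + 2)) + frobSq (hop ω (j + 1))) :=
    add_nonneg (frobSq_nonneg _) (Finset.sum_nonneg fun j _ =>
      add_nonneg (frobSq_nonneg _) (frobSq_nonneg _))
  set rest := frobSq (siteV ω 1) + ∑ j ∈ Finset.range m,
      (frobSq (siteV ω (j + 2)) + frobSq (hop ω (j + 1)))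
  have hd2 := sq_nonneg d
  have i1 := mul_le_mul_of_nonneg_left hA hd2
  have i2 := mul_nonneg hd2 hR
  have i3 := mul_nonneg hd2 hT
  nlinarith

/-- The window bound obtained by scaling the first Schur complement. -/
theorem tiltedMass_window_of_scaleFirst (hn : 2 ≤ n) (hW : 0 < W) (z q c : ℝ) {α : ℝ}
    (hα : |3 * α| ≤ 1 / 2) {Emax : ℝ}
    (hcost : 48 * W * ((3 * α) ^ 2 * (3 * Emax + 2 * z ^ 2 * W)) ≤ 2) {B : Set (OrbitalSpace n W)}
    (hB : MeasurableSet B) (hoff : ∀ ω ∉ B, energy ω ≤ Emax) (hn' : 0 < n) :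
    tiltedMass W hn' z q {ω | |X hn' z ω - c| ≤ α}
      ≤ ENNReal.ofReal (Real.exp (-1))⁻¹ * (tiltedMass W hn' z q {ω | 2 * α ≤ X hn' z ω - c} ^ (1 / 2 : ℝ)
        * tiltedMass W hn' z q {ω | X hn' z ω - c ≤ -2 * α} ^ (1 / 2 : ℝ))
        + tiltedMass W hn' z q B := by
  refine tiltedMass_window_le hn' hW z q (measurable_scaleFirst (-(3 * α))) (measurable_scaleFirst (3 * α))
    (J₁ := fun _ => scaleFirstJac n W (-(3 * α))) (J₂ := fun _ => scaleFirstJac n W (3 * α))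
    measurable_const measurable_const
    (fun F hF => lintegral_scaleFirst _ hF) (fun F hF => lintegral_scaleFirst _ hF)
    (N := fun s => 3 * α) (Real.exp_pos _) hB ?_
  filter_upwards [ae_cornerGreen_norm_pos hn' hW] with s hs hsB
  have hE := hoff _ hsB
  refine ⟨?_, ?_, le_rfl, (scaleFirstJac_pos _ _ _).le, (scaleFirstJac_pos _ _ _).le, ?_⟩
  · rw [schurX_scaleFirst hn _ hs, neg_neg]
  · rw [schurX_scaleFirst hn _ hs, sub_eq_add_neg]
  · have h1 := energy_scaleFirst_pair_le hn z hα s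
    have hW' : (0 : ℝ) < W := by exact_mod_cast hW
    set d := 3 * α with hd
    set e₁ := energy (ofSchur z (scaleFirst d s))
    set e₂ := energy (ofSchur z (scaleFirst (-d) s))
    set e₀ := energy (ofSchur z s) with he₀
    have h3 : schurDensity z (scaleFirst (-d) s) * scaleFirstJac n W (-d)
        * (schurDensity z (scaleFirst d s) * scaleFirstJac n W d) = Real.exp (-(W * (e₁ + e₂))) := by
      rw [mul_mul_mul_comm, mul_comm (scaleFirstJac n W (-d)), scaleFirstJac_mul_neg, mul_one,
        schurDensity, schurDensity, ← Real.exp_add]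
      congr 1; ring
    rw [h3, schurDensity, ← Real.exp_nat_mul, ← Real.exp_nat_mul, ← Real.exp_add, ← he₀]
    refine Real.exp_le_exp.2 ?_
    have h4 : d ^ 2 * (3 * e₀ + 2 * z ^ 2 * W) ≤ d ^ 2 * (3 * Emax + 2 * z ^ 2 * W) := by gcongr
    have h5 : W * (e₁ + e₂) ≤ W * (2 * e₀ + 48 * (d ^ 2 * (3 * Emax + 2 * z ^ 2 * W))) :=
      mul_le_mul_of_nonneg_left (by linarith) hW'.le
    push_cast
    linarith

/-- Far outside the spectrum the first self-energy is of order one. -/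
theorem frobSq_selfEnergy_one_le (z : ℝ) (hz : 1600 ≤ z ^ 2) (ω : OrbitalSpace n W)
    (hV : ‖Matrix.toEuclideanCLM (𝕜 := ℂ) (siteV ω 0)‖ ≤ 20)
    (hT : ‖Matrix.toEuclideanCLM (𝕜 := ℂ) (hop ω 0)‖ ≤ 20) :
    frobSq (selfEnergy z ω 1) ≤ 400 * W := by
  have h1 : frobSq (1 : Matrix (Fin W) (Fin W) ℂ) = W := by
    unfold frobSq
    simp [Matrix.one_apply, apply_ite, Finset.sum_ite_eq]
  have e : selfEnergy z ω 1 = hop ω 0 * (siteV ω 0 - (z : ℂ) • 1)⁻¹ * (hop ω 0)ᴴ := by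
    rw [selfEnergy, selfEnergy, sub_zero]
  rw [e]
  set Γ := (siteV ω 0 - (z : ℂ) • (1 : Matrix (Fin W) (Fin W) ℂ))⁻¹ with hΓ
  have hQ := frobSq_nonneg Γ
  have hΓle : frobSq Γ ≤ W / 400 := by
    by_cases hu : IsUnit (siteV ω 0 - (z : ℂ) • (1 : Matrix (Fin W) (Fin W) ℂ)).det
    swap
    · rw [hΓ, Matrix.nonsing_inv_apply_not_isUnit _ hu]
      have : frobSq (0 : Matrix (Fin W) (Fin W) ℂ) = 0 := frobSq_eq_zero.2 rfl
      rw [this]; positivity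
    have h2 := Matrix.mul_nonsing_inv _ hu
    rw [← hΓ, sub_mul, Matrix.smul_mul, one_mul] at h2
    -- From (V - z)Γ = 1. Then z²‖Γ‖² ≤ 800‖Γ‖² + 2W, and z² ≥ 1600 absorbs the first term.
    have h3 : z • Γ = siteV ω 0 * Γ + (-1 : ℝ) • (1 : Matrix (Fin W) (Fin W) ℂ) := by
      rw [← h2]
      have : (z : ℂ) • Γ = z • Γ := rfl
      rw [this, neg_one_smul]; abel
    have h4 : frobSq (z • Γ) ≤ 2 * frobSq (siteV ω 0 * Γ) + 2 * W := by
      have h5 := (mul_le_mul_of_nonneg_left (le_abs_self (frobInner (siteV ω 0 * Γ)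
        ((-1 : ℝ) • (1 : Matrix (Fin W) (Fin W) ℂ)))) zero_le_two).trans (two_abs_frobInner_le _ _)
      have h6 : frobSq ((-1 : ℝ) • (1 : Matrix (Fin W) (Fin W) ℂ)) = W := by
        rw [frobSq_smul, h1]; norm_num
      rw [h3, frobSq_add]
      rw [h6] at h5 ⊢
      linarith
    have h7 : frobSq (siteV ω 0 * Γ) ≤ 400 * frobSq Γ := by
      refine (frobSq_mul_le _ _).trans (mul_le_mul_of_nonneg_right ?_ hQ)
      calc _ ≤ (20 : ℝ) ^ 2 := pow_le_pow_left₀ (norm_nonneg _) hV 2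
        _ = 400 := by norm_num
    rw [frobSq_smul] at h4
    have h8 := mul_le_mul_of_nonneg_right hz hQ
    linarith
  calc _ ≤ ‖Matrix.toEuclideanCLM (𝕜 := ℂ) (hop ω 0)‖ ^ 4 * frobSq Γ := frobSq_conj_le _ _
    _ ≤ 20 ^ 4 * (W / 400) := by gcongr
    _ = _ := by ring

end OrbitalSpace

/-! ### Window bounds and exceptional events in the three regimes. -/

namespace OrbitalSpace

variable {n W : ℕ}

theorem orbitalLaw_siteV_zero_gt (hn : 0 < n) (hW : 0 < W) :
    orbitalLaw n W {ω | 20 < ‖Matrix.toEuclideanCLM (𝕜 := ℂ) (siteV ω 0)‖}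
      ≤ ENNReal.ofReal (Real.exp (-W)) := by
  have := isProbabilityMeasure_lawV hW
  have := isProbabilityMeasure_lawT hW
  have hmp : MeasurePreserving (fun ω : OrbitalSpace n W => ω.1 ⟨0, hn⟩) (orbitalLaw n W) (lawV W) := by
    rw [orbitalLaw_eq_prod hW]
    exact (measurePreserving_eval (fun _ : Fin n => lawV W) ⟨0, hn⟩).comp measurePreserving_fst
  have hm : MeasurableSet {v | 20 < ‖Matrix.toEuclideanCLM (𝕜 := ℂ) (hermitianOf (W := W) v)‖} :=
    measurableSet_lt measurable_const entrywiseMeasurable_hermitianOf.opNorm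
  have e : {ω : OrbitalSpace n W | 20 < ‖Matrix.toEuclideanCLM (𝕜 := ℂ) (siteV ω 0)‖}
      = (fun ω : OrbitalSpace n W => ω.1 ⟨0, hn⟩) ⁻¹'
        {v | 20 < ‖Matrix.toEuclideanCLM (𝕜 := ℂ) (hermitianOf v)‖} := by
    ext ω
    rw [Set.mem_preimage, Set.mem_ofPred_eq, Set.mem_ofPred_eq, siteV, dif_pos hn]
    rfl
  rw [e, hmp.measure_preimage hm.nullMeasurableSet]
  exact lawV_opNorm_tail hW

theorem orbitalLaw_largeHop_zero (hn : 2 ≤ n) (hW : 0 < W) :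
    orbitalLaw n W (largeHop 0) ≤ ENNReal.ofReal (Real.exp (-W)) := by
  have := isProbabilityMeasure_orbitalLaw (n := n) hW
  have h := lintegral_badWeight_largeHop (n := n) hW 0 1 1 (m := 0) (by omega)
  simpa [badWeight, lintegral_indicator_one (measurableSet_largeHop 0)] using h

/-- The window bound for a chain in which most self-energies are of moderate size. -/
theorem tiltedMass_window_of_badCount (hn : 2 ≤ n) (hn' : 0 < n) (hW : 0 < W) (z q c : ℝ) {lam α : ℝ}
    (hlam : 1 ≤ lam) (hα : 0 ≤ α) (h : 10 ^ 10 * lam ^ 2 * (α ^ 2 * W ^ 3) ≤ n) :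
    tiltedMass W hn' z q {ω | |X hn' z ω - c| ≤ α}
      ≤ ENNReal.ofReal (Real.exp (-1))⁻¹ * (tiltedMass W hn' z q {ω | 2 * α ≤ X hn' z ω - c} ^ (1 / 2 : ℝ)
        * tiltedMass W hn' z q {ω | X hn' z ω - c ≤ -2 * α} ^ (1 / 2 : ℝ))
        + tiltedMass W hn' z q ({ω | 4 * n * W < energy ω} ∪ {ω | n / 2 ≤ badCount z (400 * lam * W) ω}) := by
  have hW1 : (1 : ℝ) ≤ W := by exact_mod_cast hW
  have hnr : (2 : ℝ) ≤ n := by exact_mod_cast hn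
  have hm : ((n - 1 : ℕ) : ℝ) = n - 1 := by rw [Nat.cast_sub (by omega)]; simp
  set R := 400 * lam * W with hRdef
  have hR : 0 < R := by positivity
  -- Off the bad set at least half of the n - 1 hopping matrices have cutoff at least 1/2, so the
  -- shift is at least t(n - 1)/4 = 3α.
  set t := 12 * α / (n - 1) with htdef
  have hn1 : (0 : ℝ) < n - 1 := by linarith
  have ht0 : 0 ≤ t := by positivity
  have htm : t * (n - 1) = 12 * α := by rw [htdef]; field_simp
  set A := α ^ 2 * W ^ 3 with hA
  have hA0 : 0 ≤ A := by positivity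
  have hlam2 : 1 ≤ lam ^ 2 := one_le_pow₀ hlam
  have hα2A : α ^ 2 ≤ A := le_mul_of_one_le_right (sq_nonneg _) (one_le_pow₀ hW1)
  have hAn : 10 ^ 10 * A ≤ n := by nlinarith
  have htn : t * n ≤ 24 * α := by nlinarith
  have htn2 : t ^ 2 * n ^ 2 ≤ 576 * α ^ 2 := by
    have := pow_le_pow_left₀ (by positivity) htn 2
    nlinarith
  have hαn : α ^ 2 * 10 ^ 10 ≤ n := by linarith
  have hthalf : t ≤ 1 / 2 := by
    by_contra! hcon
    have h1 : 1 / 4 ≤ t ^ 2 := by nlinarith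
    have h2 : 1 / 4 * (n : ℝ) ^ 2 ≤ t ^ 2 * n ^ 2 := by gcongr
    nlinarith
  have hsum : ∑ _j ∈ Finset.range (n - 1), t ^ 2 = t ^ 2 * (n - 1) := by
    rw [Finset.sum_const, Finset.card_range, nsmul_eq_mul, hm, mul_comm]
  have hbm : MeasurableSet {ω : OrbitalSpace n W | n / 2 ≤ badCount z R ω} := by
    have : Measurable fun ω : OrbitalSpace n W => badCount z R ω := by
      unfold badCount
      simp_rw [Finset.card_filter]
      refine Finset.measurable_fun_sum _ fun j _ => ?_
      exact Measurable.ite (measurableSet_lt measurable_const (entrywiseMeasurable_selfEnergy z _).frobSq)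
        measurable_const measurable_const
    exact measurableSet_le measurable_const this
  refine tiltedMass_window_of_flow hn' hW z q c hR (t := fun _ => t) (τ := t ^ 2) (Emax := 4 * n * W)
    (fun _ => by rwa [abs_of_nonneg ht0]) (fun _ => le_rfl) ?_
    ((measurableSet_lt measurable_const measurable_energy).union hbm) fun ω hω => ?_
  · rw [hsum, hRdef]
    have h1 : t ^ 2 * n ≤ 576 * (α ^ 2 / n) := by
      rw [← mul_div_assoc, le_div_iff₀ (by linarith)]; linarith
    have h2 : t ^ 2 * (n - 1) ≤ t ^ 2 * n := by nlinarith [sq_nonneg t]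
    have h3 : lam ^ 2 * (α ^ 2 / n * W ^ 3) ≤ 1 / 10 ^ 10 := by
      have : lam ^ 2 * (α ^ 2 / n * W ^ 3) = lam ^ 2 * A / n := by rw [hA]; ring
      rw [this, div_le_iff₀ (by linarith)]; linarith
    set a := α ^ 2 / n with ha
    have ha0 : 0 ≤ a := by positivity
    have hW2 : (W : ℝ) ^ 2 ≤ W ^ 3 := pow_le_pow_right₀ hW1 (by norm_num)
    have hW3 : (1 : ℝ) ≤ W ^ 3 := one_le_pow₀ hW1
    have hb : a * W ^ 3 ≤ 1 / 10 ^ 10 := (le_mul_of_one_le_left (by positivity) hlam2).trans h3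
    have hc : a * W ^ 2 ≤ 1 / 10 ^ 10 := (mul_le_mul_of_nonneg_left hW2 ha0).trans hb
    have hd : a ≤ 1 / 10 ^ 10 := (le_mul_of_one_le_right ha0 hW3).trans hb
    have e1 : t ^ 2 * n * W ^ 2 ≤ 576 * (a * W ^ 2) := by
      rw [← mul_assoc]; gcongr
    have e2 : lam ^ 2 * (t ^ 2 * (n - 1) * W ^ 3) ≤ 576 * (lam ^ 2 * (a * W ^ 3)) := by
      have := mul_le_mul_of_nonneg_right (h2.trans h1) (show (0 : ℝ) ≤ W ^ 3 by positivity)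
      have := mul_le_mul_of_nonneg_left this (show (0 : ℝ) ≤ lam ^ 2 by positivity)
      linarith
    -- The second term dominates: W R² n t² with R = 400λW and t of order α/n is of order λ² α²
    -- W³/n, the origin of the exponent 3.
    have e3 : 48 * (W : ℝ) * (t ^ 2 * (4 * n * W) + (400 * lam * W) ^ 2 * (t ^ 2 * (n - 1)))
        = 192 * (t ^ 2 * n * W ^ 2) + 7680000 * (lam ^ 2 * (t ^ 2 * (n - 1) * W ^ 3)) := by ring
    rw [e3]
    linarith
  · rw [Set.mem_union, not_or] at hω
    obtain ⟨hE, hb⟩ := hω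
    refine ⟨not_lt.1 hE, ?_⟩
    have hb' : badCount z R ω < n / 2 := not_le.1 hb
    set good := (Finset.range (n - 1)).filter fun j => ¬ R ^ 2 < frobSq (selfEnergy z ω (j + 1)) with hgood
    have hcard : badCount z R ω + good.card = n - 1 := by
      rw [badCount, hgood, Finset.card_filter_add_card_filter_not, Finset.card_range]
    have hg : n - 1 ≤ 2 * good.card := by omega
    have hgr : (n : ℝ) - 1 ≤ 2 * good.card := by rw [← hm]; exact_mod_cast hg
    calc 3 * α = t / 2 * ((n - 1) / 2) := by rw [← mul_left_cancel_iff_of_pos four_pos]; linarith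
      _ ≤ t / 2 * good.card := by gcongr; linarith
      _ = ∑ _j ∈ good, t / 2 := by rw [Finset.sum_const, nsmul_eq_mul, mul_comm]
      _ ≤ ∑ j ∈ good, t * (1 + Real.sqrt (frobSq (selfEnergy z ω (j + 1))) / R)⁻¹ := by
          refine Finset.sum_le_sum fun j hj => ?_
          have hj2 := not_lt.1 (Finset.mem_filter.1 hj).2
          have h1 : Real.sqrt (frobSq (selfEnergy z ω (j + 1))) / R ≤ 1 := by
            rw [div_le_one hR]; exact Real.sqrt_le_iff.2 ⟨hR.le, hj2⟩
          rw [div_eq_mul_inv]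
          gcongr
          linarith
      _ ≤ _ := Finset.sum_le_sum_of_subset_of_nonneg (Finset.filter_subset _ _) fun j _ _ => by positivity

/-- The window bound obtained by scaling the first hopping matrix only, far outside the spectrum. -/
theorem tiltedMass_window_of_far (hn : 2 ≤ n) (hn' : 0 < n) (hW : 0 < W) (z q c : ℝ) {α : ℝ}
    (hz : 1600 ≤ z ^ 2) (hα : 0 ≤ α) (h : 10 ^ 10 * (α ^ 2 * W ^ 3) ≤ n) (hnW : (n : ℝ) ^ 2 ≤ 2 * W) :
    tiltedMass W hn' z q {ω | |X hn' z ω - c| ≤ α}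
      ≤ ENNReal.ofReal (Real.exp (-1))⁻¹ * (tiltedMass W hn' z q {ω | 2 * α ≤ X hn' z ω - c} ^ (1 / 2 : ℝ)
        * tiltedMass W hn' z q {ω | X hn' z ω - c ≤ -2 * α} ^ (1 / 2 : ℝ))
        + tiltedMass W hn' z q ({ω | 4 * n * W < energy ω}
          ∪ {ω | 20 < ‖Matrix.toEuclideanCLM (𝕜 := ℂ) (siteV ω 0)‖} ∪ largeHop 0) := by
  have hW1 : (1 : ℝ) ≤ W := by exact_mod_cast hW
  have hnr : (2 : ℝ) ≤ n := by exact_mod_cast hn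
  set R := 20 * Real.sqrt W with hRdef
  have hR : 0 < R := by positivity
  have hR2 : R ^ 2 = 400 * W := by rw [hRdef, mul_pow, Real.sq_sqrt (by positivity)]; norm_num
  set A := α ^ 2 * (W : ℝ) ^ 2 with hA
  have hA0 : 0 ≤ A := by positivity
  -- Moving a single site costs of order α² W² n, because the whole energy bound 4nW is charged to
  -- it. This is small since α² W³ ≤ n / 10^10 and n² ≤ 2W.
  have hAn : A * n ≤ 2 / 10 ^ 10 := by
    have h1 : A * n * W * 10 ^ 10 ≤ 2 * W := by
      calc A * n * (W : ℝ) * 10 ^ 10 = 10 ^ 10 * (α ^ 2 * W ^ 3) * n := by rw [hA]; ring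
        _ ≤ (n : ℝ) * n := by gcongr
        _ ≤ 2 * (W : ℝ) := by linarith
    have h2 : (A * n * 10 ^ 10) * W ≤ 2 * W := by linarith
    have := le_of_mul_le_mul_right h2 (by linarith)
    rw [le_div_iff₀ (by norm_num)]; exact this
  have hA1 : A ≤ A * n := le_mul_of_one_le_right hA0 (by linarith)
  have hαA : α ^ 2 ≤ A := le_mul_of_one_le_right (sq_nonneg _) (one_le_pow₀ hW1)
  have hα1 : α ≤ 1 / 12 := by
    refine le_of_sq_le_sq ?_ (by norm_num)
    norm_num at hAn ⊢
    linarith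
  have hsum : ∀ f : ℕ → ℝ, ∑ j ∈ Finset.range (n - 1), (if j = 0 then f j else 0) = f 0 := by
    intro f
    rw [Finset.sum_ite_eq' (Finset.range (n - 1)) 0 f, if_pos (Finset.mem_range.2 (by omega))]
  -- Only the first hopping matrix moves; off the bad set its cutoff is at least 1/2, so 6α yields a
  -- shift of at least 3α.
  refine tiltedMass_window_of_flow hn' hW z q c hR (t := fun j => if j = 0 then 6 * α else 0)
    (τ := 36 * α ^ 2) (Emax := 4 * n * W) (fun j => ?_) (fun j => ?_) ?_
    (((measurableSet_lt measurable_const measurable_energy).union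
      (measurableSet_lt measurable_const (entrywiseMeasurable_siteV 0).opNorm)).union
      (measurableSet_largeHop 0)) fun ω hω => ?_
  · split_ifs
    · rw [abs_of_nonneg (by positivity)]; linarith
    · norm_num
  · split_ifs
    · exact le_of_eq (by ring)
    · nlinarith [sq_nonneg α]
  · have e : ∀ j : ℕ, (if j = 0 then 6 * α else 0) ^ 2 = if j = 0 then 36 * α ^ 2 else 0 := by
      intro j; split_ifs <;> ring
    simp_rw [e]
    rw [hsum fun _ => 36 * α ^ 2, hR2]
    have e3 : 48 * (W : ℝ) * (36 * α ^ 2 * (4 * n * W) + 400 * W * (36 * α ^ 2))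
        = 6912 * (A * n) + 691200 * A := by rw [hA]; ring
    rw [e3]
    linarith
  · rw [Set.mem_union, Set.mem_union, not_or, not_or] at hω
    obtain ⟨⟨hE, hV⟩, hT⟩ := hω
    refine ⟨not_lt.1 hE, ?_⟩
    have hq := frobSq_selfEnergy_one_le z hz ω (not_lt.1 hV) (not_lt.1 hT)
    simp_rw [ite_mul, zero_mul]
    rw [hsum fun j => 6 * α * (1 + Real.sqrt (frobSq (selfEnergy z ω (j + 1))) / R)⁻¹]
    have h1 : Real.sqrt (frobSq (selfEnergy z ω (0 + 1))) / R ≤ 1 := by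
      rw [div_le_one hR]; exact Real.sqrt_le_iff.2 ⟨hR.le, by rw [hR2]; exact hq⟩
    have h2 : (2 : ℝ)⁻¹ ≤ (1 + Real.sqrt (frobSq (selfEnergy z ω (0 + 1))) / R)⁻¹ := by
      gcongr; linarith
    nlinarith

/-- The first site is rescaled by d = 3α, an exact shift. Bounded z keeps the extra cost of order α²
z² W² under control, and large energy is the only exceptional event. -/
theorem tiltedMass_window_of_near (hn : 2 ≤ n) (hn' : 0 < n) (hW : 0 < W) (z q c : ℝ) {α : ℝ}
    (hz : z ^ 2 ≤ 1600) (hα : 0 ≤ α) (h : 10 ^ 10 * (α ^ 2 * W ^ 3) ≤ n) (hnW : (n : ℝ) ^ 2 ≤ 2 * W) :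
    tiltedMass W hn' z q {ω | |X hn' z ω - c| ≤ α}
      ≤ ENNReal.ofReal (Real.exp (-1))⁻¹ * (tiltedMass W hn' z q {ω | 2 * α ≤ X hn' z ω - c} ^ (1 / 2 : ℝ)
        * tiltedMass W hn' z q {ω | X hn' z ω - c ≤ -2 * α} ^ (1 / 2 : ℝ))
        + tiltedMass W hn' z q {ω | 4 * n * W < energy ω} := by
  have hW1 : (1 : ℝ) ≤ W := by exact_mod_cast hW
  have hnr : (2 : ℝ) ≤ n := by exact_mod_cast hn
  set A := α ^ 2 * (W : ℝ) ^ 2 with hA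
  have hA0 : 0 ≤ A := by positivity
  have hAn : A * n ≤ 2 / 10 ^ 10 := by
    have h1 : A * n * W * 10 ^ 10 ≤ 2 * W := by
      calc A * n * (W : ℝ) * 10 ^ 10 = 10 ^ 10 * (α ^ 2 * W ^ 3) * n := by rw [hA]; ring
        _ ≤ (n : ℝ) * n := by gcongr
        _ ≤ 2 * (W : ℝ) := by linarith
    have h2 : (A * n * 10 ^ 10) * W ≤ 2 * W := by linarith
    have := le_of_mul_le_mul_right h2 (by linarith)
    rw [le_div_iff₀ (by norm_num)]; exact this
  have hA1 : A ≤ A * n := le_mul_of_one_le_right hA0 (by linarith)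
  have hαA : α ^ 2 ≤ A := le_mul_of_one_le_right (sq_nonneg _) (one_le_pow₀ hW1)
  have hα1 : α ≤ 1 / 12 := by
    refine le_of_sq_le_sq ?_ (by norm_num)
    norm_num at hAn ⊢
    linarith
  refine tiltedMass_window_of_scaleFirst hn hW z q c (by rw [abs_of_nonneg (by positivity)]; linarith)
    (Emax := 4 * n * W) ?_ (measurableSet_lt measurable_const measurable_energy)
    (fun ω hω => not_lt.1 hω) hn'
  have e3 : 48 * (W : ℝ) * ((3 * α) ^ 2 * (3 * (4 * n * W) + 2 * z ^ 2 * W))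
      = 5184 * (A * n) + 864 * (A * z ^ 2) := by rw [hA]; ring
  have e4 : A * z ^ 2 ≤ A * 1600 := mul_le_mul_of_nonneg_left hz hA0
  rw [e3]
  linarith

theorem weakConst_le (hW : 0 < W) : weakConst n W ≤ 101 * (n * W ^ 2) := by
  have hW1 : (1 : ℝ) ≤ W := by exact_mod_cast hW
  have hs : Real.sqrt W ≤ W := Real.sqrt_le_iff.2 ⟨by linarith, by nlinarith⟩
  have hpi := Real.pi_lt_d4
  have hpi0 := Real.pi_pos
  have h0 : (0 : ℝ) ≤ n * W ^ 2 := by positivity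
  calc weakConst n W = 32 * Real.pi * (n * W * Real.sqrt W) := by rw [weakConst]; ring
    _ ≤ 32 * Real.pi * (n * W * W) := by gcongr
    _ = 32 * Real.pi * (n * W ^ 2) := by ring
    _ ≤ _ := by nlinarith

/-- Uniformity in q: as K ≥ 1 and b ≤ 1, each factor is worst at an endpoint exponent. -/
theorem weakConst_rpow_mul_le {K b q s : ℝ} (hK : weakConst n W ≤ K) (hK1 : 1 ≤ K) (hb0 : 0 < b)
    (hb1 : b ≤ 1) (hq0 : 0 < q) (hqs : q < s) (hs1 : s < 1) :
    weakConst n W ^ q * b ^ (1 - q) / (1 - q) ≤ K * b ^ (1 - s) / (1 - s) := by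
  have hw : 0 ≤ weakConst n W := by unfold weakConst; positivity
  have h1 : weakConst n W ^ q ≤ K :=
    (Real.rpow_le_rpow hw hK hq0.le).trans
      ((Real.rpow_le_rpow_of_exponent_le hK1 (by linarith : q ≤ 1)).trans_eq (Real.rpow_one K))
  have h2 : b ^ (1 - q) ≤ b ^ (1 - s) := Real.rpow_le_rpow_of_exponent_ge hb0 hb1 (by linarith)
  have h3 : 0 < 1 - s := by linarith
  have h4 : 1 - s ≤ 1 - q := by linarith
  gcongr

/-- With Y = y², the choice of `lam` and the lower bound on W make Y(6000/lam + e^{-W}) ≤ 1. Then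
n/2 bad sites have probability at most (2/y)^(n-1) = e^{-2(L+1)(n-1)} ≤ e^{-(L+1)n}; the spare
factor e^{-n} absorbs the union with the energy event. -/
theorem orbitalLaw_badCount_union_le (hn : 2 ≤ n) (hW : 0 < W) (z : ℝ) {lam L : ℝ} (hL : 0 ≤ L)
    (hlam : lam = 12000 * (2 * Real.exp (2 * (L + 1))) ^ 2)
    (hWL : 2 * (2 * Real.exp (2 * (L + 1))) ^ 2 ≤ W) (hWL' : 2 * L + 2 ≤ W) :
    orbitalLaw n W ({ω | 4 * n * W < energy ω} ∪ {ω | n / 2 ≤ badCount z (400 * lam * W) ω})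
      ≤ ENNReal.ofReal (Real.exp (-(L * n))) := by
  set y := 2 * Real.exp (2 * (L + 1)) with hy
  have hy1 : 1 ≤ y := by
    have := Real.one_le_exp (show 0 ≤ 2 * (L + 1) by linarith)
    linarith
  have hy0 : 0 < y := by linarith
  have hW1 : (1 : ℝ) ≤ W := by exact_mod_cast hW
  have hnr : (2 : ℝ) ≤ n := by exact_mod_cast hn
  have hY : 1 ≤ y ^ 2 := one_le_pow₀ hy1
  have h := orbitalLaw_badCount_ge (n := n) hW z (lam := lam) (Y := y ^ 2) (by rw [hlam]; positivity) hY (by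
    rw [hlam, mul_add]
    have e : y ^ 2 * (6000 / (12000 * y ^ 2)) = 1 / 2 := by field_simp; norm_num
    rw [e]
    have h1 : Real.exp (-W) ≤ 1 / (2 * y ^ 2) := by
      rw [Real.exp_neg, ← one_div]
      have := Real.add_one_le_exp (W : ℝ)
      gcongr
      linarith
    have h2 : y ^ 2 * Real.exp (-W) ≤ y ^ 2 * (1 / (2 * y ^ 2)) := by gcongr
    have e2 : y ^ 2 * (1 / (2 * y ^ 2)) = 1 / 2 := by field_simp
    linarith) (n / 2)
  have hE : Real.exp (-(9 / 10 * (n * (W : ℝ) ^ 2))) ≤ Real.exp (-((L + 1) * n)) := by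
    refine Real.exp_le_exp.2 (neg_le_neg ?_)
    have h1 : L + 1 ≤ 9 / 10 * (W : ℝ) ^ 2 := by nlinarith
    nlinarith
  have hC : 2 ^ (n - 1) / (y ^ 2) ^ (n / 2) ≤ Real.exp (-((L + 1) * n)) := by
    have h1 : y ^ (n - 1) ≤ (y ^ 2) ^ (n / 2) := by
      rw [← pow_mul]; exact pow_le_pow_right₀ hy1 (by omega)
    have hm : ((n - 1 : ℕ) : ℝ) = n - 1 := by rw [Nat.cast_sub (by omega)]; simp
    calc _ ≤ 2 ^ (n - 1) / y ^ (n - 1) := by gcongr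
      _ = Real.exp (-(((n - 1 : ℕ) : ℝ) * (2 * (L + 1)))) := by
          rw [hy, mul_pow, ← Real.exp_nat_mul, Real.exp_neg]; field_simp
      _ ≤ _ := by
          refine Real.exp_le_exp.2 (neg_le_neg ?_)
          rw [hm]; nlinarith
  have hfin : Real.exp (-((L + 1) * n)) + Real.exp (-((L + 1) * n)) ≤ Real.exp (-(L * n)) := by
    have e : Real.exp (-(L * n)) = Real.exp (-((L + 1) * n)) * Real.exp n := by
      rw [← Real.exp_add]; congr 1; ring
    have h1 := Real.add_one_le_exp (n : ℝ)
    rw [e]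
    nlinarith [Real.exp_pos (-((L + 1) * n))]
  calc _ ≤ _ := measure_union_le _ _
    _ ≤ ENNReal.ofReal (Real.exp (-((L + 1) * n))) + ENNReal.ofReal (Real.exp (-((L + 1) * n))) :=
        add_le_add ((orbitalLaw_energy_gt hW).trans (ENNReal.ofReal_le_ofReal hE))
          (h.trans (ENNReal.ofReal_le_ofReal hC))
    _ = ENNReal.ofReal (Real.exp (-((L + 1) * n)) + Real.exp (-((L + 1) * n))) :=
        (ENNReal.ofReal_add (Real.exp_pos _).le (Real.exp_pos _).le).symm
    _ ≤ _ := ENNReal.ofReal_le_ofReal hfin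

theorem orbitalLaw_energy_gt_le_exp_neg (hn : 2 ≤ n) (hW : 0 < W) :
    orbitalLaw n W {ω | 4 * n * W < energy ω} ≤ ENNReal.ofReal (Real.exp (-W)) := by
  refine (orbitalLaw_energy_gt hW).trans (ENNReal.ofReal_le_ofReal (Real.exp_le_exp.2 (neg_le_neg ?_)))
  have hW1 : (1 : ℝ) ≤ W := by exact_mod_cast hW
  have hnr : (2 : ℝ) ≤ n := by exact_mod_cast hn
  nlinarith [mul_le_mul hnr hW1 zero_le_one (by linarith)]

theorem orbitalLaw_far_union_le (hn : 2 ≤ n) (hW : 0 < W) :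
    orbitalLaw n W ({ω | 4 * n * W < energy ω}
      ∪ {ω | 20 < ‖Matrix.toEuclideanCLM (𝕜 := ℂ) (siteV ω 0)‖} ∪ largeHop 0)
      ≤ ENNReal.ofReal (3 * Real.exp (-W)) := by
  have e : ENNReal.ofReal (3 * Real.exp (-W)) = ENNReal.ofReal (Real.exp (-W))
      + ENNReal.ofReal (Real.exp (-W)) + ENNReal.ofReal (Real.exp (-W)) := by
    rw [← ENNReal.ofReal_add (by positivity) (by positivity),
      ← ENNReal.ofReal_add (by positivity) (by positivity)]
    congr 1; ring
  rw [e]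
  exact (measure_union_le _ _).trans (add_le_add ((measure_union_le _ _).trans
    (add_le_add (orbitalLaw_energy_gt_le_exp_neg hn hW) (orbitalLaw_siteV_zero_gt (by omega) hW)))
    (orbitalLaw_largeHop_zero hn hW))

/-- In a short chain, exceptional events of probability `3 e^{-W}` are negligible. -/
theorem eventually_short_chain_small {ξ s : ℝ} (hs1 : s < 1) :
    ∀ᶠ W : ℕ in Filter.atTop, ∀ n : ℕ, (n : ℝ) < Real.log W → 0 ≤ ξ →
      101 * (W : ℝ) ^ 3 * (3 * Real.exp (-W)) ^ (1 - s) / (1 - s) ≤ Real.exp (-(2 * ξ * n)) / 4 := by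
  have h3 : 0 < 1 - s := by linarith
  have ht := (tendsto_rpow_mul_exp_neg_mul_atTop_nhds_zero (3 + 2 * ξ) (1 - s) h3).comp
    tendsto_natCast_atTop_atTop
  filter_upwards [ht.eventually (gt_mem_nhds (show 0 < (1 - s) / 1212 / 3 ^ (-s) by positivity)),
    Filter.eventually_ge_atTop 1] with W hW hW1 n hn hξ
  have hWpos : (0 : ℝ) < W := by exact_mod_cast hW1
  -- Since n < log W, the right-hand side is at least a fixed power of W, which e^{-(1-s)W} beats.
  -- The constant 1212 is 101 · 3 · 4.
  have h1 : Real.exp (-(2 * ξ * Real.log W)) ≤ Real.exp (-(2 * ξ * n)) :=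
    Real.exp_le_exp.2 (neg_le_neg (by gcongr))
  have h2 : Real.exp (-(2 * ξ * Real.log W)) = (W : ℝ) ^ (-(2 * ξ)) := by
    rw [Real.rpow_def_of_pos hWpos]; congr 1; ring
  have h4 : (W : ℝ) ^ 3 = (W : ℝ) ^ (3 + 2 * ξ) * (W : ℝ) ^ (-(2 * ξ)) := by
    rw [← Real.rpow_add hWpos, show 3 + 2 * ξ + -(2 * ξ) = ((3 : ℕ) : ℝ) by push_cast; ring,
      Real.rpow_natCast]
  have h5 : (3 * Real.exp (-W)) ^ (1 - s) = 3 * 3 ^ (-s) * Real.exp (-(1 - s) * W) := by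
    rw [Real.mul_rpow (by norm_num) (Real.exp_pos _).le, sub_eq_add_neg, Real.rpow_add (by norm_num),
      Real.rpow_one, ← Real.exp_mul]
    congr 2; ring
  have hW' : (W : ℝ) ^ (3 + 2 * ξ) * Real.exp (-(1 - s) * W) < (1 - s) / 1212 / 3 ^ (-s) := hW
  set a := (W : ℝ) ^ (3 + 2 * ξ) with ha
  set e := Real.exp (-(1 - s) * W) with he
  set p := (W : ℝ) ^ (-(2 * ξ)) with hp
  have hp0 : 0 < p := Real.rpow_pos_of_pos hWpos _
  set r := (3 : ℝ) ^ (-s) with hr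
  have hr0 : 0 < r := by positivity
  rw [lt_div_iff₀ hr0, lt_div_iff₀ (by norm_num)] at hW'
  refine le_trans ?_ (div_le_div_of_nonneg_right (h2 ▸ h1) (by norm_num))
  rw [h4, h5, div_le_div_iff₀ h3 (by norm_num)]
  have h6 := mul_le_mul_of_nonneg_left hW'.le hp0.le
  linarith

/-- In a long chain, exceptional events of probability `e^{-Λ n}` are negligible. -/
theorem long_chain_small {ξ s : ℝ} (hs1 : s < 1)
    (hn : 404 / (1 - s) ≤ n) :
    101 * Real.exp (3 * n) * Real.exp (-((2 * ξ + 4) / (1 - s) * n)) ^ (1 - s) / (1 - s)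
      ≤ Real.exp (-(2 * ξ * n)) / 4 := by
  have h3 : 0 < 1 - s := by linarith
  -- Of the exponent 2ξ + 4, the part 2ξ meets the lower bound on the moment, 3 the weak-type
  -- constant, and the last unit absorbs 404/(1 - s).
  have e1 : Real.exp (-((2 * ξ + 4) / (1 - s) * n)) ^ (1 - s) = Real.exp (-((2 * ξ + 4) * n)) := by
    rw [← Real.exp_mul]; congr 1; field_simp
  have e2 : Real.exp (-(2 * ξ * n)) = Real.exp (3 * n) * Real.exp (-((2 * ξ + 4) * n)) * Real.exp n := by
    rw [← Real.exp_add, ← Real.exp_add]; congr 1; ring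
  rw [e1, e2, div_le_div_iff₀ h3 (by norm_num)]
  rw [div_le_iff₀ h3] at hn
  have h4 := Real.add_one_le_exp (n : ℝ)
  have h5 : 404 ≤ Real.exp n * (1 - s) := by nlinarith
  have h6 : 0 < Real.exp (3 * n) * Real.exp (-((2 * ξ + 4) * n)) := by positivity
  nlinarith

end OrbitalSpace

end

/-! ### Conclusion. -/

theorem proposition3p4 (ξ s m sharp : ℝ) (hξ : 0 < ξ) (hs0 : 0 < s) (hs1 : s < 1)
    (hm : 0 < m) (hsharp : 3 ≤ sharp) :
    ∃ (c C ε : ℝ) (n₀ W₀ : ℕ), 0 < c ∧ 0 < C ∧ 0 < ε ∧ ε < 1 / 2 ∧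
      ∀ (n W : ℕ) (hn : 0 < n), n₀ ≤ n → W₀ ≤ W →
      ∀ z : ℝ, |z| ≤ m * Real.sqrt W →
      Real.exp (-ξ * n) ≤ ∫ ω, Real.exp (s / 2 * OrbitalSpace.X hn z ω) ∂(orbitalLaw n W) →
      ∃ α β : ℝ,
        c * Real.sqrt (n / (W : ℝ) ^ sharp) ≤ α ∧ α ≤ C * Real.sqrt (n / (W : ℝ) ^ sharp) ∧
        c ≤ β ∧ β ≤ C ∧
        ∀ q : ℝ, s / 2 < q → q < s →
          MeasureTheory.Integrable (fun ω => Real.exp (q * OrbitalSpace.X hn z ω))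
            (orbitalLaw n W) ∧
          MeasureTheory.Integrable (OrbitalSpace.X hn z) (weightedLaw W hn z q) ∧
          (weightedLaw W hn z q).real {ω | |centeredX hn z q ω| ≤ α} ≤
            β * Real.sqrt
              ((weightedLaw W hn z q).real {ω | 2 * α ≤ centeredX hn z q ω} *
                (weightedLaw W hn z q).real {ω | centeredX hn z q ω ≤ -2 * α}) + ε := by
  have h1s : 0 < 1 - s := by linarith
  set L := (2 * ξ + 4) / (1 - s) with hL
  have hL0 : 0 ≤ L := by positivity
  set y := 2 * Real.exp (2 * (L + 1)) with hy
  have hy1 : 1 ≤ y ^ 2 := by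
    have := Real.one_le_exp (show 0 ≤ 2 * (L + 1) by linarith)
    exact one_le_pow₀ (by linarith)
  set lam := 12000 * y ^ 2 with hlam
  have hlam1 : 1 ≤ lam := by linarith
  obtain ⟨W₁, hW₁⟩ := Filter.eventually_atTop.1 (OrbitalSpace.eventually_short_chain_small (ξ := ξ) hs1)
  -- Chosen so that 10^10 lam² c² = 1; with sharp ≥ 3 this is exactly the smallness of α that the
  -- long-chain bound requires.
  set c := 1 / (10 ^ 5 * lam) with hc
  have hc0 : 0 < c := by positivity
  have hc1 : c ≤ 1 := by
    rw [hc, div_le_one (by positivity)]; norm_num; linarith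
  have he1 : 1 ≤ (Real.exp (-1))⁻¹ := by
    rw [← Real.exp_neg, neg_neg]; exact Real.one_le_exp zero_le_one
  have he3 : (Real.exp (-1))⁻¹ ≤ 3 := by
    rw [← Real.exp_neg, neg_neg]; exact Real.exp_one_lt_three.le
  refine ⟨c, 3, 1 / 4, max 2 ⌈404 / (1 - s)⌉₊, max W₁ (max 2 (max ⌈2 * y ^ 2⌉₊ ⌈2 * L + 2⌉₊)),
    hc0, by norm_num, by norm_num, by norm_num, fun n W hn hn₀ hW₀ z _ h => ?_⟩
  simp only [max_le_iff, Nat.ceil_le] at hn₀ hW₀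
  obtain ⟨hn2, hn404⟩ := hn₀
  obtain ⟨hWW₁, hW2, hWy, hWL⟩ := hW₀
  have hW : 0 < W := by omega
  have hW2r : (2 : ℝ) ≤ W := by exact_mod_cast hW2
  have hn2r : (2 : ℝ) ≤ n := by exact_mod_cast hn2
  set r := Real.sqrt (n / (W : ℝ) ^ sharp) with hr
  have hr0 : 0 ≤ r := Real.sqrt_nonneg _
  have hα0 : 0 ≤ c * r := by positivity
  have hαW : 10 ^ 10 * lam ^ 2 * ((c * r) ^ 2 * W ^ 3) ≤ n := by
    have h3 : (W : ℝ) ^ 3 ≤ (W : ℝ) ^ sharp := by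
      rw [← Real.rpow_natCast]
      exact Real.rpow_le_rpow_of_exponent_le (by linarith) (by exact_mod_cast hsharp)
    have h4 : r ^ 2 = n / (W : ℝ) ^ sharp := Real.sq_sqrt (by positivity)
    have hWs : 0 < (W : ℝ) ^ sharp := by positivity
    have h5 : 10 ^ 10 * lam ^ 2 * c ^ 2 = 1 := by rw [hc]; field_simp
    calc 10 ^ 10 * lam ^ 2 * ((c * r) ^ 2 * W ^ 3) = 10 ^ 10 * lam ^ 2 * c ^ 2 * (r ^ 2 * (W : ℝ) ^ 3) := by
          ring
      _ = n / (W : ℝ) ^ sharp * W ^ 3 := by rw [h5, h4, one_mul]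
      _ ≤ n / (W : ℝ) ^ sharp * (W : ℝ) ^ sharp := by gcongr
      _ = n := by field_simp
  refine ⟨c * r, (Real.exp (-1))⁻¹, le_rfl, ?_, hc1.trans he1, he3, fun q hq0 hqs => ?_⟩
  · exact mul_le_mul_of_nonneg_right (by linarith) hr0
  have hq0' : 0 < q := by linarith
  have hq1 : q < 1 := by linarith
  refine ⟨OrbitalSpace.integrable_exp_mul_X hn hW z hq0' hq1,
    OrbitalSpace.integrable_X_weightedLaw hn hW z hq0' hq1, ?_⟩
  have hI := OrbitalSpace.exp_le_integral_exp_mul_X hn hW z hs0 hξ hs1 h hq0 hqs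
  have hI4 := div_le_div_of_nonneg_right hI (show (0 : ℝ) ≤ 4 by norm_num)
  have hwc := OrbitalSpace.weakConst_le (n := n) hW
  -- In a long chain W ≤ e^n, so the weak-type constant is at most 101 e^{3n} and events of
  -- probability e^{-Ln} are negligible. In a short chain they would not beat the powers of W, and
  -- only events of probability at most 3e^{-W} are discarded.
  rcases le_or_gt (Real.log W) n with hlog | hlog
  · have hWexp : (W : ℝ) ≤ Real.exp n := (Real.log_le_iff_le_exp (by linarith)).1 hlog
    have hnexp : (n : ℝ) ≤ Real.exp n := by linarith [Real.add_one_le_exp (n : ℝ)]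
    have hK : OrbitalSpace.weakConst n W ≤ 101 * Real.exp (3 * n) := by
      refine hwc.trans ?_
      have e : Real.exp (3 * n) = Real.exp n * Real.exp n ^ 2 := by
        rw [← Real.exp_nat_mul, ← Real.exp_add]; congr 1; push_cast; ring
      rw [e]
      gcongr
    refine OrbitalSpace.weightedLaw_window_le hn hW z hq0' hq1 (Real.exp_pos (-1)) (Real.exp_pos _)
      (OrbitalSpace.orbitalLaw_badCount_union_le hn2 hW z hL0 hlam hWy hWL) ?_
      fun a => OrbitalSpace.tiltedMass_window_of_badCount hn2 hn hW z q a hlam1 hα0 hαW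
    refine ((OrbitalSpace.weakConst_rpow_mul_le hK ?_ (Real.exp_pos _) ?_ hq0' hqs hs1).trans
      (OrbitalSpace.long_chain_small hs1 hn404)).trans hI4
    · linarith [Real.one_le_exp (show (0 : ℝ) ≤ 3 * n by positivity)]
    · exact Real.exp_le_one_iff.2 (neg_nonpos.2 (by positivity))
  · have hexp : Real.exp n < W := (Real.lt_log_iff_exp_lt (by linarith)).1 hlog
    have hnW2 : (n : ℝ) ^ 2 ≤ 2 * W := by
      have := Real.quadratic_le_exp_of_nonneg (show (0 : ℝ) ≤ n by positivity)
      linarith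
    have hnW : (n : ℝ) ≤ W := by linarith [Real.add_one_le_exp (n : ℝ)]
    have hα : 10 ^ 10 * ((c * r) ^ 2 * (W : ℝ) ^ 3) ≤ n := by
      refine le_trans ?_ hαW
      gcongr
      exact le_mul_of_one_le_right (by norm_num) (one_le_pow₀ hlam1)
    have hK : OrbitalSpace.weakConst n W ≤ 101 * (W : ℝ) ^ 3 := by
      refine hwc.trans ?_
      calc 101 * ((n : ℝ) * W ^ 2) ≤ 101 * (W * (W : ℝ) ^ 2) := by gcongr
        _ = _ := by ring
    have hb1 : 3 * Real.exp (-(W : ℝ)) ≤ 1 := by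
      have h1 := Real.quadratic_le_exp_of_nonneg (show (0 : ℝ) ≤ W by positivity)
      rw [Real.exp_neg, ← div_eq_mul_inv, div_le_one (Real.exp_pos _)]
      nlinarith
    have hsmall : OrbitalSpace.weakConst n W ^ q * (3 * Real.exp (-(W : ℝ))) ^ (1 - q) / (1 - q)
        ≤ (∫ ω, Real.exp (q * OrbitalSpace.X hn z ω) ∂(orbitalLaw n W)) / 4 := by
      refine ((OrbitalSpace.weakConst_rpow_mul_le hK ?_ (by positivity) hb1 hq0' hqs hs1).trans
        (hW₁ W hWW₁ n hlog hξ.le)).trans hI4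
      linarith [one_le_pow₀ (n := 3) (show (1 : ℝ) ≤ W by linarith)]
    -- Rescaling the first Schur complement costs a term in z², affordable for bounded z. For larger
    -- z the first self-energy is controlled, so the first hopping matrix can be flowed at scale R
    -- of order √W.
    rcases le_total (z ^ 2) 1600 with hz | hz
    · refine OrbitalSpace.weightedLaw_window_le hn hW z hq0' hq1 (Real.exp_pos (-1))
        (b := 3 * Real.exp (-(W : ℝ))) (by positivity)
        ((OrbitalSpace.orbitalLaw_energy_gt_le_exp_neg hn2 hW).trans (ENNReal.ofReal_le_ofReal ?_))
        hsmall
        fun a => OrbitalSpace.tiltedMass_window_of_near hn2 hn hW z q a hz hα0 hα hnW2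
      linarith [Real.exp_pos (-(W : ℝ))]
    · exact OrbitalSpace.weightedLaw_window_le hn hW z hq0' hq1 (Real.exp_pos (-1))
        (by positivity) (OrbitalSpace.orbitalLaw_far_union_le hn2 hW) hsmall
        fun a => OrbitalSpace.tiltedMass_window_of_far hn2 hn hW z q a hz hα0 hα hnW2
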